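/- Let $k$ be a commutative ring. A DG category is a small differential graded $k$-category: the morphisms $\mathrm{Hom}(X,Y)$ form complexes of $k$-modules (differential of degree $1$) and composition is a morphism of complexes. For a DG category $\mathcal A$ let $\mathrm{Ho}(\mathcal A)$ be its homotopy category (same objects, morphisms $H^0\mathrm{Hom}(X,Y)$), let $\mathcal A^{\mathrm{pretr}}$ be the DG category of one-sided twisted complexes $(\bigoplus_{i=1}^n C_i[r_i],q)$, where $C_i\in\mathcal A$, $r_i\in\mathbb Z$, $n\ge 0$, $q=(q_{ij})$, $q_{ij}\in\mathrm{Hom}(C_j,C_i)[r_i-r_j]$ is of degree $1$, $q_{ij}=0$ for $i\ge j$ and $dq+q^2=0$, and let $\mathcal A^{\mathrm{tr}}$ be the triangulated category given by the homotopy category of $\mathcal A^{\mathrm{pretr}}$. For a full DG subcategory $\mathcal B\subset\mathcal A$, $\mathcal B^{\mathrm{tr}}\subset\mathcal A^{\mathrm{tr}}$ is the full subcategory of twisted complexes with all $C_i\in\mathcal B$, and the quotient $\mathcal A^{\mathrm{tr}}/\mathcal B^{\mathrm{tr}}$ is the localization of $\mathcal A^{\mathrm{tr}}$ with respect to the morphisms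 whose cone is isomorphic to an object of $\mathcal B^{\mathrm{tr}}$. A DG functor $\xi:\mathcal A\to\mathcal C$ is called a DG quotient of $\mathcal A$ modulo $\mathcal B$ if $\mathrm{Ho}(\mathcal A)\to\mathrm{Ho}(\mathcal C)$ is essentially surjective and $\mathcal A^{\mathrm{tr}}\to\mathcal C^{\mathrm{tr}}$ induces an equivalence $\mathcal A^{\mathrm{tr}}/\mathcal B^{\mathrm{tr}}\to\mathcal C^{\mathrm{tr}}$. A DG category $\mathcal K$ is called homotopically flat over $k$ if for all $X,Y\in\mathcal K$ and every acyclic complex $M$ of $k$-modules the complex $M\otimes_k\mathrm{Hom}(X,Y)$ is acyclic. The tensor product $\mathcal A\otimes\mathcal K$ has as objects the pairs $a\otimes x$ with $a\in\mathcal A$, $x\in\mathcal K$, morphism complexes $\mathrm{Hom}(a,a')\otimes_k\mathrm{Hom}(x,x')$, and composition $(f_1\otimes g_1)(f_2\otimes g_2)=(-1)^{\deg g_1\deg f_2}f_1f_2\otimes g_1g_2$. **Proposition.** Let the DG functor $\xi:\mathcal A\to\mathcal C$ be a DG quotient of a DG category $\mathcal A$ modulo a full DG subcategory $\mathcal B$,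 and let $\mathcal K$ be a DG category homotopically flat over $k$. Then $\xi\otimes\mathrm{id}_{\mathcal K}:\mathcal A\otimes\mathcal K\to\mathcal C\otimes\mathcal K$ is a DG quotient of $\mathcal A\otimes\mathcal K$ modulo its full DG subcategory $\mathcal B\otimes\mathcal K$ (with objects $b\otimes x$, $b\in\mathcal B$, $x\in\mathcal K$). -/

import Mathlib

open CategoryTheory MonoidalCategory
universe u
namespace DG
noncomputable section

abbrev Cplx (k : Type u) [CommRing k] := CochainComplex (ModuleCat.{u} k) ℤ

variable {k : Type u} [CommRing k]

/-- The element `x ⊗ y` of degree `n = p + q` of the tensor product complex. -/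
def tmul (K L : Cplx k) (p q n : ℤ) (h : p + q = n) :
    K.X p →ₗ[k] L.X q →ₗ[k] (K ⊗ L).X n :=
  TensorProduct.curry (HomologicalComplex.ιTensorObj K L p q n h).hom

/-- The linear map on the degree `n` part of a tensor product complex given by a family of
bilinear maps. -/
def tlift {K L : Cplx k} {n : ℤ} {M : Type u} [AddCommGroup M] [Module k M]
    (f : ∀ p q : ℤ, p + q = n → (K.X p →ₗ[k] L.X q →ₗ[k] M)) : (K ⊗ L).X n →ₗ[k] M :=
  (HomologicalComplex.mapBifunctorDesc (K₁ := K) (K₂ := L) (F := curriedTensor (ModuleCat.{u} k))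
    (c := ComplexShape.up ℤ) (j := n) (A := ModuleCat.of k M)
    (fun p q h => ModuleCat.ofHom (TensorProduct.lift (f p q h)))).hom

theorem tlift_tmul {K L : Cplx k} {n : ℤ} {M : Type u} [AddCommGroup M] [Module k M]
    (f : ∀ p q : ℤ, p + q = n → (K.X p →ₗ[k] L.X q →ₗ[k] M)) (p q : ℤ) (h : p + q = n)
    (x : K.X p) (y : L.X q) : tlift f (tmul K L p q n h x y) = f p q h x y := by
  have := HomologicalComplex.ι_mapBifunctorDesc (K₁ := K) (K₂ := L)
    (F := curriedTensor (ModuleCat.{u} k))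
    (c := ComplexShape.up ℤ) (j := n) (A := ModuleCat.of k M)
    (fun p q h => ModuleCat.ofHom (TensorProduct.lift (f p q h))) p q h
  exact congrArg (fun g => g.hom (x ⊗ₜ[k] y)) this

theorem tensor_ext {K L : Cplx k} {n : ℤ} {M : Type u} [AddCommGroup M] [Module k M]
    {f g : (K ⊗ L).X n →ₗ[k] M}
    (h : ∀ (p q : ℤ) (h : p + q = n) (x : K.X p) (y : L.X q),
      f (tmul K L p q n h x y) = g (tmul K L p q n h x y)) : f = g := by
  have : ModuleCat.ofHom (X := (K ⊗ L).X n) (Y := M) f = ModuleCat.ofHom g := by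
    refine HomologicalComplex.mapBifunctor.hom_ext (fun p q hh => ?_)
    ext : 1
    exact TensorProduct.ext' (fun x y => h p q hh x y)
  exact congrArg ModuleCat.Hom.hom this

theorem d_tmul (K L : Cplx k) (p q n p' q' n' : ℤ) (h : p + q = n) (hp : p + 1 = p')
    (hq : q + 1 = q') (hn : n + 1 = n') (x : K.X p) (y : L.X q) :
    ((K ⊗ L).d n n').hom (tmul K L p q n h x y) =
      tmul K L p' q n' (by omega) ((K.d p p').hom x) y +
      p.negOnePow • tmul K L p q' n' (by omega) x ((L.d q q').hom y) := by
  have h1 := HomologicalComplex.mapBifunctor.d₁_eq K L (curriedTensor (ModuleCat.{u} k))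
    (ComplexShape.up ℤ) (i₁ := p) (i₁' := p') hp q n' (by simp; omega)
  have h2 := HomologicalComplex.mapBifunctor.d₂_eq K L (curriedTensor (ModuleCat.{u} k))
    (ComplexShape.up ℤ) p (i₂ := q) (i₂' := q') hq n' (by simp; omega)
  have h3 := HomologicalComplex.mapBifunctor.ι_D₁ K L (curriedTensor (ModuleCat.{u} k))
    (ComplexShape.up ℤ) n n' p q h
  have h4 := HomologicalComplex.mapBifunctor.ι_D₂ K L (curriedTensor (ModuleCat.{u} k))
    (ComplexShape.up ℤ) n n' p q h
  rw [h1] at h3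
  rw [h2] at h4
  have e1 := congrArg (fun g => g.hom (x ⊗ₜ[k] y)) h3
  have e2 := congrArg (fun g => g.hom (x ⊗ₜ[k] y)) h4
  have : ComplexShape.ε₁ (ComplexShape.up ℤ) (ComplexShape.up ℤ) (ComplexShape.up ℤ) (p, q) = 1 :=
    rfl
  rw [this, one_smul] at e1
  exact congrArg₂ (· + ·) e1 e2

theorem tensor_induction {K L : Cplx k} {n : ℤ} {P : (K ⊗ L).X n → Prop}
    (htmul : ∀ (p q : ℤ) (h : p + q = n) (x : K.X p) (y : L.X q), P (tmul K L p q n h x y))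
    (hadd : ∀ a b, P a → P b → P (a + b)) (z : (K ⊗ L).X n) : P z := by
  let S : Submodule k ((K ⊗ L).X n) :=
    Submodule.span k {z | ∃ (p q : ℤ) (h : p + q = n) (x : K.X p) (y : L.X q),
      tmul K L p q n h x y = z}
  have hS : S.mkQ = 0 := tensor_ext (fun p q h x y => by
    simpa using (Submodule.Quotient.mk_eq_zero S).2 (Submodule.subset_span ⟨p, q, h, x, y, rfl⟩))
  have hz : z ∈ S := by
    rw [← Submodule.Quotient.mk_eq_zero S]
    exact congrArg (fun f => f z) hS
  refine Submodule.closure_induction (p := fun z _ => P z) ?_ ?_ ?_ hz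
  · simpa using htmul 0 n (by simp) 0 0
  · intro x y _ _ hx hy
    exact hadd x y hx hy
  · rintro r x ⟨p, q, h, x, y, rfl⟩
    simpa using htmul p q h (r • x) y

theorem tensorHom_tmul {K L K' L' : Cplx k} (f : K ⟶ K') (g : L ⟶ L') (p q n : ℤ)
    (h : p + q = n) (x : K.X p) (y : L.X q) :
    ((f ⊗ₘ g).f n).hom (tmul K L p q n h x y) =
      tmul K' L' p q n h ((f.f p).hom x) ((g.f q).hom y) := by
  have := HomologicalComplex.ι_mapBifunctorMap f g (curriedTensor (ModuleCat.{u} k))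
    (ComplexShape.up ℤ) p q n h
  exact congrArg (fun g => g.hom (x ⊗ₜ[k] y)) this

/-- A DG category over `k` (small): the morphisms form complexes of `k`-modules, and the
composition `comp g f` of `f : X → Y` and `g : Y → Z` is bilinear, is additive on degrees, and
satisfies the Leibniz rule `d (g f) = (d g) f + (-1) ^ deg g • g (d f)`. -/
structure DGCat (k : Type u) [CommRing k] where
  Obj : Type u
  Hom : Obj → Obj → Cplx k
  id (X : Obj) : (Hom X X).X 0
  comp {X Y Z : Obj} (p q n : ℤ) (h : p + q = n) :
    (Hom Y Z).X p →ₗ[k] (Hom X Y).X q →ₗ[k] (Hom X Z).X n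
  id_comp {X Y : Obj} (n : ℤ) (f : (Hom X Y).X n) : comp 0 n n (zero_add n) (id Y) f = f
  comp_id {X Y : Obj} (n : ℤ) (f : (Hom X Y).X n) : comp n 0 n (add_zero n) f (id X) = f
  assoc {X Y Z W : Obj} (p q r pq qr n : ℤ) (hpq : p + q = pq) (hqr : q + r = qr)
    (h₁ : pq + r = n) (h₂ : p + qr = n)
    (c : (Hom Z W).X p) (b : (Hom Y Z).X q) (a : (Hom X Y).X r) :
    comp pq r n h₁ (comp p q pq hpq c b) a = comp p qr n h₂ c (comp q r qr hqr b a)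
  d_comp {X Y Z : Obj} (p q n p' q' n' : ℤ) (h : p + q = n) (hp : p + 1 = p') (hq : q + 1 = q')
    (h₁ : p' + q = n') (h₂ : p + q' = n') (g : (Hom Y Z).X p) (f : (Hom X Y).X q) :
    ((Hom X Z).d n n').hom (comp p q n h g f) =
      comp p' q n' h₁ (((Hom Y Z).d p p').hom g) f +
        p.negOnePow • comp p q' n' h₂ g (((Hom X Y).d q q').hom f)

/-- A DG functor. -/
structure DGFunctor (A C : DGCat k) where
  obj : A.Obj → C.Obj
  map (X Y : A.Obj) : A.Hom X Y ⟶ C.Hom (obj X) (obj Y)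
  map_id (X : A.Obj) : ((map X X).f 0).hom (A.id X) = C.id (obj X)
  map_comp {X Y Z : A.Obj} (p q n : ℤ) (h : p + q = n)
    (g : (A.Hom Y Z).X p) (f : (A.Hom X Y).X q) :
    ((map X Z).f n).hom (A.comp p q n h g f) =
      C.comp p q n h (((map Y Z).f p).hom g) (((map X Y).f q).hom f)

/-- The identity DG functor. -/
def DGFunctor.id (A : DGCat k) : DGFunctor A A where
  obj X := X
  map X Y := 𝟙 _
  map_id X := rfl
  map_comp _ _ _ _ _ _ := rfl

/-! ### Tensor products -/

/-- Composition in a tensor product of DG categories, see `tensorComp_tmul`. -/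
def tensorComp (A K : DGCat k) {X Y Z : A.Obj × K.Obj} (P Q N : ℤ) (h : P + Q = N) :
    (A.Hom Y.1 Z.1 ⊗ K.Hom Y.2 Z.2).X P →ₗ[k] (A.Hom X.1 Y.1 ⊗ K.Hom X.2 Y.2).X Q →ₗ[k]
      (A.Hom X.1 Z.1 ⊗ K.Hom X.2 Z.2).X N :=
  LinearMap.flip (tlift (fun q q' hq => LinearMap.mk₂ k (fun f₂ g₂ =>
    tlift (fun p p' hp => LinearMap.mk₂ k (fun f₁ g₁ => (p' * q).negOnePow •
      tmul _ _ (p + q) (p' + q') N (by omega) (A.comp p q _ rfl f₁ f₂) (K.comp p' q' _ rfl g₁ g₂))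
      (by intros; simp) (by intros; simp only [map_smul, LinearMap.smul_apply]; exact smul_comm _ _ _)
      (by intros; simp)
      (by intros; simp only [map_smul, LinearMap.smul_apply]; exact smul_comm _ _ _)))
    (by intros; apply tensor_ext; intros; simp [tlift_tmul])
    (by intros; apply tensor_ext; intros
        simp only [tlift_tmul, LinearMap.mk₂_apply, map_smul, LinearMap.smul_apply]
        exact smul_comm _ _ _)
    (by intros; apply tensor_ext; intros; simp [tlift_tmul])
    (by intros; apply tensor_ext; intros
        simp only [tlift_tmul, LinearMap.mk₂_apply, map_smul, LinearMap.smul_apply]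
        exact smul_comm _ _ _)))

theorem tensorComp_tmul (A K : DGCat k) {X Y Z : A.Obj × K.Obj} (P Q N : ℤ) (h : P + Q = N)
    (p p' q q' r r' : ℤ) (hp : p + p' = P) (hq : q + q' = Q) (hr : p + q = r) (hr' : p' + q' = r')
    (f₁ : (A.Hom Y.1 Z.1).X p) (g₁ : (K.Hom Y.2 Z.2).X p')
    (f₂ : (A.Hom X.1 Y.1).X q) (g₂ : (K.Hom X.2 Y.2).X q') :
    tensorComp A K P Q N h (tmul _ _ p p' P hp f₁ g₁) (tmul _ _ q q' Q hq f₂ g₂) =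
      (p' * q).negOnePow • tmul _ _ r r' N (by omega)
        (A.comp p q r hr f₁ f₂) (K.comp p' q' r' hr' g₁ g₂) := by
  subst hr hr'
  simp [tensorComp, tlift_tmul]

set_option maxHeartbeats 1000000 in
theorem tensor_d_comp_tmul (A K : DGCat k) {X Y Z : A.Obj × K.Obj} (P Q N P' Q' N' : ℤ)
    (h : P + Q = N) (hP : P + 1 = P') (hQ : Q + 1 = Q')
    (h₁ : P' + Q = N') (h₂ : P + Q' = N') (p p' q q' : ℤ) (hp : p + p' = P) (hq : q + q' = Q)
    (f₁ : (A.Hom Y.1 Z.1).X p) (g₁ : (K.Hom Y.2 Z.2).X p')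
    (f₂ : (A.Hom X.1 Y.1).X q) (g₂ : (K.Hom X.2 Y.2).X q') :
    ((A.Hom X.1 Z.1 ⊗ K.Hom X.2 Z.2).d N N').hom
        (tensorComp A K P Q N h (tmul _ _ p p' P hp f₁ g₁) (tmul _ _ q q' Q hq f₂ g₂)) =
      tensorComp A K P' Q N' h₁ (((A.Hom Y.1 Z.1 ⊗ K.Hom Y.2 Z.2).d P P').hom
        (tmul _ _ p p' P hp f₁ g₁)) (tmul _ _ q q' Q hq f₂ g₂) +
      P.negOnePow • tensorComp A K P Q' N' h₂ (tmul _ _ p p' P hp f₁ g₁)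
        (((A.Hom X.1 Y.1 ⊗ K.Hom X.2 Y.2).d Q Q').hom (tmul _ _ q q' Q hq f₂ g₂)) := by
  obtain ⟨p₁, hp₁⟩ : ∃ a, p + 1 = a := ⟨_, rfl⟩
  obtain ⟨p₁', hp₁'⟩ : ∃ a, p' + 1 = a := ⟨_, rfl⟩
  obtain ⟨q₁, hq₁⟩ : ∃ a, q + 1 = a := ⟨_, rfl⟩
  obtain ⟨q₁', hq₁'⟩ : ∃ a, q' + 1 = a := ⟨_, rfl⟩
  obtain ⟨r, hr⟩ : ∃ a, p + q = a := ⟨_, rfl⟩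
  obtain ⟨r', hr'⟩ : ∃ a, p' + q' = a := ⟨_, rfl⟩
  obtain ⟨r₁, hr₁⟩ : ∃ a, r + 1 = a := ⟨_, rfl⟩
  obtain ⟨r₁', hr₁'⟩ : ∃ a, r' + 1 = a := ⟨_, rfl⟩
  have e1 := d_tmul (A.Hom Y.1 Z.1) (K.Hom Y.2 Z.2) p p' P p₁ p₁' P' hp hp₁ hp₁' hP f₁ g₁
  have e2 := d_tmul (A.Hom X.1 Y.1) (K.Hom X.2 Y.2) q q' Q q₁ q₁' Q' hq hq₁ hq₁' hQ f₂ g₂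
  have c0 := tensorComp_tmul A K P Q N h p p' q q' r r' hp hq hr hr' f₁ g₁ f₂ g₂
  have e3 := d_tmul (A.Hom X.1 Z.1) (K.Hom X.2 Z.2) r r' N r₁ r₁' N'
    (by omega) hr₁ hr₁' (by omega) (A.comp p q r hr f₁ f₂) (K.comp p' q' r' hr' g₁ g₂)
  have c1 := tensorComp_tmul A K P' Q N' h₁ p₁ p' q q' r₁ r'
    (by omega) hq (by omega) hr' (((A.Hom Y.1 Z.1).d p p₁).hom f₁) g₁ f₂ g₂
  have c2 := tensorComp_tmul A K P' Q N' h₁ p p₁' q q' r r₁'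
    (by omega) hq hr (by omega) f₁ (((K.Hom Y.2 Z.2).d p' p₁').hom g₁) f₂ g₂
  have c3 := tensorComp_tmul A K P Q' N' h₂ p p' q₁ q' r₁ r'
    hp (by omega) (by omega) hr' f₁ g₁ (((A.Hom X.1 Y.1).d q q₁).hom f₂) g₂
  have c4 := tensorComp_tmul A K P Q' N' h₂ p p' q q₁' r r₁'
    hp (by omega) hr (by omega) f₁ g₁ f₂ (((K.Hom X.2 Y.2).d q' q₁').hom g₂)
  have dA := A.d_comp p q r p₁ q₁ r₁ hr hp₁ hq₁ (by omega) (by omega) f₁ f₂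
  have dK := K.d_comp p' q' r' p₁' q₁' r₁' hr' hp₁' hq₁' (by omega) (by omega) g₁ g₂
  rw [c0, e1, e2]
  simp only [Units.smul_def, map_zsmul]
  rw [e3, dA, dK]
  simp only [Units.smul_def, map_zsmul, map_add, LinearMap.add_apply, LinearMap.smul_apply]
  rw [c1, c2, c3]; rw [c4]
  simp only [Units.smul_def, smul_add, smul_smul, ← Units.val_mul, ← Int.negOnePow_add]
  have s1 : (p' * q + p).negOnePow = (P + p' * q₁).negOnePow :=
    (Int.negOnePow_eq_iff _ _).2 ⟨-p', by subst hp hq₁; ring⟩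
  have s2 : (p' * q + r).negOnePow = (p + p₁' * q).negOnePow :=
    (Int.negOnePow_eq_iff _ _).2 ⟨0, by subst hp hr hp₁'; ring⟩
  have s3 : (p' * q + (r + p')).negOnePow = (P + (q + p' * q)).negOnePow :=
    (Int.negOnePow_eq_iff _ _).2 ⟨0, by subst hp hr hp₁'; ring⟩
  rw [s1, s2, s3]
  abel

/-- The tensor product of DG categories. -/
def DGCat.tensor (A K : DGCat k) : DGCat k where
  Obj := A.Obj × K.Obj
  Hom X Y := A.Hom X.1 Y.1 ⊗ K.Hom X.2 Y.2
  id X := tmul _ _ 0 0 0 (add_zero 0) (A.id X.1) (K.id X.2)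
  comp := tensorComp A K
  id_comp n f := by
    induction f using tensor_induction with
    | htmul p q h x y =>
      rw [tensorComp_tmul A K _ _ _ _ 0 0 p q p q _ h (by omega) (by omega)]
      simp [A.id_comp, K.id_comp]
    | hadd a b ha hb => rw [map_add, ha, hb]
  comp_id n f := by
    induction f using tensor_induction with
    | htmul p q h x y =>
      rw [tensorComp_tmul A K _ _ _ _ p q 0 0 p q h _ (by omega) (by omega)]
      simp [A.comp_id, K.comp_id]
    | hadd a b ha hb => rw [map_add, LinearMap.add_apply, ha, hb]
  assoc P Q R PQ QR N hPQ hQR h₁ h₂ c b a := by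
    induction c using tensor_induction with
    | hadd c c' hc hc' => simp only [map_add, LinearMap.add_apply, hc, hc']
    | htmul p p' hp c c' =>
    induction b using tensor_induction with
    | hadd b b' hb hb' => simp only [map_add, LinearMap.add_apply, hb, hb']
    | htmul q q' hq b b' =>
    induction a using tensor_induction with
    | hadd a a' ha ha' => simp only [map_add, ha, ha']
    | htmul r r' hr a a' =>
    rw [tensorComp_tmul A K _ _ _ _ p p' q q' _ _ hp hq rfl rfl,
      tensorComp_tmul A K _ _ _ _ q q' r r' _ _ hq hr rfl rfl]
    simp only [Units.smul_def, map_zsmul, LinearMap.smul_apply]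
    rw [tensorComp_tmul A K _ _ _ _ (p + q) (p' + q') r r' (p + q + r) (p' + q' + r')
        (by omega) hr rfl rfl,
      tensorComp_tmul A K _ _ _ _ p p' (q + r) (q' + r') (p + q + r) (p' + q' + r')
        hp (by omega) (by omega) (by omega),
      A.assoc p q r (p + q) (q + r) (p + q + r) rfl rfl rfl (by omega),
      K.assoc p' q' r' (p' + q') (q' + r') (p' + q' + r') rfl rfl rfl (by omega)]
    simp only [← Units.smul_def, smul_smul, ← Int.negOnePow_add]
    congr 2
    ring
  d_comp P Q N P' Q' N' h hP hQ h₁ h₂ g f := by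
    induction g using tensor_induction with
    | hadd c c' hc hc' =>
      simp only [map_add, LinearMap.add_apply, hc, hc', smul_add]; abel
    | htmul p p' hp c c' =>
    induction f using tensor_induction with
    | hadd b b' hb hb' => 
      simp only [map_add, hb, hb', smul_add]; abel
    | htmul q q' hq b b' =>
    exact tensor_d_comp_tmul A K P Q N P' Q' N' h hP hQ h₁ h₂ p p' q q' hp hq c c' b b'

theorem tensorHom_tensorComp {A C K L : DGCat k} (F : DGFunctor A C) (G : DGFunctor K L)
    {X Y Z : A.Obj × K.Obj} (P Q N : ℤ) (h : P + Q = N)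
    (g : (A.Hom Y.1 Z.1 ⊗ K.Hom Y.2 Z.2).X P) (f : (A.Hom X.1 Y.1 ⊗ K.Hom X.2 Y.2).X Q) :
    ((F.map X.1 Z.1 ⊗ₘ G.map X.2 Z.2).f N).hom (tensorComp A K P Q N h g f) =
      tensorComp C L (X := (F.obj X.1, G.obj X.2)) (Y := (F.obj Y.1, G.obj Y.2))
        (Z := (F.obj Z.1, G.obj Z.2)) P Q N h (((F.map Y.1 Z.1 ⊗ₘ G.map Y.2 Z.2).f P).hom g)
        (((F.map X.1 Y.1 ⊗ₘ G.map X.2 Y.2).f Q).hom f) := by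
  induction g using tensor_induction with
  | hadd c c' hc hc' => simp only [map_add, LinearMap.add_apply, hc, hc']
  | htmul p p' hp c c' =>
  induction f using tensor_induction with
  | hadd b b' hb hb' => simp only [map_add, hb, hb']
  | htmul q q' hq b b' =>
  have e1 := tensorComp_tmul A K P Q N h p p' q q' _ _ hp hq rfl rfl c c' b b'
  have e2 := tensorComp_tmul C L (X := (F.obj X.1, G.obj X.2)) (Y := (F.obj Y.1, G.obj Y.2))
    (Z := (F.obj Z.1, G.obj Z.2)) P Q N h p p' q q' _ _ hp hq rfl rfl
    (((F.map _ _).f p).hom c) (((G.map _ _).f p').hom c')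
    (((F.map _ _).f q).hom b) (((G.map _ _).f q').hom b')
  have t1 := tensorHom_tmul (F.map Y.1 Z.1) (G.map Y.2 Z.2) p p' P hp c c'
  have t2 := tensorHom_tmul (F.map X.1 Y.1) (G.map X.2 Y.2) q q' Q hq b b'
  rw [e1, t1, t2]
  refine Eq.trans ?_ e2.symm
  simp only [Units.smul_def, map_zsmul]
  rw [tensorHom_tmul, F.map_comp, G.map_comp]

/-- The tensor product of DG functors. -/
def DGFunctor.tensor {A C K L : DGCat k} (F : DGFunctor A C) (G : DGFunctor K L) :
    DGFunctor (A.tensor K) (C.tensor L) where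
  obj X := (F.obj X.1, G.obj X.2)
  map X Y := F.map X.1 Y.1 ⊗ₘ G.map X.2 Y.2
  map_id X := by
    refine (tensorHom_tmul _ _ 0 0 0 _ _ _).trans ?_
    rw [F.map_id, G.map_id]
    rfl
  map_comp P Q N h g f := tensorHom_tensorComp F G P Q N h g f

/-- A DG category is homotopically flat over `k` if tensoring with any of its complexes of
morphisms preserves acyclicity of complexes of `k`-modules. -/
def DGCat.IsHomotopicallyFlat (K : DGCat k) : Prop :=
  ∀ (X Y : K.Obj) (M : Cplx k), M.Acyclic → (M ⊗ K.Hom X Y : Cplx k).Acyclic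

/-! ### The homotopy category -/

theorem DGCat.d_id (A : DGCat k) (X : A.Obj) : ((A.Hom X X).d 0 1).hom (A.id X) = 0 := by
  have h := A.d_comp 0 0 0 1 1 1 rfl rfl rfl rfl rfl (A.id X) (A.id X)
  rw [A.id_comp, A.id_comp, A.comp_id, Int.negOnePow_zero, one_smul] at h
  simpa using h

/-- The homotopy category `Ho(A)`: it has the same objects as `A`. -/
def Ho (A : DGCat k) : Type u := A.Obj

/-- Closed morphisms of degree `0`. -/
def DGCat.cycles (A : DGCat k) (X Y : A.Obj) : Submodule k ((A.Hom X Y).X 0) :=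
  LinearMap.ker ((A.Hom X Y).d 0 1).hom

/-- Exact morphisms among the closed morphisms of degree `0`. -/
def DGCat.boundaries (A : DGCat k) (X Y : A.Obj) : Submodule k (A.cycles X Y) :=
  (LinearMap.range ((A.Hom X Y).d (-1) 0).hom).comap (A.cycles X Y).subtype

/-- Morphisms in `Ho(A)`: the zeroth cohomology of the complex of morphisms. -/
abbrev DGCat.HoHom (A : DGCat k) (X Y : A.Obj) : Type u := A.cycles X Y ⧸ A.boundaries X Y

def DGCat.cyclesComp (A : DGCat k) {X Y Z : A.Obj} (g : A.cycles Y Z) (f : A.cycles X Y) :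
    A.cycles X Z :=
  ⟨A.comp 0 0 0 rfl g.1 f.1, by
    have hf : ((A.Hom X Y).d 0 1).hom f.1 = 0 := f.2
    have hg : ((A.Hom Y Z).d 0 1).hom g.1 = 0 := g.2
    refine (A.d_comp 0 0 0 1 1 1 rfl rfl rfl rfl rfl g.1 f.1).trans ?_
    rw [hf, hg]
    simp⟩

def DGCat.hoComp (A : DGCat k) {X Y Z : A.Obj} (f : A.HoHom X Y) (g : A.HoHom Y Z) :
    A.HoHom X Z :=
  Quotient.liftOn₂' f g (fun f g => Submodule.Quotient.mk (A.cyclesComp g f)) (by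
    intro f g f' g' hf hg
    rw [Submodule.quotientRel_def] at hf hg
    obtain ⟨a, ha⟩ := hf
    obtain ⟨b, hb⟩ := hg
    refine (Submodule.Quotient.eq _).2 ⟨A.comp 0 (-1) (-1) rfl g.1 a +
      A.comp (-1) 0 (-1) rfl b f'.1, ?_⟩
    have ha' : ((A.Hom X Y).d (-1) 0).hom a = f.1 - f'.1 := ha
    have hb' : ((A.Hom Y Z).d (-1) 0).hom b = g.1 - g'.1 := hb
    have hf : ((A.Hom X Y).d 0 1).hom f'.1 = 0 := f'.2
    have hg : ((A.Hom Y Z).d 0 1).hom g.1 = 0 := g.2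
    rw [map_add, A.d_comp 0 (-1) (-1) 1 0 0 rfl rfl rfl rfl rfl,
      A.d_comp (-1) 0 (-1) 0 1 0 rfl rfl rfl rfl rfl, ha', hb', hf, hg]
    simp [DGCat.cyclesComp])

instance (A : DGCat k) : Category (Ho A) where
  Hom X Y := A.HoHom X Y
  id X := Submodule.Quotient.mk ⟨A.id X, A.d_id X⟩
  comp f g := A.hoComp f g
  id_comp f := by
    induction f using Submodule.Quotient.induction_on with
    | H f => exact congrArg Submodule.Quotient.mk (Subtype.ext (A.comp_id 0 f.1))
  comp_id f := by
    induction f using Submodule.Quotient.induction_on with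
    | H f => exact congrArg Submodule.Quotient.mk (Subtype.ext (A.id_comp 0 f.1))
  assoc f g h := by
    induction f using Submodule.Quotient.induction_on with
    | H f =>
    induction g using Submodule.Quotient.induction_on with
    | H g =>
    induction h using Submodule.Quotient.induction_on with
    | H h =>
    exact congrArg Submodule.Quotient.mk (Subtype.ext
      (A.assoc 0 0 0 0 0 0 rfl rfl rfl rfl h.1 g.1 f.1).symm)

/-- The morphism of `Ho(A)` represented by a closed morphism of degree `0`. -/
def Ho.homMk (A : DGCat k) {X Y : A.Obj} (f : A.cycles X Y) :
    @Quiver.Hom (Ho A) _ X Y :=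
  Submodule.Quotient.mk f

def DGFunctor.mapCycles {A C : DGCat k} (F : DGFunctor A C) {X Y : A.Obj} (f : A.cycles X Y) :
    C.cycles (F.obj X) (F.obj Y) :=
  ⟨((F.map X Y).f 0).hom f.1, by
    have hf : ((A.Hom X Y).d 0 1).hom f.1 = 0 := f.2
    have := congrArg (fun g => g.hom f.1) ((F.map X Y).comm 0 1)
    refine this.trans ?_
    change ((F.map X Y).f 1).hom (((A.Hom X Y).d 0 1).hom f.1) = 0
    rw [hf, map_zero]⟩

/-- The functor `Ho(F) : Ho(A) ⥤ Ho(C)` induced by a DG functor `F`. -/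
def hoMap {A C : DGCat k} (F : DGFunctor A C) : Ho A ⥤ Ho C where
  obj X := F.obj X
  map {X Y} f := Quotient.liftOn' f (fun f => Ho.homMk C (F.mapCycles f)) (by
    intro f f' h
    rw [Submodule.quotientRel_def] at h
    obtain ⟨a, ha⟩ := h
    have ha' : ((A.Hom X Y).d (-1) 0).hom a = f.1 - f'.1 := ha
    refine (Submodule.Quotient.eq _).2 ⟨((F.map X Y).f (-1)).hom a, ?_⟩
    have := congrArg (fun g => g.hom a) ((F.map X Y).comm (-1) 0)
    refine this.trans ?_
    change ((F.map X Y).f 0).hom (((A.Hom X Y).d (-1) 0).hom a) = _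
    rw [ha', map_sub]
    rfl)
  map_id X := congrArg Submodule.Quotient.mk (Subtype.ext (F.map_id X))
  map_comp f g := by
    induction f using Submodule.Quotient.induction_on with
    | H f =>
    induction g using Submodule.Quotient.induction_on with
    | H g =>
    exact congrArg Submodule.Quotient.mk (Subtype.ext (F.map_comp 0 0 0 rfl g.1 f.1))

/-! ### Formal finite direct sums of shifts -/

namespace DGCat

variable (A : DGCat k)

/-- The identity of `X = Y`, as an element of degree `n = 0`. -/
def idOf {X Y : A.Obj} (e : X = Y) (n : ℤ) (hn : 0 = n) : (A.Hom X Y).X n :=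
  e ▸ hn ▸ A.id X

theorem idOf_comp {X Y : A.Obj} (p n : ℤ) (hp : 0 = p) (h : p + n = n) (f : (A.Hom X Y).X n) :
    A.comp p n n h (A.idOf rfl p hp) f = f := by
  subst hp
  exact A.id_comp n f

theorem comp_idOf {X Y : A.Obj} (p n : ℤ) (hp : 0 = p) (h : n + p = n) (f : (A.Hom X Y).X n) :
    A.comp n p n h f (A.idOf rfl p hp) = f := by
  subst hp
  exact A.comp_id n f

/-- A formal expression `⨁ i, obj i [deg i]`. -/
structure FormalSum where
  n : ℕ
  obj : Fin n → A.Obj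
  deg : Fin n → ℤ

/-- The complex of morphisms between formal sums of shifts: matrices with entries
`f i j ∈ Hom (obj j, obj' i) [deg' i - deg j]`. The sign in the differential is the one of the
shift by `deg' i`; with it the composition is the plain matrix multiplication. -/
def sumHom (X Y : A.FormalSum) : Cplx k where
  X l := ModuleCat.of k (∀ (i : Fin Y.n) (j : Fin X.n),
    (A.Hom (X.obj j) (Y.obj i)).X (l + Y.deg i - X.deg j))
  d l l' := ModuleCat.ofHom (LinearMap.pi fun i => LinearMap.pi fun j =>
    (Y.deg i).negOnePow • ((A.Hom (X.obj j) (Y.obj i)).d _ _).hom ∘ₗ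
      LinearMap.proj j ∘ₗ LinearMap.proj i)
  shape l l' h := by
    refine ModuleCat.hom_ext (LinearMap.ext fun f => funext fun i => funext fun j => ?_)
    have : ¬ (ComplexShape.up ℤ).Rel (l + Y.deg i - X.deg j) (l' + Y.deg i - X.deg j) := by
      intro h'
      apply h
      simp only [ComplexShape.up_Rel] at h' ⊢
      omega
    simp [(A.Hom (X.obj j) (Y.obj i)).shape _ _ this]
    rfl
  d_comp_d' l l' l'' _ _ := by
    refine ModuleCat.hom_ext (LinearMap.ext fun f => funext fun i => funext fun j => ?_)
    have := congrArg (fun g => g.hom (f i j)) ((A.Hom (X.obj j) (Y.obj i)).d_comp_d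
      (l + Y.deg i - X.deg j) (l' + Y.deg i - X.deg j) (l'' + Y.deg i - X.deg j))
    replace this : ((A.Hom (X.obj j) (Y.obj i)).d _ _).hom
      (((A.Hom (X.obj j) (Y.obj i)).d _ _).hom (f i j)) = 0 := this
    simp only [ModuleCat.hom_comp, ModuleCat.hom_ofHom, LinearMap.comp_apply, LinearMap.pi_apply,
      LinearMap.smul_apply, LinearMap.proj_apply, Units.smul_def, map_zsmul]
    rw [this]
    simp only [smul_zero]
    rfl

theorem sumHom_d_apply (X Y : A.FormalSum) (l l' : ℤ) (f : (A.sumHom X Y).X l) (i : Fin Y.n)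
    (j : Fin X.n) : ((A.sumHom X Y).d l l').hom f i j =
      (Y.deg i).negOnePow • ((A.Hom (X.obj j) (Y.obj i)).d _ _).hom (f i j) := rfl


/-- Matrix multiplication. -/
def sumComp {X Y Z : A.FormalSum} (p q n : ℤ) (h : p + q = n) :
    (A.sumHom Y Z).X p →ₗ[k] (A.sumHom X Y).X q →ₗ[k] (A.sumHom X Z).X n :=
  LinearMap.mk₂ k (fun g f i j => ∑ l, A.comp (p + Z.deg i - Y.deg l) (q + Y.deg l - X.deg j)
      (n + Z.deg i - X.deg j) (by omega) (g i l) (f l j))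
    (fun g g' f => funext fun i => funext fun j => by
      refine Eq.trans ?_ Finset.sum_add_distrib
      exact Finset.sum_congr rfl fun l _ => LinearMap.map_add₂ _ _ _ _)
    (fun c g f => funext fun i => funext fun j => by
      refine (Finset.sum_congr rfl fun l _ => ?_).trans (Finset.smul_sum (r := c)
        (s := Finset.univ) (f := fun l => A.comp (p + Z.deg i - Y.deg l) (q + Y.deg l - X.deg j)
          (n + Z.deg i - X.deg j) (by omega) (g i l) (f l j))).symm
      exact LinearMap.map_smul₂ _ _ _ _)
    (fun g f f' => funext fun i => funext fun j => by
      refine Eq.trans ?_ Finset.sum_add_distrib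
      exact Finset.sum_congr rfl fun l _ => map_add _ _ _)
    (fun c g f => funext fun i => funext fun j => by
      refine (Finset.sum_congr rfl fun l _ => ?_).trans (Finset.smul_sum (r := c)
        (s := Finset.univ) (f := fun l => A.comp (p + Z.deg i - Y.deg l) (q + Y.deg l - X.deg j)
          (n + Z.deg i - X.deg j) (by omega) (g i l) (f l j))).symm
      exact map_smul _ _ _)

theorem sumComp_apply {X Y Z : A.FormalSum} (p q n : ℤ) (h : p + q = n)
    (g : (A.sumHom Y Z).X p) (f : (A.sumHom X Y).X q) (i : Fin Z.n) (j : Fin X.n) :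
    A.sumComp p q n h g f i j = ∑ l, A.comp (p + Z.deg i - Y.deg l) (q + Y.deg l - X.deg j)
      (n + Z.deg i - X.deg j) (by omega) (g i l) (f l j) := rfl

/-- The identity matrix. -/
def sumId (X : A.FormalSum) : (A.sumHom X X).X 0 := fun i j =>
  if h : i = j then A.idOf (congrArg X.obj h.symm) _ (by subst h; omega) else 0

theorem sumId_of_eq {X : A.FormalSum} (i j : Fin X.n) (h : i = j) : A.sumId X i j =
    A.idOf (congrArg X.obj h.symm) _ (by subst h; omega) := dif_pos h

theorem sumId_of_ne {X : A.FormalSum} (i j : Fin X.n) (h : i ≠ j) : A.sumId X i j = 0 := dif_neg h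

/-- The DG category of formal finite direct sums of shifts of objects of `A`. -/
def sums : DGCat k where
  Obj := A.FormalSum
  Hom := A.sumHom
  id := A.sumId
  comp := A.sumComp
  id_comp {X Y} n f := funext fun i => funext fun j => by
    rw [sumComp_apply, Finset.sum_eq_single i]
    · simp only [sumId, dif_pos]
      exact A.idOf_comp _ _ _ _ _
    · intro l _ hl
      simp [sumId, hl.symm]
    · simp
  comp_id {X Y} n f := funext fun i => funext fun j => by
    rw [sumComp_apply, Finset.sum_eq_single j]
    · simp only [sumId, dif_pos]
      exact A.comp_idOf _ _ _ _ _
    · intro l _ hl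
      simp [sumId, hl]
    · simp
  assoc {X Y Z W} p q r pq qr n hpq hqr h₁ h₂ c b a := funext fun i => funext fun j => by
    simp only [sumComp_apply, map_sum, LinearMap.sum_apply]
    rw [Finset.sum_comm]
    refine Finset.sum_congr rfl fun l _ => Finset.sum_congr rfl fun m _ => ?_
    exact A.assoc _ _ _ _ _ _ _ _ _ _ _ _ _
  d_comp {X Y Z} p q n p' q' n' h hp hq h₁ h₂ g f := funext fun i => funext fun j => by
    refine (A.sumHom_d_apply _ _ _ _ _ _ _).trans ?_
    change _ = A.sumComp p' q n' h₁ (((A.sumHom Y Z).d p p').hom g) f i j +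
        p.negOnePow • A.sumComp p q' n' h₂ g (((A.sumHom X Y).d q q').hom f) i j
    simp only [sumComp_apply, map_sum, Finset.smul_sum, ← Finset.sum_add_distrib]
    refine Finset.sum_congr rfl fun l _ => ?_
    rw [sumHom_d_apply, sumHom_d_apply, A.d_comp _ _ _ (p' + Z.deg i - Y.deg l)
      (q' + Y.deg l - X.deg j) _ _ (by omega) (by omega) (by omega) (by omega)]
    simp only [Units.smul_def, map_zsmul, LinearMap.smul_apply, smul_add, smul_smul,
      ← Units.val_mul, ← Int.negOnePow_add]
    have : (Z.deg i + (p + Z.deg i - Y.deg l)).negOnePow = (p + Y.deg l).negOnePow :=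
      (Int.negOnePow_eq_iff _ _).2 ⟨Z.deg i - Y.deg l, by ring⟩
    rw [this]

/-- One-sided twisted complexes `(⨁ i, obj i [deg i], q)`. -/
structure TwistedComplex extends FormalSum A where
  q (i j : Fin n) : (A.Hom (obj j) (obj i)).X (1 + deg i - deg j)
  q_eq_zero (i j : Fin n) (h : j ≤ i) : q i j = 0
  /-- The equation `d q + q ^ 2 = 0`. -/
  d_q_add (i j : Fin n) :
    (deg i).negOnePow • ((A.Hom (obj j) (obj i)).d _ (2 + deg i - deg j)).hom (q i j) +
      ∑ l, A.comp (1 + deg i - deg l) (1 + deg l - deg j) (2 + deg i - deg j) (by omega)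
        (q i l) (q l j) = 0


variable {A}

/-- The element `q` of degree `1` of the endomorphisms of the underlying formal sum. -/
def TwistedComplex.twist (X : A.TwistedComplex) : (A.sumHom X.toFormalSum X.toFormalSum).X 1 :=
  X.q

theorem TwistedComplex.d_twist (X : A.TwistedComplex) :
    ((A.sumHom X.toFormalSum X.toFormalSum).d 1 2).hom X.twist +
      A.sumComp 1 1 2 rfl X.twist X.twist = 0 :=
  funext fun i => funext fun j => X.d_q_add i j

end DGCat

namespace Twist

/-! Given a DG category `D` and objects with endomorphisms `q` of degree `1` such that
`d q + q ^ 2 = 0`, the differential on morphisms is twisted to `d f + q' f - (-1) ^ deg f f q`. -/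

variable (D : DGCat k) {X Y Z : D.Obj}

/-- The twisted differential. -/
def diff (q : (D.Hom X X).X 1) (q' : (D.Hom Y Y).X 1) (l l' : ℤ) (h : l + 1 = l') :
    (D.Hom X Y).X l →ₗ[k] (D.Hom X Y).X l' :=
  ((D.Hom X Y).d l l').hom + D.comp 1 l l' (by omega) q' -
    l.negOnePow • (D.comp l 1 l' h).flip q

theorem diff_apply (q : (D.Hom X X).X 1) (q' : (D.Hom Y Y).X 1) (l l' : ℤ) (h : l + 1 = l')
    (f : (D.Hom X Y).X l) : diff D q q' l l' h f =
      ((D.Hom X Y).d l l').hom f + D.comp 1 l l' (by omega) q' f -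
        l.negOnePow • D.comp l 1 l' h f q := rfl

theorem diff_diff (q : (D.Hom X X).X 1) (q' : (D.Hom Y Y).X 1)
    (hq : ((D.Hom X X).d 1 2).hom q + D.comp 1 1 2 rfl q q = 0)
    (hq' : ((D.Hom Y Y).d 1 2).hom q' + D.comp 1 1 2 rfl q' q' = 0)
    (l l' l'' : ℤ) (h : l + 1 = l') (h' : l' + 1 = l'') (f : (D.Hom X Y).X l) :
    diff D q q' l' l'' h' (diff D q q' l l' h f) = 0 := by
  have hdd : ((D.Hom X Y).d l' l'').hom (((D.Hom X Y).d l l').hom f) = 0 :=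
    congrArg (fun g => g.hom f) ((D.Hom X Y).d_comp_d l l' l'')
  have e1 := D.d_comp 1 l l' 2 l' l'' (by omega) rfl h (by omega) (by omega) q' f
  have e2 := D.d_comp l 1 l' l' 2 l'' h h rfl (by omega) (by omega) f q
  have a1 := D.assoc 1 1 l 2 l' l'' rfl (by omega) (by omega) (by omega) q' q' f
  have a2 := D.assoc 1 l 1 l' l' l'' (by omega) h (by omega) (by omega) q' f q
  have a3 := D.assoc l 1 1 l' 2 l'' h rfl (by omega) (by omega) f q q
  have s : l'.negOnePow = - l.negOnePow := by subst h; exact Int.negOnePow_succ l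
  have hq1 : ((D.Hom X X).d 1 2).hom q = - D.comp 1 1 2 rfl q q := eq_neg_of_add_eq_zero_left hq
  have hq1' : ((D.Hom Y Y).d 1 2).hom q' = - D.comp 1 1 2 rfl q' q' :=
    eq_neg_of_add_eq_zero_left hq'
  simp only [diff_apply, map_add, map_sub, Units.smul_def, map_zsmul, LinearMap.add_apply,
    LinearMap.sub_apply, LinearMap.smul_apply, e1, e2, hdd, hq1, hq1', ← a1, a2, ← a3, s]
  rcases Int.units_eq_one_or l.negOnePow with hl | hl <;> simp [hl, a3] <;> abel

theorem diff_comp (q : (D.Hom X X).X 1) (q' : (D.Hom Y Y).X 1) (q'' : (D.Hom Z Z).X 1)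
    (p r n p' r' n' : ℤ) (h : p + r = n) (hp : p + 1 = p') (hr : r + 1 = r') (hn : n + 1 = n')
    (h₁ : p' + r = n') (h₂ : p + r' = n') (g : (D.Hom Y Z).X p) (f : (D.Hom X Y).X r) :
    diff D q q'' n n' hn (D.comp p r n h g f) =
      D.comp p' r n' h₁ (diff D q' q'' p p' hp g) f +
        p.negOnePow • D.comp p r' n' h₂ g (diff D q q' r r' hr f) := by
  have e1 := D.d_comp p r n p' r' n' h hp hr h₁ h₂ g f
  have a1 := D.assoc 1 p r p' n n' (by omega) (by omega) (by omega) (by omega) q'' g f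
  have a2 := D.assoc p 1 r p' r' n' (by omega) (by omega) (by omega) (by omega) g q' f
  have a3 := D.assoc p r 1 n r' n' (by omega) (by omega) (by omega) (by omega) g f q
  have s : n.negOnePow = p.negOnePow * r.negOnePow := by subst h; exact Int.negOnePow_add _ _
  simp only [diff_apply, map_add, map_sub, Units.smul_def, map_zsmul, LinearMap.add_apply,
    LinearMap.sub_apply, LinearMap.smul_apply, e1, a1, a2, a3, s]
  rcases Int.units_eq_one_or p.negOnePow with hp | hp <;>
  rcases Int.units_eq_one_or r.negOnePow with hr | hr <;> simp [hp, hr] <;> abel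

/-- The complex of morphisms with the twisted differential. -/
def cplx (q : (D.Hom X X).X 1) (q' : (D.Hom Y Y).X 1)
    (hq : ((D.Hom X X).d 1 2).hom q + D.comp 1 1 2 rfl q q = 0)
    (hq' : ((D.Hom Y Y).d 1 2).hom q' + D.comp 1 1 2 rfl q' q' = 0) : Cplx k where
  X l := (D.Hom X Y).X l
  d l l' := if h : l + 1 = l' then ModuleCat.ofHom (diff D q q' l l' h) else 0
  shape l l' h := dif_neg h
  d_comp_d' l l' l'' h h' := by
    replace h : l + 1 = l' := h
    replace h' : l' + 1 = l'' := h'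
    rw [dif_pos h, dif_pos h']
    exact ModuleCat.hom_ext (LinearMap.ext fun f => diff_diff D q q' hq hq' l l' l'' h h' f)

theorem cplx_d_apply (q : (D.Hom X X).X 1) (q' : (D.Hom Y Y).X 1)
    (hq : ((D.Hom X X).d 1 2).hom q + D.comp 1 1 2 rfl q q = 0)
    (hq' : ((D.Hom Y Y).d 1 2).hom q' + D.comp 1 1 2 rfl q' q' = 0) (l l' : ℤ) (h : l + 1 = l')
    (f : (D.Hom X Y).X l) : ((cplx D q q' hq hq').d l l').hom f = diff D q q' l l' h f := by
  have : (cplx D q q' hq hq').d l l' = ModuleCat.ofHom (diff D q q' l l' h) := dif_pos h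
  rw [this]
  rfl

end Twist

namespace DGCat

variable (A : DGCat k)

/-- The complex of morphisms between twisted complexes. -/
def pretrHom (X Y : A.TwistedComplex) : Cplx k :=
  Twist.cplx A.sums (X := X.toFormalSum) (Y := Y.toFormalSum) X.twist Y.twist X.d_twist Y.d_twist

theorem pretrHom_d_apply (X Y : A.TwistedComplex) (l l' : ℤ) (h : l + 1 = l')
    (f : (A.sumHom X.toFormalSum Y.toFormalSum).X l) : ((A.pretrHom X Y).d l l').hom f =
      ((A.sumHom X.toFormalSum Y.toFormalSum).d l l').hom f +
        A.sumComp 1 l l' (by omega) Y.twist f - l.negOnePow • A.sumComp l 1 l' h f X.twist :=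
  Twist.cplx_d_apply A.sums (X := X.toFormalSum) (Y := Y.toFormalSum) X.twist Y.twist
    X.d_twist Y.d_twist l l' h f

/-- The DG category `A^pretr` of one-sided twisted complexes over `A`. -/
def pretr : DGCat k where
  Obj := A.TwistedComplex
  Hom := A.pretrHom
  id X := A.sumId X.toFormalSum
  comp := A.sumComp
  id_comp n f := A.sums.id_comp n f
  comp_id n f := A.sums.comp_id n f
  assoc p q r pq qr n hpq hqr h₁ h₂ c b a := A.sums.assoc p q r pq qr n hpq hqr h₁ h₂ c b a
  d_comp {X Y Z} p q n p' q' n' h hp hq h₁ h₂ g f := by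
    refine (A.pretrHom_d_apply X Z n n' (by omega) (A.sumComp p q n h g f)).trans ?_
    refine (Twist.diff_comp A.sums X.twist Y.twist Z.twist p q n p' q' n' h hp hq (by omega)
      h₁ h₂ g f).trans ?_
    exact (congrArg₂ (fun a b => A.sumComp p' q n' h₁ a f + p.negOnePow • A.sumComp p q' n' h₂ g b)
      (A.pretrHom_d_apply Y Z p p' hp g) (A.pretrHom_d_apply X Y q q' hq f)).symm

end DGCat

/-! ### Functoriality of twisted complexes -/

namespace DGFunctor

variable {A C : DGCat k} (F : DGFunctor A C)

theorem map_idOf {X Y : A.Obj} (e : X = Y) (n : ℤ) (hn : 0 = n) :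
    ((F.map X Y).f n).hom (A.idOf e n hn) = C.idOf (congrArg F.obj e) n hn := by
  subst e hn
  exact F.map_id X

theorem map_d {X Y : A.Obj} (n n' : ℤ) (f : (A.Hom X Y).X n) :
    ((F.map X Y).f n').hom (((A.Hom X Y).d n n').hom f) =
      ((C.Hom (F.obj X) (F.obj Y)).d n n').hom (((F.map X Y).f n).hom f) :=
  (congrArg (fun g => g.hom f) ((F.map X Y).comm n n')).symm

/-- The action on formal sums of shifts. -/
def sumObj (X : A.FormalSum) : C.FormalSum where
  n := X.n
  obj i := F.obj (X.obj i)
  deg := X.deg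

/-- The action on matrices, entry by entry. -/
def sumMap (X Y : A.FormalSum) (l : ℤ) :
    (A.sumHom X Y).X l →ₗ[k] (C.sumHom (F.sumObj X) (F.sumObj Y)).X l :=
  LinearMap.pi fun i => LinearMap.pi fun j =>
    ((F.map (X.obj j) (Y.obj i)).f (l + Y.deg i - X.deg j)).hom ∘ₗ
      LinearMap.proj j ∘ₗ LinearMap.proj i

theorem sumMap_apply (X Y : A.FormalSum) (l : ℤ) (f : (A.sumHom X Y).X l) (i : Fin Y.n)
    (j : Fin X.n) : F.sumMap X Y l f i j =
      ((F.map (X.obj j) (Y.obj i)).f (l + Y.deg i - X.deg j)).hom (f i j) := rfl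

theorem sumMap_d (X Y : A.FormalSum) (l l' : ℤ) (f : (A.sumHom X Y).X l) :
    F.sumMap X Y l' (((A.sumHom X Y).d l l').hom f) =
      ((C.sumHom (F.sumObj X) (F.sumObj Y)).d l l').hom (F.sumMap X Y l f) :=
  funext fun (i : Fin Y.n) => funext fun (j : Fin X.n) => by
    change ((F.map (X.obj j) (Y.obj i)).f (l' + Y.deg i - X.deg j)).hom
      ((Y.deg i).negOnePow • ((A.Hom (X.obj j) (Y.obj i)).d _ _).hom (f i j)) =
      (Y.deg i).negOnePow • ((C.Hom (F.obj (X.obj j)) (F.obj (Y.obj i))).d _ _).hom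
        (((F.map (X.obj j) (Y.obj i)).f (l + Y.deg i - X.deg j)).hom (f i j))
    rw [Units.smul_def, map_zsmul, F.map_d, ← Units.smul_def]

theorem sumMap_comp {X Y Z : A.FormalSum} (p q n : ℤ) (h : p + q = n)
    (g : (A.sumHom Y Z).X p) (f : (A.sumHom X Y).X q) :
    F.sumMap X Z n (A.sumComp p q n h g f) =
      C.sumComp p q n h (F.sumMap Y Z p g) (F.sumMap X Y q f) :=
  funext fun (i : Fin Z.n) => funext fun (j : Fin X.n) => by
    change ((F.map (X.obj j) (Z.obj i)).f (n + Z.deg i - X.deg j)).hom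
      (∑ l : Fin Y.n, A.comp (p + Z.deg i - Y.deg l) (q + Y.deg l - X.deg j)
        (n + Z.deg i - X.deg j) (by omega) (g i l) (f l j)) = _
    rw [map_sum]
    exact Finset.sum_congr rfl fun l _ => F.map_comp _ _ _ _ _ _

theorem sumMap_id (X : A.FormalSum) : F.sumMap X X 0 (A.sumId X) = C.sumId (F.sumObj X) :=
  funext fun (i : Fin X.n) => funext fun (j : Fin X.n) => by
    by_cases h : i = j
    · rw [C.sumId_of_eq (X := F.sumObj X) i j h]
      refine (congrArg ((F.map (X.obj j) (X.obj i)).f (0 + X.deg i - X.deg j)).hom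
        (A.sumId_of_eq i j h)).trans ?_
      exact F.map_idOf _ _ _
    · rw [C.sumId_of_ne (X := F.sumObj X) i j h]
      exact (congrArg ((F.map (X.obj j) (X.obj i)).f (0 + X.deg i - X.deg j)).hom
        (A.sumId_of_ne i j h)).trans (map_zero ((F.map (X.obj j) (X.obj i)).f _).hom)

/-- The action on twisted complexes. -/
def pretrObj (X : A.TwistedComplex) : C.TwistedComplex where
  toFormalSum := F.sumObj X.toFormalSum
  q := F.sumMap _ _ 1 X.twist
  q_eq_zero i j h := (congrArg ((F.map (X.obj j) (X.obj i)).f (1 + X.deg i - X.deg j)).hom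
    (X.q_eq_zero i j h)).trans (map_zero ((F.map (X.obj j) (X.obj i)).f _).hom)
  d_q_add i j := by
    have := congrArg (F.sumMap _ _ 2) X.d_twist
    rw [map_add, map_zero, F.sumMap_d, F.sumMap_comp] at this
    exact congrFun (congrFun this i) j

theorem sumMap_pretr_d (X Y : A.TwistedComplex) (l l' : ℤ) (h : l + 1 = l')
    (f : (A.sumHom X.toFormalSum Y.toFormalSum).X l) :
    ((C.pretrHom (F.pretrObj X) (F.pretrObj Y)).d l l').hom (F.sumMap _ _ l f) =
      F.sumMap _ _ l' (((A.pretrHom X Y).d l l').hom f) := by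
  rw [A.pretrHom_d_apply X Y l l' h f, map_sub, map_add, F.sumMap_d, F.sumMap_comp,
    Units.smul_def, map_zsmul, F.sumMap_comp, ← Units.smul_def]
  exact C.pretrHom_d_apply (F.pretrObj X) (F.pretrObj Y) l l' h (F.sumMap _ _ l f)

/-- The DG functor `F^pretr : A^pretr → C^pretr`. -/
def pretr : DGFunctor A.pretr C.pretr where
  obj := F.pretrObj
  map X Y :=
    { f l := ModuleCat.ofHom (F.sumMap X.toFormalSum Y.toFormalSum l)
      comm' l l' h := ModuleCat.hom_ext (LinearMap.ext fun f => F.sumMap_pretr_d X Y l l' h f) }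
  map_id X := F.sumMap_id X.toFormalSum
  map_comp p q n h g f := F.sumMap_comp p q n h g f

end DGFunctor

/-! ### Cones -/

namespace DGCat

variable {A : DGCat k}

/-- Transport along an equality of degrees. -/
def castDeg {K : Cplx k} {m n : ℤ} (h : m = n) (x : K.X m) : K.X n := h ▸ x

theorem castDeg_neg {K : Cplx k} {m n : ℤ} (h : m = n) (x : K.X m) :
    castDeg h (-x) = - castDeg h x := by
  subst h; rfl

theorem castDeg_eq_zero {K : Cplx k} {m n : ℤ} (h : m = n) {x : K.X m} (hx : x = 0) :
    castDeg h x = 0 := by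
  subst h; exact hx

theorem castDeg_add {K : Cplx k} {m n : ℤ} (h : m = n) (x y : K.X m) :
    castDeg h (x + y) = castDeg h x + castDeg h y := by
  subst h; rfl

theorem castDeg_sub {K : Cplx k} {m n : ℤ} (h : m = n) (x y : K.X m) :
    castDeg h (x - y) = castDeg h x - castDeg h y := by
  subst h; rfl

theorem castDeg_sum {K : Cplx k} {m n : ℤ} (h : m = n) {ι : Type*} (s : Finset ι)
    (x : ι → K.X m) : castDeg h (∑ i ∈ s, x i) = ∑ i ∈ s, castDeg h (x i) := by
  subst h; rfl

theorem castDeg_units_smul {K : Cplx k} {m n : ℤ} (h : m = n) (c : ℤˣ) (x : K.X m) :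
    castDeg h (c • x) = c • castDeg h x := by
  subst h; rfl

theorem d_castDeg {K : Cplx k} {m n m' n' : ℤ} (h : m = n) (h' : m' = n') (x : K.X m) :
    (K.d n n').hom (castDeg h x) = castDeg h' ((K.d m m').hom x) := by
  subst h h'; rfl

theorem comp_castDeg {X Y Z : A.Obj} {p q n p' q' n' : ℤ} (h : p + q = n) (h' : p' + q' = n')
    (hp : p = p') (hq : q = q') (hn : n = n') (g : (A.Hom Y Z).X p) (f : (A.Hom X Y).X q) :
    A.comp p' q' n' h' (castDeg hp g) (castDeg hq f) = castDeg hn (A.comp p q n h g f) := by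
  subst hp hq hn; rfl

theorem castDeg_comp_neg {X Y Z : A.Obj} {p q n n' : ℤ} (h : p + q = n) (hn : n = n')
    (g : (A.Hom Y Z).X p) (f : (A.Hom X Y).X q) :
    castDeg hn (A.comp p q n h g (-f)) = - castDeg hn (A.comp p q n h g f) := by
  rw [map_neg, castDeg_neg]

theorem castDeg_neg_comp_neg {X Y Z : A.Obj} {p q n n' : ℤ} (h : p + q = n) (hn : n = n')
    (g : (A.Hom Y Z).X p) (f : (A.Hom X Y).X q) :
    castDeg hn (A.comp p q n h (-g) (-f)) = castDeg hn (A.comp p q n h g f) := by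
  rw [map_neg, LinearMap.map_neg₂, neg_neg]

theorem castDeg_neg_smul_neg {K K' : Cplx k} {m n n' : ℤ} (h : n = n') (r : ℤ)
    (φ : K.X m →ₗ[k] K'.X n) (x : K.X m) :
    (r + 1).negOnePow • castDeg h (φ (-x)) = r.negOnePow • castDeg h (φ x) := by
  rw [Int.negOnePow_succ, map_neg, castDeg_neg, Units.neg_smul, smul_neg, neg_neg]

variable (X Y : A.TwistedComplex)

/-- The objects of the cone of a morphism `X ⟶ Y`: those of `Y` followed by those of `X`. -/
def coneObj (a : Fin Y.n ⊕ Fin X.n) : A.Obj := Sum.elim Y.obj X.obj a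

/-- The shifts in the cone of a morphism `X ⟶ Y`. -/
def coneDeg (a : Fin Y.n ⊕ Fin X.n) : ℤ := Sum.elim Y.deg (fun i => X.deg i + 1) a

variable {X Y}

/-- The matrix `(q_Y, f; 0, -q_X)` of the cone of a closed morphism `f : X ⟶ Y` of degree `0`. -/
def coneQ (f : (A.sumHom X.toFormalSum Y.toFormalSum).X 0) : ∀ a b : Fin Y.n ⊕ Fin X.n,
    (A.Hom (coneObj X Y b) (coneObj X Y a)).X (1 + coneDeg X Y a - coneDeg X Y b)
  | .inl i, .inl j => Y.q i j
  | .inl i, .inr j => castDeg (K := A.Hom (X.obj j) (Y.obj i))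
      (m := 0 + Y.deg i - X.deg j) (n := 1 + Y.deg i - (X.deg j + 1)) (by omega) (f i j)
  | .inr _, .inl _ => 0
  | .inr i, .inr j => castDeg (K := A.Hom (X.obj j) (X.obj i))
      (m := 1 + X.deg i - X.deg j) (n := 1 + (X.deg i + 1) - (X.deg j + 1)) (by omega)
      (- X.q i j)

theorem coneQ_spec (f : (A.sumHom X.toFormalSum Y.toFormalSum).X 0)
    (hf : ((A.pretrHom X Y).d 0 1).hom f = 0) (a b : Fin Y.n ⊕ Fin X.n) :
    (coneDeg X Y a).negOnePow • ((A.Hom (coneObj X Y b) (coneObj X Y a)).d _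
      (2 + coneDeg X Y a - coneDeg X Y b)).hom (coneQ f a b) +
      ∑ c, A.comp (1 + coneDeg X Y a - coneDeg X Y c) (1 + coneDeg X Y c - coneDeg X Y b)
        (2 + coneDeg X Y a - coneDeg X Y b) (by omega) (coneQ f a c) (coneQ f c b) = 0 := by
  rw [Fintype.sum_sum_type]
  have eX : ∀ i, coneDeg X Y (.inr i) = X.deg i + 1 := fun _ => rfl
  have eY : ∀ i, coneDeg X Y (.inl i) = Y.deg i := fun _ => rfl
  match a, b with
  | .inl i, .inl j =>
    have h0 : ∑ l : Fin X.n, A.comp (1 + coneDeg X Y (.inl i) - coneDeg X Y (.inr l))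
        (1 + coneDeg X Y (.inr l) - coneDeg X Y (.inl j))
        (2 + coneDeg X Y (.inl i) - coneDeg X Y (.inl j)) (by omega)
        (coneQ f (.inl i) (.inr l)) (coneQ f (.inr l) (.inl j)) = 0 :=
      Finset.sum_eq_zero fun l _ => map_zero (A.comp _ _ _ _ _)
    rw [h0, add_zero]
    exact Y.d_q_add i j
  | .inr i, .inl j =>
    have h0 : ∑ l : Fin X.n, A.comp (1 + coneDeg X Y (.inr i) - coneDeg X Y (.inr l))
        (1 + coneDeg X Y (.inr l) - coneDeg X Y (.inl j))
        (2 + coneDeg X Y (.inr i) - coneDeg X Y (.inl j)) (by omega)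
        (coneQ f (.inr i) (.inr l)) (coneQ f (.inr l) (.inl j)) = 0 :=
      Finset.sum_eq_zero fun l _ => map_zero (A.comp _ _ _ _ _)
    have h1 : ∑ l : Fin Y.n, A.comp (1 + coneDeg X Y (.inr i) - coneDeg X Y (.inl l))
        (1 + coneDeg X Y (.inl l) - coneDeg X Y (.inl j))
        (2 + coneDeg X Y (.inr i) - coneDeg X Y (.inl j)) (by omega)
        (coneQ f (.inr i) (.inl l)) (coneQ f (.inl l) (.inl j)) = 0 :=
      Finset.sum_eq_zero fun l _ => LinearMap.map_zero₂ (A.comp _ _ _ _) _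
    rw [h0, h1]
    simp [coneQ]
  | .inl i, .inr j =>
    have h0 := (A.pretrHom_d_apply X Y 0 1 rfl f).symm.trans hf
    rw [Int.negOnePow_zero, one_smul] at h0
    replace h0 : (Y.deg i).negOnePow • ((A.Hom (X.obj j) (Y.obj i)).d (0 + Y.deg i - X.deg j)
        (1 + Y.deg i - X.deg j)).hom (f i j) +
        ∑ l, A.comp (1 + Y.deg i - Y.deg l) (0 + Y.deg l - X.deg j)
          (1 + Y.deg i - X.deg j) (by omega) (Y.q i l) (f l j) -
        ∑ l, A.comp (0 + Y.deg i - X.deg l) (1 + X.deg l - X.deg j)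
          (1 + Y.deg i - X.deg j) (by omega) (f i l) (X.q l j) = 0 :=
      congrFun (congrFun h0 i) j
    replace h0 := castDeg_eq_zero (n := 2 + Y.deg i - (X.deg j + 1)) (by omega) h0
    rw [castDeg_sub, castDeg_add, castDeg_units_smul, castDeg_sum, castDeg_sum] at h0
    refine Eq.trans (congrArg₂ (· + ·) (congrArg _ ?_) ((congrArg₂ (· + ·) ?_ ?_).trans
      (sub_eq_add_neg _ _).symm)) ((add_sub_assoc _ _ _).symm.trans h0)
    · exact d_castDeg _ _ _
    · exact Finset.sum_congr rfl fun l _ => comp_castDeg _ _ rfl _ _ _ _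
    · refine Eq.trans ?_ (Finset.sum_neg_distrib _)
      refine Finset.sum_congr rfl fun l _ => ?_
      refine (comp_castDeg (p := 0 + Y.deg i - X.deg l) (q := 1 + X.deg l - X.deg j)
        (n := 1 + Y.deg i - X.deg j) (by omega) _ _ _ (by simp only [eX, eY]; omega) _ _).trans ?_
      exact castDeg_comp_neg (X := X.obj j) (Y := X.obj l) (Z := Y.obj i) _ _ _ _
  | .inr i, .inr j =>
    have h1 : ∑ l : Fin Y.n, A.comp (1 + coneDeg X Y (.inr i) - coneDeg X Y (.inl l))
        (1 + coneDeg X Y (.inl l) - coneDeg X Y (.inr j))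
        (2 + coneDeg X Y (.inr i) - coneDeg X Y (.inr j)) (by omega)
        (coneQ f (.inr i) (.inl l)) (coneQ f (.inl l) (.inr j)) = 0 :=
      Finset.sum_eq_zero fun l _ => LinearMap.map_zero₂ (A.comp _ _ _ _) _
    rw [h1, zero_add]
    have h0 := castDeg_eq_zero (n := 2 + (X.deg i + 1) - (X.deg j + 1)) (by omega) (X.d_q_add i j)
    rw [castDeg_add, castDeg_units_smul, castDeg_sum] at h0
    refine Eq.trans (congrArg₂ (· + ·) ?_ ?_) h0
    · have h2 := d_castDeg (K := A.Hom (X.obj j) (X.obj i)) (m := 1 + X.deg i - X.deg j)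
        (n := 1 + (X.deg i + 1) - (X.deg j + 1)) (m' := 2 + X.deg i - X.deg j)
        (n' := 2 + (X.deg i + 1) - (X.deg j + 1)) (by omega) (by omega) (- X.q i j)
      refine (congrArg ((X.deg i + 1).negOnePow • ·) h2).trans ?_
      exact castDeg_neg_smul_neg (K := A.Hom (X.obj j) (X.obj i)) (K' := A.Hom (X.obj j) (X.obj i))
        _ (X.deg i) ((A.Hom (X.obj j) (X.obj i)).d _ _).hom (X.q i j)
    · refine Finset.sum_congr rfl fun l _ => ?_
      refine (comp_castDeg (p := 1 + X.deg i - X.deg l) (q := 1 + X.deg l - X.deg j)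
        (n := 2 + X.deg i - X.deg j) (by omega) _ _ _ (by simp only [eX]; omega) _ _).trans ?_
      exact castDeg_neg_comp_neg (X := X.obj j) (Y := X.obj l) (Z := X.obj i) _ _ _ _

/-- The cone of a closed morphism `f : X ⟶ Y` of degree `0` in `A^pretr`: it is
`(Y ⊕ X[1], (q_Y, f; 0, -q_X))`. -/
def cone (f : (A.sumHom X.toFormalSum Y.toFormalSum).X 0)
    (hf : ((A.pretrHom X Y).d 0 1).hom f = 0) : A.TwistedComplex where
  n := Y.n + X.n
  obj i := coneObj X Y (finSumFinEquiv.symm i)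
  deg i := coneDeg X Y (finSumFinEquiv.symm i)
  q i j := coneQ f (finSumFinEquiv.symm i) (finSumFinEquiv.symm j)
  q_eq_zero i j h := by
    obtain ⟨a, rfl⟩ := finSumFinEquiv.surjective i
    obtain ⟨b, rfl⟩ := finSumFinEquiv.surjective j
    rw [Equiv.symm_apply_apply, Equiv.symm_apply_apply]
    match a, b with
    | .inl i, .inl j => exact Y.q_eq_zero i j h
    | .inl i, .inr j =>
      have h' : Y.n + j.1 ≤ i.1 := h
      omega
    | .inr i, .inl j => rfl
    | .inr i, .inr j =>
      exact castDeg_eq_zero _ (neg_eq_zero.2 (X.q_eq_zero i j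
        (Nat.le_of_add_le_add_left h)))
  d_q_add i j := by
    refine Eq.trans ?_ (coneQ_spec f hf (finSumFinEquiv.symm i) (finSumFinEquiv.symm j))
    congr 1
    exact Equiv.sum_comp finSumFinEquiv.symm (fun c => A.comp
      (1 + coneDeg X Y (finSumFinEquiv.symm i) - coneDeg X Y c)
      (1 + coneDeg X Y c - coneDeg X Y (finSumFinEquiv.symm j))
      (2 + coneDeg X Y (finSumFinEquiv.symm i) - coneDeg X Y (finSumFinEquiv.symm j)) (by omega)
      (coneQ f (finSumFinEquiv.symm i) c) (coneQ f c (finSumFinEquiv.symm j)))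

end DGCat

/-! ### DG quotients -/

variable {A C : DGCat k}

/-- The triangulated category `A^tr` (its morphisms of degree `0`): the homotopy category of
`A^pretr`. -/
abbrev DGCat.tr (A : DGCat k) : Type u := Ho A.pretr

/-- The functor `F^tr : A^tr ⥤ C^tr` induced by a DG functor `F`. -/
abbrev DGFunctor.tr (F : DGFunctor A C) : A.tr ⥤ C.tr := hoMap F.pretr

/-- For a full DG subcategory of `A` with set of objects `B`, the objects of the full subcategory
`B^tr` of `A^tr`: the twisted complexes all of whose terms are in `B`. -/
def DGCat.trSub (B : Set A.Obj) : Set A.tr :=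
  {Z : A.TwistedComplex | ∀ i, Z.obj i ∈ B}

/-- The morphisms of `A^tr` whose cone is isomorphic in `A^tr` to an object of `B^tr`. The Verdier
quotient `A^tr / B^tr` is the localization of `A^tr` with respect to this class of morphisms. -/
def DGCat.verdierClass (B : Set A.Obj) : MorphismProperty A.tr := fun X Y φ =>
  ∃ (f : (A.sumHom (TwistedComplex.toFormalSum X) (TwistedComplex.toFormalSum Y)).X 0)
    (hf : ((A.pretrHom X Y).d 0 1).hom f = 0),
    φ = Ho.homMk A.pretr ⟨f, hf⟩ ∧
      ∃ Z ∈ DGCat.trSub B, Nonempty ((show A.tr from DGCat.cone f hf) ≅ Z)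

/-- The DG functor `ξ : A → C` is a DG quotient of `A` modulo the full DG subcategory with set of
objects `B`: the functor `Ho(A) ⥤ Ho(C)` is essentially surjective, and the functor `A^tr ⥤ C^tr`
inverts the morphisms whose cone is in `B^tr` and induces an equivalence `A^tr / B^tr ⥤ C^tr`. -/
structure IsDGQuotient (ξ : DGFunctor A C) (B : Set A.Obj) : Prop where
  essSurj : (hoMap ξ).EssSurj
  isLocalization : ξ.tr.IsLocalization (DGCat.verdierClass B)

/-- The set of objects of the full DG subcategory `B ⊗ K` of `A ⊗ K`, for a full DG subcategory
of `A` with set of objects `B`. -/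
def DGCat.tensorSub (B : Set A.Obj) (K : DGCat k) : Set (A.tensor K).Obj :=
  {X : A.Obj × K.Obj | X.1 ∈ B}

end
end DG

namespace DG
noncomputable section

variable {k : Type u} [CommRing k]

/-! ### The total category of a DG category -/

/-! A relative class of a DG functor `F` is a cocycle `(z, γ)` of the fibre of `Hom(X, Y) → Hom(F X,
F Y)`: `z` is closed and `dif γ = F z`. The functor `ξ.tr` is a localization with respect to the
morphisms with cone in `B^tr` exactly when it is essentially surjective, the objects of `B^tr`
become contractible, and every relative class dies after restriction along some `X' ⟶ X` with cone
in `B^tr` (`RelVanish`). Applied to classes `(0, γ)` this is fullness up to fractions; applied to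
differences of parallel morphisms it is faithfulness. The two directions are
`relVanish_of_isLocalization` with `contractible_of_isInvertedBy`, and
`isLocalization_of_relVanish`.

This condition cannot be tensored with `K` directly, because a cocycle of a tensor product is not
assembled from cocycles of the factors. Instead, for each `a'` in `A`, cells `Hom(-, b)[n]` with `b
∈ B` are attached to the right module `Hom(-, a')`, so as to kill all relative classes on objects of
`B` (`Cell`). The result is a semifree module `M` with a map to `Hom(ξ -, ξ a')`. The fibre of this
map is acyclic at the objects of `B` by construction (`Cell.relAcyclic`), and at all objects of `A`
because `ξ` is a quotient (`IsSemifree.relAcyclic`). To stay within DG categories, `M` is realized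
as the morphisms to an object `pt` adjoined to `A`.

Flatness of `K` keeps the fibre acyclic (`ConeAcyclic.tensor`), and `M ⊗ Hom(-, y)` is still
semifree over `A ⊗ K`, with one generator at `a' ⊗ y` and the others at objects of `B ⊗ K`
(`IsCellular.tensor`). So a relative class between `X` and `a' ⊗ y` is bounded in this module. The
bound involves finitely many cells, which form a twisted complex `b` over `B ⊗ K`, and the class
dies on the fibre of a morphism from `X` to a shift of `b` (`IsSemifree.relVanish`). Dévissage
(`RelVanish.of_cone`) extends this to all twisted complexes.

Computations take place in the total category `Tot D`, where morphisms of any degree are composed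
and added without equations between degrees; homogeneity is a property (`IsHom`). -/

/-- The category with the objects of `D` whose morphisms are the finite sums of homogeneous
morphisms of `D`. -/
structure Tot (D : DGCat k) : Type u where
  obj : D.Obj

namespace Tot

/-- Morphisms of the total category. -/
def THom (D : DGCat k) (X Y : D.Obj) : Type u := DirectSum ℤ fun n => (D.Hom X Y).X n

instance (D : DGCat k) (X Y : D.Obj) : AddCommGroup (THom D X Y) :=
  inferInstanceAs (AddCommGroup (DirectSum ℤ fun n => (D.Hom X Y).X n))

instance (D : DGCat k) (X Y : D.Obj) : Module k (THom D X Y) :=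
  inferInstanceAs (Module k (DirectSum ℤ fun n => (D.Hom X Y).X n))

section

variable {D : DGCat k} {X Y : D.Obj}

/-- A homogeneous morphism, as a morphism in the total category. -/
def hin (n : ℤ) : (D.Hom X Y).X n →ₗ[k] THom D X Y :=
  DirectSum.lof k ℤ (fun n => (D.Hom X Y).X n) n

/-- A homogeneous component of a morphism of the total category. -/
def hcpt (n : ℤ) : THom D X Y →ₗ[k] (D.Hom X Y).X n :=
  DirectSum.component k ℤ (fun n => (D.Hom X Y).X n) n

theorem hcpt_hin (n : ℤ) (x : (D.Hom X Y).X n) : hcpt n (hin n x) = x :=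
  DirectSum.component.lof_self (R := k) (M := fun n => (D.Hom X Y).X n) n x

theorem hcpt_hin_of_ne {m n : ℤ} (h : m ≠ n) (x : (D.Hom X Y).X n) : hcpt m (hin n x) = 0 :=
  DFinsupp.single_eq_of_ne h

theorem hin_induction {P : THom D X Y → Prop} (h : ∀ n (x : (D.Hom X Y).X n), P (hin n x))
    (hadd : ∀ f g, P f → P g → P (f + g)) (f : THom D X Y) : P f := by
  induction f using DirectSum.induction_on with
  | zero => exact (map_zero (hin (D := D) (X := X) (Y := Y) 0)) ▸ h 0 0
  | add f g hf hg => exact hadd f g hf hg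
  | of n x => exact h n x

/-- Linear maps out of the morphisms in the total category. -/
def hlift {M : Type*} [AddCommGroup M] [Module k M] (φ : ∀ n, (D.Hom X Y).X n →ₗ[k] M) :
    THom D X Y →ₗ[k] M :=
  DirectSum.toModule k ℤ _ φ

theorem hlift_hin {M : Type*} [AddCommGroup M] [Module k M] (φ : ∀ n, (D.Hom X Y).X n →ₗ[k] M)
    (n : ℤ) (x : (D.Hom X Y).X n) : hlift φ (hin n x) = φ n x :=
  DirectSum.toModule_lof (M := fun n => (D.Hom X Y).X n) k n x

end

/-- Composition in the total category. -/
def tcomp (D : DGCat k) (X Y Z : D.Obj) : THom D X Y →ₗ[k] THom D Y Z →ₗ[k] THom D X Z :=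
  hlift fun q => LinearMap.flip <| hlift fun p =>
    (D.comp (X := X) (Y := Y) (Z := Z) p q (p + q) rfl).compr₂ (hin (p + q))

theorem tcomp_hin (D : DGCat k) {X Y Z : D.Obj} (p q n : ℤ) (h : p + q = n) (g : (D.Hom Y Z).X p)
    (f : (D.Hom X Y).X q) : tcomp D X Y Z (hin q f) (hin p g) = hin n (D.comp p q n h g f) := by
  subst h
  simp [tcomp, hlift_hin]

variable {D : DGCat k}

instance : Category (Tot D) where
  Hom X Y := THom D X.obj Y.obj
  id X := hin 0 (D.id X.obj)
  comp {X Y Z} f g := tcomp D X.obj Y.obj Z.obj f g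
  id_comp {X Y} f := by
    induction f using hin_induction with
    | hadd f g hf hg => exact (map_add _ _ _).trans (congrArg₂ _ hf hg)
    | h n x => exact (tcomp_hin D n 0 n (add_zero n) x (D.id X.obj)).trans (by rw [D.comp_id])
  comp_id {X Y} f := by
    induction f using hin_induction with
    | hadd f g hf hg => exact (LinearMap.map_add₂ _ _ _ _).trans (congrArg₂ _ hf hg)
    | h n x => exact (tcomp_hin D 0 n n (zero_add n) (D.id Y.obj) x).trans (by rw [D.id_comp])
  assoc {X Y Z W} f g h := by
    induction f using hin_induction with
    | hadd f f' hf hf' => simp [hf, hf']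
    | h r a =>
    induction g using hin_induction with
    | hadd f f' hf hf' => simp [hf, hf']
    | h q b =>
    induction h using hin_induction with
    | hadd f f' hf hf' => simp [hf, hf']
    | h p c =>
    rw [tcomp_hin D q r _ rfl b a, tcomp_hin D p q _ rfl c b,
      tcomp_hin D p (q + r) (p + q + r) (by omega), tcomp_hin D (p + q) r (p + q + r) rfl,
      D.assoc p q r (p + q) (q + r) (p + q + r) rfl rfl rfl (by omega)]

instance : Preadditive (Tot D) where
  homGroup X Y := inferInstanceAs (AddCommGroup (THom D X.obj Y.obj))
  add_comp X Y Z (f f' : THom D X.obj Y.obj) (g : THom D Y.obj Z.obj) :=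
    LinearMap.map_add₂ (tcomp D X.obj Y.obj Z.obj) f f' g
  comp_add X Y Z (f : THom D X.obj Y.obj) (g g' : THom D Y.obj Z.obj) :=
    map_add (tcomp D X.obj Y.obj Z.obj f) g g'

instance : Linear k (Tot D) where
  homModule X Y := inferInstanceAs (Module k (THom D X.obj Y.obj))
  smul_comp X Y Z r (f : THom D X.obj Y.obj) (g : THom D Y.obj Z.obj) :=
    LinearMap.map_smul₂ (tcomp D X.obj Y.obj Z.obj) r f g
  comp_smul X Y Z (f : THom D X.obj Y.obj) r (g : THom D Y.obj Z.obj) :=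
    map_smul (tcomp D X.obj Y.obj Z.obj f) r g

variable {X Y Z W : Tot D}

/-- A homogeneous morphism, as a morphism in the total category. -/
def tin (n : ℤ) : (D.Hom X.obj Y.obj).X n →ₗ[k] (X ⟶ Y) := hin n

/-- A homogeneous component of a morphism of the total category. -/
def tcpt (n : ℤ) : (X ⟶ Y) →ₗ[k] (D.Hom X.obj Y.obj).X n := hcpt n

@[simp]
theorem tcpt_tin (n : ℤ) (x : (D.Hom X.obj Y.obj).X n) : tcpt n (tin n x : X ⟶ Y) = x :=
  hcpt_hin n x

theorem tcpt_tin_of_ne {m n : ℤ} (h : m ≠ n) (x : (D.Hom X.obj Y.obj).X n) :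
    tcpt m (tin n x : X ⟶ Y) = 0 :=
  hcpt_hin_of_ne h x

theorem tin_injective (n : ℤ) :
    Function.Injective (tin n : (D.Hom X.obj Y.obj).X n → (X ⟶ Y)) :=
  Function.LeftInverse.injective (g := tcpt n) (tcpt_tin n)

theorem tin_castDeg {m n : ℤ} (h : m = n) (x : (D.Hom X.obj Y.obj).X m) :
    (tin n (DGCat.castDeg h x) : X ⟶ Y) = tin m x := by
  subst h; rfl

theorem hom_induction {P : (X ⟶ Y) → Prop} (h : ∀ n (x : (D.Hom X.obj Y.obj).X n), P (tin n x))
    (hadd : ∀ f g, P f → P g → P (f + g)) (f : X ⟶ Y) : P f :=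
  hin_induction (P := P) h hadd f

theorem tin_comp (p q n : ℤ) (h : p + q = n) (g : (D.Hom Y.obj Z.obj).X p)
    (f : (D.Hom X.obj Y.obj).X q) :
    (tin n (D.comp p q n h g f) : X ⟶ Z) = (tin q f : X ⟶ Y) ≫ (tin p g : Y ⟶ Z) :=
  (tcomp_hin D p q n h g f).symm

theorem tin_id (X : Tot D) : tin 0 (D.id X.obj) = 𝟙 X := rfl

theorem tin_idOf {X Y : Tot D} (e : X.obj = Y.obj) (n : ℤ) (hn : 0 = n) :
    (tin n (D.idOf e n hn) : X ⟶ Y) = eqToHom (congrArg Tot.mk e) := by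
  obtain ⟨X⟩ := X
  obtain ⟨Y⟩ := Y
  have e' : X = Y := e
  subst e' hn; rfl

/-- Linear maps out of the morphisms in the total category. -/
def tlin {M : Type*} [AddCommGroup M] [Module k M] (φ : ∀ n, (D.Hom X.obj Y.obj).X n →ₗ[k] M) :
    (X ⟶ Y) →ₗ[k] M :=
  hlift φ

@[simp]
theorem tlin_tin {M : Type*} [AddCommGroup M] [Module k M]
    (φ : ∀ n, (D.Hom X.obj Y.obj).X n →ₗ[k] M)
    (n : ℤ) (x : (D.Hom X.obj Y.obj).X n) : tlin φ (tin n x : X ⟶ Y) = φ n x :=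
  hlift_hin φ n x

/-- The differential. -/
def dif : (X ⟶ Y) →ₗ[k] (X ⟶ Y) :=
  tlin fun n => tin (n + 1) ∘ₗ ((D.Hom X.obj Y.obj).d n (n + 1)).hom

theorem dif_tin (n n' : ℤ) (h : n + 1 = n') (x : (D.Hom X.obj Y.obj).X n) :
    dif (tin n x : X ⟶ Y) = tin n' (((D.Hom X.obj Y.obj).d n n').hom x) := by
  subst h; exact tlin_tin _ _ _

/-- The involution which is `(-1) ^ n` in degree `n`. -/
def sg : (X ⟶ Y) →ₗ[k] (X ⟶ Y) :=
  tlin fun n => (n.negOnePow : ℤ) • tin n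

theorem sg_tin (n : ℤ) (x : (D.Hom X.obj Y.obj).X n) :
    sg (tin n x : X ⟶ Y) = (n.negOnePow : ℤ) • tin n x :=
  tlin_tin _ _ _

/-- The sign falls on the second morphism because `f ≫ g` is `comp g f`, and the Leibniz rule takes
its sign from the degree of the outer factor `g`. -/
theorem dif_comp (f : X ⟶ Y) (g : Y ⟶ Z) : dif (f ≫ g) = f ≫ dif g + dif f ≫ sg g := by
  induction f using hom_induction with
  | hadd f f' h h' => simp only [Preadditive.add_comp, map_add, h, h']; abel
  | h q f =>
  induction g using hom_induction with
  | hadd f f' h h' => simp only [Preadditive.comp_add, map_add, h, h']; abel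
  | h p g =>
  rw [← tin_comp p q _ rfl, dif_tin _ _ rfl, D.d_comp p q (p + q) (p + 1) (q + 1) (p + q + 1) rfl
    rfl rfl (by omega) (by omega), dif_tin _ _ rfl, dif_tin _ _ rfl, sg_tin, map_add, tin_comp,
    Units.smul_def, map_zsmul, tin_comp, Preadditive.comp_zsmul]

theorem sg_comp (f : X ⟶ Y) (g : Y ⟶ Z) : sg (f ≫ g) = sg f ≫ sg g := by
  induction f using hom_induction with
  | hadd f f' h h' => simp only [Preadditive.add_comp, map_add, h, h']
  | h q f =>
  induction g using hom_induction with
  | hadd f f' h h' => simp only [Preadditive.comp_add, map_add, h, h']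
  | h p g =>
  rw [← tin_comp p q _ rfl, sg_tin, sg_tin, sg_tin, tin_comp, Preadditive.comp_zsmul,
    Preadditive.zsmul_comp, smul_smul, Int.negOnePow_add, Units.val_mul]

@[simp]
theorem dif_dif (f : X ⟶ Y) : dif (dif f) = 0 := by
  induction f using hom_induction with
  | hadd f f' h h' => simp only [map_add, h, h', add_zero]
  | h q f =>
    rw [dif_tin _ _ rfl, dif_tin _ _ rfl]
    exact (congrArg (tin (D := D) (X := X) (Y := Y) _) (congrArg (fun g => g.hom f)
      ((D.Hom X.obj Y.obj).d_comp_d q (q + 1) (q + 1 + 1)))).trans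
      (map_zero (tin (D := D) (X := X) (Y := Y) _))

@[simp]
theorem dif_id (X : Tot D) : dif (𝟙 X) = 0 := by
  rw [← tin_id, dif_tin 0 1 rfl, D.d_id, map_zero]

/-- Homogeneous morphisms of degree `n`. -/
def IsHom (n : ℤ) (f : X ⟶ Y) : Prop := tin n (tcpt n f) = f

theorem isHom_tin (n : ℤ) (x : (D.Hom X.obj Y.obj).X n) : IsHom n (tin n x : X ⟶ Y) := by
  rw [IsHom, tcpt_tin]

namespace IsHom

theorem zero (n : ℤ) : IsHom n (0 : X ⟶ Y) := by simp [IsHom]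

theorem add {n : ℤ} {f g : X ⟶ Y} (hf : IsHom n f) (hg : IsHom n g) : IsHom n (f + g) := by
  rw [IsHom, map_add, map_add, hf, hg]

theorem neg {n : ℤ} {f : X ⟶ Y} (hf : IsHom n f) : IsHom n (-f) := by
  rw [IsHom, map_neg, map_neg, hf]

theorem sub {n : ℤ} {f g : X ⟶ Y} (hf : IsHom n f) (hg : IsHom n g) : IsHom n (f - g) := by
  rw [IsHom, map_sub, map_sub, hf, hg]

theorem zsmul {n : ℤ} {f : X ⟶ Y} (c : ℤ) (hf : IsHom n f) : IsHom n (c • f) := by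
  rw [IsHom, map_zsmul, map_zsmul, hf]

theorem id (X : Tot D) : IsHom 0 (𝟙 X) := isHom_tin 0 (D.id X.obj)

theorem eqToHom {X Y : Tot D} (e : X = Y) : IsHom 0 (eqToHom e) := by
  subst e; exact id X

theorem comp {p q n : ℤ} {f : X ⟶ Y} {g : Y ⟶ Z} (hf : IsHom p f) (hg : IsHom q g)
    (h : p + q = n) : IsHom n (f ≫ g) := by
  rw [← hf, ← hg, ← tin_comp q p n (by omega)]
  exact isHom_tin _ _

theorem dif {n n' : ℤ} {f : X ⟶ Y} (hf : IsHom n f) (h : n + 1 = n') : IsHom n' (dif f) := by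
  rw [← hf, dif_tin n n' h]
  exact isHom_tin _ _

theorem cast {m n : ℤ} {f : X ⟶ Y} (hf : IsHom m f) (h : m = n) : IsHom n f := h ▸ hf

theorem sg_eq {n : ℤ} {f : X ⟶ Y} (hf : IsHom n f) : sg f = (n.negOnePow : ℤ) • f := by
  rw [← hf, sg_tin]

theorem sg_zero {f : X ⟶ Y} (hf : IsHom 0 f) : sg f = f := by simp [hf.sg_eq]

theorem sg_one {f : X ⟶ Y} (hf : IsHom 1 f) : sg f = -f := by simp [hf.sg_eq]

theorem sg_neg_one {f : X ⟶ Y} (hf : IsHom (-1) f) : sg f = -f := by simp [hf.sg_eq]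

end IsHom

theorem dif_eqToHom {X Y : Tot D} (e : X = Y) : dif (eqToHom e) = 0 := by
  subst e; exact dif_id X

/-- The functor on total categories given by a DG functor. -/
def mapLin {D E : DGCat k} (F : DGFunctor D E) {X Y : Tot D} :
    (X ⟶ Y) →ₗ[k] ((⟨F.obj X.obj⟩ : Tot E) ⟶ ⟨F.obj Y.obj⟩) :=
  tlin fun n => tin n ∘ₗ ((F.map X.obj Y.obj).f n).hom

theorem mapLin_tin {D E : DGCat k} (F : DGFunctor D E) {X Y : Tot D} (n : ℤ)
    (x : (D.Hom X.obj Y.obj).X n) :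
    mapLin F (tin n x : X ⟶ Y) = tin n (((F.map X.obj Y.obj).f n).hom x) :=
  tlin_tin _ _ _

end Tot

open Tot

/-- The functor on total categories given by a DG functor. -/
def DGFunctor.tot {D E : DGCat k} (F : DGFunctor D E) : Tot D ⥤ Tot E where
  obj X := ⟨F.obj X.obj⟩
  map f := mapLin F f
  map_id X := by
    rw [← tin_id, mapLin_tin, F.map_id]
    rfl
  map_comp {X Y Z} f g := by
    induction f using hom_induction with
    | hadd f f' h h' => simp only [Preadditive.add_comp, map_add, h, h']
    | h q f =>
    induction g using hom_induction with
    | hadd f f' h h' => simp only [Preadditive.comp_add, map_add, h, h']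
    | h p g =>
    rw [← tin_comp p q _ rfl, mapLin_tin, mapLin_tin, mapLin_tin, F.map_comp]
    exact tin_comp _ _ _ _ _ _

instance {D E : DGCat k} (F : DGFunctor D E) : F.tot.Additive where
  map_add {_ _ f g} := map_add (mapLin F) f g

theorem DGFunctor.tot_tin {D E : DGCat k} (F : DGFunctor D E) {X Y : Tot D} (n : ℤ)
    (x : (D.Hom X.obj Y.obj).X n) :
    F.tot.map (tin n x : X ⟶ Y) =
      (tin n (((F.map X.obj Y.obj).f n).hom x) : F.tot.obj X ⟶ F.tot.obj Y) :=
  mapLin_tin F n x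

theorem DGFunctor.dif_tot {D E : DGCat k} (F : DGFunctor D E) {X Y : Tot D} (f : X ⟶ Y) :
    dif (F.tot.map f) = F.tot.map (dif f) := by
  induction f using hom_induction with
  | hadd f f' h h' => simp only [Functor.map_add, map_add, h, h']
  | h q f =>
    rw [F.tot_tin, dif_tin q _ rfl f, F.tot_tin, F.map_d]
    exact dif_tin (X := F.tot.obj X) (Y := F.tot.obj Y) q (q + 1) rfl _

theorem DGFunctor.sg_tot {D E : DGCat k} (F : DGFunctor D E) {X Y : Tot D} (f : X ⟶ Y) :
    sg (F.tot.map f) = F.tot.map (sg f) := by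
  induction f using hom_induction with
  | hadd f f' h h' => simp only [Functor.map_add, map_add, h, h']
  | h q f =>
    rw [F.tot_tin, sg_tin q f, Functor.map_zsmul, F.tot_tin]
    exact sg_tin (X := F.tot.obj X) (Y := F.tot.obj Y) q _

theorem Tot.IsHom.tot {D E : DGCat k} (F : DGFunctor D E) {X Y : Tot D} {n : ℤ} {f : X ⟶ Y}
    (hf : IsHom n f) : IsHom n (F.tot.map f) := by
  rw [← hf, F.tot_tin]
  exact isHom_tin _ _

/-! ### The homotopy category in terms of the total category -/

namespace Tot

variable {D : DGCat k} {X Y Z : Tot D}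

/-- Closed homogeneous morphisms of degree `n`. -/
structure Closed (n : ℤ) (f : X ⟶ Y) : Prop where
  isHom : IsHom n f
  dif_eq : dif f = 0

namespace Closed

theorem id (X : Tot D) : Closed 0 (𝟙 X) := ⟨.id X, dif_id X⟩

theorem zero (n : ℤ) : Closed n (0 : X ⟶ Y) := ⟨.zero n, map_zero _⟩

theorem comp {p q n : ℤ} {f : X ⟶ Y} {g : Y ⟶ Z} (hf : Closed p f) (hg : Closed q g)
    (h : p + q = n) : Closed n (f ≫ g) :=
  ⟨hf.isHom.comp hg.isHom h, by
    rw [dif_comp, hf.dif_eq, hg.dif_eq, Limits.zero_comp, Limits.comp_zero, add_zero]⟩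

theorem add {n : ℤ} {f g : X ⟶ Y} (hf : Closed n f) (hg : Closed n g) : Closed n (f + g) :=
  ⟨hf.isHom.add hg.isHom, by rw [map_add, hf.dif_eq, hg.dif_eq, add_zero]⟩

theorem sub {n : ℤ} {f g : X ⟶ Y} (hf : Closed n f) (hg : Closed n g) : Closed n (f - g) :=
  ⟨hf.isHom.sub hg.isHom, by rw [map_sub, hf.dif_eq, hg.dif_eq, sub_zero]⟩

theorem dif {n n' : ℤ} {f : X ⟶ Y} (hf : IsHom n f) (h : n + 1 = n') : Closed n' (dif f) :=
  ⟨hf.dif h, dif_dif f⟩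

theorem tot {E : DGCat k} (F : DGFunctor D E) {n : ℤ} {f : X ⟶ Y} (hf : Closed n f) :
    Closed n (F.tot.map f) :=
  ⟨hf.isHom.tot F, by rw [F.dif_tot, hf.dif_eq, Functor.map_zero]⟩

theorem mem_cycles {f : X ⟶ Y} (hf : Closed 0 f) : tcpt 0 f ∈ D.cycles X.obj Y.obj := by
  refine LinearMap.mem_ker.2 (tin_injective (D := D) (X := X) (Y := Y) 1 ?_)
  rw [← dif_tin 0 1 rfl, hf.isHom, hf.dif_eq, map_zero]

end Closed

/-- The object of the homotopy category. -/
def ho (X : Tot D) : Ho D := X.obj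

/-- The morphism in the homotopy category given by a closed morphism of degree `0`. -/
def toHo (f : X ⟶ Y) (hf : Closed 0 f) : X.ho ⟶ Y.ho :=
  Ho.homMk D ⟨tcpt 0 f, hf.mem_cycles⟩

theorem toHo_surjective (φ : X.ho ⟶ Y.ho) : ∃ (f : X ⟶ Y) (hf : Closed 0 f), toHo f hf = φ := by
  obtain ⟨⟨(x : (D.Hom X.obj Y.obj).X 0), hx⟩, rfl⟩ := Submodule.Quotient.mk_surjective _ φ
  refine ⟨tin 0 x, ⟨isHom_tin 0 x, ?_⟩, ?_⟩
  · rw [dif_tin 0 1 rfl]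
    have hx' : ((D.Hom X.obj Y.obj).d 0 1).hom x = 0 := hx
    rw [hx', map_zero]
  · refine congrArg (Ho.homMk D) (Subtype.ext ?_)
    exact tcpt_tin 0 x

theorem toHo_eq_iff {f g : X ⟶ Y} (hf : Closed 0 f) (hg : Closed 0 g) :
    toHo f hf = toHo g hg ↔ ∃ e : X ⟶ Y, IsHom (-1) e ∧ dif e = f - g := by
  refine (Submodule.Quotient.eq _).trans ⟨fun ⟨(e : (D.Hom X.obj Y.obj).X (-1)), he⟩ => ⟨tin (-1) e, isHom_tin _ _, ?_⟩,
    fun ⟨e, he, he'⟩ => ⟨tcpt (-1) e, ?_⟩⟩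
  · rw [dif_tin (-1) 0 rfl]
    refine (congrArg (tin (D := D) (X := X) (Y := Y) 0) he).trans ?_
    exact (map_sub (tin (D := D) (X := X) (Y := Y) 0) _ _).trans
      (congrArg₂ _ hf.isHom hg.isHom)
  · refine tin_injective (D := D) (X := X) (Y := Y) 0 ?_
    refine (dif_tin (-1) 0 rfl (tcpt (-1) e)).symm.trans ?_
    rw [he, he']
    exact ((map_sub (tin (D := D) (X := X) (Y := Y) 0) _ _).trans
      (congrArg₂ _ hf.isHom hg.isHom)).symm

theorem toHo_comp {f : X ⟶ Y} {g : Y ⟶ Z} (hf : Closed 0 f) (hg : Closed 0 g) :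
    toHo f hf ≫ toHo g hg = toHo (f ≫ g) (hf.comp hg rfl) := by
  refine congrArg (Ho.homMk D) (Subtype.ext (tin_injective (D := D) (X := X) (Y := Z) 0 ?_))
  refine Eq.trans ?_ (hf.comp hg rfl).isHom.symm
  refine (tin_comp 0 0 0 rfl _ _).trans ?_
  exact congrArg₂ _ hf.isHom hg.isHom

theorem toHo_id (X : Tot D) : toHo (𝟙 X) (.id X) = 𝟙 X.ho :=
  congrArg (Ho.homMk D) (Subtype.ext (tcpt_tin (X := X) (Y := X) 0 (D.id X.obj)))

theorem hoMap_toHo {E : DGCat k} (F : DGFunctor D E) {f : X ⟶ Y} (hf : Closed 0 f) :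
    (hoMap F).map (toHo f hf) =
      (toHo (F.tot.map f) (hf.tot F) : (F.tot.obj X).ho ⟶ (F.tot.obj Y).ho) := by
  refine congrArg (Ho.homMk E) (Subtype.ext ?_)
  refine tin_injective (D := E) (X := F.tot.obj X) (Y := F.tot.obj Y) 0 ?_
  refine Eq.trans ?_ (hf.tot F).isHom.symm
  exact (F.tot_tin 0 _).symm.trans (congrArg _ hf.isHom)

/-- A closed morphism of degree `0` which is a homotopy equivalence. -/
structure Equiv (f : X ⟶ Y) : Prop where
  closed : Closed 0 f
  isIso : IsIso (toHo f closed)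

theorem equiv_iff {f : X ⟶ Y} (hf : Closed 0 f) :
    Equiv f ↔ ∃ g : Y ⟶ X, Closed 0 g ∧ (∃ e, IsHom (-1) e ∧ dif e = f ≫ g - 𝟙 X) ∧
      ∃ e, IsHom (-1) e ∧ dif e = g ≫ f - 𝟙 Y := by
  constructor
  · rintro ⟨_, ⟨φ, h₁, h₂⟩⟩
    obtain ⟨g, hg, rfl⟩ := toHo_surjective φ
    rw [toHo_comp, ← toHo_id, toHo_eq_iff] at h₁ h₂
    exact ⟨g, hg, h₁, h₂⟩
  · rintro ⟨g, hg, h₁, h₂⟩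
    refine ⟨hf, toHo g hg, ?_, ?_⟩
    · rw [toHo_comp, ← toHo_id, toHo_eq_iff]; exact h₁
    · rw [toHo_comp, ← toHo_id, toHo_eq_iff]; exact h₂

theorem Equiv.id (X : Tot D) : Equiv (𝟙 X) := ⟨.id X, by rw [toHo_id]; infer_instance⟩

theorem Equiv.comp {f : X ⟶ Y} {g : Y ⟶ Z} (hf : Equiv f) (hg : Equiv g) : Equiv (f ≫ g) := by
  have := hf.isIso
  have := hg.isIso
  exact ⟨hf.closed.comp hg.closed rfl, by rw [← toHo_comp hf.closed hg.closed]; infer_instance⟩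

theorem Equiv.of_inverse {f : X ⟶ Y} {g : Y ⟶ X} (hf : Closed 0 f) (hg : Closed 0 g)
    (h₁ : f ≫ g = 𝟙 X) {e : Y ⟶ Y} (he : IsHom (-1) e) (h₂ : dif e = g ≫ f - 𝟙 Y) : Equiv f :=
  (equiv_iff hf).2 ⟨g, hg, ⟨0, .zero _, by rw [h₁, sub_self, map_zero]⟩, e, he, h₂⟩

theorem Equiv.exists_inverse {f : X ⟶ Y} (hf : Equiv f) : ∃ g : Y ⟶ X, Equiv g ∧
    (∃ e, IsHom (-1) e ∧ dif e = f ≫ g - 𝟙 X) ∧ ∃ e, IsHom (-1) e ∧ dif e = g ≫ f - 𝟙 Y := by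
  obtain ⟨g, hg, h₁, h₂⟩ := (equiv_iff hf.closed).1 hf
  exact ⟨g, (equiv_iff hg).2 ⟨f, hf.closed, h₂, h₁⟩, h₁, h₂⟩

theorem Equiv.of_eq {f g : X ⟶ Y} (hf : Equiv f) (h : f = g) : Equiv g := h ▸ hf

theorem Equiv.tot {E : DGCat k} (F : DGFunctor D E) {f : X ⟶ Y} (hf : Equiv f) :
    Equiv (F.tot.map f) := by
  have := hf.isIso
  exact ⟨hf.closed.tot F, hoMap_toHo F hf.closed ▸
    inferInstanceAs (IsIso ((hoMap F).map (toHo f hf.closed)))⟩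

end Tot

/-! ### Extensions of objects by closed morphisms of degree 1. -/

namespace Tot

variable {D : DGCat k} {X Y Z b T : Tot D}

/-- A presentation of `T` as `X ⊕ b`, with its differential twisted by `h : b ⟶ X`. -/
structure ConeData (h : b ⟶ X) (T : Tot D) where
  i : X ⟶ T
  j : b ⟶ T
  p : T ⟶ X
  s : T ⟶ b
  isHom_i : IsHom 0 i
  isHom_j : IsHom 0 j
  isHom_p : IsHom 0 p
  isHom_s : IsHom 0 s
  i_p : i ≫ p = 𝟙 X
  j_s : j ≫ s = 𝟙 b
  j_p : j ≫ p = 0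
  i_s : i ≫ s = 0
  p_i_add : p ≫ i + s ≫ j = 𝟙 T
  dif_i : dif i = 0
  dif_j : dif j = h ≫ i

namespace ConeData

attribute [simp] i_p j_s j_p i_s dif_i dif_j

variable {h : b ⟶ X} (c : ConeData h T)

@[simp] theorem i_p_assoc (f : X ⟶ Z) : c.i ≫ c.p ≫ f = f := by
  rw [← Category.assoc, c.i_p, Category.id_comp]

@[simp] theorem j_s_assoc (f : b ⟶ Z) : c.j ≫ c.s ≫ f = f := by
  rw [← Category.assoc, c.j_s, Category.id_comp]

@[simp] theorem j_p_assoc (f : X ⟶ Z) : c.j ≫ c.p ≫ f = 0 := by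
  rw [← Category.assoc, c.j_p, Limits.zero_comp]

@[simp] theorem i_s_assoc (f : b ⟶ Z) : c.i ≫ c.s ≫ f = 0 := by
  rw [← Category.assoc, c.i_s, Limits.zero_comp]

-- With the other simp lemmas this gives a normal form for composites through `T`: `s ≫ j` is always
-- eliminated in favour of `p ≫ i`.
@[simp] theorem s_j : c.s ≫ c.j = 𝟙 T - c.p ≫ c.i := eq_sub_of_add_eq' c.p_i_add

@[simp] theorem s_j_assoc (f : T ⟶ Z) : c.s ≫ c.j ≫ f = f - c.p ≫ c.i ≫ f := by
  rw [← Category.assoc, c.s_j, Preadditive.sub_comp, Category.id_comp, Category.assoc]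

@[simp] theorem sg_i : sg c.i = c.i := c.isHom_i.sg_zero
@[simp] theorem sg_j : sg c.j = c.j := c.isHom_j.sg_zero
@[simp] theorem sg_p : sg c.p = c.p := c.isHom_p.sg_zero
@[simp] theorem sg_s : sg c.s = c.s := c.isHom_s.sg_zero

theorem hom_ext {f g : T ⟶ Z} (h₁ : c.i ≫ f = c.i ≫ g) (h₂ : c.j ≫ f = c.j ≫ g) : f = g := by
  rw [← Category.id_comp f, ← Category.id_comp g, ← c.p_i_add]
  simp only [Preadditive.add_comp, Category.assoc, h₁, h₂]

-- The differentials of the projections are not part of the data: differentiating `i ≫ s = 0` and `j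
-- ≫ s = 𝟙` determines `dif s` on both summands. The same argument gives `dif p`.
@[simp] theorem dif_s : dif c.s = 0 := by
  refine c.hom_ext ?_ ?_
  · have := dif_comp c.i c.s
    simpa using this.symm
  · have := dif_comp c.j c.s
    simpa using this.symm

@[simp] theorem dif_p : dif c.p = - c.s ≫ h := by
  refine c.hom_ext ?_ ?_
  · have := dif_comp c.i c.p
    simpa using this.symm
  · have := dif_comp c.j c.p
    simpa [eq_neg_iff_add_eq_zero] using this.symm

theorem closed_i : Closed 0 c.i := ⟨c.isHom_i, c.dif_i⟩

theorem closed_s : Closed 0 c.s := ⟨c.isHom_s, c.dif_s⟩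

/-- The image by a DG functor. -/
def map {E : DGCat k} (F : DGFunctor D E) : ConeData (F.tot.map h) (F.tot.obj T) where
  i := F.tot.map c.i
  j := F.tot.map c.j
  p := F.tot.map c.p
  s := F.tot.map c.s
  isHom_i := c.isHom_i.tot F
  isHom_j := c.isHom_j.tot F
  isHom_p := c.isHom_p.tot F
  isHom_s := c.isHom_s.tot F
  i_p := by rw [← F.tot.map_comp, c.i_p, F.tot.map_id]
  j_s := by rw [← F.tot.map_comp, c.j_s, F.tot.map_id]
  j_p := by rw [← F.tot.map_comp, c.j_p, F.tot.map_zero]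
  i_s := by rw [← F.tot.map_comp, c.i_s, F.tot.map_zero]
  p_i_add := by
    rw [← F.tot.map_comp, ← F.tot.map_comp, ← F.tot.map_add, c.p_i_add, F.tot.map_id]
  dif_i := by rw [F.dif_tot, c.dif_i, F.tot.map_zero]
  dif_j := by rw [F.dif_tot, c.dif_j, F.tot.map_comp]

/-- Change of the two terms along isomorphisms. -/
def ofIso {X' b' : Tot D} (u : X' ⟶ X) (u' : X ⟶ X') (v : b' ⟶ b) (v' : b ⟶ b')
    (hu : Closed 0 u) (hu' : Closed 0 u') (hv : Closed 0 v) (hv' : Closed 0 v')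
    (huu : u ≫ u' = 𝟙 X') (huu' : u' ≫ u = 𝟙 X) (hvv : v ≫ v' = 𝟙 b') (hvv' : v' ≫ v = 𝟙 b) :
    ConeData (v ≫ h ≫ u') T where
  i := u ≫ c.i
  j := v ≫ c.j
  p := c.p ≫ u'
  s := c.s ≫ v'
  isHom_i := hu.isHom.comp c.isHom_i rfl
  isHom_j := hv.isHom.comp c.isHom_j rfl
  isHom_p := c.isHom_p.comp hu'.isHom rfl
  isHom_s := c.isHom_s.comp hv'.isHom rfl
  i_p := by simp [huu]
  j_s := by simp [hvv]
  j_p := by simp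
  i_s := by simp
  p_i_add := by
    rw [Category.assoc, ← Category.assoc u', huu', Category.id_comp, Category.assoc,
      ← Category.assoc v', hvv', Category.id_comp, c.p_i_add]
  dif_i := by simp [dif_comp, hu.dif_eq]
  dif_j := by
    simp only [dif_comp, hv.dif_eq, c.dif_j, Limits.zero_comp, add_zero, Category.assoc]
    rw [← Category.assoc u', huu', Category.id_comp]

end ConeData

/-- A morphism of cones. -/
theorem exists_coneMap {X' b' T' : Tot D} {h : b ⟶ X} {h' : b' ⟶ X'} (c : ConeData h T)
    (c' : ConeData h' T') {ψ : X ⟶ X'} {χ : b ⟶ b'} (hψ : Closed 0 ψ) (hχ : Closed 0 χ)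
    {α : b ⟶ X'} (hα : IsHom 0 α) (hα' : dif α = h ≫ ψ - χ ≫ h') :
    ∃ θ : T ⟶ T', Closed 0 θ ∧ c.i ≫ θ = ψ ≫ c'.i ∧ θ ≫ c'.s = c.s ≫ χ := by
  -- A triangular matrix with diagonal `ψ`, `χ` and corner `α`; the equation for `dif α` is exactly
  -- its closedness.
  refine ⟨c.p ≫ ψ ≫ c'.i + c.s ≫ χ ≫ c'.j + c.s ≫ α ≫ c'.i, ⟨?_, ?_⟩, by simp, by simp⟩
  · exact ((c.isHom_p.comp (hψ.isHom.comp c'.isHom_i rfl) rfl).add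
      (c.isHom_s.comp (hχ.isHom.comp c'.isHom_j rfl) rfl)).add
      (c.isHom_s.comp (hα.comp c'.isHom_i rfl) rfl)
  · simp [dif_comp, sg_comp, hψ.dif_eq, hχ.dif_eq, hψ.isHom.sg_zero, hα']

theorem equiv_of_comp {f : X ⟶ Y} {g : Y ⟶ X} (hf : Closed 0 f) (hg : Closed 0 g)
    (h₁ : Equiv (f ≫ g)) (h₂ : Equiv (g ≫ f)) : Equiv f := by
  have h₁ := h₁.isIso
  have h₂ := h₂.isIso
  rw [← toHo_comp hf hg] at h₁
  rw [← toHo_comp hg hf] at h₂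
  have : Mono (toHo f hf) := mono_of_mono (toHo f hf) (toHo g hg)
  have : IsSplitEpi (toHo f hf) :=
    ⟨⟨inv (toHo g hg ≫ toHo f hf) ≫ toHo g hg, by simp⟩⟩
  exact ⟨hf, isIso_of_mono_of_isSplitEpi _⟩

theorem Equiv.of_homotopic {f g : X ⟶ Y} (hf : Equiv f) (hg : Closed 0 g) {e : X ⟶ Y}
    (he : IsHom (-1) e) (h : dif e = f - g) : Equiv g := by
  refine ⟨hg, ?_⟩
  rw [← (toHo_eq_iff hf.closed hg).2 ⟨e, he, h⟩]
  exact hf.isIso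

/-- After subtraction of the boundary of the diagonal homotopy `w`, the two diagonal entries of `θ`
are identities. What remains is `𝟙 + n` with `i ≫ n = 0` and `n ≫ s = 0`, so `n ≫ n = 0` and `𝟙 - n`
is a strict inverse. -/
theorem equiv_coneEndo {h : b ⟶ X} (c : ConeData h T) {θ : T ⟶ T} (hθ : Closed 0 θ)
    {ψ : X ⟶ X} {χ : b ⟶ b} (hi : c.i ≫ θ = ψ ≫ c.i) (hs : θ ≫ c.s = c.s ≫ χ)
    {e : X ⟶ X} (he : IsHom (-1) e) (he' : dif e = ψ - 𝟙 X)
    {e' : b ⟶ b} (hh : IsHom (-1) e') (hh' : dif e' = χ - 𝟙 b) : Equiv θ := by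
  let w : T ⟶ T := c.p ≫ e ≫ c.i + c.s ≫ e' ≫ c.j
  have hw : IsHom (-1) w := (c.isHom_p.comp (he.comp c.isHom_i rfl) rfl).add
    (c.isHom_s.comp (hh.comp c.isHom_j rfl) rfl)
  have hwi : c.i ≫ dif w = dif (c.i ≫ w) := by simp [dif_comp]
  have hws : dif w ≫ c.s = dif (w ≫ c.s) := by simp [dif_comp]
  let n : T ⟶ T := θ - dif w - 𝟙 T
  have hn : Closed 0 n := (hθ.sub (.dif hw rfl)).sub (.id T)
  have hni : c.i ≫ n = 0 := by
    simp only [n, Preadditive.comp_sub, hi, hwi]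
    simp [w, dif_comp, he']
  have hns : n ≫ c.s = 0 := by
    simp only [n, Preadditive.sub_comp, hs, hws]
    simp [w, dif_comp, hh']
  have hnn : n ≫ n = 0 := by
    have : n = n ≫ (c.p ≫ c.i + c.s ≫ c.j) := by rw [c.p_i_add, Category.comp_id]
    rw [Preadditive.comp_add, ← Category.assoc n c.s, hns, Limits.zero_comp, add_zero] at this
    calc n ≫ n = (n ≫ c.p ≫ c.i) ≫ n := congrArg (· ≫ n) this
      _ = 0 := by simp [hni]
  have h1 : Equiv (𝟙 T + n) := by
    refine Equiv.of_inverse (g := 𝟙 T - n) ((Closed.id T).add hn) ((Closed.id T).sub hn) ?_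
      (.zero (-1)) ?_
    · simp [hnn]
    · simp [hnn]
  -- By definition `θ = 𝟙 + n + dif w`, so `-w` is a homotopy between the invertible `𝟙 + n` and
  -- `θ`.
  refine h1.of_homotopic hθ (e := -w) hw.neg ?_
  simp only [n, map_neg]
  abel

/-- The five lemma for extensions. A morphism `θ'` in the other direction is built on homotopy
inverses of `ψ` and `χ`; both composites with `θ` have diagonal entries homotopic to identities, so
`equiv_coneEndo` applies to them. -/
theorem equiv_coneMap {X' b' T' : Tot D} {h : b ⟶ X} {h' : b' ⟶ X'} (c : ConeData h T)
    (c' : ConeData h' T') (hh : Closed 1 h) (hh' : Closed 1 h') {ψ : X ⟶ X'} {χ : b ⟶ b'}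
    (hψ : Equiv ψ) (hχ : Equiv χ) {θ : T ⟶ T'}
    (hθ : Closed 0 θ) (hi : c.i ≫ θ = ψ ≫ c'.i) (hs : θ ≫ c'.s = c.s ≫ χ) : Equiv θ := by
  obtain ⟨ψ', hψ', ⟨e₁, he₁, he₁'⟩, ⟨e₂, he₂, he₂'⟩⟩ := hψ.exists_inverse
  obtain ⟨χ', hχ', ⟨f₁, hf₁, hf₁'⟩, ⟨f₂, hf₂, hf₂'⟩⟩ := hχ.exists_inverse
  have hα : dif (c.j ≫ θ ≫ c'.p) = h ≫ ψ - χ ≫ h' := by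
    have e1 : c.j ≫ θ ≫ c'.s ≫ h' = χ ≫ h' := by
      rw [← Category.assoc θ, hs]; simp
    have e2 : h ≫ c.i ≫ θ ≫ c'.p = h ≫ ψ := by
      rw [← Category.assoc c.i, hi]; simp
    simp [dif_comp, hθ.dif_eq, hθ.isHom.sg_zero, sg_comp, e1, e2]
    abel
  have hα0 : IsHom 0 (c.j ≫ θ ≫ c'.p) :=
    c.isHom_j.comp (hθ.isHom.comp c'.isHom_p rfl) rfl
  generalize c.j ≫ θ ≫ c'.p = α at hα hα0
  -- The corner of `θ'` must bound `h' ≫ ψ' - χ' ≫ h`. The term `χ' ≫ α ≫ ψ'` carries the known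
  -- bound for `θ` to the inverses, and the homotopies `e₁` and `f₂` correct for `ψ ≫ ψ'` and `χ' ≫
  -- χ` not being identities.
  obtain ⟨θ', hθ', hi', hs'⟩ := exists_coneMap c' c hψ'.closed hχ'.closed
    (α := χ' ≫ h ≫ e₁ + f₂ ≫ h' ≫ ψ' - χ' ≫ α ≫ ψ')
    (((hχ'.closed.isHom.comp (hh.isHom.comp he₁ rfl) rfl).add
      (hf₂.comp (hh'.isHom.comp hψ'.closed.isHom rfl) rfl)).sub
      (hχ'.closed.isHom.comp (hα0.comp hψ'.closed.isHom rfl) rfl)) (by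
    simp [dif_comp, sg_comp, hχ'.closed.dif_eq, hψ'.closed.dif_eq, hh.dif_eq, hh'.dif_eq,
      hh'.isHom.sg_one, hψ'.closed.isHom.sg_zero, hα, he₁', hf₂']
    abel)
  refine equiv_of_comp hθ hθ' ?_ ?_
  · exact equiv_coneEndo c (hθ.comp hθ' rfl) (ψ := ψ ≫ ψ') (χ := χ ≫ χ')
      (by rw [← Category.assoc, hi, Category.assoc, hi', Category.assoc])
      (by rw [Category.assoc, hs', ← Category.assoc, hs, Category.assoc]) he₁ he₁' hf₁ hf₁'
  · exact equiv_coneEndo c' (hθ'.comp hθ rfl) (ψ := ψ' ≫ ψ) (χ := χ' ≫ χ)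
      (by rw [← Category.assoc, hi', Category.assoc, hi, Category.assoc])
      (by rw [Category.assoc, hs, ← Category.assoc, hs', Category.assoc]) he₂ he₂' hf₂ hf₂'

theorem exists_equiv_cone {X' b' T' : Tot D} {h : b ⟶ X} {h' : b' ⟶ X'} (c : ConeData h T)
    (c' : ConeData h' T') (hh : Closed 1 h) (hh' : Closed 1 h') {ψ : X ⟶ X'} {χ : b ⟶ b'}
    (hψ : Equiv ψ) (hχ : Equiv χ) {α : b ⟶ X'} (hα : IsHom 0 α)
    (hα' : dif α = h ≫ ψ - χ ≫ h') :
    ∃ θ : T ⟶ T', Equiv θ ∧ c.i ≫ θ = ψ ≫ c'.i ∧ θ ≫ c'.s = c.s ≫ χ := by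
  obtain ⟨θ, hθ, hi, hs⟩ := exists_coneMap c c' hψ.closed hχ.closed hα hα'
  exact ⟨θ, equiv_coneMap c c' hh hh' hψ hχ hθ hi hs, hi, hs⟩

/-- An object is contractible if its identity is a boundary. -/
def Contractible (X : Tot D) : Prop := ∃ e : X ⟶ X, IsHom (-1) e ∧ dif e = 𝟙 X

theorem Contractible.of_equiv {f : X ⟶ Y} (hf : Equiv f) (hX : Contractible X) :
    Contractible Y := by
  obtain ⟨e, he, he'⟩ := hX
  obtain ⟨g, hg, -, e₂, he₂, he₂'⟩ := hf.exists_inverse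
  refine ⟨g ≫ e ≫ f - e₂, (hg.closed.isHom.comp (he.comp hf.closed.isHom rfl) rfl).sub he₂, ?_⟩
  simp [dif_comp, hg.closed.dif_eq, hf.closed.dif_eq, he', he₂', hf.closed.isHom.sg_zero]

/-- Here `T` is `b ⊕ X` and `s` projects to `X`. The contraction `e` of `b` corrects `j` to the
closed section `j - η ≫ e ≫ i`, and `p ≫ e ≫ i` is the remaining homotopy. -/
theorem equiv_s_of_contractible {η : X ⟶ b} (c : ConeData η T) (hη : Closed 1 η)
    (hb : Contractible b) : Equiv c.s := by
  obtain ⟨e, he, he'⟩ := hb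
  have hr : Closed 0 (c.j - η ≫ e ≫ c.i) :=
    ⟨c.isHom_j.sub (hη.isHom.comp (he.comp c.isHom_i rfl) rfl), by
      simp [dif_comp, hη.dif_eq, he']⟩
  refine equiv_of_comp (g := c.j - η ≫ e ≫ c.i) c.closed_s hr ?_ ?_
  · refine (Equiv.id T).of_homotopic (e := c.p ≫ e ≫ c.i)
      (c.closed_s.comp hr rfl) (c.isHom_p.comp (he.comp c.isHom_i rfl) rfl) ?_
    · simp [dif_comp, sg_comp, he', he.sg_neg_one]
      abel
  · refine (Equiv.id X).of_eq ?_
    simp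

theorem Contractible.cone {η : X ⟶ b} (c : ConeData η T) (hη : Closed 1 η)
    (hX : Contractible X) (hb : Contractible b) : Contractible T := by
  obtain ⟨g, hg, -⟩ := (equiv_s_of_contractible c hη hb).exists_inverse
  exact hX.of_equiv hg

/-- An iterated cone `b₁ * (b₂ * Z)` is the cone `(b₁ * b₂) * Z`. -/
def ConeData.assoc {b₁ b₂ b₃ T₁ T₂ : Tot D} {η₂ : Z ⟶ b₂} {η₁ : T₂ ⟶ b₁} (c₂ : ConeData η₂ T₂)
    (c₁ : ConeData η₁ T₁) (c₃ : ConeData (c₂.i ≫ η₁) b₃) :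
    ConeData (c₂.j ≫ η₁ ≫ c₃.i + η₂ ≫ c₃.j) T₁ where
  i := c₃.p ≫ c₁.i + c₃.s ≫ c₂.i ≫ c₁.j
  j := c₂.j ≫ c₁.j
  p := c₁.p ≫ c₃.i + c₁.s ≫ c₂.p ≫ c₃.j
  s := c₁.s ≫ c₂.s
  isHom_i := (c₃.isHom_p.comp c₁.isHom_i rfl).add
    (c₃.isHom_s.comp (c₂.isHom_i.comp c₁.isHom_j rfl) rfl)
  isHom_j := c₂.isHom_j.comp c₁.isHom_j rfl
  isHom_p := (c₁.isHom_p.comp c₃.isHom_i rfl).add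
    (c₁.isHom_s.comp (c₂.isHom_p.comp c₃.isHom_j rfl) rfl)
  isHom_s := c₁.isHom_s.comp c₂.isHom_s rfl
  i_p := by simp
  j_s := by simp
  j_p := by simp
  i_s := by simp
  p_i_add := by simp
  dif_i := by simp [dif_comp]
  dif_j := by simp [dif_comp]

theorem closed_assoc {b₁ b₂ b₃ T₂ : Tot D} {η₂ : Z ⟶ b₂} {η₁ : T₂ ⟶ b₁}
    (c₂ : ConeData η₂ T₂) (c₃ : ConeData (c₂.i ≫ η₁) b₃) (hη₁ : Closed 1 η₁)
    (hη₂ : Closed 1 η₂) : Closed 1 (c₂.j ≫ η₁ ≫ c₃.i + η₂ ≫ c₃.j) := by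
  refine ⟨(c₂.isHom_j.comp (hη₁.isHom.comp c₃.isHom_i rfl) rfl).add
    (hη₂.isHom.comp c₃.isHom_j rfl), ?_⟩
  simp [dif_comp, sg_comp, hη₁.dif_eq, hη₂.dif_eq, hη₁.isHom.sg_one]

end Tot

/-! ### Fibres of morphisms to objects of `𝓑`, and their calculus of right fractions. -/

namespace Tot

variable {D : DGCat k} {X Y Z b T : Tot D}

/-- Closure properties of a DG category with a class of objects `𝓑` (thought of as the objects of
a triangulated subcategory): existence of cones, shifts and a zero object. -/
structure IsPretriangulated (𝓑 : Set (Tot D)) : Prop where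
  exists_cone {X b : Tot D} (h : b ⟶ X) (hh : Closed 1 h) :
    ∃ T : Tot D, Nonempty (ConeData h T) ∧ (X ∈ 𝓑 → b ∈ 𝓑 → T ∈ 𝓑)
  exists_shift (X : Tot D) (m : ℤ) : ∃ (X' : Tot D) (σ : X' ⟶ X) (σ' : X ⟶ X'),
    Closed m σ ∧ Closed (-m) σ' ∧ σ ≫ σ' = 𝟙 X' ∧ σ' ≫ σ = 𝟙 X ∧ (X ∈ 𝓑 → X' ∈ 𝓑)
  exists_zero : ∃ Z ∈ 𝓑, 𝟙 Z = 0

/-- The morphisms of the homotopy category which are isomorphic to the projection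
`b * X ⟶ X` for some closed `η : X ⟶ b` of degree `1` with `b ∈ 𝓑`. -/
def fibProp (𝓑 : Set (Tot D)) : MorphismProperty (Ho D) := fun X Y φ =>
  ∃ (b T : Tot D) (η : (⟨Y⟩ : Tot D) ⟶ b) (c : ConeData η T) (e : X ≅ T.ho),
    b ∈ 𝓑 ∧ Closed 1 η ∧ φ = e.hom ≫ toHo c.s c.closed_s

variable {𝓑 : Set (Tot D)}

theorem fibProp_iff (φ : X.ho ⟶ Y.ho) : fibProp 𝓑 φ ↔
    ∃ (b T : Tot D) (η : Y ⟶ b) (c : ConeData η T) (e : X.ho ≅ T.ho),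
      b ∈ 𝓑 ∧ Closed 1 η ∧ φ = e.hom ≫ toHo c.s c.closed_s := Iff.rfl

theorem fibProp_s {η : X ⟶ b} (c : ConeData η T) (hη : Closed 1 η) (hb : b ∈ 𝓑) :
    fibProp 𝓑 (toHo c.s c.closed_s) :=
  (fibProp_iff _).2 ⟨b, T, η, c, Iso.refl _, hb, hη, by simp⟩

/-- The isomorphism in the homotopy category given by a homotopy equivalence. -/
def Equiv.iso {f : X ⟶ Y} (hf : Equiv f) : X.ho ≅ Y.ho :=
  have := hf.isIso
  asIso (toHo f hf.closed)

theorem Equiv.iso_hom {f : X ⟶ Y} (hf : Equiv f) : hf.iso.hom = toHo f hf.closed := rfl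

theorem exists_equiv_iso (φ : X.ho ⟶ Y.ho) [hφ : IsIso φ] :
    ∃ (f : X ⟶ Y) (hf : Equiv f), φ = toHo f hf.closed := by
  obtain ⟨f, hf, rfl⟩ := toHo_surjective φ
  exact ⟨f, ⟨hf, hφ⟩, rfl⟩

theorem toHo_congr {f g : X ⟶ Y} (hf : Closed 0 f) (h : f = g) :
    toHo f hf = toHo g (h ▸ hf) := by subst h; rfl

/-- The extension is transported along a homotopy inverse `θ'` of `ψ`. Since `θ ≫ θ'` is only
homotopic to the identity, `η` and `θ ≫ θ' ≫ η` differ by the boundary of `e₁ ≫ η`, which serves as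
the corner of the comparison of extensions. -/
theorem fibProp_comp_iso (h𝓑 : IsPretriangulated 𝓑) (φ : X.ho ⟶ Y.ho) (ψ : Y.ho ⟶ Z.ho)
    [IsIso ψ] (hφ : fibProp 𝓑 φ) : fibProp 𝓑 (φ ≫ ψ) := by
  obtain ⟨b, T, η, c, e, hb, hη, rfl⟩ := (fibProp_iff _).1 hφ
  obtain ⟨θ, hθ, rfl⟩ := exists_equiv_iso ψ
  obtain ⟨θ', hθ', ⟨e₁, he₁, he₁'⟩, -⟩ := hθ.exists_inverse
  have hη' : Closed 1 (θ' ≫ η) := hθ'.closed.comp hη rfl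
  obtain ⟨T', ⟨c'⟩, -⟩ := h𝓑.exists_cone _ hη'
  obtain ⟨t, ht, -, hs⟩ := exists_equiv_cone c c' hη hη' (.id b) hθ (α := e₁ ≫ η)
    (he₁.comp hη.isHom rfl) (by simp [dif_comp, hη.dif_eq, he₁', hη.isHom.sg_one])
  refine (fibProp_iff _).2 ⟨b, T', _, c', e ≪≫ ht.iso, hb, hη', ?_⟩
  rw [Category.assoc, toHo_comp, Iso.trans_hom, Category.assoc, ht.iso_hom, toHo_comp,
    toHo_congr _ hs]

/-- An extension by a zero object has a projection that is an equivalence. -/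
theorem fibProp_id (h𝓑 : IsPretriangulated 𝓑) (X : Tot D) : fibProp 𝓑 (𝟙 X.ho) := by
  obtain ⟨Z, hZ, hZ'⟩ := h𝓑.exists_zero
  obtain ⟨T, ⟨c⟩, -⟩ := h𝓑.exists_cone (0 : X ⟶ Z) (.zero 1)
  have hs := equiv_s_of_contractible c (.zero 1) ⟨0, .zero _, by rw [hZ', map_zero]⟩
  exact (fibProp_iff _).2 ⟨Z, T, 0, c, hs.iso.symm, hZ, .zero 1, hs.iso.inv_hom_id.symm⟩

/-- An octahedron: extending `Z` by `b₂` and then by `b₁` is the same as extending it once by `b₃`,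
an extension of `b₂` by `b₁`, and `𝓑` is closed under such extensions. -/
theorem fibProp_comp (h𝓑 : IsPretriangulated 𝓑) (f : X.ho ⟶ Y.ho) (g : Y.ho ⟶ Z.ho)
    (hf : fibProp 𝓑 f) (hg : fibProp 𝓑 g) : fibProp 𝓑 (f ≫ g) := by
  obtain ⟨b₂, T₂, η₂, c₂, e₂, hb₂, hη₂, rfl⟩ := (fibProp_iff _).1 hg
  rw [← Category.assoc]
  have hf' := fibProp_comp_iso h𝓑 f e₂.hom hf
  obtain ⟨b₁, T₁, η₁, c₁, e₁, hb₁, hη₁, h⟩ := (fibProp_iff _).1 hf'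
  obtain ⟨b₃, ⟨c₃⟩, hb₃⟩ := h𝓑.exists_cone (c₂.i ≫ η₁) (c₂.closed_i.comp hη₁ rfl)
  refine (fibProp_iff _).2
    ⟨b₃, T₁, _, c₂.assoc c₁ c₃, e₁, hb₃ hb₁ hb₂, closed_assoc c₂ c₃ hη₁ hη₂, ?_⟩
  rw [h, Category.assoc, toHo_comp]
  rfl

/-- The Ore condition: if `s` is the projection of the fibre of `η`, then the fibre of `f ≫ η` maps
to it over `f`. -/
theorem exists_fibProp_fac (h𝓑 : IsPretriangulated 𝓑) (f : X.ho ⟶ Y.ho) {s : Z.ho ⟶ Y.ho}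
    (hs : fibProp 𝓑 s) : ∃ (T : Tot D) (t : T.ho ⟶ X.ho) (g : T.ho ⟶ Z.ho),
      fibProp 𝓑 t ∧ t ≫ f = g ≫ s := by
  obtain ⟨b, T, η, c, e, hb, hη, rfl⟩ := (fibProp_iff _).1 hs
  obtain ⟨f, hf, rfl⟩ := toHo_surjective f
  obtain ⟨T', ⟨c'⟩, -⟩ := h𝓑.exists_cone (f ≫ η) (hf.comp hη rfl)
  obtain ⟨θ, hθ, -, hs⟩ := exists_coneMap c' c (.id b) hf (α := 0) (.zero 0) (by simp)
  refine ⟨T', toHo c'.s c'.closed_s, toHo θ hθ ≫ e.inv, fibProp_s c' (hf.comp hη rfl) hb, ?_⟩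
  rw [toHo_comp, Category.assoc, Iso.inv_hom_id_assoc, toHo_comp, toHo_congr _ hs]

/-- The difference of the two morphisms factors, up to homotopy, through `b ∈ 𝓑`. It therefore
becomes nullhomotopic on the fibre of the resulting morphism from `X` to a shift of `b`. -/
theorem exists_fibProp_comp_eq (h𝓑 : IsPretriangulated 𝓑) (f₁ f₂ : X.ho ⟶ Y.ho)
    {s : Y.ho ⟶ Z.ho} (hs : fibProp 𝓑 s) (h : f₁ ≫ s = f₂ ≫ s) :
    ∃ (T : Tot D) (t : T.ho ⟶ X.ho), fibProp 𝓑 t ∧ t ≫ f₁ = t ≫ f₂ := by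
  obtain ⟨b, T, η, c, e, hb, hη, rfl⟩ := (fibProp_iff _).1 hs
  obtain ⟨g₁, hg₁, h₁⟩ := toHo_surjective (f₁ ≫ e.hom)
  obtain ⟨g₂, hg₂, h₂⟩ := toHo_surjective (f₂ ≫ e.hom)
  rw [← Category.assoc, ← Category.assoc, ← h₁, ← h₂, toHo_comp, toHo_comp, toHo_eq_iff] at h
  obtain ⟨u, hu, hu'⟩ := h
  have huj : IsHom (-1) (u ≫ c.j) := hu.comp c.isHom_j rfl
  -- The homotopy `u` is lifted along `j` and its boundary removed, so that the component of `g`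
  -- along `s` vanishes strictly and `g ≫ c.p` is closed.
  let g : X ⟶ T := g₁ - g₂ - dif (u ≫ c.j)
  have hg : Closed 0 g := (hg₁.sub hg₂).sub (.dif huj rfl)
  have hgs : g ≫ c.s = 0 := by
    simp [g, dif_comp, hu']
  have hgp : Closed 0 (g ≫ c.p) := ⟨hg.isHom.comp c.isHom_p rfl, by
    simp only [dif_comp, hg.dif_eq, c.dif_p, Preadditive.comp_neg, Limits.zero_comp, add_zero]
    rw [← Category.assoc, hgs, Limits.zero_comp, neg_zero]⟩
  obtain ⟨b', σ, σ', hσ, hσ', hσσ', hσ'σ, hb'⟩ := h𝓑.exists_shift b (-1)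
  have hη' : Closed 1 (g ≫ c.p ≫ σ') := by
    rw [← Category.assoc]
    exact hgp.comp hσ' rfl
  obtain ⟨T', ⟨c'⟩, -⟩ := h𝓑.exists_cone (g ≫ c.p ≫ σ') hη'
  refine ⟨T', toHo c'.s c'.closed_s, fibProp_s c' hη' (hb' hb), ?_⟩
  rw [← cancel_mono e.hom, Category.assoc, Category.assoc, ← h₁, ← h₂, toHo_comp, toHo_comp,
    toHo_eq_iff]
  refine ⟨c'.s ≫ u ≫ c.j + c'.p ≫ σ ≫ c.i,
    (c'.isHom_s.comp huj rfl).add (c'.isHom_p.comp (hσ.isHom.comp c.isHom_i rfl) rfl), ?_⟩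
  have hgg : g ≫ c.p ≫ c.i = g := by
    have := congrArg (g ≫ ·) c.p_i_add
    simpa only [Preadditive.comp_add, ← Category.assoc, hgs, Limits.zero_comp, add_zero,
      Category.comp_id] using this
  have e1 : c'.s ≫ g ≫ c.p ≫ σ' ≫ σ ≫ c.i = c'.s ≫ g := by
    rw [← Category.assoc σ', hσ'σ, Category.id_comp, hgg]
  have e2 : g₁ - g₂ = g + dif (u ≫ c.j) := by simp [g]
  rw [← Preadditive.comp_sub, e2]
  simp [dif_comp, sg_comp, hσ.dif_eq, hσ.isHom.sg_neg_one, e1]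
  abel

theorem fibProp_hasRightCalculusOfFractions (h𝓑 : IsPretriangulated 𝓑) :
    (fibProp 𝓑).HasRightCalculusOfFractions where
  id_mem X := fibProp_id h𝓑 ⟨X⟩
  comp_mem {X Y Z} f g hf hg := fibProp_comp h𝓑 (X := ⟨X⟩) (Y := ⟨Y⟩) (Z := ⟨Z⟩) f g hf hg
  exists_rightFraction X Y φ := by
    obtain ⟨T, t, g, ht, h⟩ := exists_fibProp_fac h𝓑 (X := ⟨X⟩) (Y := ⟨φ.Y'⟩) (Z := ⟨Y⟩) φ.f φ.hs
    exact ⟨⟨t, ht, g⟩, h⟩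
  ext X Y Y' f₁ f₂ s hs h := by
    obtain ⟨T, t, ht, h⟩ :=
      exists_fibProp_comp_eq h𝓑 (X := ⟨X⟩) (Y := ⟨Y⟩) (Z := ⟨Y'⟩) f₁ f₂ hs h
    exact ⟨T.ho, t, ht, h⟩

end Tot

/-! ### Right fractions -/

section

variable {D E : DGCat k} (F : DGFunctor D E) (𝓑 : Set (Tot D))

/-- Every relative class of `F` on `X` and `Y` vanishes after restriction along a morphism in
`fibProp 𝓑`. -/
def RelVanish (Y : Tot D) : Prop :=
  ∀ (X : Tot D) (n : ℤ) (z : X ⟶ Y) (γ : F.tot.obj X ⟶ F.tot.obj Y), Closed n z →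
    IsHom (n - 1) γ → dif γ = F.tot.map z →
    ∃ (X' : Tot D) (r : X' ⟶ X) (hr : Closed 0 r), fibProp 𝓑 (toHo r hr) ∧
      ∃ (α : X' ⟶ Y) (β : F.tot.obj X' ⟶ F.tot.obj Y), IsHom (n - 1) α ∧ IsHom (n - 2) β ∧
        dif α = r ≫ z ∧ F.tot.map r ≫ γ = F.tot.map α + dif β

variable {F 𝓑}

/-- A shift isomorphism commutes with the differential up to a sign of square 1. Naming the sign `ε`
lets it be cancelled without case distinctions on the parity of the degree. -/
theorem Tot.Closed.exists_sg {D : DGCat k} {X Y : Tot D} {m : ℤ} {σ : X ⟶ Y} (hσ : Closed m σ) :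
    ∃ ε : ℤ, ε * ε = 1 ∧ sg σ = ε • σ :=
  ⟨m.negOnePow, by rw [← Units.val_mul, ← Int.negOnePow_add, Int.negOnePow_even _ ⟨m, rfl⟩]; rfl,
    hσ.isHom.sg_eq⟩

theorem Tot.exists_ho {D : DGCat k} (X : Ho D) : ∃ X₀ : Tot D, X₀.ho = X := ⟨⟨X⟩, rfl⟩

/-- The effect of the functor on morphisms of degree `0` determines its effect on morphisms of
any degree. -/
theorem exists_precomp_closed (h𝓑 : IsPretriangulated 𝓑)
    [(hoMap F).IsLocalization (fibProp 𝓑)] {X Y : Tot D} {n : ℤ}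
    {δ : F.tot.obj X ⟶ F.tot.obj Y} (hδ : Closed n δ) :
    ∃ (X' : Tot D) (r : X' ⟶ X) (hr : Closed 0 r), fibProp 𝓑 (toHo r hr) ∧
      ∃ (α : X' ⟶ Y) (β : F.tot.obj X' ⟶ F.tot.obj Y), Closed n α ∧ IsHom (n - 1) β ∧
        F.tot.map r ≫ δ = F.tot.map α + dif β := by
  have := fibProp_hasRightCalculusOfFractions h𝓑
  -- The localization hypothesis speaks of degree 0 only; replacing `Y` by its shift brings `δ` into
  -- degree 0.
  obtain ⟨Y', σ, σ', hσ, hσ', hσσ', hσ'σ, -⟩ := h𝓑.exists_shift Y n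
  have hδ' : Closed 0 (δ ≫ F.tot.map σ') := hδ.comp (hσ'.tot F) (by omega)
  obtain ⟨φ, hφ⟩ := Localization.exists_rightFraction (hoMap F) (fibProp 𝓑)
    (X := X.ho) (Y := Y'.ho) (toHo _ hδ')
  have hφ' := φ.map_s_comp_map (hoMap F) (Localization.inverts _ _)
  obtain @⟨X', s, hs, f⟩ := φ
  obtain ⟨X', rfl⟩ := exists_ho X'
  rw [← hφ] at hφ'
  dsimp only at hφ'
  obtain ⟨r, hr, rfl⟩ := toHo_surjective s
  obtain ⟨a, ha, rfl⟩ := toHo_surjective f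
  rw [hoMap_toHo, hoMap_toHo] at hφ'
  obtain ⟨e, he, he'⟩ := (toHo_eq_iff _ _).1 ((toHo_comp (hr.tot F) hδ').symm.trans hφ')
  obtain ⟨ε, hε, hεσ⟩ := hσ.exists_sg
  refine ⟨X', r, hr, hs, a ≫ σ, ε • (e ≫ F.tot.map σ), ha.comp hσ (by omega),
    (he.comp (hσ.isHom.tot F) (by omega)).zsmul ε, ?_⟩
  have h1 : F.tot.map σ' ≫ F.tot.map σ = 𝟙 _ := by rw [← F.tot.map_comp, hσ'σ, F.tot.map_id]
  rw [map_zsmul, dif_comp, F.dif_tot, hσ.dif_eq, F.sg_tot, hεσ, he', F.tot.map_zero,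
    Limits.comp_zero, zero_add, F.tot.map_zsmul, Preadditive.comp_zsmul, smul_smul, hε, one_smul,
    Preadditive.sub_comp, Category.assoc, Category.assoc, h1, F.tot.map_comp, Category.comp_id]
  abel

/-- The element `γ` says that the image of `z` is zero in the homotopy category. Faithfulness up to
fractions thus bounds `z` after restriction, and the defect between `γ` and the image of this bound
is closed, so fullness up to fractions (`exists_precomp_closed`) removes it after another
restriction. -/
theorem relVanish_of_isLocalization (h𝓑 : IsPretriangulated 𝓑)
    [(hoMap F).IsLocalization (fibProp 𝓑)] (Y : Tot D) : RelVanish F 𝓑 Y := by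
  intro X n z γ hz hγ h
  have := fibProp_hasRightCalculusOfFractions h𝓑
  obtain ⟨Y', σ, σ', hσ, hσ', hσσ', hσ'σ, -⟩ := h𝓑.exists_shift Y n
  obtain ⟨ε, hε, hεσ⟩ := hσ.exists_sg
  obtain ⟨ε', hε', hεσ'⟩ := hσ'.exists_sg
  have hz' : Closed 0 (z ≫ σ') := hz.comp hσ' (by omega)
  have h0 : (hoMap F).map (toHo (z ≫ σ') hz') = (hoMap F).map (toHo 0 (.zero 0)) := by
    rw [hoMap_toHo, hoMap_toHo]
    refine (toHo_eq_iff _ _).2 ⟨ε' • (γ ≫ F.tot.map σ'),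
      (hγ.comp (hσ'.isHom.tot F) (by omega)).zsmul _, ?_⟩
    rw [map_zsmul, dif_comp, h, F.dif_tot, hσ'.dif_eq, F.sg_tot, hεσ', F.tot.map_zero,
      F.tot.map_zsmul, Preadditive.comp_zsmul, Limits.comp_zero, zero_add, smul_smul, hε',
      one_smul, F.tot.map_comp, F.tot.map_zero, sub_zero]
  rw [MorphismProperty.map_eq_iff_precomp (hoMap F) (fibProp 𝓑)] at h0
  obtain ⟨X₁, s, hs, h1⟩ := h0
  obtain ⟨X₁, rfl⟩ := exists_ho X₁
  obtain ⟨r, hr, rfl⟩ := toHo_surjective s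
  rw [toHo_comp, toHo_comp, toHo_eq_iff, Limits.comp_zero, sub_zero] at h1
  obtain ⟨e, he, he'⟩ := h1
  obtain ⟨α₀, hα₀, hα₀'⟩ : ∃ α₀ : X₁ ⟶ Y, IsHom (n - 1) α₀ ∧ dif α₀ = r ≫ z := by
    refine ⟨ε • (e ≫ σ), (he.comp hσ.isHom (by omega)).zsmul _, ?_⟩
    rw [map_zsmul, dif_comp, hσ.dif_eq, he', hεσ, Limits.comp_zero, zero_add,
      Preadditive.comp_zsmul, smul_smul, hε, one_smul, Category.assoc, Category.assoc, hσ'σ,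
      Category.comp_id]
  -- The element `F r ≫ γ - F α₀` is closed because both terms have boundary `F (r ≫ z)`.
  obtain ⟨X₂, t, ht, ht', α, β, hα, hβ, h2⟩ := exists_precomp_closed (F := F) h𝓑
    (n := n - 1) (δ := F.tot.map r ≫ γ - F.tot.map α₀)
    ⟨((hr.isHom.tot F).comp hγ (by omega)).sub (hα₀.tot F), by
      rw [map_sub, dif_comp, F.dif_tot, F.dif_tot, hα₀', hr.dif_eq, h, F.tot.map_zero,
        Limits.zero_comp, add_zero, F.tot.map_comp, sub_self]⟩
  refine ⟨X₂, t ≫ r, ht.comp hr rfl, ?_, t ≫ α₀ + α, β,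
    (ht.isHom.comp hα₀ (by omega)).add hα.isHom, hβ.cast (by omega), ?_, ?_⟩
  · rw [← toHo_comp ht hr]
    exact (fibProp 𝓑).comp_mem _ _ ht' hs
  · rw [map_add, dif_comp, hα₀', hα.dif_eq, ht.dif_eq, Limits.zero_comp, add_zero, add_zero,
      Category.assoc]
  · rw [Preadditive.comp_sub, sub_eq_iff_eq_add] at h2
    rw [F.tot.map_comp, Category.assoc, h2, F.tot.map_add, F.tot.map_comp]
    abel

/-- A criterion for a functor to be a localization. -/
theorem isLocalization_of_rightFractions {C₁ : Type*} {C₂ : Type*} [Category C₁] [Category C₂]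
    (L : C₁ ⥤ C₂) (W : MorphismProperty C₁) [W.HasRightCalculusOfFractions] [L.EssSurj]
    (hW : W.IsInvertedBy L)
    (hfull : ∀ (X Y : C₁) (g : L.obj X ⟶ L.obj Y), ∃ (X' : C₁) (s : X' ⟶ X) (a : X' ⟶ Y),
      W s ∧ L.map s ≫ g = L.map a)
    (hfaithful : ∀ (X Y : C₁) (f₁ f₂ : X ⟶ Y), L.map f₁ = L.map f₂ →
      ∃ (X' : C₁) (s : X' ⟶ X), W s ∧ s ≫ f₁ = s ≫ f₂) : L.IsLocalization W := by
  -- It is enough that the functor `G` induced on the constructed localization is an equivalence.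
  -- All objects of that category come from `C₁`, so fullness and faithfulness are tested on such
  -- objects.
  let G := Localization.Construction.lift L hW
  have hG : W.Q ⋙ G = L := Localization.Construction.fac L hW
  clear_value G
  subst hG
  have hQ : ∀ X, ∃ X₀, W.Q.obj X₀ = X := (Localization.Construction.objEquiv W).surjective
  have hEss : G.EssSurj := ⟨fun Y => ⟨_, ⟨(W.Q ⋙ G).objObjPreimageIso Y⟩⟩⟩
  have hFull : G.Full := ⟨fun {X Y} g => by
    obtain ⟨X, rfl⟩ := hQ X
    obtain ⟨Y, rfl⟩ := hQ Y
    obtain ⟨X', s, a, hs, h⟩ := hfull X Y g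
    have := Localization.inverts W.Q W s hs
    have := hW s hs
    refine ⟨inv (W.Q.map s) ≫ W.Q.map a, ?_⟩
    rw [← cancel_epi ((W.Q ⋙ G).map s)]
    refine Eq.trans ?_ h.symm
    change G.map (W.Q.map s) ≫ G.map _ = G.map _
    rw [← G.map_comp]
    exact congrArg _ (IsIso.hom_inv_id_assoc _ _)⟩
  have hFaithful : G.Faithful := ⟨fun {X Y} f₁ f₂ h => by
    obtain ⟨X, rfl⟩ := hQ X
    obtain ⟨Y, rfl⟩ := hQ Y
    -- The second fraction represents `f₂` precomposed with the denominator of the first, which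
    -- gives `f₁` and `f₂` the common denominator `φ₂.s ≫ φ₁.s`.
    obtain ⟨φ₁, h₁⟩ := Localization.exists_rightFraction W.Q W f₁
    have e₁ := φ₁.map_s_comp_map W.Q (Localization.inverts _ _)
    rw [← h₁] at e₁
    obtain ⟨φ₂, h₂⟩ := Localization.exists_rightFraction W.Q W (W.Q.map φ₁.s ≫ f₂)
    have e₂ := φ₂.map_s_comp_map W.Q (Localization.inverts _ _)
    rw [← h₂] at e₂
    have e₁' : W.Q.map (φ₂.s ≫ φ₁.s) ≫ f₁ = W.Q.map (φ₂.s ≫ φ₁.f) := by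
      rw [W.Q.map_comp, Category.assoc, e₁, W.Q.map_comp]
    have e₂' : W.Q.map (φ₂.s ≫ φ₁.s) ≫ f₂ = W.Q.map φ₂.f := by
      rw [W.Q.map_comp, Category.assoc, e₂]
    obtain ⟨X', s, hs, h'⟩ := hfaithful _ _ (φ₂.s ≫ φ₁.f) φ₂.f (by
      change G.map _ = G.map _
      rw [← e₁', ← e₂', G.map_comp, G.map_comp]
      exact congrArg _ h)
    have := Localization.inverts W.Q W _ hs
    have := Localization.inverts W.Q W _ φ₁.hs
    have := Localization.inverts W.Q W _ φ₂.hs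
    have : IsIso (W.Q.map (φ₂.s ≫ φ₁.s)) := by rw [W.Q.map_comp]; infer_instance
    rw [← cancel_epi (W.Q.map (φ₂.s ≫ φ₁.s)), e₁', e₂', ← cancel_epi (W.Q.map s), ← W.Q.map_comp,
      h', W.Q.map_comp]⟩
  exact Functor.IsLocalization.of_equivalence_target W.Q W (W.Q ⋙ G)
    (@Functor.asEquivalence _ _ _ _ G ⟨hFaithful, hFull, hEss⟩) (Iso.refl _)

/-- Fullness up to fractions is the vanishing of classes with `n = 1` and `z = 0`, where `γ` is any
closed morphism of degree 0. Faithfulness is the case `n = 0`, `z = f₁ - f₂`, where `γ` is a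
homotopy between the images. -/
theorem isLocalization_of_relVanish (h𝓑 : IsPretriangulated 𝓑) [(hoMap F).EssSurj]
    (hinv : (fibProp 𝓑).IsInvertedBy (hoMap F)) (hF : ∀ Y, RelVanish F 𝓑 Y) :
    (hoMap F).IsLocalization (fibProp 𝓑) := by
  have := fibProp_hasRightCalculusOfFractions h𝓑
  refine isLocalization_of_rightFractions _ _ hinv (fun X Y g => ?_) (fun X Y f₁ f₂ h => ?_)
  · obtain ⟨X, rfl⟩ := exists_ho X
    obtain ⟨Y, rfl⟩ := exists_ho Y
    obtain ⟨γ, hγ, rfl⟩ := toHo_surjective (X := F.tot.obj X) (Y := F.tot.obj Y) g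
    obtain ⟨X', r, hr, hr', α, β, hα, hβ, h1, h2⟩ := hF Y X 1 0 γ (.zero 1) hγ.isHom
      (by rw [hγ.dif_eq, F.tot.map_zero])
    have hα' : Closed 0 α := ⟨hα, by rw [h1, Limits.comp_zero]⟩
    refine ⟨X'.ho, toHo r hr, toHo α hα', hr', ?_⟩
    rw [hoMap_toHo, hoMap_toHo]
    refine (toHo_comp _ _).trans ((toHo_eq_iff _ _).2 ⟨β, hβ, ?_⟩)
    rw [h2]; abel
  · obtain ⟨X, rfl⟩ := exists_ho X
    obtain ⟨Y, rfl⟩ := exists_ho Y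
    obtain ⟨f₁, hf₁, rfl⟩ := toHo_surjective f₁
    obtain ⟨f₂, hf₂, rfl⟩ := toHo_surjective f₂
    rw [hoMap_toHo, hoMap_toHo] at h
    obtain ⟨γ, hγ, h⟩ := (toHo_eq_iff (hf₁.tot F) (hf₂.tot F)).1 h
    obtain ⟨X', r, hr, hr', α, β, hα, hβ, h1, h2⟩ := hF Y X 0 (f₁ - f₂) γ (hf₁.sub hf₂) hγ
      (by rw [h, F.tot.map_sub])
    refine ⟨X'.ho, toHo r hr, hr', ?_⟩
    rw [toHo_comp, toHo_comp, toHo_eq_iff]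
    exact ⟨α, hα, by rw [h1, Preadditive.comp_sub]⟩

/-- Dévissage. -/
theorem RelVanish.of_cone (h𝓑 : IsPretriangulated 𝓑) {Y₁ y T : Tot D} {h : y ⟶ Y₁}
    (c : ConeData h T) (h₁ : RelVanish F 𝓑 Y₁) (hy : RelVanish F 𝓑 y) :
    RelVanish F 𝓑 T := by
  intro X n z γ hz hγ hγz
  -- The component of the class in the quotient `y` of `T` is killed first.
  obtain ⟨X₁, r, hr, hr', α, β, hα, hβ, e1, e2⟩ := hy X n (z ≫ c.s) (γ ≫ F.tot.map c.s)
    (hz.comp c.closed_s (by omega)) (hγ.comp (c.isHom_s.tot F) (by omega))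
    (by simp [dif_comp, F.dif_tot, F.sg_tot, hγz])
  have := fibProp_hasRightCalculusOfFractions h𝓑
  -- The bound `(α, β)` is lifted along `j` and subtracted. The new class has zero component along
  -- `s`, hence comes from the subobject `Y₁`, where the first hypothesis applies.
  let z₁ := r ≫ z - dif (α ≫ c.j)
  let γ₁ := F.tot.map r ≫ γ - F.tot.map (α ≫ c.j) - dif (β ≫ F.tot.map c.j)
  have hαj : IsHom (n - 1) (α ≫ c.j) := hα.comp c.isHom_j (by omega)
  have hβj : IsHom (n - 2) (β ≫ F.tot.map c.j) := hβ.comp (c.isHom_j.tot F) (by omega)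
  have hz₁ : Closed n z₁ := (hr.comp hz (by omega)).sub (.dif hαj (by omega))
  have hγ₁ : IsHom (n - 1) γ₁ :=
    (((hr.isHom.tot F).comp hγ (by omega)).sub (hαj.tot F)).sub (.dif hβj (by omega))
  have hγz₁ : dif γ₁ = F.tot.map z₁ := by
    rw [map_sub, map_sub, dif_dif, sub_zero, F.dif_tot, dif_comp (F.tot.map r), hγz,
      F.dif_tot, hr.dif_eq, F.tot.map_zero, Limits.zero_comp, add_zero, F.tot.map_sub,
      F.tot.map_comp]
  have hzs : z₁ ≫ c.s = 0 := by
    simp [z₁, dif_comp, e1]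
  have hFc : F.tot.map c.j ≫ F.tot.map c.s = 𝟙 _ := by rw [← F.tot.map_comp, c.j_s, F.tot.map_id]
  have hFis : F.tot.map c.i ≫ F.tot.map c.s = 0 := by rw [← F.tot.map_comp, c.i_s, F.tot.map_zero]
  have hγs : γ₁ ≫ F.tot.map c.s = 0 := by
    simp [γ₁, dif_comp, e2, F.dif_tot, F.sg_tot, hFc, hFis]
  have hzp : z₁ ≫ c.p ≫ c.i = z₁ := by
    have := congrArg (z₁ ≫ ·) c.p_i_add
    simpa only [Preadditive.comp_add, ← Category.assoc, hzs, Limits.zero_comp, add_zero,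
      Category.comp_id] using this
  have hγp : γ₁ ≫ F.tot.map c.p ≫ F.tot.map c.i = γ₁ := by
    have := congrArg (γ₁ ≫ F.tot.map ·) c.p_i_add
    simpa only [F.tot.map_add, F.tot.map_comp, F.tot.map_id, Preadditive.comp_add,
      ← Category.assoc, hγs, Limits.zero_comp, add_zero, Category.comp_id] using this
  have hzc : Closed n (z₁ ≫ c.p) := ⟨hz₁.isHom.comp c.isHom_p (by omega), by
    rw [dif_comp, hz₁.dif_eq, c.dif_p, Preadditive.comp_neg, ← Category.assoc, hzs]; simp⟩
  obtain ⟨X₂, t, ht, ht', α₂, β₂, hα₂, hβ₂, e3, e4⟩ := h₁ X₁ n (z₁ ≫ c.p) (γ₁ ≫ F.tot.map c.p)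
    hzc (hγ₁.comp (c.isHom_p.tot F) (by omega)) (by
      rw [dif_comp, F.dif_tot, c.dif_p, F.tot.map_neg, F.tot.map_comp, Preadditive.comp_neg,
        ← Category.assoc, hγs, F.sg_tot, c.sg_p, hγz₁, F.tot.map_comp]; simp)
  refine ⟨X₂, t ≫ r, ht.comp hr rfl, ?_, t ≫ α ≫ c.j + α₂ ≫ c.i,
    F.tot.map t ≫ β ≫ F.tot.map c.j + β₂ ≫ F.tot.map c.i,
    (ht.isHom.comp hαj (by omega)).add (hα₂.comp c.isHom_i (by omega)),
    ((ht.isHom.tot F).comp hβj (by omega)).add (hβ₂.comp (c.isHom_i.tot F) (by omega)), ?_, ?_⟩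
  · rw [← toHo_comp ht hr]
    exact (fibProp 𝓑).comp_mem _ _ ht' hr'
  · have e5 : dif (α₂ ≫ c.i) = t ≫ z₁ := by
      rw [dif_comp, c.dif_i, c.sg_i, e3, Limits.comp_zero, zero_add, Category.assoc,
        Category.assoc, hzp]
    rw [map_add, e5, dif_comp t, ht.dif_eq]
    simp [z₁]
  · have e5 : F.tot.map t ≫ γ₁ = F.tot.map (α₂ ≫ c.i) + dif (β₂ ≫ F.tot.map c.i) := by
      rw [dif_comp, F.dif_tot, c.dif_i, F.sg_tot, c.sg_i, F.tot.map_zero, Limits.comp_zero,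
        zero_add, F.tot.map_comp, ← Preadditive.add_comp, ← e4, Category.assoc, Category.assoc,
        hγp]
    simp only [γ₁, Preadditive.comp_sub, sub_eq_iff_eq_add] at e5
    rw [F.tot.map_comp, Category.assoc, e5, map_add, dif_comp (F.tot.map t), F.dif_tot, ht.dif_eq]
    simp only [F.tot.map_add, F.tot.map_comp, F.tot.map_zero, Limits.zero_comp, add_zero]
    abel

theorem fibProp_isInvertedBy (hF : ∀ b ∈ 𝓑, Contractible (F.tot.obj b)) :
    (fibProp 𝓑).IsInvertedBy (hoMap F) := by
  intro X Y φ hφ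
  obtain ⟨X, rfl⟩ := exists_ho X
  obtain ⟨Y, rfl⟩ := exists_ho Y
  obtain ⟨b, T, η, c, e, hb, hη, rfl⟩ := (fibProp_iff φ).1 hφ
  have := (equiv_s_of_contractible (c.map F) (hη.tot F) (hF b hb)).isIso
  rw [Functor.map_comp, hoMap_toHo]
  exact IsIso.comp_isIso' inferInstance this

end

/-! ### Morphisms of twisted complexes as matrices -/

namespace Tot

variable {A C : DGCat k} {X Y Z : Tot A.pretr}

/-- The underlying twisted complex of an object of the total category. -/
def tw (X : Tot A.pretr) : A.TwistedComplex := X.obj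

/-- The terms of a twisted complex. -/
abbrev term (X : Tot A.pretr) (i : Fin X.tw.n) : Tot A := ⟨X.tw.obj i⟩

/-- The shifts of the terms of a twisted complex. -/
abbrev deg (X : Tot A.pretr) (i : Fin X.tw.n) : ℤ := X.tw.deg i

/-- The entries of the differential of a twisted complex. -/
def qent (X : Tot A.pretr) (i j : Fin X.tw.n) : X.term j ⟶ X.term i :=
  tin (1 + X.tw.deg i - X.tw.deg j) (X.tw.q i j)

/-- An entry of a matrix. -/
def entryLin (X Y : A.FormalSum) (l : ℤ) (i : Fin Y.n) (j : Fin X.n) :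
    (A.sumHom X Y).X l →ₗ[k] (A.Hom (X.obj j) (Y.obj i)).X (l + Y.deg i - X.deg j) :=
  LinearMap.proj j ∘ₗ LinearMap.proj i

/-- A matrix, as a morphism of the total category. -/
def mtin (l : ℤ) : (A.sumHom X.tw.toFormalSum Y.tw.toFormalSum).X l →ₗ[k] (X ⟶ Y) :=
  tin (D := A.pretr) l

/-- A homogeneous component, as a matrix. -/
def mcpt (l : ℤ) : (X ⟶ Y) →ₗ[k] (A.sumHom X.tw.toFormalSum Y.tw.toFormalSum).X l :=
  tcpt (D := A.pretr) l

theorem mcpt_mtin (l : ℤ) (f : (A.sumHom X.tw.toFormalSum Y.tw.toFormalSum).X l) :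
    mcpt l (mtin l f : X ⟶ Y) = f := tcpt_tin (D := A.pretr) l f

theorem mcpt_mtin_of_ne {l m : ℤ} (h : l ≠ m)
    (f : (A.sumHom X.tw.toFormalSum Y.tw.toFormalSum).X m) : mcpt l (mtin m f : X ⟶ Y) = 0 :=
  tcpt_tin_of_ne (D := A.pretr) h f

theorem mat_induction {P : (X ⟶ Y) → Prop}
    (h : ∀ n (x : (A.sumHom X.tw.toFormalSum Y.tw.toFormalSum).X n), P (mtin n x))
    (hadd : ∀ f g, P f → P g → P (f + g)) (f : X ⟶ Y) : P f :=
  hom_induction h hadd f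

theorem mtin_comp (p q n : ℤ) (h : p + q = n)
    (g : (A.sumHom Y.tw.toFormalSum Z.tw.toFormalSum).X p)
    (f : (A.sumHom X.tw.toFormalSum Y.tw.toFormalSum).X q) :
    (mtin n (A.sumComp p q n h g f) : X ⟶ Z) = (mtin q f : X ⟶ Y) ≫ (mtin p g : Y ⟶ Z) :=
  tin_comp (D := A.pretr) p q n h g f

theorem dif_mtin (n n' : ℤ) (h : n + 1 = n')
    (f : (A.sumHom X.tw.toFormalSum Y.tw.toFormalSum).X n) :
    dif (mtin n f : X ⟶ Y) = mtin n' (((A.sumHom X.tw.toFormalSum Y.tw.toFormalSum).d n n').hom f +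
        A.sumComp 1 n n' (by omega) Y.tw.twist f -
          n.negOnePow • A.sumComp n 1 n' h f X.tw.twist) :=
  (dif_tin (D := A.pretr) n n' h f).trans
    (congrArg (mtin n') (A.pretrHom_d_apply X.tw Y.tw n n' h f))

theorem sg_mtin (n : ℤ) (f : (A.sumHom X.tw.toFormalSum Y.tw.toFormalSum).X n) :
    sg (mtin n f : X ⟶ Y) = (n.negOnePow : ℤ) • mtin n f :=
  sg_tin (D := A.pretr) n f

/-- The entries of a morphism of twisted complexes. -/
def ent (i : Fin Y.tw.n) (j : Fin X.tw.n) : (X ⟶ Y) →ₗ[k] (X.term j ⟶ Y.term i) :=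
  tlin fun l => tin (X := X.term j) (Y := Y.term i) (l + Y.tw.deg i - X.tw.deg j) ∘ₗ
    entryLin X.tw.toFormalSum Y.tw.toFormalSum l i j

theorem ent_mtin (l : ℤ) (f : (A.sumHom X.tw.toFormalSum Y.tw.toFormalSum).X l)
    (i : Fin Y.tw.n) (j : Fin X.tw.n) :
    ent i j (mtin l f : X ⟶ Y) = tin (l + Y.tw.deg i - X.tw.deg j) (f i j) :=
  tlin_tin (D := A.pretr) _ _ _

theorem ent_comp (f : X ⟶ Y) (g : Y ⟶ Z) (i : Fin Z.tw.n) (j : Fin X.tw.n) :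
    ent i j (f ≫ g) = ∑ l, ent l j f ≫ ent i l g := by
  induction f using mat_induction with
  | hadd f f' h h' =>
    simp only [Preadditive.add_comp, map_add, h, h', Finset.sum_add_distrib]
  | h q f =>
  induction g using mat_induction with
  | hadd f f' h h' => simp only [Preadditive.comp_add, map_add, h, h', Finset.sum_add_distrib]
  | h p g =>
  rw [← mtin_comp p q _ rfl, ent_mtin, A.sumComp_apply, map_sum]
  refine Finset.sum_congr rfl fun l _ => ?_
  rw [ent_mtin, ent_mtin]
  exact tin_comp (X := X.term j) (Y := Y.term l) (Z := Z.term i) _ _ _ _ _ _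

theorem ent_id_self (i : Fin X.tw.n) : ent i i (𝟙 X) = 𝟙 (X.term i) := by
  refine (ent_mtin (X := X) (Y := X) 0 (A.sumId X.tw.toFormalSum) i i).trans ?_
  rw [A.sumId_of_eq i i rfl]
  exact tin_idOf (X := X.term i) (Y := X.term i) rfl _ _

theorem ent_id_of_ne {i j : Fin X.tw.n} (h : i ≠ j) : ent i j (𝟙 X) = 0 := by
  refine (ent_mtin (X := X) (Y := X) 0 (A.sumId X.tw.toFormalSum) i j).trans ?_
  rw [A.sumId_of_ne i j h]
  exact map_zero _

theorem qent_eq_zero (X : Tot A.pretr) (i j : Fin X.tw.n) (h : j ≤ i) : X.qent i j = 0 := by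
  rw [qent, X.tw.q_eq_zero i j h, map_zero]

theorem isHom_qent (X : Tot A.pretr) (i j : Fin X.tw.n) :
    IsHom (1 + X.deg i - X.deg j) (X.qent i j) := isHom_tin _ _

theorem dif_qent (X : Tot A.pretr) (i j : Fin X.tw.n) :
    ((X.deg i).negOnePow : ℤ) • dif (X.qent i j) + ∑ l, X.qent l j ≫ X.qent i l = 0 := by
  have := congrArg (tin (X := X.term j) (Y := X.term i) _) (X.tw.d_q_add i j)
  rw [map_add, map_zero, Units.smul_def, map_zsmul, map_sum] at this
  refine Eq.trans (congrArg₂ (· + ·) ?_ ?_) this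
  · exact congrArg _ (dif_tin _ _ (by omega) _)
  · exact Finset.sum_congr rfl fun l _ =>
      (tin_comp (X := X.term j) (Y := X.term l) (Z := X.term i) _ _ _ _ _ _).symm

/-- The sign in front of `dif (ent i j f)` is that of the shift of the target term. The last sum
takes the entry of `sg f`, not `sg` of the entry: the sign of the twist depends on the degree of `f`
as a morphism of twisted complexes. -/
theorem ent_dif (f : X ⟶ Y) (i : Fin Y.tw.n) (j : Fin X.tw.n) :
    ent i j (dif f) = ((Y.deg i).negOnePow : ℤ) • dif (ent i j f) +
      ∑ l, ent l j f ≫ Y.qent i l - ∑ l, X.qent l j ≫ ent i l (sg f) := by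
  induction f using mat_induction with
  | hadd f f' h h' =>
    simp only [map_add, h, h', smul_add, Preadditive.add_comp, Preadditive.comp_add,
      Finset.sum_add_distrib]
    abel
  | h l f =>
  rw [dif_mtin l (l + 1) rfl, map_sub, map_add, map_sub, map_add, Units.smul_def, map_zsmul,
    map_zsmul, sg_mtin]
  simp only [map_zsmul, Preadditive.comp_zsmul, ← Finset.smul_sum, ent_mtin]
  refine congrArg₂ (· - ·) (congrArg₂ (· + ·) ?_ ?_) (congrArg _ ?_)
  · rw [A.sumHom_d_apply, Units.smul_def, map_zsmul]
    exact congrArg _ (dif_tin (X := X.term j) (Y := Y.term i) _ _ (by omega) _).symm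
  · rw [A.sumComp_apply, map_sum]
    exact Finset.sum_congr rfl fun m _ =>
      tin_comp (X := X.term j) (Y := Y.term m) (Z := Y.term i) _ _ _ _ _ _
  · rw [A.sumComp_apply, map_sum]
    exact Finset.sum_congr rfl fun m _ =>
      tin_comp (X := X.term j) (Y := X.term m) (Z := Y.term i) _ _ _ _ _ _

/-- For fixed indices, matrices of different degrees have entries of different degrees. Hence
entries do not mix homogeneous components, and both equality and homogeneity can be tested
entrywise. -/
theorem tcpt_ent (f : X ⟶ Y) (i : Fin Y.tw.n) (j : Fin X.tw.n) (l : ℤ) :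
    tcpt (l + Y.tw.deg i - X.tw.deg j) (ent i j f) =
      entryLin X.tw.toFormalSum Y.tw.toFormalSum l i j (mcpt l f) := by
  induction f using mat_induction with
  | hadd f f' h h' => rw [map_add, map_add, map_add, map_add, h, h']
  | h m f =>
  rw [ent_mtin]
  by_cases hm : l = m
  · subst hm
    rw [tcpt_tin, mcpt_mtin]
    rfl
  · rw [mcpt_mtin_of_ne hm, tcpt_tin_of_ne (by omega), map_zero]

theorem tcpt_ext {D : DGCat k} {X Y : Tot D} {f g : X ⟶ Y} (h : ∀ n, tcpt n f = tcpt n g) :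
    f = g :=
  DFinsupp.ext h

theorem ent_ext {f g : X ⟶ Y} (h : ∀ i j, ent i j f = ent i j g) : f = g := by
  refine tcpt_ext fun l => funext fun i => funext fun j => ?_
  exact (tcpt_ent f i j l).symm.trans ((congrArg _ (h i j)).trans (tcpt_ent g i j l))

theorem isHom_of_ent {f : X ⟶ Y} {n : ℤ} (h : ∀ i j, IsHom (n + Y.deg i - X.deg j) (ent i j f)) :
    IsHom n f := by
  refine ent_ext fun i j => ?_
  refine (ent_mtin n (mcpt n f) i j).trans (Eq.trans ?_ (h i j))
  exact congrArg _ (tcpt_ent f i j n).symm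

theorem IsHom.ent {f : X ⟶ Y} {n : ℤ} (hf : IsHom n f) (i : Fin Y.tw.n) (j : Fin X.tw.n) :
    IsHom (n + Y.deg i - X.deg j) (ent i j f) := by
  have h := ent_mtin n (mcpt n f) i j
  rw [show mtin n (mcpt n f) = f from hf] at h
  rw [h]
  exact isHom_tin _ _

theorem exists_ent (n : ℤ) (φ : ∀ (i : Fin Y.tw.n) (j : Fin X.tw.n), X.term j ⟶ Y.term i)
    (hφ : ∀ i j, IsHom (n + Y.deg i - X.deg j) (φ i j)) :
    ∃ f : X ⟶ Y, IsHom n f ∧ ∀ i j, ent i j f = φ i j := by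
  let f : (A.sumHom X.tw.toFormalSum Y.tw.toFormalSum).X n := fun i j => tcpt _ (φ i j)
  exact ⟨mtin n f, isHom_tin (D := A.pretr) n f, fun i j => (ent_mtin n f i j).trans (hφ i j)⟩

theorem ent_tot (F : DGFunctor A C) (f : X ⟶ Y) (i : Fin Y.tw.n) (j : Fin X.tw.n) :
    ent (X := F.pretr.tot.obj X) (Y := F.pretr.tot.obj Y) i j (F.pretr.tot.map f) =
      F.tot.map (X := X.term j) (Y := Y.term i) (ent i j f) := by
  induction f using mat_induction with
  | hadd f f' h h' =>
    exact (congrArg (ent (X := F.pretr.tot.obj X) (Y := F.pretr.tot.obj Y) i j)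
      (F.pretr.tot.map_add (f := f) (g := f'))).trans ((map_add _ _ _).trans
      ((congrArg₂ (· + ·) h h').trans (F.tot.map_add.symm.trans
      (congrArg F.tot.map (map_add (ent i j) f f').symm))))
  | h l f =>
  rw [ent_mtin, F.tot_tin]
  refine (congrArg _ (F.pretr.tot_tin (X := X) (Y := Y) l f)).trans ?_
  exact ent_mtin (X := F.pretr.tot.obj X) (Y := F.pretr.tot.obj Y) l _ i j

theorem dif_ent_id (i j : Fin X.tw.n) : dif (ent i j (𝟙 X)) = 0 := by
  by_cases h : i = j
  · subst h; rw [ent_id_self, dif_id]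
  · rw [ent_id_of_ne h, map_zero]

theorem isHom_ent_id (i j : Fin X.tw.n) : IsHom 0 (ent i j (𝟙 X)) := by
  by_cases h : i = j
  · subst h; rw [ent_id_self]; exact .id _
  · rw [ent_id_of_ne h]; exact .zero _

theorem isHom_ent_id' {n : ℤ} (i j : Fin X.tw.n) (h : i = j → n = 0) :
    IsHom n (ent i j (𝟙 X)) := by
  by_cases h' : i = j
  · exact (isHom_ent_id i j).cast (h h').symm
  · rw [ent_id_of_ne h']; exact .zero _

theorem sum_id_comp {W : Tot A} (j : Fin X.tw.n) (g : ∀ l, X.term l ⟶ W) :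
    ∑ l, ent l j (𝟙 X) ≫ g l = g j := by
  rw [Finset.sum_eq_single j, ent_id_self, Category.id_comp]
  · intro l _ hl
    rw [ent_id_of_ne hl, Limits.zero_comp]
  · simp

theorem sum_comp_id {W : Tot A} (i : Fin X.tw.n) (g : ∀ l, W ⟶ X.term l) :
    ∑ l, g l ≫ ent i l (𝟙 X) = g i := by
  rw [Finset.sum_eq_single i, ent_id_self, Category.comp_id]
  · intro l _ hl
    rw [ent_id_of_ne hl.symm, Limits.comp_zero]
  · simp

theorem sum_id_comp_assoc {W W' : Tot A} (j : Fin X.tw.n) (f : W ⟶ X.term j)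
    (g : ∀ l, X.term l ⟶ W') : ∑ l, f ≫ ent l j (𝟙 X) ≫ g l = f ≫ g j := by
  rw [← Preadditive.comp_sum, sum_id_comp]

theorem sum_comp_id_assoc {W W' : Tot A} (i : Fin X.tw.n) (g : ∀ l, W ⟶ X.term l)
    (f : X.term i ⟶ W') : ∑ l, g l ≫ ent i l (𝟙 X) ≫ f = g i ≫ f := by
  simp only [← Category.assoc]
  rw [← Preadditive.sum_comp, sum_comp_id]

/-- The twisted complex given by a matrix. -/
def mkTw (S : A.FormalSum) (Q : ∀ i j : Fin S.n, (⟨S.obj j⟩ : Tot A) ⟶ ⟨S.obj i⟩)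
    (hQ : ∀ i j, IsHom (1 + S.deg i - S.deg j) (Q i j)) (hQ₀ : ∀ i j, j ≤ i → Q i j = 0)
    (hQ₁ : ∀ i j, ((S.deg i).negOnePow : ℤ) • dif (Q i j) + ∑ l, Q l j ≫ Q i l = 0) :
    A.TwistedComplex where
  toFormalSum := S
  q i j := tcpt (1 + S.deg i - S.deg j) (Q i j)
  q_eq_zero i j h := by rw [hQ₀ i j h, map_zero]
  d_q_add i j := by
    have hQ' : ∀ i j, tin (1 + S.deg i - S.deg j) (tcpt (1 + S.deg i - S.deg j) (Q i j)) = Q i j :=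
      hQ
    refine tin_injective (X := ⟨S.obj j⟩) (Y := ⟨S.obj i⟩) (2 + S.deg i - S.deg j) ?_
    rw [map_add, map_zero, Units.smul_def, map_zsmul, map_sum, ← hQ₁ i j]
    refine congrArg₂ (· + ·) (congrArg _ ?_) (Finset.sum_congr rfl fun l _ => ?_)
    · refine (dif_tin (X := ⟨S.obj j⟩) (Y := ⟨S.obj i⟩) _ _ (by omega) _).symm.trans ?_
      rw [hQ']
    · refine (tin_comp (X := ⟨S.obj j⟩) (Y := ⟨S.obj l⟩) (Z := ⟨S.obj i⟩) _ _ _ _ _ _).trans ?_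
      rw [hQ', hQ']

theorem qent_mkTw {S : A.FormalSum} {Q : ∀ i j : Fin S.n, (⟨S.obj j⟩ : Tot A) ⟶ ⟨S.obj i⟩}
    {hQ : ∀ i j, IsHom (1 + S.deg i - S.deg j) (Q i j)} {hQ₀ : ∀ i j, j ≤ i → Q i j = 0}
    {hQ₁ : ∀ i j, ((S.deg i).negOnePow : ℤ) • dif (Q i j) + ∑ l, Q l j ≫ Q i l = 0}
    (i j : Fin S.n) : qent (⟨mkTw S Q hQ hQ₀ hQ₁⟩ : Tot A.pretr) i j = Q i j :=
  hQ i j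

/-! ### Splitting of twisted complexes -/

/-- A decomposition of the terms of `Z` into those of `X₁` and those of `X₂`, for which the
differential of `Z` is triangular. -/
structure Split (Z X₁ X₂ : Tot A.pretr) where
  e : Fin X₁.tw.n ⊕ Fin X₂.tw.n ≃ Fin Z.tw.n
  term_inl i : X₁.term i = Z.term (e (.inl i))
  term_inr i : X₂.term i = Z.term (e (.inr i))
  deg_inl i : Z.deg (e (.inl i)) = X₁.deg i
  deg_inr i : Z.deg (e (.inr i)) = X₂.deg i
  qent_inl i j : eqToHom (term_inl j) ≫ Z.qent (e (.inl i)) (e (.inl j)) =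
    X₁.qent i j ≫ eqToHom (term_inl i)
  qent_inr i j : eqToHom (term_inr j) ≫ Z.qent (e (.inr i)) (e (.inr j)) =
    X₂.qent i j ≫ eqToHom (term_inr i)
  qent_inr_inl i j : Z.qent (e (.inr i)) (e (.inl j)) = 0

namespace Split

variable {X₁ X₂ : Tot A.pretr} (σ : Split Z X₁ X₂)

theorem sum_eq {M : Type*} [AddCommMonoid M] (f : Fin Z.tw.n → M) :
    ∑ l, f l = ∑ l, f (σ.e (.inl l)) + ∑ l, f (σ.e (.inr l)) := by
  rw [← Equiv.sum_comp σ.e, Fintype.sum_sum_type]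

theorem ext_to {f g : X ⟶ Z} (h₁ : ∀ i j, ent (σ.e (.inl i)) j f = ent (σ.e (.inl i)) j g)
    (h₂ : ∀ i j, ent (σ.e (.inr i)) j f = ent (σ.e (.inr i)) j g) : f = g := by
  refine ent_ext fun i j => ?_
  obtain ⟨i | i, rfl⟩ := σ.e.surjective i
  exacts [h₁ i j, h₂ i j]

theorem exists_to (n : ℤ) (f₁ : ∀ i j, X.term j ⟶ Z.term (σ.e (.inl i)))
    (f₂ : ∀ i j, X.term j ⟶ Z.term (σ.e (.inr i)))
    (h₁ : ∀ i j, IsHom (n + X₁.deg i - X.deg j) (f₁ i j))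
    (h₂ : ∀ i j, IsHom (n + X₂.deg i - X.deg j) (f₂ i j)) :
    ∃ f : X ⟶ Z, IsHom n f ∧ (∀ i j, ent (σ.e (.inl i)) j f = f₁ i j) ∧
      ∀ i j, ent (σ.e (.inr i)) j f = f₂ i j := by
  let φ : ∀ a j, X.term j ⟶ Z.term a := fun a j =>
    Equiv.piCongrLeft (fun a => X.term j ⟶ Z.term a) σ.e
      (fun | .inl i => f₁ i j | .inr i => f₂ i j) a
  have hφ₁ : ∀ i j, φ (σ.e (.inl i)) j = f₁ i j := fun i j =>
    Equiv.piCongrLeft_apply_apply (fun a => X.term j ⟶ Z.term a) σ.e _ (.inl i)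
  have hφ₂ : ∀ i j, φ (σ.e (.inr i)) j = f₂ i j := fun i j =>
    Equiv.piCongrLeft_apply_apply (fun a => X.term j ⟶ Z.term a) σ.e _ (.inr i)
  obtain ⟨f, hf, hf'⟩ := exists_ent (X := X) (Y := Z) n φ (fun i j => by
    obtain ⟨i | i, rfl⟩ := σ.e.surjective i
    · rw [hφ₁, σ.deg_inl]; exact h₁ i j
    · rw [hφ₂, σ.deg_inr]; exact h₂ i j)
  exact ⟨f, hf, fun i j => (hf' _ _).trans (hφ₁ i j), fun i j => (hf' _ _).trans (hφ₂ i j)⟩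

theorem exists_from (n : ℤ) (f₁ : ∀ i j, Z.term (σ.e (.inl j)) ⟶ X.term i)
    (f₂ : ∀ i j, Z.term (σ.e (.inr j)) ⟶ X.term i)
    (h₁ : ∀ i j, IsHom (n + X.deg i - X₁.deg j) (f₁ i j))
    (h₂ : ∀ i j, IsHom (n + X.deg i - X₂.deg j) (f₂ i j)) :
    ∃ f : Z ⟶ X, IsHom n f ∧ (∀ i j, ent i (σ.e (.inl j)) f = f₁ i j) ∧
      ∀ i j, ent i (σ.e (.inr j)) f = f₂ i j := by
  let φ : ∀ i a, Z.term a ⟶ X.term i := fun i a =>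
    Equiv.piCongrLeft (fun a => Z.term a ⟶ X.term i) σ.e
      (fun | .inl j => f₁ i j | .inr j => f₂ i j) a
  have hφ₁ : ∀ i j, φ i (σ.e (.inl j)) = f₁ i j := fun i j =>
    Equiv.piCongrLeft_apply_apply (fun a => Z.term a ⟶ X.term i) σ.e _ (.inl j)
  have hφ₂ : ∀ i j, φ i (σ.e (.inr j)) = f₂ i j := fun i j =>
    Equiv.piCongrLeft_apply_apply (fun a => Z.term a ⟶ X.term i) σ.e _ (.inr j)
  obtain ⟨f, hf, hf'⟩ := exists_ent (X := Z) (Y := X) n φ (fun i j => by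
    obtain ⟨j | j, rfl⟩ := σ.e.surjective j
    · rw [hφ₁, σ.deg_inl]; exact h₁ i j
    · rw [hφ₂, σ.deg_inr]; exact h₂ i j)
  exact ⟨f, hf, fun i j => (hf' _ _).trans (hφ₁ i j), fun i j => (hf' _ _).trans (hφ₂ i j)⟩

theorem isHom_id_eqToHom {W : Tot A} {n : ℤ} (i j : Fin X.tw.n) (e : X.term i = W)
    (h : i = j → n = 0) : IsHom n (ent i j (𝟙 X) ≫ eqToHom e) :=
  (isHom_ent_id' i j h).comp (.eqToHom e) (add_zero _)

theorem isHom_eqToHom_id {W : Tot A} {n : ℤ} (i j : Fin X.tw.n) (e : W = X.term j)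
    (h : i = j → n = 0) : IsHom n (eqToHom e ≫ ent i j (𝟙 X)) :=
  (IsHom.eqToHom e).comp (isHom_ent_id' i j h) (zero_add _)

theorem ent_id_inl_inl (i j : Fin X₁.tw.n) : ent (σ.e (.inl i)) (σ.e (.inl j)) (𝟙 Z) =
    eqToHom (σ.term_inl j).symm ≫ ent i j (𝟙 X₁) ≫ eqToHom (σ.term_inl i) := by
  by_cases h : i = j
  · subst h
    simp [ent_id_self]
  · rw [ent_id_of_ne h, ent_id_of_ne (by simpa using h)]
    simp

theorem ent_id_inr_inr (i j : Fin X₂.tw.n) : ent (σ.e (.inr i)) (σ.e (.inr j)) (𝟙 Z) =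
    eqToHom (σ.term_inr j).symm ≫ ent i j (𝟙 X₂) ≫ eqToHom (σ.term_inr i) := by
  by_cases h : i = j
  · subst h
    simp [ent_id_self]
  · rw [ent_id_of_ne h, ent_id_of_ne (by simpa using h)]
    simp

/-- The morphism `h` is the off-diagonal block of the differential of `Z`; the other structure maps
are the block inclusions and projections, and triangularity makes the inclusion of `X₁` closed. The
`eqToHom` are there because the terms of `Z` equal those of `X₁` and `X₂` only propositionally. -/
theorem exists_coneData : ∃ (h : X₂ ⟶ X₁) (_ : ConeData h Z), IsHom 1 h ∧
    ∀ i j, ent i j h ≫ eqToHom (σ.term_inl i) =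
      eqToHom (σ.term_inr j) ≫ Z.qent (σ.e (.inl i)) (σ.e (.inr j)) := by
  obtain ⟨ι, hι, hι₁, hι₂⟩ := σ.exists_to (X := X₁) 0
    (fun i j => ent i j (𝟙 X₁) ≫ eqToHom (σ.term_inl i)) 0
    (fun i j => isHom_id_eqToHom _ _ _ (by rintro rfl; omega)) (fun _ _ => .zero _)
  obtain ⟨κ, hκ, hκ₁, hκ₂⟩ := σ.exists_to (X := X₂) 0 0
    (fun i j => ent i j (𝟙 X₂) ≫ eqToHom (σ.term_inr i))
    (fun _ _ => .zero _) (fun i j => isHom_id_eqToHom _ _ _ (by rintro rfl; omega))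
  obtain ⟨π, hπ, hπ₁, hπ₂⟩ := σ.exists_from (X := X₁) 0
    (fun i j => eqToHom (σ.term_inl j).symm ≫ ent i j (𝟙 X₁)) 0
    (fun i j => isHom_eqToHom_id _ _ _ (by rintro rfl; omega)) (fun _ _ => .zero _)
  obtain ⟨ρ, hρ, hρ₁, hρ₂⟩ := σ.exists_from (X := X₂) 0 0
    (fun i j => eqToHom (σ.term_inr j).symm ≫ ent i j (𝟙 X₂))
    (fun _ _ => .zero _) (fun i j => isHom_eqToHom_id _ _ _ (by rintro rfl; omega))
  obtain ⟨h, hh, hh'⟩ := exists_ent (X := X₂) (Y := X₁) 1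
    (fun i j => eqToHom (σ.term_inr j) ≫ Z.qent (σ.e (.inl i)) (σ.e (.inr j)) ≫
      eqToHom (σ.term_inl i).symm)
    (fun i j => (IsHom.eqToHom _).comp ((Z.isHom_qent _ _).comp (.eqToHom _) (add_zero _)) (by
      rw [σ.deg_inl, σ.deg_inr, zero_add]))
  refine ⟨h, ⟨ι, κ, π, ρ, hι, hκ, hπ, hρ, ?_, ?_, ?_, ?_, ?_, ?_, ?_⟩, hh, ?_⟩
  · refine ent_ext fun i j => ?_
    simp [ent_comp, σ.sum_eq, hι₁, hι₂, hπ₁, hπ₂, sum_id_comp]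
  · refine ent_ext fun i j => ?_
    simp [ent_comp, σ.sum_eq, hκ₁, hκ₂, hρ₁, hρ₂, sum_id_comp]
  · refine ent_ext fun i j => ?_
    simp [ent_comp, σ.sum_eq, hκ₁, hκ₂, hπ₁, hπ₂]
  · refine ent_ext fun i j => ?_
    simp [ent_comp, σ.sum_eq, hι₁, hι₂, hρ₁, hρ₂]
  · refine ent_ext fun i j => ?_
    obtain ⟨i | i, rfl⟩ := σ.e.surjective i <;> obtain ⟨j | j, rfl⟩ := σ.e.surjective j <;>
    simp [ent_comp, hι₁, hι₂, hκ₁, hκ₂, hπ₁, hπ₂, hρ₁, hρ₂, ent_id_of_ne, ent_id_inl_inl,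
      ent_id_inr_inr, sum_id_comp_assoc]
  · refine σ.ext_to (fun i j => ?_) (fun i j => ?_)
    · simp [ent_dif, hι.sg_zero, σ.sum_eq, hι₁, hι₂, dif_comp, dif_ent_id, dif_eqToHom,
        sum_id_comp, sum_comp_id_assoc, σ.qent_inl]
    · simp [ent_dif, hι.sg_zero, σ.sum_eq, hι₁, hι₂, σ.qent_inr_inl]
  · refine σ.ext_to (fun i j => ?_) (fun i j => ?_)
    · rw [ent_comp]
      simp only [hι₁, sum_comp_id_assoc, hh']
      simp [ent_dif, hκ.sg_zero, σ.sum_eq, hκ₁, hκ₂, sum_id_comp]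
    · simp [ent_dif, hκ.sg_zero, σ.sum_eq, hκ₁, hκ₂, dif_comp, dif_ent_id, dif_eqToHom,
        sum_id_comp, sum_comp_id_assoc, σ.qent_inr, ent_comp, hι₂]
  · intro i j
    simp [hh']

end Split

/-- The degree and closedness of `h` are forced by the rest of the data: `h = dif j ≫ p`, and `dif
(dif j) = 0` reads `dif h ≫ i = 0`, where `i` is split. -/
theorem ConeData.closed {D : DGCat k} {X b T : Tot D} {h : b ⟶ X} (c : ConeData h T) :
    Closed 1 h := by
  have e : h = dif c.j ≫ c.p := by rw [c.dif_j, Category.assoc, c.i_p, Category.comp_id]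
  refine ⟨e ▸ (c.isHom_j.dif rfl).comp c.isHom_p rfl, ?_⟩
  have : dif h ≫ c.i = 0 := by
    have h2 := dif_dif c.j
    rw [c.dif_j, dif_comp, c.dif_i, c.sg_i, Limits.comp_zero, zero_add] at h2
    exact h2
  rw [← Category.comp_id (dif h), ← c.i_p, ← Category.assoc, this, Limits.zero_comp]

/-! ### Shifts -/

theorem negOnePow_mul_self (m : ℤ) : (m.negOnePow : ℤ) * m.negOnePow = 1 := by
  rw [← Units.val_mul, ← Int.negOnePow_add, Int.negOnePow_even _ ⟨m, rfl⟩]; rfl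

/-- Shifts are recorded as strict isomorphisms of degree `m`. In the total category this replaces a
shift functor, and the signs of a shift only appear when the isomorphism passes a differential. -/
theorem exists_shift_of_eq {X X' : Tot A.pretr} (m : ℤ) (e : Fin X'.tw.n ≃ Fin X.tw.n)
    (ht : ∀ i, X'.term i = X.term (e i)) (hd : ∀ i, X'.deg i = X.deg (e i) + m)
    (hq : ∀ i j, X'.qent i j ≫ eqToHom (ht i) =
      (m.negOnePow : ℤ) • eqToHom (ht j) ≫ X.qent (e i) (e j)) :
    ∃ (σ : X' ⟶ X) (σ' : X ⟶ X'), Closed m σ ∧ Closed (-m) σ' ∧ σ ≫ σ' = 𝟙 X' ∧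
      σ' ≫ σ = 𝟙 X ∧ ∀ i j, ent i j σ = eqToHom (ht j) ≫ ent i (e j) (𝟙 X) := by
  obtain ⟨σ, hσ, hσ₁⟩ := exists_ent (X := X') (Y := X) m
    (fun i j => eqToHom (ht j) ≫ ent i (e j) (𝟙 X)) (fun i j => Split.isHom_eqToHom_id _ _ _ (by
      rintro rfl; rw [hd]; omega))
  obtain ⟨τ, hτ, hτ₁⟩ := exists_ent (X := X) (Y := X') (-m)
    (fun i j => ent (e i) j (𝟙 X) ≫ eqToHom (ht i).symm)
    (fun i j => Split.isHom_id_eqToHom _ _ _ (by rintro rfl; rw [hd]; omega))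
  have h1 : σ ≫ τ = 𝟙 X' := by
    refine ent_ext fun i j => ?_
    simp only [ent_comp, hσ₁, hτ₁, Category.assoc, sum_id_comp_assoc]
    by_cases h : i = j
    · subst h
      simp [ent_id_self]
    · rw [ent_id_of_ne h, ent_id_of_ne (by simpa using h)]
      simp
  have h2 : τ ≫ σ = 𝟙 X := by
    refine ent_ext fun i j => ?_
    simp only [ent_comp, hσ₁, hτ₁, Category.assoc, eqToHom_trans_assoc, eqToHom_refl,
      Category.id_comp]
    rw [Equiv.sum_comp e (fun l => ent l j (𝟙 X) ≫ ent i l (𝟙 X)), sum_id_comp]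
  -- The sign `(-1) ^ m` of `sg σ` cancels the one by which the differential of `X'` differs from
  -- that of `X`.
  have h3 : dif σ = 0 := by
    refine ent_ext fun i j => ?_
    simp only [ent_dif, hσ.sg_eq, map_zsmul, hσ₁, dif_comp, dif_ent_id, dif_eqToHom,
      Limits.comp_zero, Limits.zero_comp, Category.assoc, sum_id_comp_assoc,
      Preadditive.comp_zsmul, ← Category.assoc (X'.qent _ _), hq, Preadditive.zsmul_comp, smul_smul,
      negOnePow_mul_self, one_smul, add_zero, smul_zero, zero_add, map_zero]
    rw [Equiv.sum_comp e (fun l => eqToHom (ht j) ≫ X.qent l (e j) ≫ ent i l (𝟙 X)),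
      ← Preadditive.comp_sum, sum_comp_id, sub_self]
  refine ⟨σ, τ, ⟨hσ, h3⟩, ⟨hτ, ?_⟩, h1, h2, hσ₁⟩
  -- Closedness of the inverse is obtained by differentiating `σ ≫ τ = 𝟙`, which avoids a second
  -- computation with matrices.
  have h4 := congrArg dif h1
  rw [dif_comp, h3, Limits.zero_comp, add_zero, dif_id] at h4
  rw [← Category.id_comp (dif τ), ← h2, Category.assoc, h4, Limits.comp_zero]

/-- The shift of a twisted complex. -/
def shiftTw (X : A.TwistedComplex) (m : ℤ) : A.TwistedComplex :=
  mkTw ⟨X.n, X.obj, fun i => X.deg i + m⟩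
    (fun i j => (m.negOnePow : ℤ) • qent (⟨X⟩ : Tot A.pretr) i j)
    (fun i j => ((isHom_qent (⟨X⟩ : Tot A.pretr) i j).zsmul _).cast (by
      change 1 + X.deg i - X.deg j = 1 + (X.deg i + m) - (X.deg j + m)
      omega))
    (fun i j h => by
      have key (X : Tot A.pretr) (i j : Fin X.tw.n) (h : j ≤ i) :
          (m.negOnePow : ℤ) • X.qent i j = 0 := by rw [X.qent_eq_zero i j h, smul_zero]
      exact key ⟨X⟩ i j h)
    (fun i j => by
      have key (X : Tot A.pretr) (i j : Fin X.tw.n) :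
          ((X.deg i + m).negOnePow : ℤ) • dif ((m.negOnePow : ℤ) • X.qent i j) +
            ∑ l, ((m.negOnePow : ℤ) • X.qent l j) ≫ ((m.negOnePow : ℤ) • X.qent i l) = 0 := by
        simp only [map_zsmul, Preadditive.zsmul_comp, Preadditive.comp_zsmul, smul_smul,
          Int.negOnePow_add, Units.val_mul, mul_assoc, negOnePow_mul_self, one_smul, mul_one,
          dif_qent]
      exact key ⟨X⟩ i j)

theorem exists_shift (X : Tot A.pretr) (m : ℤ) :
    ∃ (σ : (⟨shiftTw X.tw m⟩ : Tot A.pretr) ⟶ X) (σ' : X ⟶ ⟨shiftTw X.tw m⟩), Closed m σ ∧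
      Closed (-m) σ' ∧ σ ≫ σ' = 𝟙 _ ∧ σ' ≫ σ = 𝟙 X ∧
      ∀ i (j : Fin X.tw.n), ent (X := ⟨shiftTw X.tw m⟩) i j σ = ent (X := X) i j (𝟙 X) := by
  obtain ⟨σ, σ', hσ, hσ', h₁, h₂, h₃⟩ := exists_shift_of_eq (X := X) (X' := ⟨shiftTw X.tw m⟩) m
    (Equiv.refl (Fin X.tw.n)) (fun _ => rfl) (fun _ => rfl) fun i j =>
      (congrArg (· ≫ eqToHom rfl) (qent_mkTw (S := ⟨X.tw.n, X.tw.obj, fun i => X.deg i + m⟩)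
        i j)).trans ((Category.comp_id _).trans
          (congrArg (_ • ·) (Category.id_comp (X.qent i j)).symm))
  exact ⟨σ, σ', hσ, hσ', h₁, h₂, fun i j => (h₃ i j).trans (Category.id_comp _)⟩

/-! ### Cones -/

/-- The terms of `cone` are indexed through the inverse of `finSumFinEquiv`, so its indices equal
elements of the sum type only propositionally. Stating the comparison for arbitrary equal indices
allows substitution. -/
theorem qent_cone_of_eq {X Y : A.TwistedComplex} (f : (A.sumHom X.toFormalSum Y.toFormalSum).X 0)
    {a a' b b' : Fin Y.n ⊕ Fin X.n} (ha : a = a') (hb : b = b')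
    (ea : (⟨DGCat.coneObj X Y a'⟩ : Tot A) = ⟨DGCat.coneObj X Y a⟩)
    (eb : (⟨DGCat.coneObj X Y b'⟩ : Tot A) = ⟨DGCat.coneObj X Y b⟩) :
    eqToHom eb ≫ (tin _ (DGCat.coneQ f a b) : (⟨DGCat.coneObj X Y b⟩ : Tot A) ⟶
      ⟨DGCat.coneObj X Y a⟩) = (tin _ (DGCat.coneQ f a' b')) ≫ eqToHom ea := by
  subst ha hb
  rw [eqToHom_refl, Category.id_comp]
  exact (Category.comp_id _).symm

/-- Identifies the explicit cone as an extension of `Y` and the shift of `X` with `f` as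
off-diagonal block; the sign of the block `-q_X` is the one in `shiftTw X.tw 1`. -/
theorem exists_split_cone {X Y : Tot A.pretr}
    (f : (A.sumHom X.tw.toFormalSum Y.tw.toFormalSum).X 0)
    (hf : ((A.pretrHom X.tw Y.tw).d 0 1).hom f = 0) :
    ∃ σ : Split (⟨DGCat.cone f hf⟩ : Tot A.pretr) Y ⟨shiftTw X.tw 1⟩,
      ∀ i j, eqToHom (σ.term_inr j) ≫ qent _ (σ.e (.inl i)) (σ.e (.inr j)) =
        ent (X := X) i j (mtin 0 f) ≫ eqToHom (σ.term_inl i) := by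
  have hs : ∀ a, (finSumFinEquiv.symm : _ ≃ Fin Y.tw.n ⊕ Fin X.tw.n) (finSumFinEquiv a) = a :=
    finSumFinEquiv.symm_apply_apply
  have ht : ∀ a : Fin Y.tw.n ⊕ Fin X.tw.n, (⟨DGCat.coneObj X.tw Y.tw a⟩ : Tot A) =
    ⟨DGCat.coneObj X.tw Y.tw (finSumFinEquiv.symm (finSumFinEquiv a))⟩ := fun a => by rw [hs]
  refine ⟨⟨(finSumFinEquiv : Fin Y.tw.n ⊕ Fin X.tw.n ≃ _), fun i => ht (.inl i), fun i => ht (.inr i),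
    fun i => congrArg (DGCat.coneDeg X.tw Y.tw) (hs (.inl i)),
    fun i => congrArg (DGCat.coneDeg X.tw Y.tw) (hs (.inr i)), fun i j => ?_, fun i j => ?_,
    fun i j => ?_⟩, fun i j => ?_⟩
  · exact qent_cone_of_eq f (hs _) (hs _) _ _
  · refine (qent_cone_of_eq f (hs _) (hs _) _ _).trans (congrArg (· ≫ _) ?_)
    have h1 := tin_castDeg (X := X.term j) (Y := X.term i)
      (m := 1 + X.tw.deg i - X.tw.deg j) (n := 1 + (X.tw.deg i + 1) - (X.tw.deg j + 1)) (by omega)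
      (- X.tw.q i j)
    refine (h1.trans (map_neg (tin (X := X.term j) (Y := X.term i) _) _)).trans ?_
    refine Eq.trans ?_ (qent_mkTw (S := ⟨X.tw.n, X.tw.obj, fun i => X.deg i + 1⟩) i j).symm
    change - X.qent i j = ((1 : ℤ).negOnePow : ℤ) • X.qent i j
    simp
  · have key : ∀ a b, a = .inr i → b = .inl j → (tin _ (DGCat.coneQ f a b) :
        (⟨DGCat.coneObj X.tw Y.tw b⟩ : Tot A) ⟶ ⟨DGCat.coneObj X.tw Y.tw a⟩) = 0 := by
      rintro _ _ rfl rfl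
      exact map_zero _
    exact key _ _ (hs _) (hs _)
  · refine (qent_cone_of_eq f (hs _) (hs _) _ _).trans (congrArg (· ≫ _) ?_)
    refine (tin_castDeg (X := X.term j) (Y := Y.term i) (m := 0 + Y.tw.deg i - X.tw.deg j)
      (n := 1 + Y.tw.deg i - (X.tw.deg j + 1)) (by omega) (f i j)).trans ?_
    exact (ent_mtin 0 f i j).symm

/-- The twisted complexes with terms in `B`. -/
def trSet (B : Set A.Obj) : Set (Tot A.pretr) := {X | ∀ i, (X.term i).obj ∈ B}

theorem Split.mem_trSet {X₁ X₂ : Tot A.pretr} (σ : Split Z X₁ X₂) {B : Set A.Obj}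
    (h₁ : X₁ ∈ trSet B) (h₂ : X₂ ∈ trSet B) : Z ∈ trSet B := by
  intro i
  obtain ⟨i | i, rfl⟩ := σ.e.surjective i
  · rw [← σ.term_inl]; exact h₁ i
  · rw [← σ.term_inr]; exact h₂ i

theorem Split.mem_left {X₁ X₂ : Tot A.pretr} (σ : Split Z X₁ X₂) {B : Set A.Obj}
    (h : Z ∈ trSet B) : X₁ ∈ trSet B := fun i => by
  rw [σ.term_inl]; exact h _

theorem Split.mem_right {X₁ X₂ : Tot A.pretr} (σ : Split Z X₁ X₂) {B : Set A.Obj}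
    (h : Z ∈ trSet B) : X₂ ∈ trSet B := fun i => by
  rw [σ.term_inr]; exact h _

/-- The bridge between the explicit cone in the definition of `verdierClass` and the abstract
`ConeData`. The degree 1 morphism of the extension is `f` precomposed with the shift isomorphism. -/
theorem exists_coneData_cone {X Y : Tot A.pretr}
    (f : (A.sumHom X.tw.toFormalSum Y.tw.toFormalSum).X 0)
    (hf : ((A.pretrHom X.tw Y.tw).d 0 1).hom f = 0) :
    ∃ (X' : Tot A.pretr) (σ : X' ⟶ X) (σ' : X ⟶ X'), Closed 1 σ ∧ Closed (-1) σ' ∧ σ ≫ σ' = 𝟙 X' ∧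
      σ' ≫ σ = 𝟙 X ∧ Nonempty (ConeData (σ ≫ (mtin 0 f : X ⟶ Y)) ⟨DGCat.cone f hf⟩) ∧
      ∀ B : Set A.Obj, X ∈ trSet B → Y ∈ trSet B → (⟨DGCat.cone f hf⟩ : Tot A.pretr) ∈ trSet B := by
  obtain ⟨σ, σ', hσ, hσ', hσσ', hσ'σ, hσ''⟩ := exists_shift X 1
  obtain ⟨τ, hτ⟩ := exists_split_cone f hf
  obtain ⟨h, c, hh, hh'⟩ := τ.exists_coneData
  have e : h = σ ≫ mtin 0 f := by
    refine ent_ext fun i j => ?_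
    refine (((cancel_mono _).1 ((hh' i j).trans (hτ i j)) :).trans ?_).trans
      (ent_comp _ _ i j).symm
    exact (sum_id_comp (X := X) j fun l => ent i l (mtin 0 f)).symm.trans
      (Finset.sum_congr rfl fun l _ => congrArg (· ≫ _) (hσ'' l j).symm)
  exact ⟨_, σ, σ', hσ, hσ', hσσ', hσ'σ, ⟨e ▸ c⟩, fun B hX hY => τ.mem_trSet hY hX⟩

/-! ### The last term of a twisted complex -/

/-- Since the differential is strictly upper triangular, the first `m` terms form a subobject, and
the last term carries zero differential. This is where one-sidedness makes dévissage possible. -/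
theorem exists_split_last (Z : Tot A.pretr) (m : ℕ) (hm : Z.tw.n = m + 1) :
    ∃ X₁ X₂ : Tot A.pretr, X₁.tw.n = m ∧ X₂.tw.n = 1 ∧ Nonempty (Split Z X₁ X₂) := by
  let e : Fin m ⊕ Fin 1 ≃ Fin Z.tw.n := finSumFinEquiv.trans (finCongr hm.symm)
  have h1 : ∀ i j, e (.inl i) ≤ e (.inl j) ↔ i ≤ j := fun i j => Iff.rfl
  have h2 : ∀ i j, e (.inl i) ≤ e (.inr j) := fun i j => by
    change i.1 ≤ m + j.1
    omega
  let S₁ : A.FormalSum := ⟨m, fun i => Z.tw.obj (e (.inl i)), fun i => Z.tw.deg (e (.inl i))⟩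
  let S₂ : A.FormalSum := ⟨1, fun i => Z.tw.obj (e (.inr i)), fun i => Z.tw.deg (e (.inr i))⟩
  let X₁ := mkTw S₁ (fun i j => Z.qent (e (.inl i)) (e (.inl j))) (fun i j => Z.isHom_qent _ _)
    (fun i j h => Z.qent_eq_zero _ _ ((h1 _ _).2 h)) (fun i j => by
      have := Z.dif_qent (e (.inl i)) (e (.inl j))
      rw [← Equiv.sum_comp e, Fintype.sum_sum_type, Finset.sum_eq_zero (s := Finset.univ)
        (f := fun x : Fin 1 => Z.qent (e (.inr x)) (e (.inl j)) ≫ Z.qent (e (.inl i)) (e (.inr x)))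
        (fun x _ => by rw [Z.qent_eq_zero _ _ (h2 j x), Limits.zero_comp]), add_zero] at this
      exact this)
  let X₂ := mkTw S₂ 0 (fun i j => .zero _) (fun i j h => rfl) (fun i j => by simp)
  refine ⟨⟨X₁⟩, ⟨X₂⟩, rfl, rfl, ⟨⟨e, fun _ => rfl, fun _ => rfl, fun _ => rfl, fun _ => rfl,
    fun i j => ?_, fun i j => ?_, fun i j => Z.qent_eq_zero _ _ (h2 j i)⟩⟩⟩
  · refine (Category.id_comp _).trans (Eq.trans ?_ (Category.comp_id _).symm)
    have h3 : qent (⟨X₁⟩ : Tot A.pretr) i j = Z.qent (e (.inl i)) (e (.inl j)) :=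
      qent_mkTw (S := S₁) i j
    exact h3.symm
  · have h3 : Z.qent (e (.inr i)) (e (.inr j)) = 0 :=
      Z.qent_eq_zero _ _ (by rw [Subsingleton.elim (α := Fin 1) i j])
    have h4 : qent (⟨X₂⟩ : Tot A.pretr) i j = 0 := qent_mkTw (S := S₂) i j
    refine (congrArg (eqToHom _ ≫ ·) h3).trans (Limits.comp_zero.trans ?_)
    exact (Limits.zero_comp.symm).trans (congrArg (· ≫ eqToHom _) h4.symm)

theorem id_eq_zero_of_size (X : Tot A.pretr) (h : X.tw.n = 0) : 𝟙 X = 0 := by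
  have := Fin.isEmpty'
  refine ent_ext fun i => ?_
  exact absurd i.2 (by omega)

/-- Dévissage. -/
theorem pretr_induction {P : Tot A.pretr → Prop} (zero : ∀ X, 𝟙 X = 0 → P X)
    (single : ∀ X : Tot A.pretr, X.tw.n = 1 → P X)
    (cone : ∀ {X b T : Tot A.pretr} {h : b ⟶ X}, ConeData h T → P X → b.tw.n = 1 → P b → P T)
    (X : Tot A.pretr) : P X := by
  obtain ⟨m, hm⟩ : ∃ m, X.tw.n = m := ⟨_, rfl⟩
  induction m generalizing X with
  | zero => exact zero X (X.id_eq_zero_of_size hm)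
  | succ m ih =>
    obtain ⟨X₁, X₂, h₁, h₂, ⟨σ⟩⟩ := exists_split_last X m hm
    obtain ⟨h, c, -⟩ := σ.exists_coneData
    exact cone c (ih X₁ h₁) h₂ (single X₂ h₂)

theorem trSet_induction {B : Set A.Obj} {P : Tot A.pretr → Prop} (zero : ∀ X, 𝟙 X = 0 → P X)
    (single : ∀ X : Tot A.pretr, X.tw.n = 1 → X ∈ trSet B → P X)
    (cone : ∀ {X b T : Tot A.pretr} {h : b ⟶ X}, ConeData h T → P X → P b → P T)
    (X : Tot A.pretr) (hX : X ∈ trSet B) : P X := by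
  obtain ⟨m, hm⟩ : ∃ m, X.tw.n = m := ⟨_, rfl⟩
  induction m generalizing X with
  | zero => exact zero X (X.id_eq_zero_of_size hm)
  | succ m ih =>
    obtain ⟨X₁, X₂, h₁, h₂, ⟨σ⟩⟩ := exists_split_last X m hm
    obtain ⟨h, c, -⟩ := σ.exists_coneData
    exact cone c (ih X₁ (σ.mem_left hX) h₁) (single X₂ h₂ (σ.mem_right hX))

theorem isPretriangulated_trSet (B : Set A.Obj) : IsPretriangulated (trSet B) where
  exists_cone {X b} h hh := by
    -- The explicit cone accepts a morphism of degree 0, so `h` is precomposed with a shift of `b`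
    -- by -1. The cone then contains the shift of `b` by -1 and again by 1, and `ofIso` cancels the
    -- two.
    obtain ⟨σ, σ', hσ, hσ', hσσ', hσ'σ, -⟩ := exists_shift b (-1)
    have hf : Closed 0 (σ ≫ h) := hσ.comp hh (by omega)
    obtain ⟨X', τ, τ', hτ, hτ', hττ', hτ'τ, ⟨c⟩, hB⟩ :=
      exists_coneData_cone (mcpt 0 (σ ≫ h)) hf.mem_cycles
    have e1 : (mtin 0 (mcpt 0 (σ ≫ h)) : _ ⟶ X) = σ ≫ h := hf.isHom
    rw [e1] at c
    have c' := c.ofIso (𝟙 X) (𝟙 X) (σ' ≫ τ') (τ ≫ σ) (.id X) (.id X) (hσ'.comp hτ' (by omega))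
      (hτ.comp hσ (by omega)) (by simp) (by simp)
      (by rw [Category.assoc, ← Category.assoc τ', hτ'τ, Category.id_comp, hσ'σ])
      (by rw [Category.assoc, ← Category.assoc σ, hσσ', Category.id_comp, hττ'])
    have e2 : (σ' ≫ τ') ≫ (τ ≫ σ ≫ h) ≫ 𝟙 X = h := by
      rw [Category.comp_id, Category.assoc, ← Category.assoc τ', hτ'τ, Category.id_comp,
        ← Category.assoc, hσ'σ, Category.id_comp]
    rw [e2] at c'
    exact ⟨_, ⟨c'⟩, fun hX hb => hB B hb hX⟩
  exists_shift X m := by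
    obtain ⟨σ, σ', hσ, hσ', hσσ', hσ'σ, -⟩ := exists_shift X m
    exact ⟨_, σ, σ', hσ, hσ', hσσ', hσ'σ, fun h => h⟩
  exists_zero :=
    let X := mkTw (A := A) ⟨0, Fin.elim0, Fin.elim0⟩ (fun i => Fin.elim0 i) (fun i => Fin.elim0 i)
      (fun i => Fin.elim0 i) (fun i => Fin.elim0 i)
    ⟨⟨X⟩, fun i => Fin.elim0 i, id_eq_zero_of_size ⟨X⟩ rfl⟩

end Tot

/-! ### Cones and fibers -/

namespace Tot

section

variable {D : DGCat k} {X Y Z b T : Tot D}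

theorem comp_comp_of_id {X' : Tot D} {σ : X ⟶ X'} {σ' : X' ⟶ X} (h : σ ≫ σ' = 𝟙 X) (f : X ⟶ Y) :
    σ ≫ σ' ≫ f = f := by
  rw [← Category.assoc, h, Category.id_comp]

/-- Transport of a homotopy equivalence along isomorphisms of arbitrary degree. -/
theorem Equiv.conj {f : X ⟶ Y} (hf : Equiv f) {m : ℤ} {X' Y' : Tot D} {σ : X' ⟶ X} {σ' : X ⟶ X'}
    {τ : Y' ⟶ Y} {τ' : Y ⟶ Y'} (hσ : Closed m σ) (hσ' : Closed (-m) σ') (hτ : Closed m τ)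
    (hτ' : Closed (-m) τ') (h₁ : σ ≫ σ' = 𝟙 X') (h₂ : σ' ≫ σ = 𝟙 X) (h₃ : τ ≫ τ' = 𝟙 Y')
    (h₄ : τ' ≫ τ = 𝟙 Y) : Equiv (σ ≫ f ≫ τ') := by
  obtain ⟨g, hg, ⟨e₁, he₁, he₁'⟩, ⟨e₂, he₂, he₂'⟩⟩ := (equiv_iff hf.closed).1 hf
  refine (equiv_iff (hσ.comp (hf.closed.comp hτ' rfl) (by omega))).2 ⟨τ ≫ g ≫ σ',
    hτ.comp (hg.comp hσ' rfl) (by omega),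
    ⟨((-m).negOnePow : ℤ) • (σ ≫ e₁ ≫ σ'),
      (hσ.isHom.comp (he₁.comp hσ'.isHom rfl) (by omega)).zsmul _, ?_⟩,
    ⟨((-m).negOnePow : ℤ) • (τ ≫ e₂ ≫ τ'),
      (hτ.isHom.comp (he₂.comp hτ'.isHom rfl) (by omega)).zsmul _, ?_⟩⟩
  · simp only [map_zsmul, dif_comp, hσ.dif_eq, hσ'.dif_eq, hσ'.isHom.sg_eq, Limits.comp_zero,
      Limits.zero_comp, zero_add, add_zero, he₁', Preadditive.comp_zsmul, smul_smul,
      negOnePow_mul_self, one_smul, Category.assoc, comp_comp_of_id h₄]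
    simp [h₁]
  · simp only [map_zsmul, dif_comp, hτ.dif_eq, hτ'.dif_eq, hτ'.isHom.sg_eq, Limits.comp_zero,
      Limits.zero_comp, zero_add, add_zero, he₂', Preadditive.comp_zsmul, smul_smul,
      negOnePow_mul_self, one_smul, Category.assoc, comp_comp_of_id h₂]
    simp [h₃]

/-- A morphism is the projection of an extension by the shift of its cone. -/
theorem exists_fiber_of_cone {X' E E' : Tot D} {f : X ⟶ Y} (hf : Closed 0 f) {σ : X' ⟶ X}
    {σ' : X ⟶ X'} (hσ : Closed 1 σ) (hσ' : Closed (-1) σ') (h₁ : σ ≫ σ' = 𝟙 X')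
    (h₂ : σ' ≫ σ = 𝟙 X) (c : ConeData (σ ≫ f) E) {l : E' ⟶ E} {l' : E ⟶ E'} (hl : Closed (-1) l)
    (hl' : Closed 1 l') (h₃ : l ≫ l' = 𝟙 E') (h₄ : l' ≫ l = 𝟙 E) {T₀ : Tot D}
    (c₀ : ConeData (c.i ≫ l') T₀) :
    ∃ w : X ⟶ T₀, Equiv w ∧ w ≫ c₀.s = f := by
  -- As graded objects `E` is `Y ⊕ X'` and `T₀` is the shift `E'` of `E` plus another `Y`. The two
  -- copies of `Y` cancel and leave `X`; the homotopy `-(p ≫ l ≫ p ≫ j)` used below moves one copy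
  -- to the other.
  have hw : Closed 0 (σ' ≫ c.j ≫ l' ≫ c₀.i + f ≫ c₀.j) :=
    ⟨(hσ'.isHom.comp (c.isHom_j.comp (hl'.isHom.comp c₀.isHom_i rfl) rfl) rfl).add
      (hf.isHom.comp c₀.isHom_j rfl), by
      simp [dif_comp, sg_comp, hσ'.dif_eq, hl'.dif_eq, hf.dif_eq, hl'.isHom.sg_one,
        comp_comp_of_id h₂]⟩
  have hv : Closed 0 (c₀.p ≫ l ≫ c.s ≫ σ) :=
    ⟨c₀.isHom_p.comp (hl.isHom.comp (c.isHom_s.comp hσ.isHom rfl) rfl) rfl, by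
      simp [dif_comp, sg_comp, hσ.dif_eq, hl.dif_eq, hl.isHom.sg_neg_one, hσ.isHom.sg_one,
        comp_comp_of_id h₄]⟩
  refine ⟨_, Equiv.of_inverse hw hv ?_ (e := -(c₀.p ≫ l ≫ c.p ≫ c₀.j)) ?_ ?_, ?_⟩
  · simp [comp_comp_of_id h₄, h₂]
  · exact (c₀.isHom_p.comp (hl.isHom.comp (c.isHom_p.comp c₀.isHom_j rfl) rfl) rfl).neg
  · simp [dif_comp, sg_comp, hl.dif_eq, hl.isHom.sg_neg_one, comp_comp_of_id h₄,
      comp_comp_of_id h₁, comp_comp_of_id h₃]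
    abel
  · simp

/-- The cone of the projection `b * X ⟶ X` is a shift of `b`. -/
theorem exists_equiv_of_cone_s {T' E b' : Tot D} {η : X ⟶ b} (hη : Closed 1 η) (c : ConeData η T)
    {σ : T' ⟶ T} {σ' : T ⟶ T'} (hσ : Closed 1 σ) (hσ' : Closed (-1) σ') (h₁ : σ ≫ σ' = 𝟙 T')
    (h₂ : σ' ≫ σ = 𝟙 T) (d : ConeData (σ ≫ c.s) E) {ρ : b' ⟶ b} {ρ' : b ⟶ b'} (hρ : Closed 1 ρ)
    (hρ' : Closed (-1) ρ') (h₃ : ρ ≫ ρ' = 𝟙 b') (h₄ : ρ' ≫ ρ = 𝟙 b) :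
    ∃ w : b' ⟶ E, Equiv w := by
  -- Now `E` is `X` plus a shift of `T`, and `T` is `b ⊕ X`. The two copies of `X` cancel, which
  -- leaves a shift of `b`.
  have hv : Closed 0 (ρ ≫ c.i ≫ σ' ≫ d.j) :=
    ⟨hρ.isHom.comp (c.isHom_i.comp (hσ'.isHom.comp d.isHom_j rfl) rfl) rfl, by
      simp [dif_comp, sg_comp, hσ'.dif_eq, hρ.dif_eq, comp_comp_of_id h₂]⟩
  have hu : Closed 0 (d.s ≫ σ ≫ c.p ≫ ρ' + d.p ≫ η ≫ ρ') :=
    ⟨(d.isHom_s.comp (hσ.isHom.comp (c.isHom_p.comp hρ'.isHom rfl) rfl) rfl).add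
      (d.isHom_p.comp (hη.isHom.comp hρ'.isHom rfl) rfl), by
      simp [dif_comp, sg_comp, hσ.dif_eq, hρ'.dif_eq, hη.dif_eq, hσ.isHom.sg_one,
        hη.isHom.sg_one, hρ'.isHom.sg_neg_one]⟩
  refine ⟨_, Equiv.of_inverse hv hu ?_ (e := -(d.p ≫ c.j ≫ σ' ≫ d.j)) ?_ ?_⟩
  · simp [comp_comp_of_id h₂, h₃]
  · exact (d.isHom_p.comp (c.isHom_j.comp (hσ'.isHom.comp d.isHom_j rfl) rfl) rfl).neg
  · simp [dif_comp, sg_comp, hσ'.dif_eq, hσ'.isHom.sg_neg_one, comp_comp_of_id h₄,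
      comp_comp_of_id h₂, comp_comp_of_id h₁]
    abel

/-- A morphism is the projection of the extension of its target by the shifted cone. The cone may
then be replaced by the object `Z` of `𝓑` homotopy equivalent to it. -/
theorem fibProp_of_cone {𝓑 : Set (Tot D)} (h𝓑 : IsPretriangulated 𝓑) {X' E : Tot D} {f : X ⟶ Y}
    (hf : Closed 0 f) {σ : X' ⟶ X} {σ' : X ⟶ X'} (hσ : Closed 1 σ) (hσ' : Closed (-1) σ')
    (h₁ : σ ≫ σ' = 𝟙 X') (h₂ : σ' ≫ σ = 𝟙 X) (c : ConeData (σ ≫ f) E) (hZ : Z ∈ 𝓑)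
    (e : E.ho ≅ Z.ho) : fibProp 𝓑 (toHo f hf) := by
  obtain ⟨E', l, l', hl, hl', h₃, h₄, -⟩ := h𝓑.exists_shift E (-1)
  have hη : Closed 1 (c.i ≫ l') := c.closed_i.comp hl' rfl
  obtain ⟨T₀, ⟨c₀⟩, -⟩ := h𝓑.exists_cone (c.i ≫ l') hη
  obtain ⟨w, hw, hw'⟩ := exists_fiber_of_cone hf hσ hσ' h₁ h₂ c hl hl' h₃ h₄ c₀
  obtain ⟨θ, hθ, -⟩ := exists_equiv_iso e.hom
  obtain ⟨b, τ, τ', hτ, hτ', h₅, h₆, hb⟩ := h𝓑.exists_shift Z (-1)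
  have hθ' := hθ.conj hl hl' hτ hτ' h₃ h₄ h₅ h₆
  obtain ⟨T, ⟨c₁⟩, -⟩ := h𝓑.exists_cone ((c.i ≫ l') ≫ (l ≫ θ ≫ τ')) (hη.comp hθ'.closed rfl)
  obtain ⟨t, ht, -, hs⟩ := exists_equiv_cone c₀ c₁ hη (hη.comp hθ'.closed rfl) hθ' (.id Y)
    (α := 0) (.zero 0) (by simp)
  refine (fibProp_iff _).2 ⟨b, T, _, c₁, (hw.comp ht).iso, hb hZ, hη.comp hθ'.closed rfl, ?_⟩
  rw [Equiv.iso_hom, toHo_comp]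
  exact toHo_congr _ (by rw [Category.assoc, hs, Category.comp_id, hw'])

/-- The conclusion ranges over all shifts of `X` and all extensions `E`, because it has to be
applied to the explicit cone chosen in `verdierClass`. -/
theorem exists_iso_of_fibProp {𝓑 : Set (Tot D)} (h𝓑 : IsPretriangulated 𝓑) {φ : X.ho ⟶ Y.ho}
    (h : fibProp 𝓑 φ) : ∃ (f : X ⟶ Y) (hf : Closed 0 f), φ = toHo f hf ∧
      ∀ {X' E : Tot D} {σ : X' ⟶ X} {σ' : X ⟶ X'}, Closed 1 σ → Closed (-1) σ' →
        σ ≫ σ' = 𝟙 X' → σ' ≫ σ = 𝟙 X → ConeData (σ ≫ f) E →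
        ∃ b' ∈ 𝓑, Nonempty (E.ho ≅ b'.ho) := by
  obtain ⟨b, T, η, c, e, hb, hη, rfl⟩ := (fibProp_iff φ).1 h
  obtain ⟨ε, hε, he⟩ := exists_equiv_iso e.hom
  refine ⟨ε ≫ c.s, hε.closed.comp c.closed_s rfl, by rw [he, toHo_comp], ?_⟩
  intro X' E σ σ' hσ hσ' h₁ h₂ d
  obtain ⟨b', ρ, ρ', hρ, hρ', h₃, h₄, hb'⟩ := h𝓑.exists_shift b 1
  obtain ⟨T', τ, τ', hτ, hτ', h₅, h₆, -⟩ := h𝓑.exists_shift T 1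
  have hε' := hε.conj hσ hσ' hτ hτ' h₁ h₂ h₅ h₆
  obtain ⟨E', ⟨d'⟩, -⟩ := h𝓑.exists_cone (τ ≫ c.s) (hτ.comp c.closed_s rfl)
  obtain ⟨t, ht, -⟩ := exists_equiv_cone d d' d.closed d'.closed (.id Y) hε' (α := 0) (.zero 0)
    (by simp [comp_comp_of_id h₆])
  obtain ⟨w, hw⟩ := exists_equiv_of_cone_s hη c hτ hτ' h₅ h₆ d' hρ hρ' h₃ h₄
  exact ⟨b', hb' hb, ⟨ht.iso ≪≫ hw.iso.symm⟩⟩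

end

variable {A : DGCat k}

theorem toHo_mtin {X Y : Tot A.pretr} (f : (A.sumHom X.tw.toFormalSum Y.tw.toFormalSum).X 0)
    (hf : ((A.pretrHom X.tw Y.tw).d 0 1).hom f = 0) :
    ∃ h : Closed 0 (mtin 0 f : X ⟶ Y), toHo (mtin 0 f) h = Ho.homMk A.pretr ⟨f, hf⟩ :=
  ⟨⟨isHom_tin (D := A.pretr) 0 f, (dif_tin (D := A.pretr) 0 1 rfl f).trans
    ((congrArg _ hf).trans (map_zero _))⟩, congrArg (Ho.homMk A.pretr)
      (Subtype.ext (tcpt_tin (D := A.pretr) 0 f))⟩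

/-- Replaces cones by fibres. The right calculus of fractions and the dévissage arguments are
adapted to `fibProp`, where the object of `𝓑` and the morphism to it are visible. -/
theorem verdierClass_eq (B : Set A.Obj) : DGCat.verdierClass B = fibProp (trSet B) := by
  have hB := isPretriangulated_trSet B
  ext X Y φ
  obtain ⟨X, rfl⟩ := exists_ho X
  obtain ⟨Y, rfl⟩ := exists_ho Y
  constructor
  · rintro ⟨f, hf, rfl, Z, hZ, ⟨e⟩⟩
    obtain ⟨Z, rfl⟩ := exists_ho Z
    obtain ⟨X', σ, σ', hσ, hσ', h₁, h₂, ⟨c⟩, -⟩ := exists_coneData_cone (X := X) (Y := Y) f hf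
    obtain ⟨hf', h⟩ := toHo_mtin (X := X) (Y := Y) f hf
    have := fibProp_of_cone hB hf' hσ hσ' h₁ h₂ c hZ e
    rw [h] at this
    exact this
  · intro h
    obtain ⟨f, hf, rfl, H⟩ := exists_iso_of_fibProp hB h
    obtain ⟨X', σ, σ', hσ, hσ', h₁, h₂, ⟨d⟩, -⟩ :=
      exists_coneData_cone (mcpt 0 f) hf.mem_cycles
    rw [show (mtin 0 (mcpt 0 f) : X ⟶ Y) = f from hf.isHom] at d
    obtain ⟨b', hb', e⟩ := H hσ hσ' h₁ h₂ d
    exact ⟨mcpt 0 f, hf.mem_cycles, rfl, b'.ho, hb', e⟩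

end Tot

/-! ### Vanishing of relative classes -/

section

variable {P E : DGCat k} (Ξ : DGFunctor P E)

/-- The cone of `Hom(X, Y) → Hom(Ξ X, Ξ Y)` is acyclic. -/
def RelAcyclic (X Y : Tot P) : Prop :=
  ∀ (n : ℤ) (z : X ⟶ Y) (γ : Ξ.tot.obj X ⟶ Ξ.tot.obj Y), Closed n z →
    IsHom (n - 1) γ → dif γ = Ξ.tot.map z →
    ∃ (α : X ⟶ Y) (β : Ξ.tot.obj X ⟶ Ξ.tot.obj Y), IsHom (n - 1) α ∧ IsHom (n - 2) β ∧
      dif α = z ∧ γ = Ξ.tot.map α + dif β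

variable {Ξ} {X Y b T : Tot P}

theorem RelAcyclic.of_id_eq_zero (h : 𝟙 X = 0) : RelAcyclic Ξ X Y := by
  intro n z γ _ _ _
  have h' : 𝟙 (Ξ.tot.obj X) = 0 := by rw [← Ξ.tot.map_id, h, Ξ.tot.map_zero]
  refine ⟨0, 0, .zero _, .zero _, ?_, ?_⟩
  · rw [← Category.id_comp z, h, Limits.zero_comp, map_zero]
  · rw [← Category.id_comp γ, h', Limits.zero_comp, Ξ.tot.map_zero, map_zero, add_zero]

theorem RelAcyclic.of_iso {X' : Tot P} {m : ℤ} {σ : X' ⟶ X} {σ' : X ⟶ X'} (hσ : Closed m σ)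
    (hσ' : Closed (-m) σ') (h : σ ≫ σ' = 𝟙 X') (hX : RelAcyclic Ξ X Y) : RelAcyclic Ξ X' Y := by
  intro n z γ hz hγ hγz
  have hF : Ξ.tot.map σ ≫ Ξ.tot.map σ' = 𝟙 _ := by rw [← Ξ.tot.map_comp, h, Ξ.tot.map_id]
  obtain ⟨α, β, hα, hβ, h₁, h₂⟩ := hX (-m + n) (σ' ≫ z) (Ξ.tot.map σ' ≫ γ) (hσ'.comp hz rfl)
    ((hσ'.isHom.tot Ξ).comp hγ (by omega))
    (by rw [dif_comp, Ξ.dif_tot, hσ'.dif_eq, hγz, Ξ.tot.map_comp, Ξ.tot.map_zero,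
      Limits.zero_comp, add_zero])
  refine ⟨σ ≫ α, Ξ.tot.map σ ≫ β, hσ.isHom.comp hα (by omega),
    (hσ.isHom.tot Ξ).comp hβ (by omega), ?_, ?_⟩
  · rw [dif_comp, h₁, hσ.dif_eq, Limits.zero_comp, add_zero, comp_comp_of_id h]
  · rw [dif_comp, Ξ.dif_tot, hσ.dif_eq, Ξ.tot.map_zero, Limits.zero_comp, add_zero,
      Ξ.tot.map_comp, ← Preadditive.comp_add, ← h₂, comp_comp_of_id hF]

/-- Dévissage in the source. A bound on `X` is extended to `T` along `p` and subtracted; the class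
that remains vanishes on `i`, hence factors through `s` and is bounded on `b`. -/
theorem RelAcyclic.cone {h : b ⟶ X} (c : ConeData h T) (hX : RelAcyclic Ξ X Y)
    (hb : RelAcyclic Ξ b Y) : RelAcyclic Ξ T Y := by
  intro n z γ hz hγ hγz
  let C := c.map Ξ
  obtain ⟨α₁, β₁, hα₁, hβ₁, h₁, h₂⟩ := hX n (c.i ≫ z) (C.i ≫ γ) (c.closed_i.comp hz (by omega))
    (C.isHom_i.comp hγ (by omega))
    (by rw [dif_comp, C.dif_i, hγz, Ξ.tot.map_comp, Limits.zero_comp, add_zero]; rfl)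
  let z' := z - dif (c.p ≫ α₁)
  let γ' := γ - Ξ.tot.map (c.p ≫ α₁) - dif (C.p ≫ β₁)
  have hz' : c.i ≫ z' = 0 := by
    simp [z', dif_comp, h₁]
  have hγ' : C.i ≫ γ' = 0 := by
    have : C.i ≫ Ξ.tot.map c.p = 𝟙 _ := C.i_p
    simp [γ', dif_comp, h₂, comp_comp_of_id this]
  have hsγ' : C.i ≫ sg γ' = 0 := by
    rw [← C.sg_i, ← sg_comp, hγ', map_zero]
  have dγ' : dif γ' = Ξ.tot.map z' := by
    simp only [γ', z', map_sub, hγz, Ξ.dif_tot, dif_dif, sub_zero, Ξ.tot.map_sub]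
  have hcz : Closed n z' := hz.sub (.dif (c.isHom_p.comp hα₁ (zero_add _)) (by omega))
  have hγ'' : IsHom (n - 1) γ' :=
    (hγ.sub ((c.isHom_p.comp hα₁ (zero_add _)).tot Ξ)).sub
      ((C.isHom_p.comp hβ₁ (zero_add _)).dif (by omega))
  obtain ⟨α₂, β₂, hα₂, hβ₂, h₃, h₄⟩ := hb n (c.j ≫ z') (C.j ≫ γ')
    ⟨c.isHom_j.comp hcz.isHom (zero_add _), by
      rw [dif_comp, hcz.dif_eq, c.dif_j, hcz.isHom.sg_eq, Preadditive.comp_zsmul, Category.assoc,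
        hz']; simp⟩
    (C.isHom_j.comp hγ'' (zero_add _))
    (by rw [dif_comp, C.dif_j, Category.assoc, hsγ', dγ', Ξ.tot.map_comp, Limits.comp_zero,
          add_zero]; rfl)
  refine ⟨c.p ≫ α₁ + c.s ≫ α₂, C.p ≫ β₁ + C.s ≫ β₂,
    (c.isHom_p.comp hα₁ (zero_add _)).add (c.isHom_s.comp hα₂ (zero_add _)),
    (C.isHom_p.comp hβ₁ (zero_add _)).add (C.isHom_s.comp hβ₂ (zero_add _)), ?_, ?_⟩
  · have : dif (c.s ≫ α₂) = z' := by
      simp [dif_comp, h₃, hz']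
    rw [map_add, this]; simp [z']
  · have : Ξ.tot.map (c.s ≫ α₂) + dif (C.s ≫ β₂) = γ' := by
      have e : C.s ≫ C.j ≫ γ' = γ' := by simp [hγ']
      rw [dif_comp, C.dif_s, Limits.zero_comp, add_zero, Ξ.tot.map_comp]
      refine Eq.trans ?_ e
      rw [h₄, Preadditive.comp_add]; rfl
    rw [map_add, Ξ.tot.map_add]
    have e2 : γ = Ξ.tot.map (c.p ≫ α₁) + dif (C.p ≫ β₁) + γ' := by simp [γ']
    rw [e2, ← this]; abel

/-- If `b` has no relative classes, then the restriction of relative classes along the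
projection `b * X ⟶ X` is injective. -/
theorem RelAcyclic.exists_of_comp_s {η : X ⟶ b} (c : ConeData η T) (hb : RelAcyclic Ξ b Y)
    {n : ℤ} {z : X ⟶ Y} {γ : Ξ.tot.obj X ⟶ Ξ.tot.obj Y} {α : T ⟶ Y}
    {β : Ξ.tot.obj T ⟶ Ξ.tot.obj Y} (hα : IsHom (n - 1) α) (hβ : IsHom (n - 2) β)
    (h₁ : dif α = c.s ≫ z) (h₂ : Ξ.tot.map c.s ≫ γ = Ξ.tot.map α + dif β) :
    ∃ (α : X ⟶ Y) (β : Ξ.tot.obj X ⟶ Ξ.tot.obj Y), IsHom (n - 1) α ∧ IsHom (n - 2) β ∧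
      dif α = z ∧ γ = Ξ.tot.map α + dif β := by
  let C := c.map Ξ
  have h₂' : C.s ≫ γ = Ξ.tot.map α + dif β := h₂
  have h₃ : dif β = C.s ≫ γ - Ξ.tot.map α := by rw [h₂']; abel
  -- Since `s` vanishes on `i`, the restriction of the bound to `b` is itself a relative class, one
  -- degree lower. Its vanishing allows the bound to be changed so that it is zero on `i` and
  -- descends along `s`.
  obtain ⟨α', β', hα', hβ', h₄, h₅⟩ := hb (n - 1) (c.i ≫ α) (-(C.i ≫ β))
    ⟨c.isHom_i.comp hα (zero_add _), by simp [dif_comp, h₁]⟩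
    ((C.isHom_i.comp hβ (by omega)).neg)
    (by rw [map_neg, dif_comp, h₃, C.dif_i, Limits.zero_comp, add_zero, Preadditive.comp_sub,
          C.i_s_assoc, Ξ.tot.map_comp]
        simp; rfl)
  let α'' := α - dif (c.p ≫ α')
  let β'' := β + Ξ.tot.map (c.p ≫ α') + dif (C.p ≫ β')
  have hiα : c.i ≫ α'' = 0 := by simp [α'', dif_comp, h₄]
  have hiα' : c.i ≫ sg α'' = 0 := by rw [← c.sg_i, ← sg_comp, hiα, map_zero]
  have hiβ : C.i ≫ β'' = 0 := by
    have e1 : C.i ≫ Ξ.tot.map c.p = 𝟙 _ := C.i_p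
    have e2 : C.i ≫ β = -(Ξ.tot.map α' + dif β') := by rw [← h₅, neg_neg]
    simp [β'', dif_comp, e2, comp_comp_of_id e1]
  have hiβ' : C.i ≫ sg β'' = 0 := by rw [← C.sg_i, ← sg_comp, hiβ, map_zero]
  have hα'' : IsHom (n - 1) α'' := hα.sub ((c.isHom_p.comp hα' (zero_add _)).dif (by omega))
  have hβ'' : IsHom (n - 2) β'' := (hβ.add (((c.isHom_p.comp hα' (zero_add _)).tot Ξ).cast
    (by omega))).add ((C.isHom_p.comp hβ' (zero_add _)).dif (by omega))
  have hd : Ξ.tot.map α'' + dif β'' = C.s ≫ γ := by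
    simp only [α'', β'', map_add, Ξ.tot.map_sub, dif_dif, Ξ.dif_tot, h₃]; abel
  refine ⟨c.j ≫ α'', C.j ≫ β'', c.isHom_j.comp hα'' (zero_add _),
    C.isHom_j.comp hβ'' (zero_add _), ?_, ?_⟩
  · rw [dif_comp, c.dif_j, Category.assoc, hiα', Limits.comp_zero, add_zero]
    simp only [α'', map_sub, dif_dif, sub_zero, h₁, c.j_s_assoc]
  · rw [dif_comp, C.dif_j, Category.assoc, hiβ', Limits.comp_zero, add_zero, Ξ.tot.map_comp]
    refine Eq.trans ?_ (Preadditive.comp_add _ _ _ C.j (Ξ.tot.map α'') (dif β''))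
    rw [hd, C.j_s_assoc]

end

section

variable {D E : DGCat k} {F : DGFunctor D E} {𝓑 : Set (Tot D)}

/-- Relative classes vanish after restriction along a projection `b * X ⟶ X` with `b ∈ 𝓑`. -/
theorem RelVanish.exists_cone {Y : Tot D} (hY : RelVanish F 𝓑 Y) {X : Tot D} {n : ℤ} {z : X ⟶ Y}
    {γ : F.tot.obj X ⟶ F.tot.obj Y} (hz : Closed n z) (hγ : IsHom (n - 1) γ)
    (h : dif γ = F.tot.map z) :
    ∃ (b T : Tot D) (η : X ⟶ b) (c : ConeData η T) (α : T ⟶ Y)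
      (β : F.tot.obj T ⟶ F.tot.obj Y), b ∈ 𝓑 ∧ IsHom (n - 1) α ∧ IsHom (n - 2) β ∧
        dif α = c.s ≫ z ∧ F.tot.map c.s ≫ γ = F.tot.map α + dif β := by
  obtain ⟨X', r, hr, hr', α, β, hα, hβ, h₁, h₂⟩ := hY X n z γ hz hγ h
  obtain ⟨b, T, η, c, e, hb, hη, he⟩ := (fibProp_iff _).1 hr'
  -- The projection `s` agrees with `r` up to an equivalence `g` and a homotopy `H`. The homotopy is
  -- absorbed by adding multiples of `H ≫ z` and `F H ≫ γ` to the bound.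
  obtain ⟨g, hg, hg'⟩ := exists_equiv_iso e.inv
  have h₃ : toHo (g ≫ r) (hg.closed.comp hr rfl) = toHo c.s c.closed_s := by
    rw [← toHo_comp hg.closed hr, he, ← hg', Iso.inv_hom_id_assoc]
  obtain ⟨H, hH, h₄⟩ := (toHo_eq_iff _ _).1 h₃
  have hs : c.s = g ≫ r - dif H := by rw [h₄]; abel
  have hzε := hz.isHom.sg_eq
  have hγε := hγ.sg_eq
  have hεε := negOnePow_mul_self n
  have hε' : ((n - 1).negOnePow : ℤ) = - n.negOnePow := by
    rw [Int.negOnePow_sub]; simp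
  rw [hε'] at hγε
  generalize (n.negOnePow : ℤ) = ε at hzε hγε hεε
  have hFg : dif (F.tot.map g) = 0 := by rw [F.dif_tot, hg.closed.dif_eq, F.tot.map_zero]
  refine ⟨b, T, η, c, g ≫ α - ε • (H ≫ z), F.tot.map g ≫ β + ε • (F.tot.map H ≫ γ), hb,
    (hg.closed.isHom.comp hα (zero_add _)).sub ((hH.comp hz.isHom (by omega)).zsmul _),
    ((hg.closed.isHom.tot F).comp hβ (zero_add _)).add
      (((hH.tot F).comp hγ (by omega)).zsmul _), ?_, ?_⟩
  · rw [map_sub, map_zsmul, dif_comp, dif_comp, hz.dif_eq, hg.closed.dif_eq, h₁, hzε, hs]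
    simp [smul_smul, hεε]
  · rw [map_add, map_zsmul, dif_comp, dif_comp, hFg, h, hγε, hs, F.dif_tot, F.tot.map_sub,
      F.tot.map_sub, F.tot.map_zsmul, F.tot.map_comp, F.tot.map_comp, F.tot.map_comp,
      Preadditive.sub_comp, Category.assoc, h₂]
    simp [smul_smul, hεε]
    abel

/-- Apply the hypothesis to the projection of the trivial extension `b ⊕ Z` onto a zero object `Z`.
Its image is an equivalence, so the image of `b ⊕ Z` is contractible, and the image of `b` is a
retract of it. -/
theorem contractible_of_isInvertedBy (h𝓑 : IsPretriangulated 𝓑)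
    (hF : (fibProp 𝓑).IsInvertedBy (hoMap F)) {b : Tot D} (hb : b ∈ 𝓑) :
    Contractible (F.tot.obj b) := by
  obtain ⟨Z, -, hZ⟩ := h𝓑.exists_zero
  obtain ⟨T, ⟨c⟩, -⟩ := h𝓑.exists_cone (0 : Z ⟶ b) (.zero 1)
  have h₁ := hF _ (fibProp_s c (.zero 1) hb)
  rw [hoMap_toHo] at h₁
  have h₂ : Equiv (F.tot.map c.s) := ⟨c.closed_s.tot F, h₁⟩
  obtain ⟨g, hg, -⟩ := h₂.exists_inverse
  have hZ' : 𝟙 (F.tot.obj Z) = 0 := by rw [← F.tot.map_id, hZ, F.tot.map_zero]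
  obtain ⟨e, he, he'⟩ := Contractible.of_equiv hg ⟨0, .zero _, by rw [hZ', map_zero]⟩
  let C := c.map F
  refine ⟨C.i ≫ e ≫ C.p, C.isHom_i.comp (he.comp C.isHom_p rfl) rfl, ?_⟩
  simp [dif_comp, he']

end

/-! ### Composition of DG functors -/

/-- The composition of DG functors. -/
def DGFunctor.comp {D P E : DGCat k} (F : DGFunctor D P) (G : DGFunctor P E) : DGFunctor D E where
  obj X := G.obj (F.obj X)
  map X Y := F.map X Y ≫ G.map (F.obj X) (F.obj Y)
  map_id X := (congrArg ((G.map _ _).f 0).hom (F.map_id X)).trans (G.map_id _)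
  map_comp p q n h g f := (congrArg ((G.map _ _).f n).hom (F.map_comp p q n h g f)).trans
    (G.map_comp p q n h _ _)

theorem DGFunctor.comp_tot_map {D P E : DGCat k} (F : DGFunctor D P) (G : DGFunctor P E)
    {X Y : Tot D} (f : X ⟶ Y) : (F.comp G).tot.map f = G.tot.map (F.tot.map f) := by
  induction f using hom_induction with
  | hadd f f' h h' =>
    refine ((F.comp G).tot.map_add).trans ((congrArg₂ (· + ·) h h').trans ?_)
    rw [F.tot.map_add, G.tot.map_add]; rfl
  | h n x =>
    rw [F.tot_tin]
    exact ((F.comp G).tot_tin n x).trans (G.tot_tin (X := F.tot.obj X) (Y := F.tot.obj Y) n _).symm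

/-! ### Semifree extensions by an object -/

section

variable {D P E : DGCat k}

/-- The closed morphism `e : I a' → Q` is such that every morphism `I X → Q` factors through
an extension of `e` to an object `I (a' * b)` with `b ∈ 𝓑`, which is monic relative to `I`. -/
structure IsSemifree (I : DGFunctor D P) (𝓑 : Set (Tot D)) {a' : Tot D} {Q : Tot P}
    (e : I.tot.obj a' ⟶ Q) : Prop where
  exists_fac (X : Tot D) (n : ℤ) (α : I.tot.obj X ⟶ Q) (hα : IsHom n α) :
    ∃ (b Y : Tot D) (h : b ⟶ a') (c : ConeData h Y) (u : I.tot.obj Y ⟶ Q) (w : X ⟶ Y),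
      b ∈ 𝓑 ∧ Closed 0 u ∧ I.tot.map c.i ≫ u = e ∧
      (∀ (X' : Tot D) (w' : X' ⟶ Y), I.tot.map w' ≫ u = 0 → w' = 0) ∧ IsHom n w ∧
      α = I.tot.map w ≫ u

variable {I : DGFunctor D P} {Ξ : DGFunctor P E} {𝓑 : Set (Tot D)} {a' : Tot D} {Q : Tot P}
  {e : I.tot.obj a' ⟶ Q} {e' : Ξ.tot.obj Q ⟶ Ξ.tot.obj (I.tot.obj a')}

/-- The two ways to apply a composite functor to a morphism agree only propositionally; this form
has the functors applied one after the other. -/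
theorem relVanish_comp_iff {Y : Tot D} : RelVanish (I.comp Ξ) 𝓑 Y ↔
    ∀ (X : Tot D) (n : ℤ) (z : X ⟶ Y)
      (γ : Ξ.tot.obj (I.tot.obj X) ⟶ Ξ.tot.obj (I.tot.obj Y)), Closed n z →
      IsHom (n - 1) γ → dif γ = Ξ.tot.map (I.tot.map z) →
      ∃ (X' : Tot D) (r : X' ⟶ X) (hr : Closed 0 r), fibProp 𝓑 (toHo r hr) ∧
        ∃ (α : X' ⟶ Y) (β : Ξ.tot.obj (I.tot.obj X') ⟶ Ξ.tot.obj (I.tot.obj Y)),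
        IsHom (n - 1) α ∧ IsHom (n - 2) β ∧ dif α = r ≫ z ∧
        Ξ.tot.map (I.tot.map r) ≫ γ = Ξ.tot.map (I.tot.map α) + dif β := by
  simp only [← I.comp_tot_map Ξ]
  rfl

theorem RelVanish.exists_cone_comp {Y : Tot D} (hY : RelVanish (I.comp Ξ) 𝓑 Y) {X : Tot D} {n : ℤ}
    {z : X ⟶ Y} {γ : Ξ.tot.obj (I.tot.obj X) ⟶ Ξ.tot.obj (I.tot.obj Y)} (hz : Closed n z)
    (hγ : IsHom (n - 1) γ) (h : dif γ = Ξ.tot.map (I.tot.map z)) :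
    ∃ (b T : Tot D) (η : X ⟶ b) (c : ConeData η T) (α : T ⟶ Y)
      (β : Ξ.tot.obj (I.tot.obj T) ⟶ Ξ.tot.obj (I.tot.obj Y)), b ∈ 𝓑 ∧ IsHom (n - 1) α ∧
        IsHom (n - 2) β ∧ dif α = c.s ≫ z ∧
        Ξ.tot.map (I.tot.map c.s) ≫ γ = Ξ.tot.map (I.tot.map α) + dif β := by
  rw [← I.comp_tot_map Ξ] at h
  obtain ⟨b, T, η, c, α, β, hb, hα, hβ, h₁, h₂⟩ := hY.exists_cone hz (γ := γ) hγ h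
  refine ⟨b, T, η, c, α, β, hb, hα, hβ, h₁, ?_⟩
  rw [← I.comp_tot_map Ξ, ← I.comp_tot_map Ξ]
  exact h₂

/-- A relative class of `(I X, Q)` lives on a finite stage `Y` of the semifree object. There it
becomes a relative class of the composite functor on `(X, Y)`, because `Ξ u` is a homotopy
equivalence: `Y` differs from `a'` by an object of `𝓑`, which becomes contractible. Vanishing for
the composite bounds it on an extension of `X` by some `b₁ ∈ 𝓑`, and acyclicity at `b₁` brings the
bound back to `X`. -/
theorem IsSemifree.relAcyclic (hI : IsSemifree I 𝓑 e) (he' : Closed 0 e')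
    (h₁ : Ξ.tot.map e ≫ e' = 𝟙 _) (h₂ : e' ≫ Ξ.tot.map e = 𝟙 _)
    (h𝓑 : ∀ b ∈ 𝓑, RelAcyclic Ξ (I.tot.obj b) Q)
    (hcon : ∀ b ∈ 𝓑, Contractible (Ξ.tot.obj (I.tot.obj b)))
    (hvan : ∀ Y, RelVanish (I.comp Ξ) 𝓑 Y) (X : Tot D) : RelAcyclic Ξ (I.tot.obj X) Q := by
  intro n z γ hz hγ hγz
  obtain ⟨b, Y, h, c, u, z', hb, hu, hcu, hmono, hz', rfl⟩ := hI.exists_fac X n z hz.isHom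
  have dz' : dif z' = 0 := hmono _ _ (by
    have := hz.dif_eq
    rwa [dif_comp, hu.dif_eq, Limits.comp_zero, zero_add, hu.isHom.sg_zero, I.dif_tot] at this)
  let C := (c.map I).map Ξ
  have hC : C.i ≫ Ξ.tot.map u = Ξ.tot.map e := by rw [← hcu, Ξ.tot.map_comp]; rfl
  have hΞu : dif (Ξ.tot.map u) = 0 := by rw [Ξ.dif_tot, hu.dif_eq, Ξ.tot.map_zero]
  obtain ⟨ε, hε, hε'⟩ := hcon b hb
  -- The image of `u` has the right homotopy inverse `e' ≫ C.i`. The defect `π` vanishes on the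
  -- summand `a'`, so the contraction `ε` of the other summand bounds it.
  let π := 𝟙 _ - Ξ.tot.map u ≫ e' ≫ C.i
  have hπ : Closed 0 π :=
    (Closed.id _).sub ((hu.tot Ξ).comp (he'.comp C.closed_i rfl) rfl)
  have hiπ : C.i ≫ π = 0 := by
    simp only [π, Preadditive.comp_sub, Category.comp_id]
    rw [← Category.assoc C.i, hC, ← Category.assoc, h₁, Category.id_comp, sub_self]
  have hπu : π ≫ Ξ.tot.map u = 0 := by
    simp only [π, Preadditive.sub_comp, Category.id_comp, Category.assoc]
    rw [hC, h₂, Category.comp_id, sub_self]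
  let κ := C.s ≫ ε ≫ C.j ≫ π
  have hκ : IsHom (-1) κ :=
    C.isHom_s.comp (hε.comp (C.isHom_j.comp hπ.isHom rfl) rfl) rfl
  have dκ : dif κ = π := by
    simp [κ, dif_comp, sg_comp, hε', hπ.dif_eq, hiπ, hπ.isHom.sg_zero]
  -- Transport of `γ` to `Y`: the term with `κ` corrects for `Ξ u ≫ e' ≫ C.i` being only homotopic
  -- to the identity.
  have hγ' : IsHom (n - 1) (γ ≫ e' ≫ C.i + Ξ.tot.map (I.tot.map z') ≫ κ) :=
    (hγ.comp (he'.isHom.comp C.isHom_i rfl) (add_zero _)).add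
      (((hz'.tot I).tot Ξ).comp hκ (by omega))
  obtain ⟨b₁, T, η, c₁, α, β, hb₁, hα, hβ, h₃, h₄⟩ := (hvan Y).exists_cone_comp ⟨hz', dz'⟩ hγ' (by
    rw [map_add, dif_comp γ, dif_comp _ κ, (he'.comp C.closed_i rfl).dif_eq, hγz, dκ, Ξ.dif_tot,
      I.dif_tot, dz', (he'.comp C.closed_i rfl).isHom.sg_zero]
    simp only [π, Preadditive.comp_sub, Ξ.tot.map_comp, I.tot.map_zero, Ξ.tot.map_zero]
    simp)
  have h₅ : γ = (γ ≫ e' ≫ C.i + Ξ.tot.map (I.tot.map z') ≫ κ) ≫ Ξ.tot.map u -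
      Ξ.tot.map (I.tot.map z') ≫ κ ≫ Ξ.tot.map u := by
    simp [hC, h₂]
  have dκu : dif (κ ≫ Ξ.tot.map u) = 0 := by
    rw [dif_comp, hΞu, dκ, (hu.isHom.tot Ξ).sg_zero, hπu]; simp
  have hκu : IsHom (-1) (κ ≫ Ξ.tot.map u) := hκ.comp (hu.isHom.tot Ξ) (add_zero _)
  -- Pushed forward along `u`, the bound is off by the closed morphism `κ ≫ Ξ u` applied to the
  -- image of `dif α`. This is a boundary up to sign, which accounts for the second term of `β`.
  refine (h𝓑 b₁ hb₁).exists_of_comp_s (c₁.map I) (α := I.tot.map α ≫ u)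
    (β := β ≫ Ξ.tot.map u + Ξ.tot.map (I.tot.map α) ≫ κ ≫ Ξ.tot.map u)
    ((hα.tot I).comp hu.isHom (add_zero _)) ((hβ.comp (hu.isHom.tot Ξ) (add_zero _)).add
      (((hα.tot I).tot Ξ).comp hκu (by omega))) ?_ ?_
  · rw [dif_comp, hu.dif_eq, hu.isHom.sg_zero, I.dif_tot, h₃, I.tot.map_comp, Limits.comp_zero,
      zero_add, Category.assoc]; rfl
  · have h₆ : Ξ.tot.map (I.tot.map c₁.s) ≫ Ξ.tot.map (I.tot.map z') =
        Ξ.tot.map (I.tot.map (dif α)) := by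
      rw [h₃, I.tot.map_comp, Ξ.tot.map_comp]
    have h₇ : Ξ.tot.map (I.tot.map c₁.s) ≫ γ = (Ξ.tot.map (I.tot.map α) + dif β) ≫ Ξ.tot.map u -
        Ξ.tot.map (I.tot.map (dif α)) ≫ κ ≫ Ξ.tot.map u := by
      rw [← h₄, ← h₆, Category.assoc, Category.assoc, ← Preadditive.comp_sub, ← h₅]
    refine h₇.trans ?_
    rw [map_add, dif_comp, dif_comp, dκu, hΞu, (hu.isHom.tot Ξ).sg_zero, hκu.sg_neg_one,
      Ξ.dif_tot, I.dif_tot, Ξ.tot.map_comp]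
    simp
    abel

/-- Pushed forward along `e` the class is bounded by acyclicity. The bound lives on a finite stage
`Y`, an extension of `b ∈ 𝓑` by `a'`. The only obstruction to bounding the class in `a'` is the
component in `b`, a closed morphism that is nullhomotopic on its fibre. -/
theorem IsSemifree.relVanish (h𝓑 : IsPretriangulated 𝓑) (hI : IsSemifree I 𝓑 e) (he : Closed 0 e)
    (he' : Closed 0 e') (h₁ : Ξ.tot.map e ≫ e' = 𝟙 _)
    (hac : ∀ X, RelAcyclic Ξ (I.tot.obj X) Q) : RelVanish (I.comp Ξ) 𝓑 a' := by
  rw [relVanish_comp_iff]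
  intro X n z γ hz hγ hγz
  obtain ⟨α, β₀, hα, hβ₀, h₂, h₃⟩ := hac X n (I.tot.map z ≫ e) (γ ≫ Ξ.tot.map e)
    ((hz.tot I).comp he (add_zero _)) (hγ.comp (he.isHom.tot Ξ) (add_zero _))
    (by rw [dif_comp, Ξ.dif_tot, he.dif_eq, (he.isHom.tot Ξ).sg_zero, hγz, Ξ.tot.map_comp]; simp)
  obtain ⟨b, Y, h, c, u, w, hb, hu, hcu, hmono, hw, rfl⟩ := hI.exists_fac X _ α hα
  have hh : Closed 1 h := c.closed
  -- Monicity of `u` lifts the bounding equation from `Q` to `Y`.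
  have hzi : z ≫ c.i = dif w := by
    rw [← sub_eq_zero]
    refine hmono _ _ ?_
    rw [I.tot.map_sub, Preadditive.sub_comp, I.tot.map_comp, Category.assoc, hcu, ← h₂, dif_comp,
      hu.dif_eq, hu.isHom.sg_zero, I.dif_tot]
    simp
  let C := (c.map I).map Ξ
  have hC : C.i ≫ Ξ.tot.map u = Ξ.tot.map e := by rw [← hcu, Ξ.tot.map_comp]; rfl
  have hΞu : dif (Ξ.tot.map u) = 0 := by rw [Ξ.dif_tot, hu.dif_eq, Ξ.tot.map_zero]
  -- The component `w ≫ c.s` has degree `n - 1`; the shift by `n - 2` makes it of degree 1, as an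
  -- extension requires.
  obtain ⟨b', σ, σ', hσ, hσ', h₄, h₅, hb'⟩ := h𝓑.exists_shift b (n - 2)
  have hη : Closed 1 (w ≫ c.s ≫ σ') :=
    ⟨hw.comp (c.isHom_s.comp hσ'.isHom (zero_add _)) (by omega), by
      simp [dif_comp, sg_comp, hσ'.dif_eq, ← hzi]⟩
  obtain ⟨T, ⟨c₁⟩, -⟩ := h𝓑.exists_cone _ hη
  obtain ⟨ε, hε, hεσ⟩ := hσ.exists_sg
  have hpσ : dif (c₁.p ≫ σ) = -(ε • (c₁.s ≫ w ≫ c.s)) := by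
    simp [dif_comp, hσ.dif_eq, hεσ, h₅]
  have hpσ' : c₁.s ≫ w ≫ c.s = -(ε • dif (c₁.p ≫ σ)) := by
    rw [hpσ, smul_neg, neg_neg, smul_smul, hε, one_smul]
  -- This is the component on `b` of the retraction `Ξ u ≫ e'` of the image of `Y` onto that of
  -- `a'`; the component on `a'` is the identity. It is closed only up to the attaching morphism
  -- `h`.
  let ω := C.j ≫ Ξ.tot.map u ≫ e'
  have dω : dif ω = Ξ.tot.map (I.tot.map h) := by
    simp only [ω]
    rw [dif_comp, C.dif_j, dif_comp, hΞu, he'.dif_eq, sg_comp, he'.isHom.sg_zero,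
      (hu.isHom.tot Ξ).sg_zero, Category.assoc, ← Category.assoc C.i, hC, h₁]
    simp
  have hω : IsHom 0 ω := C.isHom_j.comp ((hu.isHom.tot Ξ).comp he'.isHom rfl) rfl
  have hu' : Ξ.tot.map u ≫ e' = C.p + C.s ≫ ω := by
    refine C.hom_ext ?_ ?_
    · rw [← Category.assoc, hC, h₁]; simp
    · simp [ω]
  -- On the fibre, `c₁.p ≫ σ` is up to the sign `ε` a nullhomotopy of the component in `b`. Composed
  -- with `h` and with `ω`, it gives the corrections of the two parts of the bound.
  refine ⟨T, c₁.s, c₁.closed_s, fibProp_s c₁ hη (hb' hb), c₁.s ≫ w ≫ c.p + ε • (c₁.p ≫ σ ≫ h),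
    Ξ.tot.map (I.tot.map c₁.s) ≫ β₀ ≫ e' - ε • (Ξ.tot.map (I.tot.map (c₁.p ≫ σ)) ≫ ω),
    (c₁.isHom_s.comp (hw.comp c.isHom_p (add_zero _)) (zero_add _)).add
      ((c₁.isHom_p.comp (hσ.isHom.comp hh.isHom (by omega)) (zero_add _)).zsmul _),
    (((c₁.isHom_s.tot I).tot Ξ).comp (hβ₀.comp he'.isHom (add_zero _)) (zero_add _)).sub
      (((((c₁.isHom_p.comp hσ.isHom (zero_add _)).tot I).tot Ξ).comp hω (by omega)).zsmul _),
      ?_, ?_⟩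
  · have e1 : dif (c₁.p ≫ σ ≫ h) = ε • (c₁.s ≫ w ≫ c.s ≫ h) := by
      rw [← Category.assoc, dif_comp, hh.dif_eq, hh.isHom.sg_one, hpσ]
      simp
    have e2 : dif (c₁.s ≫ w ≫ c.p) = c₁.s ≫ z - c₁.s ≫ w ≫ c.s ≫ h := by
      simp [dif_comp, ← hzi]
      abel
    rw [map_add, map_zsmul, e1, e2, smul_smul, hε, one_smul]
    abel
  · have e1 : γ = (Ξ.tot.map (I.tot.map w ≫ u) + dif β₀) ≫ e' := by
      rw [← h₃, Category.assoc, h₁, Category.comp_id]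
    have e2 : dif (Ξ.tot.map (I.tot.map (c₁.p ≫ σ)) ≫ ω) =
        Ξ.tot.map (I.tot.map (c₁.p ≫ σ)) ≫ Ξ.tot.map (I.tot.map h) -
          ε • (Ξ.tot.map (I.tot.map (c₁.s ≫ w ≫ c.s)) ≫ ω) := by
      rw [dif_comp, dω, hω.sg_zero, Ξ.dif_tot, I.dif_tot, hpσ]
      simp only [I.tot.map_neg, I.tot.map_zsmul, Ξ.tot.map_neg, Ξ.tot.map_zsmul,
        Preadditive.neg_comp, Preadditive.zsmul_comp]
      abel
    have e3 : dif (Ξ.tot.map (I.tot.map c₁.s) ≫ β₀ ≫ e') =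
        Ξ.tot.map (I.tot.map c₁.s) ≫ dif β₀ ≫ e' := by
      rw [dif_comp, dif_comp, Ξ.dif_tot, I.dif_tot, c₁.dif_s, he'.dif_eq, he'.isHom.sg_zero]
      simp
    rw [map_sub, map_zsmul, e2, e3, e1, Preadditive.add_comp, Ξ.tot.map_comp, Category.assoc, hu',
      smul_sub, smul_smul, hε, one_smul]
    have e4 : C.p = Ξ.tot.map (I.tot.map c.p) := rfl
    have e5 : C.s = Ξ.tot.map (I.tot.map c.s) := rfl
    rw [e4, e5]
    simp only [I.tot.map_add, Ξ.tot.map_add, I.tot.map_comp, Ξ.tot.map_comp, I.tot.map_zsmul,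
      Ξ.tot.map_zsmul, Preadditive.comp_add, Category.assoc]
    abel

end

/-! ### Twisted complexes with one term -/

namespace Tot

variable {A C : DGCat k} {X Y Z : Tot A.pretr}

/-- The twisted complex has a single term, which is not shifted. -/
structure IsSingle (X : Tot A.pretr) : Prop where
  size : X.tw.n = 1
  deg_eq (i : Fin X.tw.n) : X.deg i = 0

namespace IsSingle

theorem subsingleton (hX : IsSingle X) : Subsingleton (Fin X.tw.n) := by
  rw [hX.size]; infer_instance

variable (hX : IsSingle X) (hY : IsSingle Y) (hZ : IsSingle Z)

/-- The index of the term. -/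
def idx : Fin X.tw.n := ⟨0, by rw [hX.size]; exact Nat.zero_lt_one⟩

/-- The term. -/
abbrev the : Tot A := X.term hX.idx

/-- The morphism of terms given by a morphism of twisted complexes with one term. -/
def hom : (X ⟶ Y) →ₗ[k] (hX.the ⟶ hY.the) := ent hY.idx hX.idx

theorem hom_comp (f : X ⟶ Y) (g : Y ⟶ Z) : hX.hom hZ (f ≫ g) = hX.hom hY f ≫ hY.hom hZ g := by
  have := hY.subsingleton
  exact (ent_comp f g _ _).trans (Fintype.sum_subsingleton _ hY.idx)

theorem hom_id : hX.hom hX (𝟙 X) = 𝟙 hX.the := ent_id_self _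

theorem hom_dif (f : X ⟶ Y) : hX.hom hY (dif f) = dif (hX.hom hY f) := by
  have := hX.subsingleton
  have := hY.subsingleton
  refine (ent_dif f _ _).trans ?_
  rw [hY.deg_eq, Finset.sum_eq_zero, Finset.sum_eq_zero, Int.negOnePow_zero]
  · simp; rfl
  · intro l _
    rw [X.qent_eq_zero _ _ (Subsingleton.elim _ _).le, Limits.zero_comp]
  · intro l _
    rw [Y.qent_eq_zero _ _ (Subsingleton.elim _ _).le, Limits.comp_zero]

theorem hom_injective : Function.Injective (hX.hom hY) := fun f g h => by
  have := hX.subsingleton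
  have := hY.subsingleton
  refine ent_ext fun i j => ?_
  rw [Subsingleton.elim i hY.idx, Subsingleton.elim j hX.idx]
  exact h

theorem isHom_hom {n : ℤ} {f : X ⟶ Y} : IsHom n (hX.hom hY f) ↔ IsHom n f := by
  have := hX.subsingleton
  have := hY.subsingleton
  constructor
  · refine fun h => isHom_of_ent fun i j => ?_
    rw [Subsingleton.elim i hY.idx, Subsingleton.elim j hX.idx]
    exact h.cast (by rw [hX.deg_eq, hY.deg_eq]; omega)
  · exact fun h => (h.ent hY.idx hX.idx).cast (by rw [hX.deg_eq, hY.deg_eq]; omega)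

theorem closed_hom {n : ℤ} {f : X ⟶ Y} : Closed n (hX.hom hY f) ↔ Closed n f :=
  ⟨fun h => ⟨(hX.isHom_hom hY).1 h.isHom, hX.hom_injective hY (by
    rw [hom_dif, h.dif_eq, map_zero])⟩,
    fun h => ⟨(hX.isHom_hom hY).2 h.isHom, by rw [← hom_dif, h.dif_eq, map_zero]⟩⟩

theorem hom_surjective : Function.Surjective (hX.hom hY) := fun g => by
  have := hX.subsingleton
  have := hY.subsingleton
  induction g using hom_induction with
  | hadd g g' h h' =>
    obtain ⟨f, rfl⟩ := h
    obtain ⟨f', rfl⟩ := h'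
    exact ⟨f + f', map_add _ _ _⟩
  | h n g =>
    have hi : ∀ i, i = hY.idx := fun i => Subsingleton.elim _ _
    have hj : ∀ j, j = hX.idx := fun j => Subsingleton.elim _ _
    obtain ⟨f, -, hf⟩ := exists_ent (X := X) (Y := Y) n
      (fun i j => eqToHom (by rw [hj j]) ≫ (tin n g : hX.the ⟶ hY.the) ≫ eqToHom (by rw [hi i]))
      (fun i j => ((IsHom.eqToHom _).comp ((isHom_tin n g).comp (.eqToHom _) (add_zero n))
        (zero_add n)).cast (by rw [hX.deg_eq, hY.deg_eq]; omega))
    exact ⟨f, (hf _ _).trans (by simp)⟩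

theorem pretr {X : Tot A.pretr} (hX : IsSingle X) (F : DGFunctor A C) : IsSingle (F.pretr.tot.obj X) := ⟨hX.size, hX.deg_eq⟩

theorem hom_tot (F : DGFunctor A C) (f : X ⟶ Y) :
    (hX.pretr F).hom (hY.pretr F) (F.pretr.tot.map f) = F.tot.map (hX.hom hY f) :=
  ent_tot F f _ _

theorem relAcyclic_iff (F : DGFunctor A C) :
    RelAcyclic F hX.the hY.the ↔ RelAcyclic F.pretr X Y := by
  have hFX := hX.pretr F
  have hFY := hY.pretr F
  constructor
  · intro H n z γ hz hγ hγz
    obtain ⟨α, β, hα, hβ, h₁, h₂⟩ := H n (hX.hom hY z) (hFX.hom hFY γ)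
      ((hX.closed_hom hY).2 hz) ((hFX.isHom_hom hFY).2 hγ)
      (((hFX.hom_dif hFY γ).symm.trans (congrArg _ hγz)).trans (hX.hom_tot hY F z))
    obtain ⟨α, rfl⟩ := hX.hom_surjective hY α
    obtain ⟨β, rfl⟩ := hFX.hom_surjective hFY β
    refine ⟨α, β, (hX.isHom_hom hY).1 hα, (hFX.isHom_hom hFY).1 hβ, hX.hom_injective hY ?_,
      hFX.hom_injective hFY ?_⟩
    · rw [hom_dif, h₁]
    · rw [map_add, hom_dif, hX.hom_tot hY F]
      exact h₂
  · intro H n z γ hz hγ hγz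
    obtain ⟨z, rfl⟩ := hX.hom_surjective hY z
    obtain ⟨γ, rfl⟩ := hFX.hom_surjective hFY γ
    obtain ⟨α, β, hα, hβ, h₁, h₂⟩ := H n z γ ((hX.closed_hom hY).1 hz)
      ((hFX.isHom_hom hFY).1 hγ) (hFX.hom_injective hFY
        ((hFX.hom_dif hFY γ).trans (hγz.trans (hX.hom_tot hY F z).symm)))
    refine ⟨hX.hom hY α, hFX.hom hFY β, (hX.isHom_hom hY).2 hα, (hFX.isHom_hom hFY).2 hβ, ?_, ?_⟩
    · rw [← hom_dif, h₁]
    · rw [h₂, map_add, hom_dif, hX.hom_tot hY F]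
      rfl

end IsSingle

/-- An object, as a twisted complex. -/
def single (a : Tot A) : Tot A.pretr where
  obj :=
    { n := 1
      obj := fun _ => a.obj
      deg := fun _ => 0
      q := fun _ _ => 0
      q_eq_zero := fun _ _ _ => rfl
      d_q_add := fun _ _ => by simp }

theorem isSingle_single (a : Tot A) : IsSingle (single a) := ⟨rfl, fun _ => rfl⟩

theorem exists_iso_single (X : Tot A.pretr) (hX : X.tw.n = 1) :
    ∃ (i : Fin X.tw.n) (m : ℤ) (σ : X ⟶ single (X.term i)) (σ' : single (X.term i) ⟶ X),
      Closed m σ ∧ Closed (-m) σ' ∧ σ ≫ σ' = 𝟙 X ∧ σ' ≫ σ = 𝟙 _ := by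
  have hs : Subsingleton (Fin X.tw.n) := by rw [hX]; infer_instance
  let i : Fin X.tw.n := ⟨0, by rw [hX]; exact Nat.zero_lt_one⟩
  have hi : ∀ j, j = i := fun j => Subsingleton.elim _ _
  have hS := isSingle_single (X.term i)
  have hS' := hS.subsingleton
  obtain ⟨σ, σ', hσ, hσ', h₁, h₂, -⟩ := exists_shift_of_eq (X := single (X.term i)) (X' := X)
    (X.deg i) (finCongr hX) (fun j => by rw [hi j]; rfl)
    (fun j => by rw [hi j, hS.deg_eq, zero_add])
    (fun j l => by
      rw [qent_eq_zero _ _ _ (Subsingleton.elim _ _).le,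
        qent_eq_zero _ _ _ (Subsingleton.elim _ _).le]
      simp)
  exact ⟨i, X.deg i, σ, σ', hσ, hσ', h₁, h₂⟩

end Tot

theorem RelAcyclic.of_size_one {A C : DGCat k} {F : DGFunctor A C} {X Y : Tot A.pretr}
    (hX : X.tw.n = 1) (hY : IsSingle Y) (h : ∀ i, RelAcyclic F (X.term i) hY.the) :
    RelAcyclic F.pretr X Y := by
  obtain ⟨i, m, σ, σ', hσ, hσ', h₁, -⟩ := exists_iso_single X hX
  exact (((isSingle_single (X.term i)).relAcyclic_iff hY F).1 (h i)).of_iso hσ hσ' h₁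

/-! ### Free generators -/

namespace Tot

variable {D P : DGCat k}

/-- The homogeneous part of degree `n` of a morphism. -/
def hpart (n : ℤ) {X Y : Tot D} (f : X ⟶ Y) : X ⟶ Y := tin n (tcpt n f)

theorem hpart_add (n : ℤ) {X Y : Tot D} (f g : X ⟶ Y) :
    hpart n (f + g) = hpart n f + hpart n g := by
  rw [hpart, map_add, map_add]; rfl

theorem IsHom.hpart_eq {n : ℤ} {X Y : Tot D} {f : X ⟶ Y} (hf : IsHom n f) : hpart n f = f := hf

theorem IsHom.hpart_of_ne {m n : ℤ} (h : m ≠ n) {X Y : Tot D} {f : X ⟶ Y} (hf : IsHom n f) :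
    hpart m f = 0 := by
  rw [← hf, hpart, tcpt_tin_of_ne h, map_zero]

theorem hpart_comp (m n l : ℤ) (h : m + n = l) {X Y Z : Tot D} (f : X ⟶ Y) {g : Y ⟶ Z}
    (hg : IsHom n g) : hpart l (f ≫ g) = hpart m f ≫ g := by
  induction f using hom_induction with
  | hadd f f' h h' => rw [Preadditive.add_comp, hpart_add, h, h', hpart_add, Preadditive.add_comp]
  | h p f =>
    by_cases hp : m = p
    · subst hp
      rw [((isHom_tin m f).comp hg h).hpart_eq, (isHom_tin m f).hpart_eq]
    · rw [((isHom_tin p f).comp hg rfl).hpart_of_ne (by omega), (isHom_tin p f).hpart_of_ne hp,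
        Limits.zero_comp]

theorem hpart_tot (I : DGFunctor D P) (n : ℤ) {X Y : Tot D} (f : X ⟶ Y) :
    hpart n (I.tot.map f) = I.tot.map (hpart n f) := by
  induction f using hom_induction with
  | hadd f f' h h' => rw [I.tot.map_add, hpart_add, h, h', hpart_add, I.tot.map_add]
  | h p f =>
    by_cases hp : n = p
    · subst hp
      rw [((isHom_tin n f).tot I).hpart_eq, (isHom_tin n f).hpart_eq]
    · rw [((isHom_tin p f).tot I).hpart_of_ne hp, (isHom_tin p f).hpart_of_ne hp, I.tot.map_zero]

end Tot

section

variable {D P : DGCat k}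

/-- The family `u` is a basis of the morphisms `I X → Q` over the morphisms of `D`. -/
structure IsFreeOn (I : DGFunctor D P) {Q : Tot P} {G : Type u} (o : G → Tot D)
    (u : ∀ g, I.tot.obj (o g) ⟶ Q) (X : Tot D) : Prop where
  exists_sum (w : I.tot.obj X ⟶ Q) : ∃ (S : Finset G) (c : ∀ g, X ⟶ o g),
    w = ∑ g ∈ S, I.tot.map (c g) ≫ u g
  eq_zero (S : Finset G) (c : ∀ g, X ⟶ o g) (h : ∑ g ∈ S, I.tot.map (c g) ≫ u g = 0) :
    ∀ g ∈ S, c g = 0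

variable {I : DGFunctor D P} {Q : Tot P} {G : Type u} {o : G → Tot D}
  {u : ∀ g, I.tot.obj (o g) ⟶ Q} {X b T : Tot D}

theorem IsFreeOn.of_id_eq_zero (h : 𝟙 X = 0) : IsFreeOn I o u X where
  exists_sum w := ⟨∅, fun _ => 0, by
    have h' : 𝟙 (I.tot.obj X) = 0 := by rw [← I.tot.map_id, h, I.tot.map_zero]
    rw [← Category.id_comp w, h', Limits.zero_comp, Finset.sum_empty]⟩
  eq_zero S c _ g _ := by rw [← Category.id_comp (c g), h, Limits.zero_comp]

theorem IsFreeOn.of_iso {X' : Tot D} {σ : X' ⟶ X} {σ' : X ⟶ X'} (h : σ ≫ σ' = 𝟙 X')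
    (hX : IsFreeOn I o u X) : IsFreeOn I o u X' where
  exists_sum w := by
    obtain ⟨S, c, hc⟩ := hX.exists_sum (I.tot.map σ' ≫ w)
    refine ⟨S, fun g => σ ≫ c g, ?_⟩
    simp only [I.tot.map_comp, Category.assoc, ← Preadditive.comp_sum, ← hc]
    rw [comp_comp_of_id (by rw [← I.tot.map_comp, h, I.tot.map_id])]
  eq_zero S c hc g hg := by
    have := hX.eq_zero S (fun g => σ' ≫ c g) (by
      simp only [I.tot.map_comp, Category.assoc, ← Preadditive.comp_sum, hc, Limits.comp_zero]) g hg
    rw [← comp_comp_of_id h (c g), this, Limits.comp_zero]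

theorem exists_subset_sum {S S' : Finset G} (hS : S ⊆ S') (c : ∀ g, X ⟶ o g) :
    ∃ c' : ∀ g, X ⟶ o g, ∀ {Z : Tot P} (v : ∀ g, I.tot.obj (o g) ⟶ Z),
      ∑ g ∈ S, I.tot.map (c g) ≫ v g = ∑ g ∈ S', I.tot.map (c' g) ≫ v g := by
  classical
  refine ⟨fun g => if g ∈ S then c g else 0, fun v => ?_⟩
  rw [← Finset.sum_subset hS]
  · refine Finset.sum_congr rfl fun g hg => ?_
    simp only [hg, if_true]
  · intro g _ hg
    simp only [hg, if_false, I.tot.map_zero, Limits.zero_comp]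

theorem IsFreeOn.cone {h : b ⟶ X} (c : ConeData h T) (hX : IsFreeOn I o u X)
    (hb : IsFreeOn I o u b) : IsFreeOn I o u T where
  exists_sum w := by
    classical
    obtain ⟨S₁, c₁, h₁⟩ := hX.exists_sum (I.tot.map c.i ≫ w)
    obtain ⟨S₂, c₂, h₂⟩ := hb.exists_sum (I.tot.map c.j ≫ w)
    obtain ⟨c₁', h₁'⟩ := exists_subset_sum (I := I) (S := S₁) (S' := S₁ ∪ S₂)
      Finset.subset_union_left c₁
    obtain ⟨c₂', h₂'⟩ := exists_subset_sum (I := I) (S := S₂) (S' := S₁ ∪ S₂)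
      Finset.subset_union_right c₂
    refine ⟨S₁ ∪ S₂, fun g => c.p ≫ c₁' g + c.s ≫ c₂' g, ?_⟩
    simp only [I.tot.map_add, I.tot.map_comp, Preadditive.add_comp, Category.assoc,
      Finset.sum_add_distrib, ← Preadditive.comp_sum, ← h₁', ← h₂', ← h₁, ← h₂]
    have := (c.map I).p_i_add
    change I.tot.map c.p ≫ I.tot.map c.i + I.tot.map c.s ≫ I.tot.map c.j = 𝟙 _ at this
    rw [← Category.assoc, ← Category.assoc, ← Preadditive.add_comp, this, Category.id_comp]
  eq_zero S e he g hg := by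
    refine c.hom_ext ?_ ?_
    · rw [Limits.comp_zero]
      refine hX.eq_zero S (fun g => c.i ≫ e g) ?_ g hg
      simp only [I.tot.map_comp, Category.assoc, ← Preadditive.comp_sum, he, Limits.comp_zero]
    · rw [Limits.comp_zero]
      refine hb.eq_zero S (fun g => c.j ≫ e g) ?_ g hg
      simp only [I.tot.map_comp, Category.assoc, ← Preadditive.comp_sum, he, Limits.comp_zero]

/-! ### Finite stages of a semifree object, obtained by attaching cells. -/

/-- An iterated cone `(Z * b₂) * b₁` is the cone `Z * (b₂ * b₁)`. -/
def Tot.ConeData.assoc' {Z b₁ b₂ b₃ T₁ T₂ : Tot D} {h₂ : b₂ ⟶ Z} {h₁ : b₁ ⟶ T₂}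
    (c₂ : ConeData h₂ T₂) (c₁ : ConeData h₁ T₁) (c₃ : ConeData (h₁ ≫ c₂.s) b₃) :
    ConeData (c₃.p ≫ h₂ + c₃.s ≫ h₁ ≫ c₂.p) T₁ where
  i := c₂.i ≫ c₁.i
  j := c₃.p ≫ c₂.j ≫ c₁.i + c₃.s ≫ c₁.j
  p := c₁.p ≫ c₂.p
  s := c₁.p ≫ c₂.s ≫ c₃.i + c₁.s ≫ c₃.j
  isHom_i := c₂.isHom_i.comp c₁.isHom_i rfl
  isHom_j := (c₃.isHom_p.comp (c₂.isHom_j.comp c₁.isHom_i rfl) rfl).add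
    (c₃.isHom_s.comp c₁.isHom_j rfl)
  isHom_p := c₁.isHom_p.comp c₂.isHom_p rfl
  isHom_s := (c₁.isHom_p.comp (c₂.isHom_s.comp c₃.isHom_i rfl) rfl).add
    (c₁.isHom_s.comp c₃.isHom_j rfl)
  i_p := by simp
  j_s := by simp
  j_p := by simp
  i_s := by simp
  p_i_add := by simp
  dif_i := by simp [dif_comp]
  dif_j := by
    simp [dif_comp, sg_comp]
    abel

/-- The objects `Y` obtained from `o g₀` by attaching cells from `𝓑` to which the generators in
`S` are lifted. -/
structure IsAttached (𝓑 : Set (Tot D)) (u : ∀ g, I.tot.obj (o g) ⟶ Q) (g₀ : G) (S : Finset G)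
    {Y : Tot D} (U : I.tot.obj Y ⟶ Q) (v : ∀ g, o g ⟶ Y) : Prop where
  mem : g₀ ∈ S
  closed : Closed 0 U
  exists_cone : ∃ (b : Tot D) (h : b ⟶ o g₀) (c : ConeData h Y), b ∈ 𝓑 ∧ v g₀ = c.i
  lift_comp (g : G) (hg : g ∈ S) : I.tot.map (v g) ≫ U = u g
  exists_sum {X : Tot D} (w : X ⟶ Y) : ∃ c : ∀ g, X ⟶ o g, w = ∑ g ∈ S, c g ≫ v g

variable {𝓑 : Set (Tot D)} {g₀ : G} {S : Finset G} {Y : Tot D} {U : I.tot.obj Y ⟶ Q}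
  {v : ∀ g, o g ⟶ Y}

namespace IsAttached

/-- The lifts `v g` generate the morphisms to `Y`, and `U` sends them to basis elements, so
coefficients can be compared in `Q`. -/
theorem eq_zero (hu : ∀ X, IsFreeOn I o u X) (hY : IsAttached 𝓑 u g₀ S U v) (w : X ⟶ Y)
    (hw : I.tot.map w ≫ U = 0) : w = 0 := by
  obtain ⟨c, rfl⟩ := hY.exists_sum w
  refine Finset.sum_eq_zero fun g hg => ?_
  rw [(hu X).eq_zero S c ?_ g hg, Limits.zero_comp]
  rw [← hw, I.tot.map_sum, Preadditive.sum_comp]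
  refine Finset.sum_congr rfl fun g hg => ?_
  rw [I.tot.map_comp, Category.assoc, hY.lift_comp g hg]

/-- Composition with `U` commutes with taking homogeneous parts, so `hpart n w - w` is killed by `U`
and vanishes by `eq_zero`. -/
theorem isHom (hu : ∀ X, IsFreeOn I o u X) (hY : IsAttached 𝓑 u g₀ S U v) {n : ℤ} {w : X ⟶ Y}
    (hw : IsHom n (I.tot.map w ≫ U)) : IsHom n w := by
  refine sub_eq_zero.1 (hY.eq_zero hu (hpart n w - w) ?_)
  rw [I.tot.map_sub, Preadditive.sub_comp, ← hpart_tot,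
    ← hpart_comp n 0 n (add_zero n) _ hY.closed.isHom, hw.hpart_eq, sub_self]

theorem exists_eq_comp (hY : IsAttached 𝓑 u g₀ S U v) {S' : Finset G} (hS : S' ⊆ S)
    (c : ∀ g, X ⟶ o g) : ∃ w : X ⟶ Y, ∑ g ∈ S', I.tot.map (c g) ≫ u g = I.tot.map w ≫ U := by
  refine ⟨∑ g ∈ S', c g ≫ v g, ?_⟩
  rw [I.tot.map_sum, Preadditive.sum_comp]
  refine Finset.sum_congr rfl fun g hg => ?_
  rw [I.tot.map_comp, Category.assoc, hY.lift_comp g (hS hg)]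

theorem base (h𝓑 : IsPretriangulated 𝓑) (hu₀ : Closed 0 (u g₀)) :
    ∃ (Y : Tot D) (U : I.tot.obj Y ⟶ Q) (v : ∀ g, o g ⟶ Y), IsAttached 𝓑 u g₀ {g₀} U v := by
  classical
  obtain ⟨Z, hZ, hZ'⟩ := h𝓑.exists_zero
  obtain ⟨Y, ⟨c⟩, -⟩ := h𝓑.exists_cone (0 : Z ⟶ o g₀) (.zero 1)
  have hp : Closed 0 c.p := ⟨c.isHom_p, by simp⟩
  -- The first stage is `o g₀` itself, written as an extension by a zero object to fit the shape of
  -- `IsAttached`. The values of `v` outside the chosen finite set are irrelevant and set to 0.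
  refine ⟨Y, I.tot.map c.p ≫ u g₀, fun g => if h : g = g₀ then eqToHom (by rw [h]) ≫ c.i else 0,
    Finset.mem_singleton_self _, (hp.tot I).comp hu₀ rfl, ⟨Z, 0, c, hZ, by simp⟩, ?_, ?_⟩
  · intro g hg
    obtain rfl := Finset.mem_singleton.1 hg
    have : I.tot.map c.i ≫ I.tot.map c.p = 𝟙 _ := (c.map I).i_p
    simp [comp_comp_of_id this]
  · intro X w
    refine ⟨fun g => if h : g = g₀ then w ≫ c.p ≫ eqToHom (by rw [h]) else 0, ?_⟩
    have hs : c.s = 0 := by rw [← Category.comp_id c.s, hZ', Limits.comp_zero]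
    have := c.p_i_add
    rw [hs, Limits.zero_comp, add_zero] at this
    simp [this]

/-- The boundary of `u g` already factors through the stage `Y`, by a morphism `w` which is closed
of degree `n + 1` since `U` is monic relative to `I`. Shifting `o g` by `-n` makes it an attaching
morphism of degree 1. -/
theorem attach [DecidableEq G] (h𝓑 : IsPretriangulated 𝓑) (hu : ∀ X, IsFreeOn I o u X)
    (hY : IsAttached 𝓑 u g₀ S U v) {g : G} (hg : g ∉ S) (hg' : o g ∈ 𝓑) {n : ℤ}
    (hn : IsHom n (u g)) {w : o g ⟶ Y} (hw : dif (u g) = I.tot.map w ≫ U) :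
    ∃ (Y : Tot D) (U : I.tot.obj Y ⟶ Q) (v : ∀ g, o g ⟶ Y),
      IsAttached 𝓑 u g₀ (insert g S) U v := by
  have hwc : Closed (n + 1) w := by
    refine ⟨hY.isHom hu (hw ▸ hn.dif rfl), hY.eq_zero hu _ ?_⟩
    have := congrArg dif hw
    rw [dif_dif, dif_comp, hY.closed.dif_eq, hY.closed.isHom.sg_zero, I.dif_tot] at this
    simpa using this.symm
  obtain ⟨x, σ, σ', hσ, hσ', h₁, h₂, hx⟩ := h𝓑.exists_shift (o g) (-n)
  have hσw : Closed 1 (σ ≫ w) := hσ.comp hwc (by omega)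
  obtain ⟨T, ⟨c⟩, -⟩ := h𝓑.exists_cone (σ ≫ w) hσw
  obtain ⟨b, h, d, hb, hd⟩ := hY.exists_cone
  -- The new cell and the earlier ones are gathered into one object of `𝓑`, so that the new stage is
  -- again a single extension over `o g₀`.
  obtain ⟨b', ⟨c'⟩, hb'⟩ := h𝓑.exists_cone ((σ ≫ w) ≫ d.s) (hσw.comp d.closed_s rfl)
  have hC : I.tot.map c.i ≫ I.tot.map c.p = 𝟙 _ := (c.map I).i_p
  have hC' : I.tot.map c.i ≫ I.tot.map c.s = 0 := (c.map I).i_s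
  have hC'' : I.tot.map c.j ≫ I.tot.map c.p = 0 := (c.map I).j_p
  have hD : I.tot.map c.j ≫ I.tot.map c.s = 𝟙 _ := (c.map I).j_s
  have hσI : I.tot.map σ' ≫ I.tot.map σ = 𝟙 _ := by rw [← I.tot.map_comp, h₂, I.tot.map_id]
  refine ⟨T, I.tot.map c.p ≫ U + I.tot.map (c.s ≫ σ) ≫ u g,
    fun f => if e : f = g then eqToHom (by rw [e]) ≫ σ' ≫ c.j else v f ≫ c.i,
    Finset.mem_insert_of_mem hY.mem, ⟨?_, ?_⟩, ⟨b', _, d.assoc' c c', hb' hb (hx hg'), ?_⟩,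
    ?_, ?_⟩
  · exact ((c.isHom_p.tot I).comp hY.closed.isHom rfl).add
      (((c.isHom_s.comp hσ.isHom rfl).tot I).comp hn (by omega))
  · have e1 : dif (c.s ≫ σ) = 0 := by simp [dif_comp, hσ.dif_eq]
    rw [map_add, dif_comp, dif_comp, I.dif_tot, I.dif_tot, hw, hY.closed.dif_eq, e1,
      hY.closed.isHom.sg_zero, c.dif_p]
    simp
  · have : g₀ ≠ g := fun e => hg (e ▸ hY.mem)
    simp only [this, dif_neg, not_false_eq_true]
    rw [hd]; rfl
  · intro f hf
    by_cases e : f = g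
    · subst e
      simp only [dif_pos, eqToHom_refl, Category.id_comp, I.tot.map_comp, Preadditive.comp_add,
        Category.assoc]
      rw [← Category.assoc (I.tot.map c.j), hC'', comp_comp_of_id hD, comp_comp_of_id hσI]
      simp
    · have hf' : f ∈ S := (Finset.mem_insert.1 hf).resolve_left e
      simp only [e, dif_neg, not_false_eq_true, I.tot.map_comp, Preadditive.comp_add,
        Category.assoc]
      rw [comp_comp_of_id hC, hY.lift_comp f hf', ← Category.assoc (I.tot.map c.i), hC']
      simp
  · intro X w'
    obtain ⟨a, ha⟩ := hY.exists_sum (w' ≫ c.p)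
    refine ⟨fun f => if e : f = g then w' ≫ c.s ≫ σ ≫ eqToHom (by rw [e]) else a f, ?_⟩
    rw [Finset.sum_insert hg]
    have e1 : ∑ f ∈ S, (if e : f = g then w' ≫ c.s ≫ σ ≫ eqToHom (by rw [e]) else a f) ≫
        (if e : f = g then eqToHom (by rw [e]) ≫ σ' ≫ c.j else v f ≫ c.i) =
        (w' ≫ c.p) ≫ c.i := by
      rw [ha, Preadditive.sum_comp]
      refine Finset.sum_congr rfl fun f hf => ?_
      have e : f ≠ g := fun e => hg (e ▸ hf)
      simp only [e, dif_neg, not_false_eq_true, Category.assoc]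
    rw [e1]
    simp [comp_comp_of_id h₁]

end IsAttached

/-- A morphism to `Q` involves finitely many generators, whose boundaries involve finitely many
generators of lower rank, and so on. Hence all of them lie in one finite stage. -/
theorem isSemifree_of_isFreeOn (h𝓑 : IsPretriangulated 𝓑) (hu : ∀ X, IsFreeOn I o u X)
    (hu₀ : Closed 0 (u g₀)) (ho : ∀ g ≠ g₀, o g ∈ 𝓑) (rk : G → ℕ) {dg : G → ℤ}
    (hdg : ∀ g, IsHom (dg g) (u g))
    (hd : ∀ g, ∃ (S : Finset G) (c : ∀ f, o g ⟶ o f), (∀ f ∈ S, rk f < rk g) ∧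
      dif (u g) = ∑ f ∈ S, I.tot.map (c f) ≫ u f) : IsSemifree I 𝓑 (u g₀) := by
  classical
  -- Induction on a bound for the rank: `g` can be attached once the generators in its boundary,
  -- which have smaller rank, are attached to the given stage.
  have step : ∀ (n : ℕ) (g : G), rk g < n → ∀ (S : Finset G) (Y : Tot D) (U : I.tot.obj Y ⟶ Q)
      (v : ∀ g, o g ⟶ Y), IsAttached 𝓑 u g₀ S U v → ∃ (S' : Finset G) (Y : Tot D)
      (U : I.tot.obj Y ⟶ Q) (v : ∀ g, o g ⟶ Y), insert g S ⊆ S' ∧ IsAttached 𝓑 u g₀ S' U v := by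
    intro n
    induction n with
    | zero => intro g hg; omega
    | succ n ih =>
      intro g hg S Y U v hY
      obtain ⟨R, c, hR, hc⟩ := hd g
      have key : ∀ R : Finset G, (∀ f ∈ R, rk f < n) → ∃ (S' : Finset G) (Y : Tot D)
          (U : I.tot.obj Y ⟶ Q) (v : ∀ g, o g ⟶ Y), R ∪ S ⊆ S' ∧ IsAttached 𝓑 u g₀ S' U v := by
        intro R
        induction R using Finset.induction_on with
        | empty => exact fun _ => ⟨S, Y, U, v, by simp, hY⟩
        | insert f R _ ihR =>
          intro hR
          obtain ⟨S', Y', U', v', hS', hY'⟩ := ihR fun f hf => hR f (Finset.mem_insert_of_mem hf)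
          obtain ⟨S'', Y'', U'', v'', hS'', hY''⟩ :=
            ih f (hR f (Finset.mem_insert_self _ _)) S' Y' U' v' hY'
          refine ⟨S'', Y'', U'', v'', ?_, hY''⟩
          rw [Finset.insert_union]
          exact (Finset.insert_subset_insert _ hS').trans hS''
      obtain ⟨S', Y', U', v', hS', hY'⟩ := key R fun f hf => by have := hR f hf; omega
      by_cases hg' : g ∈ S'
      · exact ⟨S', Y', U', v', Finset.insert_subset hg' (Finset.union_subset_right hS'), hY'⟩
      · obtain ⟨w, hw⟩ := hY'.exists_eq_comp (Finset.union_subset_left hS') c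
        obtain ⟨Y'', U'', v'', hY''⟩ := hY'.attach h𝓑 hu hg' (ho g fun e => hg' (e ▸ hY'.mem))
          (hdg g) (hc.trans hw)
        exact ⟨_, Y'', U'', v'', Finset.insert_subset_insert _ (Finset.union_subset_right hS'),
          hY''⟩
  have hall : ∀ R : Finset G, ∃ (S : Finset G) (Y : Tot D) (U : I.tot.obj Y ⟶ Q)
      (v : ∀ g, o g ⟶ Y), R ⊆ S ∧ IsAttached 𝓑 u g₀ S U v := by
    intro R
    induction R using Finset.induction_on with
    | empty =>
      obtain ⟨Y, U, v, hY⟩ := IsAttached.base h𝓑 hu₀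
      exact ⟨_, Y, U, v, by simp, hY⟩
    | insert g R _ ih =>
      obtain ⟨S, Y, U, v, hS, hY⟩ := ih
      obtain ⟨S', Y', U', v', hS', hY'⟩ := step (rk g + 1) g (Nat.lt_succ_self _) S Y U v hY
      exact ⟨S', Y', U', v', (Finset.insert_subset_insert _ hS).trans hS', hY'⟩
  refine ⟨fun X n α hα => ?_⟩
  obtain ⟨R, c, rfl⟩ := (hu X).exists_sum α
  obtain ⟨S, Y, U, v, hS, hY⟩ := hall R
  obtain ⟨w, hw⟩ := hY.exists_eq_comp hS c
  obtain ⟨b, h, d, hb, hd⟩ := hY.exists_cone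
  rw [hw] at hα ⊢
  exact ⟨b, Y, h, d, U, w, hb, hY.closed, hd ▸ hY.lift_comp g₀ hY.mem,
    fun X' w' h' => hY.eq_zero hu w' h', hY.isHom hu hα, rfl⟩

end

/-! ### Free graded modules over a DG category -/

/-- The elements of degree `n` of the value at `x` of the free graded right module over `A` with
generators `g` of degree `dg g` at the objects `o g`. -/
def FreeMod (A : DGCat k) {G : Type u} (o : G → A.Obj) (dg : G → ℤ) (x : A.Obj) (n : ℤ) : Type u :=
  DirectSum G fun g => (A.Hom x (o g)).X (n - dg g)

namespace FreeMod

variable {A C : DGCat k} {G : Type u} {o : G → A.Obj} {dg : G → ℤ} {x y w : A.Obj} {n n' : ℤ}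

instance : AddCommGroup (FreeMod A o dg x n) :=
  inferInstanceAs (AddCommGroup (DirectSum G fun g => (A.Hom x (o g)).X (n - dg g)))

instance : Module k (FreeMod A o dg x n) :=
  inferInstanceAs (Module k (DirectSum G fun g => (A.Hom x (o g)).X (n - dg g)))

/-- The multiple of a generator by a morphism. -/
def mk (g : G) : (A.Hom x (o g)).X (n - dg g) →ₗ[k] FreeMod A o dg x n :=
  haveI := Classical.decEq G
  DirectSum.lof k G (fun g => (A.Hom x (o g)).X (n - dg g)) g

/-- A coordinate. -/
def coord (g : G) : FreeMod A o dg x n →ₗ[k] (A.Hom x (o g)).X (n - dg g) :=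
  DirectSum.component k G (fun g => (A.Hom x (o g)).X (n - dg g)) g

theorem coord_mk (g : G) (c : (A.Hom x (o g)).X (n - dg g)) :
    coord g (mk g c : FreeMod A o dg x n) = c :=
  letI := Classical.decEq G
  DirectSum.component.lof_self (R := k) (M := fun g => (A.Hom x (o g)).X (n - dg g)) g c

theorem coord_mk_of_ne {f g : G} (h : f ≠ g) (c : (A.Hom x (o g)).X (n - dg g)) :
    coord f (mk g c : FreeMod A o dg x n) = 0 :=
  letI := Classical.decEq G
  DFinsupp.single_eq_of_ne h

theorem exists_sum (t : FreeMod A o dg x n) :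
    ∃ S : Finset G, t = ∑ g ∈ S, mk g (coord g t) := by
  classical
  have h := DirectSum.sum_support_of (β := fun g => (A.Hom x (o g)).X (n - dg g)) t
  refine ⟨DFinsupp.support (show Π₀ g, (A.Hom x (o g)).X (n - dg g) from t), h.symm.trans ?_⟩
  refine Finset.sum_congr rfl fun g _ => ?_
  -- Two classical decidability instances occur: one in `mk`, the other in the decomposition of `t`.
  have : Classical.decEq G = fun a b => Classical.propDecidable (a = b) := Subsingleton.elim _ _
  unfold mk
  rw [this]
  rfl

@[elab_as_elim]
theorem induction {P : FreeMod A o dg x n → Prop} (zero : P 0) (mk : ∀ g c, P (mk g c))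
    (add : ∀ t t', P t → P t' → P (t + t')) (t : FreeMod A o dg x n) : P t := by
  obtain ⟨S, hS⟩ := exists_sum t
  rw [hS]
  exact Finset.sum_induction _ P add zero fun g _ => mk _ _

/-- Linear maps out of a free module. -/
def lift {M : Type u} [AddCommGroup M] [Module k M]
    (φ : ∀ g, (A.Hom x (o g)).X (n - dg g) →ₗ[k] M) : FreeMod A o dg x n →ₗ[k] M :=
  haveI := Classical.decEq G
  DirectSum.toModule k G M φ

@[simp]
theorem lift_mk {M : Type u} [AddCommGroup M] [Module k M]
    (φ : ∀ g, (A.Hom x (o g)).X (n - dg g) →ₗ[k] M) (g : G)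
    (c : (A.Hom x (o g)).X (n - dg g)) : lift φ (mk g c) = φ g c :=
  letI := Classical.decEq G
  DirectSum.toModule_lof (M := fun g => (A.Hom x (o g)).X (n - dg g)) k g c

/-- The action of `A`. -/
def act (p q n : ℤ) (h : p + q = n) :
    FreeMod A o dg y p →ₗ[k] (A.Hom x y).X q →ₗ[k] FreeMod A o dg x n :=
  lift fun g => (A.comp (p - dg g) q (n - dg g) (by omega)).compr₂ (mk g)

@[simp]
theorem act_mk (p q n : ℤ) (h : p + q = n) (g : G) (c : (A.Hom y (o g)).X (p - dg g))
    (f : (A.Hom x y).X q) :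
    act p q n h (mk g c : FreeMod A o dg y p) f =
      mk g (A.comp (p - dg g) q (n - dg g) (by omega) c f) := by
  simp [act]

theorem act_id (h : n + 0 = n) (t : FreeMod A o dg x n) : act n 0 n h t (A.id x) = t := by
  induction t using FreeMod.induction with
  | zero => simp
  | mk g c => rw [act_mk, A.comp_id]
  | add t t' h h' => rw [map_add, LinearMap.add_apply, h, h']

theorem act_act (p q r pq qr n : ℤ) (hpq : p + q = pq) (hqr : q + r = qr) (h₁ : pq + r = n)
    (h₂ : p + qr = n) (t : FreeMod A o dg w p) (b : (A.Hom y w).X q) (a : (A.Hom x y).X r) :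
    act pq r n h₁ (act p q pq hpq t b) a = act p qr n h₂ t (A.comp q r qr hqr b a) := by
  induction t using FreeMod.induction with
  | zero => simp
  | mk g c =>
    rw [act_mk, act_mk, act_mk, A.assoc (p - dg g) q r (pq - dg g) qr (n - dg g)]
  | add t t' h h' => simp only [map_add, LinearMap.add_apply, h, h']

variable (bd : ∀ g, FreeMod A o dg (o g) (dg g + 1))

/-- The differential determined by the boundaries of the generators. -/
def diff (n n' : ℤ) (h : n + 1 = n') : FreeMod A o dg x n →ₗ[k] FreeMod A o dg x n' :=
  lift fun g => act (dg g + 1) (n - dg g) n' (by omega) (bd g) +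
    ((dg g).negOnePow : ℤ) • mk g ∘ₗ ((A.Hom x (o g)).d (n - dg g) (n' - dg g)).hom

@[simp]
theorem diff_mk (h : n + 1 = n') (g : G) (c : (A.Hom x (o g)).X (n - dg g)) :
    diff bd n n' h (mk g c) = act (dg g + 1) (n - dg g) n' (by omega) (bd g) c +
      ((dg g).negOnePow : ℤ) • mk g (((A.Hom x (o g)).d (n - dg g) (n' - dg g)).hom c) := by
  rw [diff, lift_mk]
  rfl

theorem diff_act (p q n p' q' n' : ℤ) (h : p + q = n) (hp : p + 1 = p') (hq : q + 1 = q')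
    (h₁ : p' + q = n') (h₂ : p + q' = n') (hn : n + 1 = n') (t : FreeMod A o dg y p)
    (f : (A.Hom x y).X q) : diff bd n n' hn (act p q n h t f) =
      act p' q n' h₁ (diff bd p p' hp t) f +
        (p.negOnePow : ℤ) • act p q' n' h₂ t (((A.Hom x y).d q q').hom f) := by
  induction t using FreeMod.induction with
  | zero => simp
  | mk g c =>
    rw [act_mk, diff_mk, diff_mk, act_mk, A.d_comp (p - dg g) q (n - dg g) (p' - dg g) q'
      (n' - dg g) (by omega) (by omega) hq (by omega) (by omega)]
    simp only [map_add, LinearMap.add_apply, map_zsmul, LinearMap.smul_apply, act_mk, smul_add,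
      Units.smul_def, smul_smul, ← Units.val_mul, ← Int.negOnePow_add]
    rw [act_act (dg g + 1) (p - dg g) q p' (n - dg g) n' (by omega) (by omega) h₁ (by omega),
      show dg g + (p - dg g) = p by omega]
    exact (add_assoc _ _ _).symm
  | add t t' h h' => simp only [map_add, LinearMap.add_apply, h, h', smul_add]; abel

variable {bd}

/-- By `diff_act` the square of the differential is linear over `A`, so it vanishes as soon as it
vanishes on the generators. -/
theorem diff_diff (hbd : ∀ g, diff bd (dg g + 1) (dg g + 1 + 1) rfl (bd g) = 0) {n'' : ℤ}
    (h : n + 1 = n') (h' : n' + 1 = n'') (t : FreeMod A o dg x n) :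
    diff bd n' n'' h' (diff bd n n' h t) = 0 := by
  induction t using FreeMod.induction with
  | zero => simp
  | mk g c =>
    rw [diff_mk, map_add, diff_act bd (dg g + 1) (n - dg g) n' (dg g + 1 + 1) (n' - dg g) n''
      (by omega) rfl (by omega) (by omega) (by omega), hbd, map_zsmul, diff_mk, Int.negOnePow_succ]
    have : ((A.Hom x (o g)).d (n' - dg g) (n'' - dg g)).hom
        (((A.Hom x (o g)).d (n - dg g) (n' - dg g)).hom c) = 0 :=
      congrArg (fun φ => φ.hom c) 
        ((A.Hom x (o g)).d_comp_d (n - dg g) (n' - dg g) (n'' - dg g))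
    rw [this]
    simp
  | add t t' h h' => simp only [map_add, h, h', add_zero]

variable (F : DGFunctor A C) {q : C.Obj} (v : ∀ g, (C.Hom (F.obj (o g)) q).X (dg g))

/-- The linear map determined by the images of the generators. -/
def eval (n : ℤ) : FreeMod A o dg x n →ₗ[k] (C.Hom (F.obj x) q).X n :=
  lift fun g => C.comp (dg g) (n - dg g) n (by omega) (v g) ∘ₗ ((F.map x (o g)).f (n - dg g)).hom

@[simp]
theorem eval_mk (g : G) (c : (A.Hom x (o g)).X (n - dg g)) :
    eval F v n (mk g c) = C.comp (dg g) (n - dg g) n (by omega) (v g)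
      (((F.map x (o g)).f (n - dg g)).hom c) := by
  rw [eval, lift_mk]; rfl

theorem eval_act (p q n : ℤ) (h : p + q = n) (t : FreeMod A o dg y p) (f : (A.Hom x y).X q) :
    eval F v n (act p q n h t f) = C.comp p q n h (eval F v p t) (((F.map x y).f q).hom f) := by
  induction t using FreeMod.induction with
  | zero => simp
  | mk g c =>
    rw [act_mk, eval_mk, eval_mk, F.map_comp, C.assoc (dg g) (p - dg g) q p (n - dg g) n]
  | add t t' h h' => simp only [map_add, LinearMap.add_apply, h, h']

/-- Both sides satisfy the Leibniz rule, so compatibility with the differentials is a condition on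
the generators only. -/
theorem eval_diff (hv : ∀ g, ((C.Hom (F.obj (o g)) q).d (dg g) (dg g + 1)).hom (v g) =
    eval F v (dg g + 1) (bd g)) (h : n + 1 = n') (t : FreeMod A o dg x n) :
    eval F v n' (diff bd n n' h t) =
      ((C.Hom (F.obj x) q).d n n').hom (eval F v n t) := by
  induction t using FreeMod.induction with
  | zero => simp
  | mk g c =>
    rw [diff_mk, map_add, map_zsmul, eval_act, eval_mk, eval_mk, F.map_d, ← hv,
      C.d_comp (dg g) (n - dg g) n (dg g + 1) (n' - dg g) n', Units.smul_def] <;> omega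
  | add t t' h h' => simp only [map_add, h, h']

end FreeMod

/-! ### Semifree modules and the adjunction of an object -/

/-- A semifree right module over a DG category: a free graded module together with the boundaries
of its generators. -/
structure CellModule (A : DGCat k) where
  G : Type u
  o : G → A.Obj
  dg : G → ℤ
  bd (g : G) : FreeMod A o dg (o g) (dg g + 1)
  diff_bd (g : G) : FreeMod.diff bd (dg g + 1) (dg g + 1 + 1) rfl (bd g) = 0

namespace CellModule

variable {A C : DGCat k} (M : CellModule A)

/-- The value of the module at an object. -/
def cplx (x : A.Obj) : Cplx k where
  X n := ModuleCat.of k (FreeMod A M.o M.dg x n)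
  d n n' := if h : n + 1 = n' then ModuleCat.ofHom (FreeMod.diff M.bd n n' h) else 0
  shape n n' h := dif_neg h
  d_comp_d' n n' n'' h h' := by
    rw [dif_pos (show n + 1 = n' from h), dif_pos (show n' + 1 = n'' from h')]
    exact ModuleCat.hom_ext (LinearMap.ext fun t => FreeMod.diff_diff M.diff_bd h h' t)

theorem cplx_d {x : A.Obj} {n n' : ℤ} (h : n + 1 = n') (t : FreeMod A M.o M.dg x n) :
    ((M.cplx x).d n n').hom t = FreeMod.diff M.bd n n' h t := by
  have : (M.cplx x).d n n' = ModuleCat.ofHom (FreeMod.diff M.bd n n' h) := dif_pos h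
  rw [this]
  rfl

end CellModule

/-! ### The ring `k` in degree 0, as the endomorphisms of the adjoined object. -/

/-- The elements of `k` which are zero unless `n = 0`. -/
def scalars (k : Type u) [CommRing k] (n : ℤ) : Submodule k k where
  carrier := {c | n ≠ 0 → c = 0}
  add_mem' ha hb h := by rw [ha h, hb h, add_zero]
  zero_mem' _ := rfl
  smul_mem' r c hc h := by rw [hc h, smul_zero]

/-- The ring `k` as a complex concentrated in degree `0`. -/
def scalarCplx (k : Type u) [CommRing k] : Cplx k where
  X n := ModuleCat.of k (scalars k n)
  d _ _ := 0

/-- The zero complex. -/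
def trivialCplx (k : Type u) [CommRing k] : Cplx k where
  X _ := ModuleCat.of k PUnit
  d _ _ := 0

/-- Multiplication by scalars. -/
def scalarAct (L : Cplx k) (p q n : ℤ) (h : p + q = n) :
    (scalarCplx k).X p →ₗ[k] L.X q →ₗ[k] L.X n :=
  if hp : p = 0 then
    LinearMap.mk₂ k (fun (c : scalars k p) (t : L.X q) =>
      DGCat.castDeg (show q = n by omega) (c.1 • t))
      (by intros; rw [← DGCat.castDeg_add, ← add_smul]; rfl)
      (by
        intros
        obtain rfl : q = n := by omega
        exact mul_smul _ _ _)
      (by intros; rw [← DGCat.castDeg_add, ← smul_add])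
      (by
        intros
        obtain rfl : q = n := by omega
        exact smul_comm _ _ _)
  else 0

theorem scalarAct_zero (L : Cplx k) (n : ℤ) (h : 0 + n = n) (c : (scalarCplx k).X 0)
    (t : L.X n) : scalarAct L 0 n n h c t = (show scalars k 0 from c).1 • t := by
  rw [scalarAct, dif_pos rfl]
  rfl

theorem scalarAct_of_ne (L : Cplx k) (p q n : ℤ) (h : p + q = n) (hp : p ≠ 0) :
    scalarAct L p q n h = 0 := dif_neg hp

theorem scalars_eq_zero {p : ℤ} (hp : p ≠ 0) (c : (scalarCplx k).X p) : c = 0 :=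
  Subtype.ext ((show scalars k p from c).2 hp)

/-- The unit scalar. -/
def scalarOne (k : Type u) [CommRing k] : (scalarCplx k).X 0 :=
  (⟨1, fun h => absurd rfl h⟩ : scalars k 0)

theorem scalarAct_one (L : Cplx k) (n : ℤ) (h : 0 + n = n) (t : L.X n) :
    scalarAct L 0 n n h (scalarOne k) t = t := by
  exact (scalarAct_zero L n h _ t).trans (one_smul k t)

theorem scalarAct_scalarOne (n : ℤ) (h : n + 0 = n) (c : (scalarCplx k).X n) :
    scalarAct (scalarCplx k) n 0 n h c (scalarOne k) = c := by
  by_cases hn : n = 0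
  · subst hn
    rw [scalarAct_zero]
    exact Subtype.ext (mul_one (show scalars k 0 from c).1)
  · rw [scalars_eq_zero hn c, map_zero, LinearMap.zero_apply]

theorem map_scalarAct {L L' : Cplx k} (φ : L ⟶ L') (p q n : ℤ) (h : p + q = n)
    (c : (scalarCplx k).X p) (t : L.X q) :
    (φ.f n).hom (scalarAct L p q n h c t) = scalarAct L' p q n h c ((φ.f q).hom t) := by
  by_cases hp : p = 0
  · subst hp
    obtain rfl : q = n := by omega
    rw [scalarAct_zero, scalarAct_zero, map_smul]
  · rw [scalarAct_of_ne _ _ _ _ _ hp, scalarAct_of_ne _ _ _ _ _ hp]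
    simp

theorem comp_scalarAct_id (C : DGCat k) {X Y : C.Obj} (p q n : ℤ) (h : p + q = n)
    (c : (scalarCplx k).X p) (f : (C.Hom X Y).X q) :
    C.comp p q n h (scalarAct (C.Hom Y Y) p 0 p (add_zero p) c (C.id Y)) f =
      scalarAct (C.Hom X Y) p q n h c f := by
  by_cases hp : p = 0
  · subst hp
    obtain rfl : q = n := by omega
    rw [scalarAct_zero, scalarAct_zero, LinearMap.map_smul₂, C.id_comp]
  · rw [scalarAct_of_ne _ _ _ _ _ hp, scalarAct_of_ne _ _ _ _ _ hp]
    simp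

theorem scalarAct_scalarAct (L : Cplx k) (p q r pq qr n : ℤ) (hpq : p + q = pq) (hqr : q + r = qr)
    (h₁ : pq + r = n) (h₂ : p + qr = n) (c b : (scalarCplx k).X _) (t : L.X r) :
    scalarAct L pq r n h₁ (scalarAct (scalarCplx k) p q pq hpq c b) t =
      scalarAct L p qr n h₂ c (scalarAct L q r qr hqr b t) := by
  by_cases hp : p = 0
  · subst hp
    by_cases hq : q = 0
    · subst hq
      obtain rfl : pq = 0 := by omega
      obtain rfl : r = qr := by omega
      obtain rfl : r = n := by omega
      simp only [scalarAct_zero]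
      exact mul_smul _ _ _
    · rw [scalars_eq_zero hq b]
      simp only [map_zero, LinearMap.zero_apply]
  · rw [scalars_eq_zero hp c]
    simp only [map_zero, LinearMap.zero_apply]

theorem d_scalarAct (L : Cplx k) (p q n p' q' n' : ℤ) (h : p + q = n) (hq : q + 1 = q')
    (h₁ : p' + q = n') (h₂ : p + q' = n') (c : (scalarCplx k).X p) (t : L.X q) :
    (L.d n n').hom (scalarAct L p q n h c t) =
      scalarAct L p' q n' h₁ (((scalarCplx k).d p p').hom c) t +
        p.negOnePow • scalarAct L p q' n' h₂ c ((L.d q q').hom t) := by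
  have : ((scalarCplx k).d p p').hom c = 0 := rfl
  rw [this, map_zero, LinearMap.zero_apply, zero_add]
  by_cases hp : p = 0
  · subst hp
    obtain rfl : q = n := by omega
    obtain rfl : q' = n' := by omega
    rw [scalarAct_zero, scalarAct_zero, map_smul, Int.negOnePow_zero, one_smul]
  · rw [scalars_eq_zero hp c]
    simp only [map_zero, LinearMap.zero_apply, smul_zero]

theorem scalarAct_act {A : DGCat k} (M : CellModule A) {x y : A.Obj} (p q r pq qr n : ℤ)
    (hpq : p + q = pq) (hqr : q + r = qr) (h₁ : pq + r = n) (h₂ : p + qr = n)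
    (c : (scalarCplx k).X p) (t : (M.cplx y).X q) (a : (A.Hom x y).X r) :
    FreeMod.act pq r n h₁ (scalarAct (M.cplx y) p q pq hpq c t) a =
      scalarAct (M.cplx x) p qr n h₂ c (FreeMod.act q r qr hqr t a) := by
  by_cases hp : p = 0
  · subst hp
    obtain rfl : q = pq := by omega
    obtain rfl : qr = n := by omega
    exact (congrArg (fun s => FreeMod.act q r qr h₁ s a) (scalarAct_zero _ _ _ c t)).trans
      ((LinearMap.map_smul₂ (FreeMod.act q r qr h₁) _ _ _).trans
        (scalarAct_zero (M.cplx x) qr h₂ c (FreeMod.act q r qr h₁ t a)).symm)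
  · rw [scalars_eq_zero hp c]
    simp only [map_zero, LinearMap.zero_apply]
    exact LinearMap.map_zero₂ _ _

namespace CellModule

variable {A C : DGCat k} (M : CellModule A)

theorem d_act {x y : A.Obj} (p q n p' q' n' : ℤ) (h : p + q = n) (hp : p + 1 = p')
    (hq : q + 1 = q') (h₁ : p' + q = n') (h₂ : p + q' = n') (t : FreeMod A M.o M.dg y p)
    (f : (A.Hom x y).X q) : ((M.cplx x).d n n').hom (FreeMod.act p q n h t f) =
      FreeMod.act p' q n' h₁ (((M.cplx y).d p p').hom t) f +
        p.negOnePow • FreeMod.act p q' n' h₂ t (((A.Hom x y).d q q').hom f) := by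
  rw [M.cplx_d (by omega), M.cplx_d hp]
  exact FreeMod.diff_act M.bd p q n p' q' n' h hp hq h₁ h₂ (by omega) t f

/-- The complexes of morphisms of `M.adjoin`. -/
def adjoinHom : Option A.Obj → Option A.Obj → Cplx k
  | some x, some y => A.Hom x y
  | some x, none => M.cplx x
  -- Nothing maps from the new object to `A`, so `A` remains a full subcategory and the only new
  -- composites are the action of `A` on the module and scalar multiplication.
  | none, some _ => trivialCplx k
  | none, none => scalarCplx k

/-- The composition of `M.adjoin`. -/
def adjoinComp : ∀ {X Y Z : Option A.Obj} (p q n : ℤ), p + q = n →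
    ((M.adjoinHom Y Z).X p →ₗ[k] (M.adjoinHom X Y).X q →ₗ[k] (M.adjoinHom X Z).X n)
  | some _, some _, some _ => fun p q n h => A.comp p q n h
  | some _, some _, none => fun p q n h => FreeMod.act p q n h
  | some _, none, none => fun p q n h => scalarAct _ p q n h
  | none, none, none => fun p q n h => scalarAct _ p q n h
  | some _, none, some _ => fun _ _ _ _ => 0
  | none, none, some _ => fun _ _ _ _ => 0
  | none, some _, some _ => fun _ _ _ _ => 0
  | none, some _, none => fun _ _ _ _ => 0

/-- The DG category obtained from `A` by adjoining an object such that the morphisms to it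
form the module `M`. -/
def adjoin : DGCat k where
  Obj := Option A.Obj
  Hom := M.adjoinHom
  id
    | some x => A.id x
    | none => scalarOne k
  comp := M.adjoinComp
  id_comp {X Y} n f := match X, Y with
    | some _, some _ => A.id_comp n f
    | some _, none => scalarAct_one _ n (zero_add n) f
    | none, some _ => rfl
    | none, none => scalarAct_one _ n (zero_add n) f
  comp_id {X Y} n f := match X, Y with
    | some _, some _ => A.comp_id n f
    | some _, none => FreeMod.act_id (add_zero n) f
    | none, some _ => rfl
    | none, none => scalarAct_scalarOne n (add_zero n) f
  assoc {X Y Z W} p q r pq qr n hpq hqr h₁ h₂ c b a := match X, Y, Z, W with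
    | some _, some _, some _, some _ => A.assoc p q r pq qr n hpq hqr h₁ h₂ c b a
    | some _, some _, some _, none => FreeMod.act_act p q r pq qr n hpq hqr h₁ h₂ c b a
    | some _, some _, none, none => scalarAct_act M p q r pq qr n hpq hqr h₁ h₂ c b a
    | some _, none, none, none => scalarAct_scalarAct _ p q r pq qr n hpq hqr h₁ h₂ c b a
    | none, none, none, none => scalarAct_scalarAct _ p q r pq qr n hpq hqr h₁ h₂ c b a
    | none, none, none, some _ => rfl
    | none, none, some _, some _ => rfl
    | none, some _, none, some _ => rfl
    | none, some _, some _, some _ => rfl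
    | some _, some _, none, some _ => LinearMap.map_zero₂ _ _
    | some _, none, some _, some _ => (map_zero (A.comp p qr n h₂ c)).symm
    | some _, none, none, some _ => rfl
    | some _, none, some _, none => (LinearMap.map_zero₂ (scalarAct _ pq r n h₁) _).trans
        (map_zero (FreeMod.act p qr n h₂ c)).symm
    | none, some _, some _, none => rfl
    | none, some _, none, none => (map_zero (scalarAct (scalarCplx k) p qr n h₂ c)).symm
    | none, none, some _, none => LinearMap.map_zero₂ (scalarAct (scalarCplx k) pq r n h₁) _
  d_comp {X Y Z} p q n p' q' n' h hp hq h₁ h₂ g f := match X, Y, Z with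
    | some _, some _, some _ => A.d_comp p q n p' q' n' h hp hq h₁ h₂ g f
    | some _, some _, none => M.d_act p q n p' q' n' h hp hq h₁ h₂ g f
    | some _, none, none => d_scalarAct _ p q n p' q' n' h hq h₁ h₂ g f
    | none, none, none => d_scalarAct _ p q n p' q' n' h hq h₁ h₂ g f
    | some _, none, some _ => (map_zero _).trans (by
        change 0 = 0 + p.negOnePow • 0
        rw [smul_zero, add_zero])
    | none, none, some _ => rfl
    | none, some _, some _ => rfl
    | none, some _, none => (map_zero _).trans (by
        change 0 = 0 + p.negOnePow • 0
        rw [smul_zero, add_zero])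

/-- The inclusion of `A` in `M.adjoin`. -/
def inc : DGFunctor A M.adjoin where
  obj x := some x
  map _ _ := 𝟙 _
  map_id _ := rfl
  map_comp _ _ _ _ _ _ := rfl

section

variable (F : DGFunctor A C) {q : C.Obj} (v : ∀ g, (C.Hom (F.obj (M.o g)) q).X (M.dg g))
  (hv : ∀ g, ((C.Hom (F.obj (M.o g)) q).d (M.dg g) (M.dg g + 1)).hom (v g) =
    FreeMod.eval F v (M.dg g + 1) (M.bd g))

/-- The morphism of complexes determined by the images of the generators. -/
def evalHom (x : A.Obj) : M.cplx x ⟶ C.Hom (F.obj x) q where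
  f n := ModuleCat.ofHom (FreeMod.eval F v n)
  comm' n n' h := ModuleCat.hom_ext (LinearMap.ext fun t => by
    refine (FreeMod.eval_diff F v hv h t).symm.trans ?_
    exact congrArg (FreeMod.eval F v n') (M.cplx_d h t).symm)

/-- The multiples of the identity. -/
def scalarHom (q : C.Obj) : scalarCplx k ⟶ C.Hom q q where
  f n := ModuleCat.ofHom ((scalarAct (C.Hom q q) n 0 n (add_zero n)).flip (C.id q))
  comm' n n' h := ModuleCat.hom_ext (LinearMap.ext fun c => by
    have := d_scalarAct (C.Hom q q) n 0 n n' 1 n' (add_zero n) rfl (add_zero n') h c (C.id q)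
    rw [C.d_id, map_zero, smul_zero, add_zero] at this
    exact this)

/-- The action on objects of `M.ext`. -/
def extObj (q : C.Obj) : Option A.Obj → C.Obj
  | some x => F.obj x
  | none => q

/-- The action on morphisms of `M.ext`. -/
def extMap : ∀ X Y : Option A.Obj, M.adjoinHom X Y ⟶ C.Hom (extObj F q X) (extObj F q Y)
  | some x, some y => F.map x y
  | some x, none => M.evalHom F v hv x
  | none, some _ => 0
  | none, none => scalarHom q

/-- The extension of a DG functor to `M.adjoin`. -/
def ext : DGFunctor M.adjoin C where
  obj := extObj F q
  map := M.extMap F v hv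
  map_id
    | some x => F.map_id x
    | none => scalarAct_one _ 0 rfl _
  map_comp {X Y Z} p q n h g f := match X, Y, Z with
    | some _, some _, some _ => F.map_comp p q n h g f
    | some _, some _, none => FreeMod.eval_act F v p q n h g f
    | some x, none, none => (map_scalarAct (M.evalHom F v hv x) p q n h g f).trans
        (comp_scalarAct_id C p q n h g _).symm
    | none, none, none => (map_scalarAct (scalarHom _) p q n h g f).trans
        (comp_scalarAct_id C p q n h g _).symm
    | some _, none, some _ => (map_zero _).trans (LinearMap.map_zero₂ (C.comp p q n h) _).symm
    | none, none, some _ => (LinearMap.map_zero₂ (C.comp p q n h) _).symm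
    | none, some _, some _ => (map_zero (C.comp p q n h _)).symm
    | none, some _, none => (map_zero _).trans (map_zero (C.comp p q n h _)).symm

end

end CellModule

/-- The type of `map` depends on `obj`, hence the heterogeneous equality. -/
theorem DGFunctor.eq_of_map_eq {A C : DGCat k} {F G : DGFunctor A C} (h : F.obj = G.obj)
    (h' : HEq F.map G.map) : F = G := by
  obtain ⟨o, m, _, _⟩ := F
  obtain ⟨o', m', _, _⟩ := G
  obtain rfl : o = o' := h
  obtain rfl : m = m' := eq_of_heq h'
  rfl

namespace CellModule

variable {A C : DGCat k} (M : CellModule A)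

/-- A strict equality of functors: hypotheses on `F` can be rewritten as hypotheses on the
composite. -/
theorem inc_comp_ext (F : DGFunctor A C) {q : C.Obj}
    (v : ∀ g, (C.Hom (F.obj (M.o g)) q).X (M.dg g))
    (hv : ∀ g, ((C.Hom (F.obj (M.o g)) q).d (M.dg g) (M.dg g + 1)).hom (v g) =
      FreeMod.eval F v (M.dg g + 1) (M.bd g)) : M.inc.comp (M.ext F v hv) = F :=
  DGFunctor.eq_of_map_eq rfl (heq_of_eq (funext fun _ => funext fun _ => Category.id_comp _))

/-- The adjoined object. -/
abbrev pt : Tot M.adjoin := ⟨(none : Option A.Obj)⟩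

/-- The generators of the module, as morphisms to the adjoined object. -/
def gen (g : M.G) : M.inc.tot.obj ⟨M.o g⟩ ⟶ M.pt :=
  tin (X := M.inc.tot.obj ⟨M.o g⟩) (Y := M.pt) (M.dg g)
    (FreeMod.mk g (A.idOf rfl (M.dg g - M.dg g) (by omega)))

/-- A homogeneous element of the module, as a morphism to the adjoined object. -/
def elt {x : A.Obj} (n : ℤ) : FreeMod A M.o M.dg x n →ₗ[k] (M.inc.tot.obj ⟨x⟩ ⟶ M.pt) :=
  tin (X := M.inc.tot.obj ⟨x⟩) (Y := M.pt) n

theorem isHom_gen (g : M.G) : IsHom (M.dg g) (M.gen g) := isHom_tin _ _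

theorem tin_comp_gen {x : A.Obj} (g : M.G) {m n : ℤ} (h : M.dg g + m = n)
    (c : (A.Hom x (M.o g)).X m) :
    M.inc.tot.map (tin m c : (⟨x⟩ : Tot A) ⟶ ⟨M.o g⟩) ≫ M.gen g =
      M.elt n (FreeMod.mk g (A.comp (M.dg g - M.dg g) m (n - M.dg g) (by omega)
        (A.idOf rfl (M.dg g - M.dg g) (by omega)) c)) := by
  rw [M.inc.tot_tin]
  refine (tin_comp (D := M.adjoin) (X := M.inc.tot.obj ⟨x⟩) (Y := M.inc.tot.obj ⟨M.o g⟩)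
    (Z := M.pt) (M.dg g) m n h _ _).symm.trans ?_
  exact congrArg (M.elt n) (FreeMod.act_mk (M.dg g) m n h g _ c)

theorem tin_comp_gen' {x : A.Obj} (g : M.G) {n : ℤ} (c : (A.Hom x (M.o g)).X (n - M.dg g)) :
    M.inc.tot.map (tin _ c : (⟨x⟩ : Tot A) ⟶ ⟨M.o g⟩) ≫ M.gen g = M.elt n (FreeMod.mk g c) := by
  rw [M.tin_comp_gen g (n := n) (by omega), A.idOf_comp _ _ (by omega)]

theorem elt_eq_sum {x : A.Obj} {n : ℤ} (t : FreeMod A M.o M.dg x n) :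
    ∃ S : Finset M.G, M.elt n t =
      ∑ g ∈ S, M.inc.tot.map (tin _ (FreeMod.coord g t) : (⟨x⟩ : Tot A) ⟶ ⟨M.o g⟩) ≫ M.gen g := by
  obtain ⟨S, hS⟩ := FreeMod.exists_sum t
  refine ⟨S, (congrArg (M.elt n) hS).trans ((map_sum _ _ _).trans ?_)⟩
  exact Finset.sum_congr rfl fun g _ => (M.tin_comp_gen' g _).symm

theorem dif_gen (g : M.G) : dif (M.gen g) = M.elt (M.dg g + 1) (M.bd g) := by
  refine (dif_tin (X := M.inc.tot.obj ⟨M.o g⟩) (Y := M.pt) _ _ rfl _).trans ?_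
  refine congrArg (M.elt (M.dg g + 1)) ((M.cplx_d rfl _).trans ?_)
  rw [FreeMod.diff_mk]
  -- The identity in the generator sits in degree `M.dg g - M.dg g`, which is 0 only
  -- propositionally; generalizing the degree permits substitution here and in `h₂`.
  have h₁ : ∀ (n : ℤ) (hn : 0 = n) (n' : ℤ),
      ((A.Hom (M.o g) (M.o g)).d n n').hom (A.idOf rfl n hn) = 0 := by
    rintro n rfl n'
    by_cases hn : 0 + 1 = n'
    · subst hn
      exact A.d_id _
    · rw [(A.Hom (M.o g) (M.o g)).shape 0 n' hn]
      rfl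
  rw [h₁, map_zero, smul_zero, add_zero]
  have h₂ : ∀ (m : ℤ) (hm : 0 = m) (h : M.dg g + 1 + m = M.dg g + 1),
      FreeMod.act (M.dg g + 1) m (M.dg g + 1) h (M.bd g) (A.idOf rfl m hm) = M.bd g := by
    rintro m rfl h
    exact FreeMod.act_id h _
  exact h₂ _ _ _

theorem coord_lin {x : A.Obj} (g : M.G) : ∃ π : (M.inc.tot.obj ⟨x⟩ ⟶ M.pt) →ₗ[k]
    ((⟨x⟩ : Tot A) ⟶ ⟨M.o g⟩), ∀ n t, π (M.elt n t) = tin (n - M.dg g) (FreeMod.coord g t) :=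
  ⟨tlin (X := M.inc.tot.obj ⟨x⟩) (Y := M.pt) fun n => tin (X := (⟨x⟩ : Tot A)) (Y := ⟨M.o g⟩)
    (n - M.dg g) ∘ₗ FreeMod.coord g, fun n t => tlin_tin (X := M.inc.tot.obj ⟨x⟩) (Y := M.pt) _ n t⟩

end CellModule

section

variable {D P : DGCat k} {I : DGFunctor D P} {Q : Tot P} {G : Type u} {o : G → Tot D}
  {u : ∀ g, I.tot.obj (o g) ⟶ Q} {X : Tot D}

theorem exists_sum_add {w w' : I.tot.obj X ⟶ Q}
    (h : ∃ (S : Finset G) (c : ∀ g, X ⟶ o g), w = ∑ g ∈ S, I.tot.map (c g) ≫ u g)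
    (h' : ∃ (S : Finset G) (c : ∀ g, X ⟶ o g), w' = ∑ g ∈ S, I.tot.map (c g) ≫ u g) :
    ∃ (S : Finset G) (c : ∀ g, X ⟶ o g), w + w' = ∑ g ∈ S, I.tot.map (c g) ≫ u g := by
  classical
  obtain ⟨S₁, c₁, rfl⟩ := h
  obtain ⟨S₂, c₂, rfl⟩ := h'
  obtain ⟨c₁', h₁'⟩ := exists_subset_sum (I := I) (S := S₁) (S' := S₁ ∪ S₂)
    Finset.subset_union_left c₁
  obtain ⟨c₂', h₂'⟩ := exists_subset_sum (I := I) (S := S₂) (S' := S₁ ∪ S₂)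
    Finset.subset_union_right c₂
  refine ⟨S₁ ∪ S₂, fun g => c₁' g + c₂' g, ?_⟩
  simp only [h₁', h₂', I.tot.map_add, Preadditive.add_comp, Finset.sum_add_distrib]

theorem isFreeOn_of_coord (hw : ∀ (n : ℤ) (w : I.tot.obj X ⟶ Q), IsHom n w →
      ∃ (S : Finset G) (c : ∀ g, X ⟶ o g), w = ∑ g ∈ S, I.tot.map (c g) ≫ u g)
    (π : ∀ g, (I.tot.obj X ⟶ Q) →ₗ[k] (X ⟶ o g))
    (h₁ : ∀ g (c : X ⟶ o g), π g (I.tot.map c ≫ u g) = c)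
    (h₂ : ∀ f g (c : X ⟶ o g), f ≠ g → π f (I.tot.map c ≫ u g) = 0) : IsFreeOn I o u X where
  exists_sum w := by
    induction w using hom_induction with
    | hadd w w' h h' => exact exists_sum_add h h'
    | h n w => exact hw n _ (isHom_tin n w)
  eq_zero S c h g hg := by
    have := congrArg (π g) h
    rw [map_zero, map_sum, Finset.sum_eq_single g (fun f _ hf => h₂ _ _ _ (Ne.symm hf))
      (fun h => absurd hg h), h₁] at this
    exact this

end

/-- Stronger than uniqueness of coefficients: the coordinates are linear maps. Injectivity alone
need not survive a tensor product over `k`, while linear coordinates do. -/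
theorem CellModule.exists_coord {A : DGCat k} (M : CellModule A) (X : Tot A) :
    ∃ π : ∀ g, (M.inc.tot.obj X ⟶ M.pt) →ₗ[k] (X ⟶ ⟨M.o g⟩),
      (∀ g c, π g (M.inc.tot.map c ≫ M.gen g) = c) ∧
        ∀ f g c, f ≠ g → π f (M.inc.tot.map c ≫ M.gen g) = 0 := by
  choose π hπ using M.coord_lin (x := X.obj)
  refine ⟨π, fun g c => ?_, fun f g c hf => ?_⟩
  · induction c using hom_induction with
    | hadd c c' h h' => rw [M.inc.tot.map_add, Preadditive.add_comp, map_add, h, h']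
    | h m c =>
      refine (congrArg (π g) (M.tin_comp_gen g rfl c)).trans ((hπ _ _ _).trans ?_)
      rw [FreeMod.coord_mk]
      refine (tin_comp (X := X) (Y := ⟨M.o g⟩) (Z := ⟨M.o g⟩) _ _ _ _ _ _).trans ?_
      rw [tin_idOf]
      exact Category.comp_id _
  · induction c using hom_induction with
    | hadd c c' h h' => rw [M.inc.tot.map_add, Preadditive.add_comp, map_add, h, h', add_zero]
    | h m c =>
      refine (congrArg (π f) (M.tin_comp_gen g rfl c)).trans ((hπ _ _ _).trans ?_)
      rw [FreeMod.coord_mk_of_ne hf, map_zero]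

theorem CellModule.isFreeOn {A : DGCat k} (M : CellModule A) (X : Tot A) :
    IsFreeOn M.inc (fun g => ⟨M.o g⟩) M.gen X := by
  obtain ⟨π, h₁, h₂⟩ := M.exists_coord X
  refine isFreeOn_of_coord (fun n w hw => ?_) π h₁ h₂
  obtain ⟨S, hS⟩ := M.elt_eq_sum (x := X.obj) (n := n) (tcpt n w)
  exact ⟨S, _, hw.symm.trans hS⟩

namespace CellModule

variable {A C : DGCat k} (M : CellModule A)

theorem exists_dif_gen (rk : M.G → ℕ)
    (h : ∀ g f, FreeMod.coord f (M.bd g) ≠ 0 → rk f < rk g) (g : M.G) :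
    ∃ (S : Finset M.G) (c : ∀ f, (⟨M.o g⟩ : Tot A) ⟶ ⟨M.o f⟩), (∀ f ∈ S, rk f < rk g) ∧
      dif (M.gen g) = ∑ f ∈ S, M.inc.tot.map (c f) ≫ M.gen f := by
  classical
  obtain ⟨S, hS⟩ := M.elt_eq_sum (M.bd g)
  -- Generators with zero coefficient are dropped, since the rank condition only concerns those that
  -- occur in the boundary.
  refine ⟨S.filter fun f => FreeMod.coord f (M.bd g) ≠ 0,
    fun f => tin _ (FreeMod.coord f (M.bd g)),
    fun f hf => h g f (Finset.mem_filter.1 hf).2, (M.dif_gen g).trans (hS.trans ?_)⟩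
  refine (Finset.sum_subset (Finset.filter_subset _ _) fun f hf hf' => ?_).symm
  have : FreeMod.coord f (M.bd g) = 0 := by
    by_contra h'
    exact hf' (Finset.mem_filter.2 ⟨hf, h'⟩)
  have h₁ : (tin _ (FreeMod.coord f (M.bd g)) : (⟨M.o g⟩ : Tot A) ⟶ ⟨M.o f⟩) = 0 :=
    (congrArg _ this).trans (map_zero _)
  rw [h₁, M.inc.tot.map_zero, Limits.zero_comp]

variable (F : DGFunctor A C) {q : C.Obj} (v : ∀ g, (C.Hom (F.obj (M.o g)) q).X (M.dg g))
  (hv : ∀ g, ((C.Hom (F.obj (M.o g)) q).d (M.dg g) (M.dg g + 1)).hom (v g) =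
    FreeMod.eval F v (M.dg g + 1) (M.bd g))

theorem ext_elt {x : A.Obj} {n : ℤ} (t : FreeMod A M.o M.dg x n) :
    (M.ext F v hv).tot.map (M.elt n t) =
      (tin n (FreeMod.eval F v n t) : (⟨F.obj x⟩ : Tot C) ⟶ ⟨q⟩) :=
  (M.ext F v hv).tot_tin (X := M.inc.tot.obj ⟨x⟩) (Y := M.pt) n t

theorem ext_gen (g : M.G) : (M.ext F v hv).tot.map (M.gen g) =
    (tin (M.dg g) (v g) : (⟨F.obj (M.o g)⟩ : Tot C) ⟶ ⟨q⟩) := by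
  refine (M.ext_elt F v hv _).trans (congrArg (tin (M.dg g)) ?_)
  rw [FreeMod.eval_mk]
  have : ∀ (m : ℤ) (hm : 0 = m) (h : M.dg g + m = M.dg g),
      C.comp (M.dg g) m (M.dg g) h (v g)
        (((F.map (M.o g) (M.o g)).f m).hom (A.idOf rfl m hm)) = v g := by
    rintro m rfl h
    exact (congrArg _ (F.map_id _)).trans (C.comp_id _ _)
  exact this _ _ _

end CellModule

/-! ### Resolutions -/

/-- Iterated cells attached to `a'` along objects of `B`, together with elements of
`Hom(ξ b, ξ a')`. -/
inductive Cell {A C : DGCat k} (ξ : DGFunctor A C) (B : Set A.Obj) (a' : A.Obj) :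
    A.Obj → ℤ → Type u
  | base : Cell ξ B a' a' 0
  -- No closedness condition is imposed here: it would involve the boundaries of the children, which
  -- are only defined by recursion on this type. All formal data are admitted, and `data`
  -- neutralizes the inadmissible ones by giving them zero boundary and zero image.
  | node (b : A.Obj) (hb : b ∈ B) (n : ℤ) (γ : (C.Hom (ξ.obj b) (ξ.obj a')).X n) (m : ℕ)
      (ob : Fin m → A.Obj) (dg : Fin m → ℤ) (coef : ∀ i, (A.Hom b (ob i)).X (n + 1 - dg i))
      (child : ∀ i, Cell ξ B a' (ob i) (dg i)) : Cell ξ B a' b n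

namespace Cell

variable {A C : DGCat k} (ξ : DGFunctor A C) (B : Set A.Obj) (a' : A.Obj)

/-- The set of all cells. -/
abbrev Gen : Type u := Σ (b : A.Obj) (n : ℤ), Cell ξ B a' b n

/-- The target of a generator. -/
abbrev o (g : Gen ξ B a') : A.Obj := g.1

/-- The degree of a generator. -/
abbrev dg (g : Gen ξ B a') : ℤ := g.2.1

variable {ξ B a'}

open scoped Classical in
/-- The boundary of a cell and its image; both are zero if the boundary is not closed or is not
compatible with the image. -/
def data : ∀ {b : A.Obj} {n : ℤ}, Cell ξ B a' b n →
    FreeMod A (o ξ B a') (dg ξ B a') b (n + 1) × (C.Hom (ξ.obj b) (ξ.obj a')).X n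
  | _, _, base => (0, C.id _)
  | _, _, node b _ n γ _ ob dg coef child =>
    if ∑ i, (FreeMod.act (dg i + 1) (n + 1 - dg i) (n + 1 + 1) (by omega) (child i).data.1
          (coef i) + ((dg i).negOnePow : ℤ) • FreeMod.mk (n := n + 1 + 1) (⟨_, _, child i⟩ : Gen ξ B a')
            (((A.Hom b (ob i)).d (n + 1 - dg i) (n + 1 + 1 - dg i)).hom (coef i))) = 0 ∧
        ((C.Hom (ξ.obj b) (ξ.obj a')).d n (n + 1)).hom γ =
          ∑ i, C.comp (dg i) (n + 1 - dg i) (n + 1) (by omega) (child i).data.2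
            (((ξ.map b (ob i)).f (n + 1 - dg i)).hom (coef i)) then
      (∑ i, FreeMod.mk (⟨_, _, child i⟩ : Gen ξ B a') (coef i), γ)
    else 0

/-- The depth of a cell. -/
def depth : ∀ {b : A.Obj} {n : ℤ}, Cell ξ B a' b n → ℕ
  | _, _, base => 0
  | _, _, node _ _ _ _ _ _ _ _ child => ∑ i, (child i).depth + 1

variable (ξ B a') in
/-- The boundary of a generator. -/
def bd (g : Gen ξ B a') : FreeMod A (o ξ B a') (dg ξ B a') g.1 (g.2.1 + 1) := g.2.2.data.1

variable (ξ B a') in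
/-- The image of a generator. -/
def val (g : Gen ξ B a') : (C.Hom (ξ.obj g.1) (ξ.obj a')).X g.2.1 := g.2.2.data.2

section

variable {b : A.Obj} (hb : b ∈ B) {n : ℤ} (γ : (C.Hom (ξ.obj b) (ξ.obj a')).X n) {m : ℕ}
  (ob : Fin m → A.Obj) (dg' : Fin m → ℤ) (coef : ∀ i, (A.Hom b (ob i)).X (n + 1 - dg' i))
  (child : ∀ i, Cell ξ B a' (ob i) (dg' i))

theorem diff_sum : FreeMod.diff (bd ξ B a') (n + 1) (n + 1 + 1) rfl
      (∑ i, FreeMod.mk (⟨_, _, child i⟩ : Gen ξ B a') (coef i)) =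
    ∑ i, (FreeMod.act (dg' i + 1) (n + 1 - dg' i) (n + 1 + 1) (by omega) (child i).data.1
        (coef i) + ((dg' i).negOnePow : ℤ) • FreeMod.mk (n := n + 1 + 1) (⟨_, _, child i⟩ : Gen ξ B a')
          (((A.Hom b (ob i)).d (n + 1 - dg' i) (n + 1 + 1 - dg' i)).hom (coef i))) := by
  rw [map_sum]
  exact Finset.sum_congr rfl fun i _ => FreeMod.diff_mk (bd ξ B a') rfl ⟨_, _, child i⟩ (coef i)

theorem eval_sum : FreeMod.eval ξ (val ξ B a') (n + 1)
      (∑ i, FreeMod.mk (⟨_, _, child i⟩ : Gen ξ B a') (coef i)) =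
    ∑ i, C.comp (dg' i) (n + 1 - dg' i) (n + 1) (by omega) (child i).data.2
      (((ξ.map b (ob i)).f (n + 1 - dg' i)).hom (coef i)) := by
  rw [map_sum]
  exact Finset.sum_congr rfl fun i _ =>
    FreeMod.eval_mk ξ (val ξ B a') (⟨_, _, child i⟩ : Gen ξ B a') (coef i)

theorem data_node_of_closed
    (h₁ : FreeMod.diff (bd ξ B a') (n + 1) (n + 1 + 1) rfl
      (∑ i, FreeMod.mk (⟨_, _, child i⟩ : Gen ξ B a') (coef i)) = 0)
    (h₂ : ((C.Hom (ξ.obj b) (ξ.obj a')).d n (n + 1)).hom γ =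
      FreeMod.eval ξ (val ξ B a') (n + 1)
        (∑ i, FreeMod.mk (⟨_, _, child i⟩ : Gen ξ B a') (coef i))) :
    (node b hb n γ m ob dg' coef child).data =
      (∑ i, FreeMod.mk (⟨_, _, child i⟩ : Gen ξ B a') (coef i), γ) := by
  rw [diff_sum] at h₁
  rw [eval_sum] at h₂
  rw [data, if_pos ⟨h₁, h₂⟩]

theorem data_node : ((node b hb n γ m ob dg' coef child).data = 0) ∨
    (FreeMod.diff (bd ξ B a') (n + 1) (n + 1 + 1) rfl
      (∑ i, FreeMod.mk (⟨_, _, child i⟩ : Gen ξ B a') (coef i)) = 0 ∧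
    ((C.Hom (ξ.obj b) (ξ.obj a')).d n (n + 1)).hom γ = FreeMod.eval ξ (val ξ B a') (n + 1)
        (∑ i, FreeMod.mk (⟨_, _, child i⟩ : Gen ξ B a') (coef i)) ∧
    (node b hb n γ m ob dg' coef child).data =
      (∑ i, FreeMod.mk (⟨_, _, child i⟩ : Gen ξ B a') (coef i), γ)) := by
  rw [diff_sum, eval_sum, data]
  split_ifs with h
  · exact .inr ⟨h.1, h.2, rfl⟩
  · exact .inl rfl

end

theorem diff_bd : ∀ g : Gen ξ B a',
    FreeMod.diff (bd ξ B a') (dg ξ B a' g + 1) (dg ξ B a' g + 1 + 1) rfl (bd ξ B a' g) = 0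
  | ⟨_, _, base⟩ => map_zero _
  | ⟨_, _, node b hb n γ m ob dg' coef child⟩ => by
    rcases data_node hb γ ob dg' coef child with h | ⟨h₁, -, h⟩
    · exact (congrArg (FreeMod.diff (bd ξ B a') _ _ rfl) (congrArg Prod.fst h)).trans (map_zero _)
    · exact (congrArg (FreeMod.diff (bd ξ B a') _ _ rfl) (congrArg Prod.fst h)).trans h₁

theorem d_val : ∀ g : Gen ξ B a',
    ((C.Hom (ξ.obj g.1) (ξ.obj a')).d g.2.1 (g.2.1 + 1)).hom (val ξ B a' g) =
      FreeMod.eval ξ (val ξ B a') (g.2.1 + 1) (bd ξ B a' g)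
  | ⟨_, _, base⟩ => (C.d_id _).trans (map_zero (FreeMod.eval ξ (val ξ B a') (0 + 1))).symm
  | ⟨_, _, node b hb n γ m ob dg' coef child⟩ => by
    rcases data_node hb γ ob dg' coef child with h | ⟨-, h₁, h⟩
    · exact (congrArg ((C.Hom (ξ.obj b) (ξ.obj a')).d n (n + 1)).hom (congrArg Prod.snd h)).trans
        ((map_zero _).trans ((congrArg (FreeMod.eval ξ (val ξ B a') _)
          (congrArg Prod.fst h)).trans (map_zero _)).symm)
    · exact (congrArg ((C.Hom (ξ.obj b) (ξ.obj a')).d n (n + 1)).hom (congrArg Prod.snd h)).trans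
        (h₁.trans (congrArg (FreeMod.eval ξ (val ξ B a') _) (congrArg Prod.fst h)).symm)

/-- Only the children of a cell occur in its boundary, and each is less deep than the cell. -/
theorem depth_lt : ∀ g f : Gen ξ B a', FreeMod.coord f (bd ξ B a' g) ≠ 0 →
    f.2.2.depth < g.2.2.depth
  | ⟨_, _, base⟩, f, hf => absurd (map_zero (FreeMod.coord f)) hf
  | ⟨_, _, node b hb n γ m ob dg' coef child⟩, f, hf => by
    rcases data_node hb γ ob dg' coef child with h | ⟨-, -, h⟩
    · exact absurd ((congrArg (FreeMod.coord f) (congrArg Prod.fst h)).trans (map_zero _)) hf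
    · by_contra hlt
      refine hf ((congrArg (FreeMod.coord f) (congrArg Prod.fst h)).trans ?_)
      rw [map_sum]
      refine Finset.sum_eq_zero fun i _ => FreeMod.coord_mk_of_ne ?_ _
      rintro rfl
      refine hlt ?_
      have : (child i).depth ≤ ∑ i, (child i).depth :=
        Finset.single_le_sum (f := fun i => (child i).depth) (fun _ _ => Nat.zero_le _)
          (Finset.mem_univ i)
      change (child i).depth < ∑ i, (child i).depth + 1
      omega

variable (ξ B a') in
/-- The module generated by all cells. -/
def module : CellModule A where
  G := Gen ξ B a'
  o := o ξ B a'
  dg := dg ξ B a'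
  bd := bd ξ B a'
  diff_bd := diff_bd

variable (ξ B a') in
/-- The DG functor to `C` on the category obtained by adjoining the module of cells. -/
abbrev resolution : DGFunctor (module ξ B a').adjoin C :=
  (module ξ B a').ext ξ (val ξ B a') d_val

/-- The inductive type is closed under attaching cells along any finite combination of cells, so
every relative cocycle over an object of `B` is already the data of a cell. This replaces an
iterated attachment with passage to a union. -/
theorem exists_cell {b : A.Obj} (hb : b ∈ B) {n : ℤ} {γ : (C.Hom (ξ.obj b) (ξ.obj a')).X n}
    {t : FreeMod A (o ξ B a') (dg ξ B a') b (n + 1)}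
    (ht : FreeMod.diff (bd ξ B a') (n + 1) (n + 1 + 1) rfl t = 0)
    (h : ((C.Hom (ξ.obj b) (ξ.obj a')).d n (n + 1)).hom γ = FreeMod.eval ξ (val ξ B a') (n + 1) t) :
    ∃ c : Cell ξ B a' b n, c.data = (t, γ) := by
  obtain ⟨S, hS⟩ := FreeMod.exists_sum t
  let e := S.equivFin.symm
  have hS' : t = ∑ i, FreeMod.mk (e i).1 (FreeMod.coord (e i).1 t) :=
    hS.trans ((Finset.sum_coe_sort S (fun g => FreeMod.mk g (FreeMod.coord g t))).symm.trans
      (e.sum_comp fun g : S => FreeMod.mk g.1 (FreeMod.coord g.1 t)).symm)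
  refine ⟨node b hb n γ S.card (fun i => (e i).1.1) (fun i => (e i).1.2.1)
    (fun i => FreeMod.coord (e i).1 t) fun i => (e i).1.2.2, ?_⟩
  refine (data_node_of_closed hb γ _ _ _ _ ?_ ?_).trans ?_
  · exact (congrArg (FreeMod.diff (bd ξ B a') (n + 1) (n + 1 + 1) rfl) hS'.symm).trans ht
  · exact h.trans (congrArg (FreeMod.eval ξ (val ξ B a') (n + 1)) hS')
  · exact congrArg (·, γ) hS'.symm

/-- A relative cocycle `(t, γ)` is the boundary and the image of a cell, and the generator of that
cell bounds it, with correction term `β = 0`. -/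
theorem relAcyclic {b : A.Obj} (hb : b ∈ B) :
    RelAcyclic (resolution ξ B a') ((module ξ B a').inc.tot.obj ⟨b⟩) (module ξ B a').pt := by
  intro n z γ hz hγ h
  obtain ⟨m, rfl⟩ : ∃ m, n = m + 1 := ⟨n - 1, by omega⟩
  obtain ⟨t, rfl⟩ : ∃ t, z = (module ξ B a').elt (m + 1) t := ⟨_, hz.isHom.symm⟩
  obtain ⟨y, rfl⟩ : ∃ y, γ = (tin m y : (⟨ξ.obj b⟩ : Tot C) ⟶ ⟨ξ.obj a'⟩) :=
    ⟨_, (hγ.cast (by omega : m + 1 - 1 = m)).symm⟩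
  obtain ⟨c, hc⟩ := exists_cell (ξ := ξ) (a' := a') hb (γ := y) (t := t)
    (tin_injective (X := (module ξ B a').inc.tot.obj ⟨b⟩) (Y := (module ξ B a').pt) _
      (((congrArg (tin (X := (module ξ B a').inc.tot.obj ⟨b⟩) (Y := (module ξ B a').pt) _)
        ((module ξ B a').cplx_d rfl t)).symm.trans ((dif_tin
        (X := (module ξ B a').inc.tot.obj ⟨b⟩) (Y := (module ξ B a').pt) _ _ rfl t).symm.trans
        hz.dif_eq)).trans (map_zero _).symm))
    (tin_injective (X := (⟨ξ.obj b⟩ : Tot C)) (Y := ⟨ξ.obj a'⟩) _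
      ((dif_tin (X := (⟨ξ.obj b⟩ : Tot C)) (Y := ⟨ξ.obj a'⟩) _ _ rfl y).symm.trans
        (h.trans ((module ξ B a').ext_elt ξ _ d_val t))))
  let g : Gen ξ B a' := ⟨b, m, c⟩
  refine ⟨(module ξ B a').gen g, 0, ((module ξ B a').isHom_gen g).cast (by omega : m = _),
    .zero _, ?_, ?_⟩
  · exact ((module ξ B a').dif_gen g).trans (congrArg ((module ξ B a').elt (m + 1))
      (congrArg Prod.fst hc))
  · rw [map_zero, add_zero]
    exact (((module ξ B a').ext_gen ξ _ d_val g).trans (congrArg (tin m) (congrArg Prod.snd hc))).symm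

theorem mem_of_ne : ∀ g : Gen ξ B a', g ≠ ⟨a', 0, base⟩ → g.1 ∈ B
  | ⟨_, _, base⟩, h => absurd rfl h
  | ⟨_, _, node _ hb _ _ _ _ _ _ _⟩, _ => hb

end Cell

/-! ### Passage to twisted complexes -/

theorem DGFunctor.comp_pretr {D P E : DGCat k} (F : DGFunctor D P) (G : DGFunctor P E) :
    (F.comp G).pretr = F.pretr.comp G.pretr :=
  DGFunctor.eq_of_map_eq rfl HEq.rfl

namespace Tot.IsSingle

variable {A C : DGCat k} {X Y Z : Tot A.pretr} (hX : IsSingle X) (hY : IsSingle Y)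
  (hZ : IsSingle Z)

/-- The morphism of twisted complexes with one term given by a morphism of terms. -/
def lift (f : hX.the ⟶ hY.the) : X ⟶ Y := (hX.hom_surjective hY f).choose

theorem hom_lift (f : hX.the ⟶ hY.the) : hX.hom hY (hX.lift hY f) = f :=
  (hX.hom_surjective hY f).choose_spec

theorem lift_comp (f : hX.the ⟶ hY.the) (g : hY.the ⟶ hZ.the) :
    hX.lift hY f ≫ hY.lift hZ g = hX.lift hZ (f ≫ g) :=
  hX.hom_injective hZ (by rw [hX.hom_comp hY, hom_lift, hom_lift, hom_lift])

theorem lift_id : hX.lift hX (𝟙 _) = 𝟙 X :=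
  hX.hom_injective hX (by rw [hom_lift, hom_id])

theorem dif_lift (f : hX.the ⟶ hY.the) : dif (hX.lift hY f) = hX.lift hY (dif f) :=
  hX.hom_injective hY (by rw [hom_dif, hom_lift, hom_lift])

theorem lift_sum {ι : Type*} (S : Finset ι) (f : ι → (hX.the ⟶ hY.the)) :
    hX.lift hY (∑ i ∈ S, f i) = ∑ i ∈ S, hX.lift hY (f i) :=
  hX.hom_injective hY (by simp only [hom_lift, map_sum])

theorem isHom_lift {n : ℤ} {f : hX.the ⟶ hY.the} (hf : IsHom n f) : IsHom n (hX.lift hY f) :=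
  (hX.isHom_hom hY).1 (by rwa [hom_lift])

theorem closed_lift {n : ℤ} {f : hX.the ⟶ hY.the} (hf : Closed n f) :
    Closed n (hX.lift hY f) :=
  (hX.closed_hom hY).1 (by rwa [hom_lift])

theorem tot_lift (F : DGFunctor A C) (f : hX.the ⟶ hY.the) :
    F.pretr.tot.map (hX.lift hY f) = (hX.pretr F).lift (hY.pretr F) (F.tot.map f) :=
  (hX.pretr F).hom_injective (hY.pretr F) ((hX.hom_tot hY F _).trans
    ((congrArg F.tot.map (hX.hom_lift hY f)).trans
      ((hX.pretr F).hom_lift (hY.pretr F) (F.tot.map f)).symm))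

theorem lift_equiv {f : hX.the ⟶ hY.the} (hf : Equiv f) : Equiv (hX.lift hY f) := by
  obtain ⟨g, hg, ⟨e, he, he'⟩, e₁, he₁, he₁'⟩ := (equiv_iff hf.closed).1 hf
  refine (equiv_iff (hX.closed_lift hY hf.closed)).2 ⟨hY.lift hX g, hY.closed_lift hX hg,
    ⟨hX.lift hX e, hX.isHom_lift hX he, hX.hom_injective hX ?_⟩,
    hY.lift hY e₁, hY.isHom_lift hY he₁, hY.hom_injective hY ?_⟩
  · rw [hom_dif, hom_lift, he', map_sub, hX.hom_comp hY, hom_lift, hom_lift, hom_id]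
  · rw [hom_dif, hom_lift, he₁', map_sub, hY.hom_comp hX, hom_lift, hom_lift, hom_id]

theorem contractible_iff : Contractible hX.the ↔ Contractible X := by
  constructor
  · rintro ⟨e, he, he'⟩
    refine ⟨hX.lift hX e, hX.isHom_lift hX he, ?_⟩
    rw [dif_lift, he', lift_id]
  · rintro ⟨e, he, he'⟩
    refine ⟨hX.hom hX e, (hX.isHom_hom hX).2 he, ?_⟩
    rw [← hom_dif, he', hom_id]

end Tot.IsSingle

theorem Tot.single_mem_trSet {A : DGCat k} {B : Set A.Obj} {a : Tot A} (h : a.obj ∈ B) :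
    single a ∈ trSet B := fun _ => h

/-- The morphisms `u g` form a basis of a right module over `D`, with `u g₀` closed, the others
at objects of `B`, and boundaries of lower rank. -/
structure IsCellular {D P : DGCat k} (I : DGFunctor D P) (B : Set D.Obj) {Q : Tot P} {G : Type u}
    (o : G → Tot D) (u : ∀ g, I.tot.obj (o g) ⟶ Q) (g₀ : G) : Prop where
  isFreeOn (X : Tot D) : IsFreeOn I o u X
  closed : Closed 0 (u g₀)
  mem (g : G) (hg : g ≠ g₀) : (o g).obj ∈ B
  exists_isHom (g : G) : ∃ n, IsHom n (u g)
  exists_rank : ∃ rk : G → ℕ, ∀ g, ∃ (S : Finset G) (c : ∀ f, o g ⟶ o f),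
    (∀ f ∈ S, rk f < rk g) ∧ dif (u g) = ∑ f ∈ S, I.tot.map (c f) ≫ u f

section

variable {D P E : DGCat k} {I : DGFunctor D P} {B : Set D.Obj} {Q : Tot P} {G : Type u}
  {o : G → Tot D} {u : ∀ g, I.tot.obj (o g) ⟶ Q} {g₀ : G}

variable (I) in
/-- A morphism to `Q`, as a morphism of twisted complexes with one term. -/
def toSingle {a : Tot D} (f : I.tot.obj a ⟶ Q) : I.pretr.tot.obj (single a) ⟶ single Q :=
  ((isSingle_single a).pretr I).lift (isSingle_single Q) f

theorem isFreeOn_single {X : Tot D.pretr} (hX : IsSingle X) (h : IsFreeOn I o u hX.the) :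
    IsFreeOn I.pretr (fun g => single (o g)) (fun g => toSingle I (u g)) X := by
  have key : ∀ (S : Finset G) (c : ∀ g, X ⟶ single (o g)),
      (hX.pretr I).hom (isSingle_single Q) (∑ g ∈ S, I.pretr.tot.map (c g) ≫ toSingle I (u g)) =
        ∑ g ∈ S, I.tot.map (hX.hom (isSingle_single (o g)) (c g)) ≫ u g := by
    intro S c
    rw [map_sum]
    refine Finset.sum_congr rfl fun g _ => ?_
    refine ((hX.pretr I).hom_comp ((isSingle_single (o g)).pretr I) (isSingle_single Q)
      _ _).trans ?_
    exact congrArg₂ (· ≫ ·) (hX.hom_tot (isSingle_single (o g)) I (c g))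
      (((isSingle_single (o g)).pretr I).hom_lift (isSingle_single Q) (u g))
  constructor
  · intro w
    obtain ⟨S, c, hc⟩ := h.exists_sum ((hX.pretr I).hom (isSingle_single Q) w)
    refine ⟨S, fun g => hX.lift (isSingle_single (o g)) (c g),
      (hX.pretr I).hom_injective (isSingle_single Q) (hc.trans ?_)⟩
    rw [key]
    refine Finset.sum_congr rfl fun g _ => ?_
    exact congrArg (fun f => I.tot.map f ≫ u g)
      (hX.hom_lift (isSingle_single (o g)) (c g)).symm
  · intro S c hc g hg
    refine hX.hom_injective (isSingle_single (o g)) ?_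
    rw [map_zero]
    refine h.eq_zero S (fun g => hX.hom (isSingle_single (o g)) (c g)) ?_ g hg
    refine (key S c).symm.trans ?_
    rw [hc, map_zero]
    rfl

/-- Freeness on objects of `D` passes to twisted complexes by dévissage in the source, with the same
basis. -/
theorem isFreeOn_pretr (h : ∀ X, IsFreeOn I o u X) (X : Tot D.pretr) :
    IsFreeOn I.pretr (fun g => single (o g)) (fun g => toSingle I (u g)) X := by
  have single : ∀ X : Tot D.pretr, X.tw.n = 1 →
      IsFreeOn I.pretr (fun g => single (o g)) (fun g => toSingle I (u g)) X := by
    intro X hX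
    obtain ⟨i, m, σ, σ', -, -, h₁, -⟩ := exists_iso_single X hX
    exact (isFreeOn_single (isSingle_single _) (h _)).of_iso h₁
  induction X using pretr_induction with
  | zero X hX => exact .of_id_eq_zero hX
  | single X hX => exact single X hX
  | cone c h₁ _ h₂ => exact h₁.cone c h₂

/-- Cells can be assembled into finite stages only among twisted complexes, so the notion over `D`
is transported to `I.pretr` before `isSemifree_of_isFreeOn` is applied. -/
theorem IsCellular.isSemifree (h : IsCellular I B o u g₀) :
    IsSemifree I.pretr (trSet B) (toSingle I (u g₀)) := by
  obtain ⟨rk, hrk⟩ := h.exists_rank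
  choose dg hdg using h.exists_isHom
  refine isSemifree_of_isFreeOn (u := fun g => toSingle I (u g)) (isPretriangulated_trSet B)
    (isFreeOn_pretr h.isFreeOn)
    (IsSingle.closed_lift _ _ h.closed) (fun g hg => single_mem_trSet (h.mem g hg)) rk
    (dg := dg) (fun g => IsSingle.isHom_lift _ _ (hdg g)) fun g => ?_
  obtain ⟨S, c, hS, hc⟩ := hrk g
  refine ⟨S, fun f => (isSingle_single (o g)).lift (isSingle_single (o f)) (c f), hS, ?_⟩
  refine (IsSingle.dif_lift _ _ _).trans ((congrArg _ hc).trans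
    ((IsSingle.lift_sum _ _ _ _).trans (Finset.sum_congr rfl fun f _ => ?_)))
  refine ((congrArg (· ≫ toSingle I (u f)) ((isSingle_single (o g)).tot_lift
    (isSingle_single (o f)) I (c f))).trans (IsSingle.lift_comp _ _ _ _ _)).symm

variable {Ξ : DGFunctor P E}

theorem relAcyclic_pretr_of_mem (h : ∀ b ∈ B, RelAcyclic Ξ (I.tot.obj ⟨b⟩) Q) (X : Tot D.pretr)
    (hX : X ∈ trSet B) : RelAcyclic Ξ.pretr (I.pretr.tot.obj X) (single Q) := by
  refine trSet_induction (P := fun X => RelAcyclic Ξ.pretr (I.pretr.tot.obj X) (single Q)) ?_ ?_ ?_ X hX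
  · exact fun X hX =>
      .of_id_eq_zero (by rw [← I.pretr.tot.map_id, hX, I.pretr.tot.map_zero])
  · exact fun X hX hXB => .of_size_one hX (isSingle_single Q) fun i => h _ (hXB i)
  · exact fun c h₁ h₂ => h₁.cone (c.map I.pretr) h₂

theorem relAcyclic_pretr_iff :
    (∀ X, RelAcyclic Ξ.pretr (I.pretr.tot.obj X) (single Q)) ↔
      ∀ a, RelAcyclic Ξ (I.tot.obj a) Q := by
  constructor
  · exact fun h a => (((isSingle_single a).pretr I).relAcyclic_iff (isSingle_single Q) Ξ).2 (h _)
  -- Taking all objects of `D` for `B`, membership in `trSet` becomes vacuous.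
  · exact fun h X => relAcyclic_pretr_of_mem (B := Set.univ) (fun b _ => h ⟨b⟩) X
      fun _ => trivial

variable {e' : Ξ.tot.obj Q ⟶ Ξ.tot.obj (I.tot.obj (o g₀))}

variable (Ξ) in
/-- A morphism from the image of `Q`, as a morphism of twisted complexes with one term. -/
def fromSingle {a : Tot D} (f : Ξ.tot.obj Q ⟶ Ξ.tot.obj (I.tot.obj a)) :
    Ξ.pretr.tot.obj (single Q) ⟶ Ξ.pretr.tot.obj (I.pretr.tot.obj (single a)) :=
  ((isSingle_single Q).pretr Ξ).lift (((isSingle_single a).pretr I).pretr Ξ) f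

theorem toSingle_comp_fromSingle {a : Tot D} {f : I.tot.obj a ⟶ Q}
    {f' : Ξ.tot.obj Q ⟶ Ξ.tot.obj (I.tot.obj a)} (h : Ξ.tot.map f ≫ f' = 𝟙 _) :
    Ξ.pretr.tot.map (toSingle I f) ≫ fromSingle Ξ f' = 𝟙 _ := by
  refine (congrArg (· ≫ fromSingle Ξ f')
    (((isSingle_single a).pretr I).tot_lift (isSingle_single Q) Ξ f)).trans ?_
  exact (IsSingle.lift_comp _ _ _ _ _).trans ((congrArg _ h).trans (IsSingle.lift_id _))

theorem fromSingle_comp_toSingle {a : Tot D} {f : I.tot.obj a ⟶ Q}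
    {f' : Ξ.tot.obj Q ⟶ Ξ.tot.obj (I.tot.obj a)} (h : f' ≫ Ξ.tot.map f = 𝟙 _) :
    fromSingle Ξ f' ≫ Ξ.pretr.tot.map (toSingle I f) = 𝟙 _ := by
  refine (congrArg (fromSingle Ξ f' ≫ ·)
    (((isSingle_single a).pretr I).tot_lift (isSingle_single Q) Ξ f)).trans ?_
  exact (IsSingle.lift_comp _ _ _ _ _).trans ((congrArg _ h).trans (IsSingle.lift_id _))

/-- Acyclicity of the fibre spreads from the objects of `B`, where it is built in, to all objects of
`D`. The argument needs twisted complexes, while its hypothesis `hB` and conclusion concern plain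
objects. -/
theorem IsCellular.relAcyclic (h : IsCellular I B o u g₀) (he' : Closed 0 e')
    (h₁ : Ξ.tot.map (u g₀) ≫ e' = 𝟙 _) (h₂ : e' ≫ Ξ.tot.map (u g₀) = 𝟙 _)
    (hB : ∀ b ∈ B, RelAcyclic Ξ (I.tot.obj ⟨b⟩) Q)
    (hcon : ∀ b ∈ trSet B, Contractible ((I.comp Ξ).pretr.tot.obj b))
    (hvan : ∀ Y, RelVanish (I.comp Ξ).pretr (trSet B) Y) (a : Tot D) :
    RelAcyclic Ξ (I.tot.obj a) Q := by
  rw [I.comp_pretr Ξ] at hvan hcon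
  exact relAcyclic_pretr_iff.1 (h.isSemifree.relAcyclic (e' := fromSingle Ξ e')
    (IsSingle.closed_lift _ _ he') (toSingle_comp_fromSingle h₁) (fromSingle_comp_toSingle h₂)
    (relAcyclic_pretr_of_mem hB) hcon hvan) a

theorem IsCellular.relVanish (h : IsCellular I B o u g₀) (he' : Closed 0 e')
    (h₁ : Ξ.tot.map (u g₀) ≫ e' = 𝟙 _) (hac : ∀ a, RelAcyclic Ξ (I.tot.obj a) Q) :
    RelVanish (I.comp Ξ).pretr (trSet B) (single (o g₀)) := by
  rw [I.comp_pretr Ξ]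
  exact h.isSemifree.relVanish (isPretriangulated_trSet B) (e' := fromSingle Ξ e')
    (IsSingle.closed_lift _ _ h.closed) (IsSingle.closed_lift _ _ he')
    (toSingle_comp_fromSingle h₁) (relAcyclic_pretr_iff.2 hac)

end

namespace Cell

variable {A C : DGCat k} (ξ : DGFunctor A C) (B : Set A.Obj) (a' : A.Obj)

/-- The generator which is the identity of `a'`. -/
abbrev zeroGen : (module ξ B a').G := (⟨a', 0, base⟩ : Gen ξ B a')

theorem isCellular : IsCellular (module ξ B a').inc B (fun g => ⟨(module ξ B a').o g⟩)
    (module ξ B a').gen (zeroGen ξ B a') where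
  isFreeOn := (module ξ B a').isFreeOn
  closed := ⟨(module ξ B a').isHom_gen _,
    ((module ξ B a').dif_gen _).trans (map_zero ((module ξ B a').elt (0 + 1)))⟩
  mem g hg := mem_of_ne g hg
  exists_isHom g := ⟨_, (module ξ B a').isHom_gen g⟩
  exists_rank := ⟨fun g : Gen ξ B a' => g.2.2.depth, (module ξ B a').exists_dif_gen _ depth_lt⟩

theorem resolution_zeroGen :
    (resolution ξ B a').tot.map ((module ξ B a').gen (zeroGen ξ B a')) = 𝟙 (⟨ξ.obj a'⟩ : Tot C) :=
  (module ξ B a').ext_gen ξ _ d_val _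

/-- The inverse of the image of the generator which is the identity of `a'`. -/
def zeroGenInv : (resolution ξ B a').tot.obj (module ξ B a').pt ⟶
    (resolution ξ B a').tot.obj ((module ξ B a').inc.tot.obj ⟨a'⟩) :=
  𝟙 (⟨ξ.obj a'⟩ : Tot C)

theorem map_zeroGen_comp : (resolution ξ B a').tot.map ((module ξ B a').gen (zeroGen ξ B a')) ≫
    zeroGenInv ξ B a' = 𝟙 _ :=
  (congrArg (· ≫ 𝟙 (⟨ξ.obj a'⟩ : Tot C)) (resolution_zeroGen ξ B a')).trans (Category.id_comp _)

theorem zeroGenInv_comp_map : zeroGenInv ξ B a' ≫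
    (resolution ξ B a').tot.map ((module ξ B a').gen (zeroGen ξ B a')) = 𝟙 _ :=
  (congrArg (𝟙 (⟨ξ.obj a'⟩ : Tot C) ≫ ·) (resolution_zeroGen ξ B a')).trans (Category.comp_id _)

theorem closed_zeroGenInv : Closed 0 (zeroGenInv ξ B a') := .id (⟨ξ.obj a'⟩ : Tot C)

theorem inc_comp_resolution : (module ξ B a').inc.comp (resolution ξ B a') = ξ :=
  (module ξ B a').inc_comp_ext ξ _ d_val

-- The morphisms to `pt` form a semifree model of `Hom(ξ -, ξ a')` on all of `A`. This is the form
-- in which the quotient property can be tensored with `K`.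
variable {ξ B} in
theorem relAcyclic_resolution (hcon : ∀ b ∈ trSet B, Contractible (ξ.pretr.tot.obj b))
    (hvan : ∀ Y, RelVanish ξ.pretr (trSet B) Y) (a : A.Obj) :
    RelAcyclic (resolution ξ B a') ((module ξ B a').inc.tot.obj ⟨a⟩) (module ξ B a').pt := by
  have hcon' : ∀ b ∈ trSet B,
      Contractible (((module ξ B a').inc.comp (resolution ξ B a')).pretr.tot.obj b) := by
    rwa [inc_comp_resolution]
  have hvan' : ∀ Y, RelVanish ((module ξ B a').inc.comp (resolution ξ B a')).pretr (trSet B) Y := by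
    rwa [inc_comp_resolution]
  refine IsCellular.relAcyclic (I := (module ξ B a').inc) (Q := (module ξ B a').pt)
    (G := Gen ξ B a') (g₀ := zeroGen ξ B a') (Ξ := resolution ξ B a') (e' := zeroGenInv ξ B a')
    (B := B) (a := ⟨a⟩) (h := isCellular ξ B a') ?_ ?_ ?_ ?_ hcon' hvan'
  · exact closed_zeroGenInv ξ B a'
  · exact map_zeroGen_comp ξ B a'
  · exact zeroGenInv_comp_map ξ B a'
  · exact fun b hb => relAcyclic hb

end Cell

/-! ### Acyclicity of fibers and tensor products -/

theorem acyclic_iff {M : Cplx k} : M.Acyclic ↔ ∀ (n n' n'' : ℤ) (_ : n + 1 = n') (_ : n' + 1 = n'')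
    (x : M.X n'), (M.d n' n'').hom x = 0 → ∃ y : M.X n, (M.d n n').hom y = x := by
  constructor
  · intro h n n' n'' h₁ h₂ x hx
    have := (M.exactAt_iff' n n' n'' (by simp; omega) (by simp; omega)).1 (h n')
    exact (ShortComplex.moduleCat_exact_iff _).1 this x hx
  · intro h n
    rw [M.exactAt_iff' (n - 1) n (n + 1) (by simp) (by simp), ShortComplex.moduleCat_exact_iff]
    exact fun x hx => h (n - 1) n (n + 1) (by omega) rfl x hx

/-- The cone of a morphism of complexes is acyclic. -/
def ConeAcyclic {M N : Cplx k} (f : M ⟶ N) : Prop :=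
  ∀ (l m n n' : ℤ) (_ : l + 1 = m) (_ : m + 1 = n) (_ : n + 1 = n') (z : M.X n) (γ : N.X m),
    (M.d n n').hom z = 0 → (N.d m n).hom γ = (f.f n).hom z →
      ∃ (α : M.X m) (β : N.X l), (M.d m n).hom α = z ∧ γ = (f.f m).hom α + (N.d l m).hom β

section

variable {M N L : Cplx k} (f : M ⟶ N)

/-- Change of degree, as a linear map. -/
def degLin (N : Cplx k) (m n : ℤ) (h : m = n) : N.X m →ₗ[k] N.X n := h ▸ LinearMap.id

theorem d_degLin (m n m' n' : ℤ) (h : m = n) (h' : m' = n') (x : N.X m) :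
    (N.d n n').hom (degLin N m n h x) = degLin N m' n' h' ((N.d m m').hom x) := by
  subst h h'; rfl

theorem degLin_degLin (m n l : ℤ) (h : m = n) (h' : n = l) (x : N.X m) :
    degLin N n l h' (degLin N m n h x) = degLin N m l (h.trans h') x := by
  subst h h'; rfl

theorem degLin_self (n : ℤ) (h : n = n) (x : N.X n) : degLin N n n h x = x := rfl

/-- The differential of the fiber of a morphism of complexes. -/
def fiberD (n n' : ℤ) (h : n + 1 = n') :
    (M.X n × N.X (n - 1)) →ₗ[k] (M.X n' × N.X (n' - 1)) :=
  LinearMap.prod ((M.d n n').hom ∘ₗ LinearMap.fst k _ _)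
    (degLin N n (n' - 1) (by omega) ∘ₗ (f.f n).hom ∘ₗ LinearMap.fst k _ _ -
      (N.d (n - 1) (n' - 1)).hom ∘ₗ LinearMap.snd k _ _)

/-- The fiber of a morphism of complexes. -/
def fiber : Cplx k where
  X n := ModuleCat.of k (M.X n × N.X (n - 1))
  d n n' := if h : n + 1 = n' then ModuleCat.ofHom (fiberD f n n' h) else 0
  shape n n' h := dif_neg h
  d_comp_d' n n' n'' h h' := by
    have e : n + 1 = n' := h
    have e' : n' + 1 = n'' := h'
    rw [dif_pos e, dif_pos e']
    refine ModuleCat.hom_ext (LinearMap.ext fun t => ?_)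
    have h₁ : (M.d n' n'').hom ((M.d n n').hom t.1) = 0 :=
      congrArg (fun φ => φ.hom t.1) (M.d_comp_d n n' n'')
    have h₂ : (N.d (n' - 1) (n'' - 1)).hom ((N.d (n - 1) (n' - 1)).hom t.2) = 0 :=
      congrArg (fun φ => φ.hom t.2) (N.d_comp_d (n - 1) (n' - 1) (n'' - 1))
    have h₃ : (f.f n').hom ((M.d n n').hom t.1) = (N.d n n').hom ((f.f n).hom t.1) :=
      (congrArg (fun φ => φ.hom t.1) (f.comm n n')).symm
    refine Prod.ext h₁ ?_
    change degLin N n' (n'' - 1) _ ((f.f n').hom ((M.d n n').hom t.1)) -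
      (N.d (n' - 1) (n'' - 1)).hom (degLin N n (n' - 1) _ ((f.f n).hom t.1) -
        (N.d (n - 1) (n' - 1)).hom t.2) = 0
    rw [h₃, map_sub, h₂, d_degLin n (n' - 1) n' (n'' - 1) (by omega) (by omega), sub_zero,
      sub_self]

theorem fiber_d (n n' : ℤ) (h : n + 1 = n') (t : (fiber f).X n) :
    ((fiber f).d n n').hom t = fiberD f n n' h t := by
  have : (fiber f).d n n' = ModuleCat.ofHom (fiberD f n n' h) := dif_pos h
  rw [this]; rfl

/-- A cocycle of the fibre is a pair `(z, γ)` as in `ConeAcyclic`; the differential `(x, y) ↦ (d x,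
f x - d y)` explains the sign of `β` in the witness. -/
theorem acyclic_fiber (hf : ConeAcyclic f) : (fiber f).Acyclic := by
  rw [acyclic_iff]
  intro n n' n'' h h' x hx
  rw [fiber_d f n' n'' h'] at hx
  have h₁ := congrArg Prod.fst hx
  have h₂ : degLin N n' (n'' - 1) _ ((f.f n').hom x.1) - (N.d (n' - 1) (n'' - 1)).hom x.2 = 0 :=
    congrArg Prod.snd hx
  obtain ⟨α, β, hα, hβ⟩ := hf (n - 1) n n' n'' (by omega) h h' x.1
    (degLin N (n' - 1) n (by omega) x.2) h₁ (by
      rw [d_degLin (n' - 1) n (n'' - 1) n' (by omega) (by omega), ← sub_eq_zero.1 h₂,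
        degLin_degLin, degLin_self])
  refine ⟨(α, - β), ?_⟩
  refine (fiber_d f n n' h (α, -β)).trans (Prod.ext hα ?_)
  change degLin N n (n' - 1) _ ((f.f n).hom α) - (N.d (n - 1) (n' - 1)).hom (- β) = x.2
  have h₃ : degLin N n (n' - 1) (by omega) (degLin N (n' - 1) n (by omega) x.2) = x.2 :=
    degLin_degLin _ _ _ _ _ _
  rw [← h₃, hβ, map_add, map_neg, sub_neg_eq_add]
  congr 1
  exact (d_degLin (n - 1) (n - 1) n (n' - 1) rfl (by omega) β)

/-- The map of degree `s` of tensor products given by a map of degree `s` of the left factors. -/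
def tshift (L : Cplx k) {s : ℤ} (φ : ∀ p p' : ℤ, p + s = p' → (M.X p →ₗ[k] N.X p')) (n n' : ℤ)
    (h : n + s = n') : (M ⊗ L).X n →ₗ[k] (N ⊗ L).X n' :=
  tlift fun p q hp => tmul N L (p + s) q n' (by omega) ∘ₗ φ p (p + s) rfl

theorem tshift_tmul {s : ℤ} (φ : ∀ p p' : ℤ, p + s = p' → (M.X p →ₗ[k] N.X p')) (n n' : ℤ)
    (h : n + s = n') (p q p' : ℤ) (hp : p + q = n) (hp' : p + s = p') (x : M.X p) (y : L.X q) :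
    tshift L φ n n' h (tmul M L p q n hp x y) =
      tmul N L p' q n' (by omega) (φ p p' hp' x) y := by
  subst hp'
  exact tlift_tmul _ _ _ _ _ _

end

section

variable {M N L : Cplx k} (f : M ⟶ N)

/-- The inclusion in the fiber of the first summand. -/
def fiberInl (p p' : ℤ) (h : p + 0 = p') : M.X p →ₗ[k] (fiber f).X p' :=
  LinearMap.inl k _ _ ∘ₗ degLin M p p' (by omega)

/-- The inclusion in the fiber of the second summand. -/
def fiberInr (p p' : ℤ) (h : p + 1 = p') : N.X p →ₗ[k] (fiber f).X p' :=
  LinearMap.inr k _ _ ∘ₗ degLin N p (p' - 1) (by omega)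

/-- The projection of the fiber to the first summand. -/
def fiberFst (p p' : ℤ) (h : p + 0 = p') : (fiber f).X p →ₗ[k] M.X p' :=
  degLin M p p' (by omega) ∘ₗ LinearMap.fst k _ _

/-- The projection of the fiber to the second summand. -/
def fiberSnd (p p' : ℤ) (h : p + (-1) = p') : (fiber f).X p →ₗ[k] N.X p' :=
  degLin N (p - 1) p' (by omega) ∘ₗ LinearMap.snd k _ _

theorem d_fiberInl (p p' : ℤ) (h : p + 1 = p') (x : M.X p) :
    ((fiber f).d p p').hom (fiberInl f p p (by omega) x) =
      fiberInl f p' p' (by omega) ((M.d p p').hom x) + fiberInr f p p' h ((f.f p).hom x) := by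
  rw [fiber_d f p p' h]
  refine Prod.ext ?_ ?_
  · exact (add_zero ((M.d p p').hom x)).symm
  · refine Eq.trans ?_ (zero_add (degLin N p (p' - 1) (by omega) ((f.f p).hom x))).symm
    change degLin N p (p' - 1) _ ((f.f p).hom x) - (N.d (p - 1) (p' - 1)).hom 0 = _
    rw [map_zero, sub_zero]

theorem d_fiberInr (p p' p'' : ℤ) (h : p + 1 = p') (h' : p' + 1 = p'') (x : N.X p) :
    ((fiber f).d p' p'').hom (fiberInr f p p' h x) =
      - fiberInr f p' p'' h' ((N.d p p').hom x) := by
  rw [fiber_d f p' p'' h']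
  refine Prod.ext ?_ ?_
  · exact (map_zero (M.d p' p'').hom).trans neg_zero.symm
  · change degLin N p' (p'' - 1) _ ((f.f p').hom 0) - (N.d (p' - 1) (p'' - 1)).hom
      (degLin N p (p' - 1) _ x) = - degLin N p' (p'' - 1) _ ((N.d p p').hom x)
    rw [map_zero, map_zero, zero_sub, d_degLin p (p' - 1) p' (p'' - 1) (by omega) (by omega)]

theorem fiberFst_d (p p' : ℤ) (h : p + 1 = p') (x : (fiber f).X p) :
    fiberFst f p' p' (by omega) (((fiber f).d p p').hom x) =
      (M.d p p').hom (fiberFst f p p (by omega) x) := by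
  rw [fiber_d f p p' h]; rfl

theorem fiberSnd_d (p p' p'' : ℤ) (h : p' + (-1) = p) (h' : p + (-1) = p'') (x : (fiber f).X p) :
    fiberSnd f p' p h (((fiber f).d p p').hom x) =
      (f.f p).hom (fiberFst f p p (by omega) x) -
        (N.d p'' p).hom (fiberSnd f p p'' h' x) := by
  rw [fiber_d f p p' (by omega)]
  change degLin N (p' - 1) p _ (degLin N p (p' - 1) _ ((f.f p).hom x.1) -
    (N.d (p - 1) (p' - 1)).hom x.2) = (f.f p).hom x.1 - (N.d p'' p).hom (degLin N (p - 1) p'' _ x.2)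
  rw [map_sub, degLin_degLin, degLin_self, d_degLin (p - 1) p'' (p' - 1) p (by omega) (by omega)]

theorem fiberSnd_fiberInr (p p' : ℤ) (h : p + 1 = p') (h' : p' + (-1) = p) (x : N.X p) :
    fiberSnd f p' p h' (fiberInr f p p' h x) = x := degLin_degLin _ _ _ _ _ _

theorem fiberFst_fiberInr (p p' p'' : ℤ) (h : p + 1 = p') (h' : p' + 0 = p'') (x : N.X p) :
    fiberFst f p' p'' h' (fiberInr f p p' h x) = 0 :=
  map_zero (degLin M p' p'' (by omega))

theorem fiberSnd_fiberInl (p p' p'' : ℤ) (h : p + 0 = p') (h' : p' + (-1) = p'') (x : M.X p) :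
    fiberSnd f p' p'' h' (fiberInl f p p' h x) = 0 :=
  map_zero (degLin N (p' - 1) p'' (by omega))

/-- This and the next three lemmas say that the fibre of `f` tensored with `L` has the differential
of the fibre of `f ⊗ 𝟙`. They are stated through inclusions and projections, so no isomorphism
between the two complexes has to be constructed. -/
theorem d_tshift_fiberInl (n n' : ℤ) (h : n + 1 = n') (z : (M ⊗ L).X n) :
    ((fiber f ⊗ L : Cplx k).d n n').hom (tshift L (fiberInl f) n n (by omega) z) =
      tshift L (fiberInl f) n' n' (by omega) (((M ⊗ L : Cplx k).d n n').hom z) +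
        tshift L (fiberInr f) n n' h (((f ⊗ₘ 𝟙 L).f n).hom z) := by
  induction z using tensor_induction with
  | hadd a b ha hb => simp only [map_add, ha, hb]; abel
  | htmul p q hp x y =>
    have e := tensorHom_tmul f (𝟙 L) p q n hp x y
    rw [e, d_tmul M L p q n (p + 1) (q + 1) n' hp rfl rfl h, map_add,
      tshift_tmul _ _ _ _ p q p hp (by omega), Units.smul_def, map_zsmul,
      tshift_tmul _ _ _ _ _ q _ _ (add_zero (p + 1)), tshift_tmul _ _ _ _ p _ p _ (by omega),
      tshift_tmul _ _ _ _ p q (p + 1) hp rfl,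
      d_tmul (fiber f) L p q n (p + 1) (q + 1) n' hp rfl rfl h, d_fiberInl f p (p + 1) rfl,
      map_add, LinearMap.add_apply, Units.smul_def]
    change _ = _ + tmul (fiber f) L (p + 1) q n' _ (fiberInr f p (p + 1) _ ((f.f p).hom x)) y
    abel

theorem d_tshift_fiberInr (n n' n'' : ℤ) (h : n + 1 = n') (h' : n' + 1 = n'') (z : (N ⊗ L).X n) :
    ((fiber f ⊗ L : Cplx k).d n' n'').hom (tshift L (fiberInr f) n n' h z) =
      - tshift L (fiberInr f) n' n'' h' (((N ⊗ L : Cplx k).d n n').hom z) := by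
  induction z using tensor_induction with
  | hadd a b ha hb => simp only [map_add, ha, hb]; abel
  | htmul p q hp x y =>
    rw [d_tmul N L p q n (p + 1) (q + 1) n' hp rfl rfl h, map_add,
      tshift_tmul _ _ _ _ p q (p + 1) hp rfl, Units.smul_def, map_zsmul,
      tshift_tmul _ _ _ _ (p + 1) q (p + 2) (by omega) (by omega),
      tshift_tmul _ _ _ _ p _ (p + 1) _ rfl,
      d_tmul (fiber f) L (p + 1) q n' (p + 2) (q + 1) n'' (by omega) (by omega) rfl h',
      d_fiberInr f p (p + 1) (p + 2) rfl (by omega), Int.negOnePow_succ]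
    simp only [map_neg, LinearMap.neg_apply, Units.smul_def, Units.val_neg, neg_smul]
    abel

theorem tshift_fiberFst_d (n n' : ℤ) (h : n + 1 = n') (z : (fiber f ⊗ L : Cplx k).X n) :
    tshift L (fiberFst f) n' n' (by omega) (((fiber f ⊗ L : Cplx k).d n n').hom z) =
      ((M ⊗ L : Cplx k).d n n').hom (tshift L (fiberFst f) n n (by omega) z) := by
  induction z using tensor_induction with
  | hadd a b ha hb => simp only [map_add, ha, hb]
  | htmul p q hp x y =>
    rw [d_tmul (fiber f) L p q n (p + 1) (q + 1) n' hp rfl rfl h, map_add,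
      tshift_tmul _ _ _ _ p q p hp (by omega), Units.smul_def, map_zsmul,
      tshift_tmul _ _ _ _ _ q _ _ (add_zero (p + 1)), tshift_tmul _ _ _ _ p _ p _ (by omega),
      d_tmul M L p q n (p + 1) (q + 1) n' hp rfl rfl h, fiberFst_d f p (p + 1) rfl]
    rfl

theorem tshift_fiberSnd_d (n n' n'' : ℤ) (h : n' + (-1) = n) (h' : n + (-1) = n'')
    (z : (fiber f ⊗ L : Cplx k).X n) :
    tshift L (fiberSnd f) n' n h (((fiber f ⊗ L : Cplx k).d n n').hom z) =
      ((f ⊗ₘ 𝟙 L).f n).hom (tshift L (fiberFst f) n n (by omega) z) -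
        ((N ⊗ L : Cplx k).d n'' n).hom (tshift L (fiberSnd f) n n'' h' z) := by
  induction z using tensor_induction with
  | hadd a b ha hb => simp only [map_add, ha, hb]; abel
  | htmul p q hp x y =>
    have e := tensorHom_tmul f (𝟙 L) p q n hp (fiberFst f p p (by omega) x) y
    rw [d_tmul (fiber f) L p q n (p + 1) (q + 1) n' hp rfl rfl (by omega), map_add,
      tshift_tmul _ _ _ _ p q p hp (by omega), e, Units.smul_def, map_zsmul,
      tshift_tmul _ _ _ _ (p + 1) q p (by omega) (by omega),
      tshift_tmul _ _ _ _ p (q + 1) (p - 1) (by omega) (by omega),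
      tshift_tmul _ _ _ _ p q (p - 1) hp (by omega),
      d_tmul N L (p - 1) q n'' p (q + 1) n (by omega) (by omega) rfl (by omega),
      fiberSnd_d f p (p + 1) (p - 1) (by omega) (by omega), Int.negOnePow_sub, Int.negOnePow_one]
    simp only [map_sub, LinearMap.sub_apply, Units.smul_def, mul_neg, mul_one, Units.val_neg,
      neg_smul]
    change tmul N L p q n _ ((f.f p).hom (fiberFst f p p _ x)) y - _ + _ =
      tmul N L p q n _ ((f.f p).hom (fiberFst f p p _ x)) y - _
    abel

theorem tshift_fiberFst_add (n m : ℤ) (h : m + 1 = n) (z : (M ⊗ L : Cplx k).X n)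
    (γ : (N ⊗ L : Cplx k).X m) : tshift L (fiberFst f) n n (by omega)
      (tshift L (fiberInl f) n n (by omega) z + tshift L (fiberInr f) m n h γ) = z := by
  have h₁ : tshift L (fiberFst f) n n (by omega) (tshift L (fiberInl f) n n (by omega) z) = z := by
    induction z using tensor_induction with
    | hadd a b ha hb => simp only [map_add, ha, hb]
    | htmul p q hp x y =>
      rw [tshift_tmul _ _ _ _ p q p hp (by omega), tshift_tmul _ _ _ _ p q p hp (by omega)]
      rfl
  have h₂ : tshift L (fiberFst f) n n (by omega) (tshift L (fiberInr f) m n h γ) = 0 := by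
    induction γ using tensor_induction with
    | hadd a b ha hb => simp only [map_add, ha, hb, add_zero]
    | htmul p q hp x y =>
      rw [tshift_tmul _ _ _ _ p q (p + 1) hp rfl,
        tshift_tmul _ _ _ _ (p + 1) q (p + 1) (by omega) (by omega)]
      rw [fiberFst_fiberInr, map_zero, LinearMap.zero_apply]
  rw [map_add, h₁, h₂, add_zero]

theorem tshift_fiberSnd_add (n m : ℤ) (h : m + 1 = n) (z : (M ⊗ L : Cplx k).X n)
    (γ : (N ⊗ L : Cplx k).X m) : tshift L (fiberSnd f) n m (by omega)
      (tshift L (fiberInl f) n n (by omega) z + tshift L (fiberInr f) m n h γ) = γ := by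
  have h₁ : tshift L (fiberSnd f) n m (by omega) (tshift L (fiberInl f) n n (by omega) z) = 0 := by
    induction z using tensor_induction with
    | hadd a b ha hb => simp only [map_add, ha, hb, add_zero]
    | htmul p q hp x y =>
      rw [tshift_tmul _ _ _ _ p q p hp (by omega),
        tshift_tmul _ _ _ _ p q (p - 1) (by omega) (by omega)]
      rw [fiberSnd_fiberInl, map_zero, LinearMap.zero_apply]
  have h₂ : tshift L (fiberSnd f) n m (by omega) (tshift L (fiberInr f) m n h γ) = γ := by
    induction γ using tensor_induction with
    | hadd a b ha hb => simp only [map_add, ha, hb]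
    | htmul p q hp x y =>
      rw [tshift_tmul _ _ _ _ p q (p + 1) hp rfl,
        tshift_tmul _ _ _ _ (p + 1) q p (by omega) (by omega), fiberSnd_fiberInr]
  rw [map_add, h₁, h₂, zero_add]

/-- A cocycle `(z, γ)` for `f ⊗ 𝟙` is put into the acyclic complex `fiber f ⊗ L` by the two
inclusions; the two projections of a bound there are the required `α` and, up to sign, `β`. -/
theorem ConeAcyclic.tensor {f : M ⟶ N} (hf : ConeAcyclic f)
    (hL : ∀ E : Cplx k, E.Acyclic → (E ⊗ L : Cplx k).Acyclic) : ConeAcyclic (f ⊗ₘ 𝟙 L) := by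
  intro l m n n' hl hm hn z γ hz hγ
  have hE := acyclic_iff.1 (hL _ (acyclic_fiber f hf))
  obtain ⟨v, hv⟩ := hE m n n' hm hn
    (tshift L (fiberInl f) n n (by omega) z + tshift L (fiberInr f) m n hm γ) (by
      rw [map_add, d_tshift_fiberInl f n n' hn, d_tshift_fiberInr f m n n' hm hn, hz, hγ, map_zero,
        zero_add, add_neg_cancel])
  refine ⟨tshift L (fiberFst f) m m (by omega) v, - tshift L (fiberSnd f) m l (by omega) v, ?_, ?_⟩
  · rw [← tshift_fiberFst_d f m n hm, hv, tshift_fiberFst_add]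
  · rw [← tshift_fiberSnd_add f n m hm z γ, ← hv, tshift_fiberSnd_d f m n l (by omega) (by omega),
      map_neg, sub_eq_add_neg]

end

theorem relAcyclic_iff_coneAcyclic {P E : DGCat k} {Ξ : DGFunctor P E} {X Y : Tot P} :
    RelAcyclic Ξ X Y ↔ ConeAcyclic (Ξ.map X.obj Y.obj) := by
  constructor
  · intro H l m n n' hl hm hn z γ hz hγ
    obtain ⟨α, β, hα, hβ, h₁, h₂⟩ := H n (tin n z)
      (tin (X := Ξ.tot.obj X) (Y := Ξ.tot.obj Y) m γ)
      ⟨isHom_tin _ _, by rw [dif_tin n n' hn, hz, map_zero]⟩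
      ((isHom_tin _ _).cast (by omega)) (by
        rw [Ξ.tot_tin]
        exact (dif_tin (X := Ξ.tot.obj X) (Y := Ξ.tot.obj Y) m n hm γ).trans (congrArg _ hγ))
    have hα := hα.cast (show n - 1 = m by omega)
    have hβ := hβ.cast (show n - 2 = l by omega)
    refine ⟨tcpt m α, tcpt (X := Ξ.tot.obj X) (Y := Ξ.tot.obj Y) l β, ?_, ?_⟩
    · refine tin_injective (X := X) (Y := Y) n ((dif_tin m n hm _).symm.trans ?_)
      rw [hα, h₁]
    · refine tin_injective (X := Ξ.tot.obj X) (Y := Ξ.tot.obj Y) m (h₂.trans ?_)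
      refine Eq.trans ?_ (map_add _ _ _).symm
      refine congrArg₂ (· + ·) ?_ ?_
      · exact (congrArg Ξ.tot.map hα.symm).trans (Ξ.tot_tin m _)
      · exact (congrArg dif hβ.symm).trans
          (dif_tin (X := Ξ.tot.obj X) (Y := Ξ.tot.obj Y) l m hl _)
  · intro H n z γ hz hγ h
    obtain ⟨z, rfl⟩ : ∃ z', z = tin n z' := ⟨_, hz.isHom.symm⟩
    obtain ⟨γ, rfl⟩ : ∃ γ', γ = tin (X := Ξ.tot.obj X) (Y := Ξ.tot.obj Y) (n - 1) γ' :=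
      ⟨_, hγ.symm⟩
    obtain ⟨α, β, hα, hβ⟩ := H (n - 2) (n - 1) n (n + 1) (by omega) (by omega) rfl z γ
      (tin_injective (X := X) (Y := Y) (n + 1) (by
        rw [← dif_tin n (n + 1) rfl, hz.dif_eq, map_zero]))
      (tin_injective (X := Ξ.tot.obj X) (Y := Ξ.tot.obj Y) n
        ((dif_tin (X := Ξ.tot.obj X) (Y := Ξ.tot.obj Y) (n - 1) n (by omega) γ).symm.trans
          (h.trans (Ξ.tot_tin n z))))
    refine ⟨tin (n - 1) α, tin (X := Ξ.tot.obj X) (Y := Ξ.tot.obj Y) (n - 2) β, isHom_tin _ _,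
      isHom_tin _ _, ?_, ?_⟩
    · rw [dif_tin (n - 1) n (by omega), hα]
    · refine (congrArg (tin (X := Ξ.tot.obj X) (Y := Ξ.tot.obj Y) (n - 1)) hβ).trans
        ((map_add _ _ _).trans (congrArg₂ (· + ·) (Ξ.tot_tin _ _).symm ?_))
      exact (dif_tin (X := Ξ.tot.obj X) (Y := Ξ.tot.obj Y) (n - 2) (n - 1) (by omega) β).symm

/-- Homotopical flatness enters here: it is applied to the fibre of the map between complexes of
morphisms. -/
theorem RelAcyclic.tensor {P E K : DGCat k} (hK : K.IsHomotopicallyFlat) {Ξ : DGFunctor P E}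
    {X Y : Tot P} (h : RelAcyclic Ξ X Y) (x y : K.Obj) :
    RelAcyclic (Ξ.tensor (DGFunctor.id K)) (⟨(X.obj, x)⟩ : Tot (P.tensor K))
      (⟨(Y.obj, y)⟩ : Tot (P.tensor K)) :=
  relAcyclic_iff_coneAcyclic.2 ((relAcyclic_iff_coneAcyclic.1 h).tensor (hK x y))

/-! ### Tensor products with an object -/

/-- The DG functor `a ↦ a ⊗ y`. -/
def DGFunctor.tensorObj (A : DGCat k) {K : DGCat k} (y : K.Obj) : DGFunctor A (A.tensor K) where
  obj a := (a, y)
  map X Y :=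
    { f n := ModuleCat.ofHom ((tmul (A.Hom X Y) (K.Hom y y) n 0 n (add_zero n)).flip (K.id y))
      comm' n n' h := by
        have e : n + 1 = n' := h
        refine ModuleCat.hom_ext (LinearMap.ext fun f => ?_)
        have := d_tmul (A.Hom X Y) (K.Hom y y) n 0 n n' 1 n' (add_zero n) e rfl e f (K.id y)
        rw [K.d_id, map_zero, smul_zero, add_zero] at this
        exact this }
  map_id X := rfl
  map_comp {X Y Z} p q n h g f := by
    have := tensorComp_tmul A K (X := (X, y)) (Y := (Y, y)) (Z := (Z, y)) p q n h p 0 q 0 n 0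
      (add_zero p) (add_zero q) h rfl g (K.id y) f (K.id y)
    rw [zero_mul, Int.negOnePow_zero, one_smul, K.id_comp] at this
    exact this.symm

theorem DGFunctor.tensorObj_tin (A : DGCat k) {K : DGCat k} (y : K.Obj) {X Y : Tot A} (n : ℤ)
    (f : (A.Hom X.obj Y.obj).X n) : (tensorObj A y).tot.map (tin n f : X ⟶ Y) =
      (tin n (tmul (A.Hom X.obj Y.obj) (K.Hom y y) n 0 n (add_zero n) f (K.id y)) :
        (tensorObj A y).tot.obj X ⟶ (tensorObj A y).tot.obj Y) :=
  (tensorObj A y).tot_tin n f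

/-- The object `a ⊗ x`. -/
def tpair {A K : DGCat k} (a : Tot A) (x : Tot K) : Tot (A.tensor K) := ⟨(a.obj, x.obj)⟩

section

variable {A C K : DGCat k} {a b c : Tot A} {x y : Tot K}

/-- The tensor product of morphisms. -/
def tprod : (a ⟶ b) →ₗ[k] (x ⟶ y) →ₗ[k] (tpair a x ⟶ tpair b y) :=
  tlin fun p => LinearMap.flip <| tlin fun q =>
    ((tmul (A.Hom a.obj b.obj) (K.Hom x.obj y.obj) p q (p + q) rfl).compr₂
      (tin (X := tpair a x) (Y := tpair b y) (p + q))).flip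

theorem tprod_tin (p q n : ℤ) (h : p + q = n) (f : (A.Hom a.obj b.obj).X p)
    (κ : (K.Hom x.obj y.obj).X q) : tprod (tin p f : a ⟶ b) (tin q κ : x ⟶ y) =
      tin (X := tpair a x) (Y := tpair b y) n
        (tmul (A.Hom a.obj b.obj) (K.Hom x.obj y.obj) p q n h f κ) := by
  subst h
  rw [tprod, tlin_tin, LinearMap.flip_apply, tlin_tin]
  rfl

/-- No sign appears, because the second factor of the outer morphism is an identity and has degree
0. -/
theorem tprod_comp_id (f : a ⟶ b) (κ : x ⟶ y) (g : b ⟶ c) :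
    tprod f κ ≫ tprod g (𝟙 y) = tprod (f ≫ g) κ := by
  induction f using hom_induction with
  | hadd f f' h h' =>
    rw [map_add, LinearMap.add_apply, Preadditive.add_comp, h, h', Preadditive.add_comp, map_add,
      LinearMap.add_apply]
  | h q f =>
  induction κ using hom_induction with
  | hadd f f' h h' => rw [map_add, Preadditive.add_comp, h, h', map_add]
  | h q' κ =>
  induction g using hom_induction with
  | hadd f f' h h' =>
    rw [map_add, LinearMap.add_apply, Preadditive.comp_add, h, h', Preadditive.comp_add, map_add,
      LinearMap.add_apply]
  | h p g =>
  have e := tensorComp_tmul A K (X := (a.obj, x.obj)) (Y := (b.obj, y.obj)) (Z := (c.obj, y.obj))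
    p (q + q') (p + (q + q')) rfl p 0 q q' (p + q) q' (add_zero p) rfl rfl (zero_add _)
    g (K.id y.obj) f κ
  rw [zero_mul, Int.negOnePow_zero, one_smul, K.id_comp] at e
  rw [← tin_id, ← tin_comp p q _ rfl, tprod_tin q q' _ rfl, tprod_tin p 0 p (add_zero p),
    tprod_tin (p + q) q' (p + (q + q')) (by omega)]
  exact (tin_comp (X := tpair a x) (Y := tpair b y) (Z := tpair c y) p (q + q') _ rfl _ _).symm.trans
    (congrArg (tin (X := tpair a x) (Y := tpair c y) (p + (q + q'))) e)

theorem tprod_induction {P : (tpair a x ⟶ tpair b y) → Prop}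
    (hadd : ∀ w w', P w → P w' → P (w + w')) (h : ∀ f κ, P (tprod f κ)) (w) : P w := by
  induction w using hom_induction with
  | hadd w w' h h' => exact hadd _ _ h h'
  | h n t =>
    induction t using tensor_induction with
    | hadd t t' h h' =>
      exact (map_add (tin (X := tpair a x) (Y := tpair b y) n) t t') ▸ hadd _ _ h h'
    | htmul p q hp f κ => exact tprod_tin p q n hp f κ ▸ h _ _

/-- The universal property of the tensor product for the total categories, used to tensor the
coordinate maps with morphisms of `K`. -/
theorem exists_lift_tprod {M : Type u} [AddCommGroup M] [Module k M]
    (β : (a ⟶ b) →ₗ[k] (x ⟶ y) →ₗ[k] M) :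
    ∃ φ : (tpair a x ⟶ tpair b y) →ₗ[k] M, ∀ f κ, φ (tprod f κ) = β f κ := by
  let φ : (tpair a x ⟶ tpair b y) →ₗ[k] M := tlin (X := tpair a x) (Y := tpair b y) fun n =>
    tlift (K := A.Hom a.obj b.obj) (L := K.Hom x.obj y.obj) fun p q _ =>
      (β ∘ₗ tin (X := a) (Y := b) p).compl₂ (tin (X := x) (Y := y) q)
  refine ⟨φ, fun f κ => ?_⟩
  induction f using hom_induction with
  | hadd f f' h h' => rw [map_add, LinearMap.add_apply, map_add, h, h', map_add, LinearMap.add_apply]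
  | h p f =>
  induction κ using hom_induction with
  | hadd f f' h h' => rw [map_add, map_add, h, h', map_add]
  | h q κ =>
  rw [tprod_tin p q _ rfl]
  exact (tlin_tin (X := tpair a x) (Y := tpair b y) _ _ _).trans (tlift_tmul _ _ _ _ _ _)

theorem DGFunctor.tensorObj_map_eq (f : a ⟶ b) : (tensorObj A y.obj).tot.map f =
    (tprod f (𝟙 y) : tpair a y ⟶ tpair b y) := by
  induction f using hom_induction with
  | hadd f f' h h' =>
    rw [Functor.map_add, h, h', map_add, LinearMap.add_apply]
    rfl
  | h n f =>
    rw [tensorObj_tin, ← tin_id]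
    exact (tprod_tin n 0 n (add_zero n) f (K.id y.obj)).symm

variable (F : DGFunctor A C) {p : Tot C}

/-- The tensor product of morphisms, for a morphism from the image of an object. -/
def tprodFrom : (F.tot.obj a ⟶ p) →ₗ[k] (x ⟶ y) →ₗ[k]
    ((F.tensor (DGFunctor.id K)).tot.obj (tpair a x) ⟶ tpair p y) :=
  tprod

theorem tensor_tot_map_tprod (f : a ⟶ b) (κ : x ⟶ y) :
    (F.tensor (DGFunctor.id K)).tot.map (tprod f κ) =
      (tprod (F.tot.map f) κ : tpair (F.tot.obj a) x ⟶ tpair (F.tot.obj b) y) := by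
  induction f using hom_induction with
  | hadd f f' h h' =>
    rw [map_add, LinearMap.add_apply, Functor.map_add, h, h', Functor.map_add, map_add,
      LinearMap.add_apply]
    rfl
  | h q f =>
  induction κ using hom_induction with
  | hadd f f' h h' => rw [map_add, Functor.map_add, h, h', map_add]; rfl
  | h q' κ =>
  rw [tprod_tin q q' _ rfl, F.tot_tin]
  refine ((F.tensor (DGFunctor.id K)).tot_tin (X := tpair a x) (Y := tpair b y) _ _).trans ?_
  refine Eq.trans ?_ (tprod_tin (a := F.tot.obj a) (b := F.tot.obj b) q q' _ rfl _ _).symm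
  exact congrArg (tin (X := tpair (F.tot.obj a) x) (Y := tpair (F.tot.obj b) y) (q + q'))
    (tensorHom_tmul (F.map a.obj b.obj) (𝟙 (K.Hom x.obj y.obj)) q q' _ rfl f κ)

theorem tensor_tot_map_tprod_comp (f : a ⟶ b) (κ : x ⟶ y) (g : F.tot.obj b ⟶ p) :
    (F.tensor (DGFunctor.id K)).tot.map (tprod f κ) ≫ tprodFrom F g (𝟙 y) =
      tprodFrom F (F.tot.map f ≫ g) κ :=
  (congrArg (· ≫ (tprod g (𝟙 y) : tpair (F.tot.obj b) y ⟶ tpair p y))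
    (tensor_tot_map_tprod F f κ)).trans (tprod_comp_id _ _ _)

end

section

variable {D P K : DGCat k} {I : DGFunctor D P} {Q : Tot P} {G : Type u} {o : G → Tot D}
  {u : ∀ g, I.tot.obj (o g) ⟶ Q}

/-- The elements `u g ⊗ 𝟙 y` form a basis over `D ⊗ K`: they generate since `f ⊗ κ` can be expanded
in the first factor, and the coordinates are those of `Q` tensored with the identity of `Hom(x, y)`.
-/
theorem isFreeOn_tensor (h : ∀ X, IsFreeOn I o u X)
    (hπ : ∀ X, ∃ π : ∀ g, (I.tot.obj X ⟶ Q) →ₗ[k] (X ⟶ o g),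
      (∀ g c, π g (I.tot.map c ≫ u g) = c) ∧ ∀ f g c, f ≠ g → π f (I.tot.map c ≫ u g) = 0)
    (y : Tot K) (X : Tot (D.tensor K)) : IsFreeOn (I.tensor (DGFunctor.id K))
      (fun g => tpair (o g) y) (fun g => tprodFrom I (u g) (𝟙 y)) X := by
  obtain ⟨a, x, rfl⟩ : ∃ a x, X = tpair a x := ⟨⟨X.obj.1⟩, ⟨X.obj.2⟩, rfl⟩
  obtain ⟨π, h₁, h₂⟩ := hπ a
  have key : ∀ g, ∃ φ : ((I.tensor (DGFunctor.id K)).tot.obj (tpair a x) ⟶ tpair Q y) →ₗ[k]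
      (tpair a x ⟶ tpair (o g) y), ∀ f κ, φ (tprodFrom I f κ) = tprod (π g f) κ := fun g =>
    exists_lift_tprod (a := I.tot.obj a) (b := Q) (x := x) (y := y) (tprod ∘ₗ π g)
  choose φ hφ using key
  refine isFreeOn_of_coord (fun n w _ => ?_) φ (fun g c => ?_) fun f g c hfg => ?_
  · clear * - h
    induction w using tprod_induction (a := I.tot.obj a) (b := Q) with
    | hadd w w' h h' =>
      exact exists_sum_add (I := I.tensor (DGFunctor.id K)) (X := tpair a x)
        (o := fun g => tpair (o g) y) (u := fun g => tprodFrom I (u g) (𝟙 y)) h h'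
    | h f κ =>
      obtain ⟨S, c, rfl⟩ := (h a).exists_sum f
      refine ⟨S, fun g => tprod (c g) κ, ?_⟩
      refine (LinearMap.map_sum₂ (tprodFrom I) _ _ _).trans (Finset.sum_congr rfl fun g _ => ?_)
      exact (tensor_tot_map_tprod_comp I (c g) κ (u g)).symm
  · induction c using tprod_induction with
    | hadd c c' h h' => rw [Functor.map_add, Preadditive.add_comp, map_add, h, h']
    | h c κ => rw [tensor_tot_map_tprod_comp, hφ, h₁]
  · induction c using tprod_induction with
    | hadd c c' h h' => rw [Functor.map_add, Preadditive.add_comp, map_add, h, h', add_zero]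
    | h c κ => rw [tensor_tot_map_tprod_comp, hφ, h₂ _ _ _ hfg, map_zero, LinearMap.zero_apply]

/-- The DG functor `a ↦ a ⊗ y` carries the degrees and boundaries of the generators over unchanged,
so the same ranks serve; only freeness needs a separate argument. -/
theorem IsCellular.tensor {B : Set D.Obj} {g₀ : G} (h : IsCellular I B o u g₀)
    (hπ : ∀ X, ∃ π : ∀ g, (I.tot.obj X ⟶ Q) →ₗ[k] (X ⟶ o g),
      (∀ g c, π g (I.tot.map c ≫ u g) = c) ∧ ∀ f g c, f ≠ g → π f (I.tot.map c ≫ u g) = 0)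
    (y : Tot K) : IsCellular (I.tensor (DGFunctor.id K)) (DGCat.tensorSub B K)
      (fun g => tpair (o g) y) (fun g => tprodFrom I (u g) (𝟙 y)) g₀ := by
  have e : ∀ {a : Tot D} (f : I.tot.obj a ⟶ Q),
      tprodFrom I f (𝟙 y) = (DGFunctor.tensorObj P y.obj).tot.map f :=
    fun f => (DGFunctor.tensorObj_map_eq f).symm
  refine ⟨isFreeOn_tensor h.isFreeOn hπ y, ?_, fun g hg => h.mem g hg, fun g => ?_, ?_⟩
  · rw [e]
    exact h.closed.tot (DGFunctor.tensorObj P y.obj)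
  · obtain ⟨n, hn⟩ := h.exists_isHom g
    refine ⟨n, ?_⟩
    rw [e]
    exact hn.tot (DGFunctor.tensorObj P y.obj)
  · obtain ⟨rk, hrk⟩ := h.exists_rank
    refine ⟨rk, fun g => ?_⟩
    obtain ⟨S, c, hS, hc⟩ := hrk g
    refine ⟨S, fun f => tprod (c f) (𝟙 y), hS, ?_⟩
    rw [e]
    refine ((DGFunctor.tensorObj P y.obj).dif_tot (u g)).trans ?_
    refine (congrArg (DGFunctor.tensorObj P y.obj).tot.map hc).trans ?_
    refine (Functor.map_sum _ _ _).trans (Finset.sum_congr rfl fun f _ => ?_)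
    exact (e (I.tot.map (c f) ≫ u f)).symm.trans
      (tensor_tot_map_tprod_comp I (c f) (𝟙 y) (u f)).symm

end

/-! ### Contractibility and vanishing along isomorphisms of arbitrary degree -/

section

variable {D E : DGCat k} {X Y Z X' Y' : Tot D} {m : ℤ}

theorem Tot.Contractible.of_id_eq_zero (h : 𝟙 X = 0) : Contractible X :=
  ⟨0, .zero _, by rw [h, map_zero]⟩

theorem Tot.Contractible.of_iso {σ : X' ⟶ X} {σ' : X ⟶ X'} (hσ : Closed m σ)
    (hσ' : Closed (-m) σ') (h : σ ≫ σ' = 𝟙 X') (hX : Contractible X) : Contractible X' := by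
  obtain ⟨e, he, he'⟩ := hX
  refine ⟨(m.negOnePow : ℤ) • σ ≫ e ≫ σ',
    ((hσ.isHom.comp (he.comp hσ'.isHom rfl) (by omega)).zsmul _), ?_⟩
  rw [map_zsmul, dif_comp, dif_comp, hσ.dif_eq, hσ'.dif_eq, he', hσ'.isHom.sg_eq,
    Limits.comp_zero, zero_add, Limits.zero_comp, add_zero, Category.id_comp,
    Preadditive.comp_zsmul, h, smul_smul, Int.negOnePow_neg, negOnePow_mul_self, one_smul]

theorem Tot.Contractible.tot (F : DGFunctor D E) (hX : Contractible X) :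
    Contractible (F.tot.obj X) := by
  obtain ⟨e, he, he'⟩ := hX
  exact ⟨F.tot.map e, he.tot F, by rw [F.dif_tot, he', F.tot.map_id]⟩

theorem Tot.equiv_of_id_eq_zero (hX : 𝟙 X = 0) (hY : 𝟙 Y = 0) : Equiv (0 : X ⟶ Y) :=
  .of_inverse (.zero 0) (.zero 0) (by rw [hX, Limits.zero_comp]) (.zero _)
    (by rw [hY, Limits.zero_comp, map_zero, sub_zero])

variable {F : DGFunctor D E} {𝓑 : Set (Tot D)}

theorem RelVanish.of_id_eq_zero (h𝓑 : IsPretriangulated 𝓑) (h : 𝟙 Y = 0) : RelVanish F 𝓑 Y := by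
  intro X n z γ _ _ _
  have h' : 𝟙 (F.tot.obj Y) = 0 := by rw [← F.tot.map_id, h, F.tot.map_zero]
  refine ⟨X, 𝟙 X, .id X, ?_, 0, 0, .zero _, .zero _, ?_, ?_⟩
  · rw [toHo_id]
    exact fibProp_id h𝓑 X
  · rw [← Category.comp_id z, h, Limits.comp_zero, Limits.comp_zero, map_zero]
  · rw [← Category.comp_id γ, h', Limits.comp_zero, Limits.comp_zero, F.tot.map_zero, map_zero,
      add_zero]

theorem RelVanish.of_iso {σ : Y' ⟶ Y} {σ' : Y ⟶ Y'} (hσ : Closed m σ)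
    (hσ' : Closed (-m) σ') (h : σ ≫ σ' = 𝟙 Y') (hY : RelVanish F 𝓑 Y) : RelVanish F 𝓑 Y' := by
  intro X n z γ hz hγ hγz
  have hF : F.tot.map σ ≫ F.tot.map σ' = 𝟙 _ := by rw [← F.tot.map_comp, h, F.tot.map_id]
  have hs := (hσ.isHom.tot F).sg_eq
  have hs' := (hσ'.isHom.tot F).sg_eq
  obtain ⟨X', r, hr, hrB, α, β, hα, hβ, h₁, h₂⟩ := hY X (n + m) (z ≫ σ)
    ((m.negOnePow : ℤ) • γ ≫ F.tot.map σ) (hz.comp hσ rfl)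
    ((hγ.comp (hσ.isHom.tot F) (by omega)).zsmul _) (by
      rw [map_zsmul, dif_comp, F.dif_tot, hσ.dif_eq, F.tot.map_zero, Limits.comp_zero, zero_add,
        hγz, hs, Preadditive.comp_zsmul, smul_smul, negOnePow_mul_self, one_smul, F.tot.map_comp])
  refine ⟨X', r, hr, hrB, (m.negOnePow : ℤ) • α ≫ σ', β ≫ F.tot.map σ',
    (hα.comp hσ'.isHom (by omega)).zsmul _, hβ.comp (hσ'.isHom.tot F) (by omega), ?_, ?_⟩
  · rw [map_zsmul, dif_comp, hσ'.dif_eq, Limits.comp_zero, zero_add, h₁, hσ'.isHom.sg_eq,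
      Preadditive.comp_zsmul, smul_smul, Int.negOnePow_neg, negOnePow_mul_self, one_smul,
      Category.assoc, Category.assoc, h, Category.comp_id]
  · rw [dif_comp, F.dif_tot, hσ'.dif_eq, F.tot.map_zero, Limits.comp_zero, zero_add, hs',
      Int.negOnePow_neg, Preadditive.comp_zsmul, F.tot.map_zsmul, F.tot.map_comp, ← smul_add,
      ← Preadditive.add_comp, ← h₂, Preadditive.comp_zsmul, Preadditive.zsmul_comp, smul_smul,
      negOnePow_mul_self, one_smul, Category.assoc, Category.assoc, hF, Category.comp_id]

/-- The case `z = 0`, where `γ` is just a closed morphism. -/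
theorem RelVanish.exists_precomp_closed {n : ℤ} {δ : F.tot.obj X ⟶ F.tot.obj Y}
    (hY : RelVanish F 𝓑 Y) (hδ : Closed n δ) :
    ∃ (X' : Tot D) (r : X' ⟶ X) (hr : Closed 0 r), fibProp 𝓑 (toHo r hr) ∧
      ∃ (α : X' ⟶ Y) (β : F.tot.obj X' ⟶ F.tot.obj Y), Closed n α ∧ IsHom (n - 1) β ∧
        F.tot.map r ≫ δ = F.tot.map α + dif β := by
  obtain ⟨X', r, hr, hrB, α, β, hα, hβ, h₁, h₂⟩ := hY X (n + 1) 0 δ (.zero _)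
    (hδ.isHom.cast (by omega)) (by rw [hδ.dif_eq, F.tot.map_zero])
  exact ⟨X', r, hr, hrB, α, β, ⟨hα.cast (by omega), by rw [h₁, Limits.comp_zero]⟩,
    hβ.cast (by omega), h₂⟩

/-- The essential image is closed under extensions. The attaching morphism, transported between
images of `F`, becomes homotopic to one from the source after restriction along a morphism that `F`
inverts; the extension by that morphism is the preimage. -/
theorem exists_equiv_cone_tot (h𝓑 : IsPretriangulated 𝓑)
    (hinv : (fibProp 𝓑).IsInvertedBy (hoMap F)) (hF : ∀ Y, RelVanish F 𝓑 Y) {X b T : Tot E}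
    {h : b ⟶ X} (c : ConeData h T) {X₀ b₀ : Tot D} {u : F.tot.obj X₀ ⟶ X} (hu : Equiv u)
    {v : F.tot.obj b₀ ⟶ b} (hv : Equiv v) :
    ∃ (T₀ : Tot D) (w : F.tot.obj T₀ ⟶ T), Equiv w := by
  obtain ⟨u', hu', -, e, he, he'⟩ := hu.exists_inverse
  obtain ⟨b₁, r, hr, hrB, α, β, hα, hβ, hαβ⟩ := (hF X₀).exists_precomp_closed
    (δ := v ≫ h ≫ u') (hv.closed.comp (c.closed.comp hu'.closed (add_zero 1)) (zero_add 1))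
  have hFr : Equiv (F.tot.map r) := ⟨hr.tot F, hoMap_toHo F hr ▸ hinv _ hrB⟩
  obtain ⟨T₀, ⟨c₀⟩, -⟩ := h𝓑.exists_cone α hα
  obtain ⟨w, hw, -, -⟩ := exists_equiv_cone (c₀.map F) c (hα.tot F) c.closed hu (hFr.comp hv)
    (α := (F.tot.map r ≫ v) ≫ h ≫ e - β ≫ u)
    (((hr.tot F).isHom.comp hv.closed.isHom (add_zero 0)).comp
      (c.closed.isHom.comp he (by omega : 1 + (-1) = (0 : ℤ))) (zero_add 0) |>.sub
      (hβ.comp hu.closed.isHom (by omega))) (by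
      have h₁ : F.tot.map α = F.tot.map r ≫ v ≫ h ≫ u' - dif β := by rw [hαβ]; abel
      have h₂ : dif (F.tot.map r) = 0 := (hr.tot F).dif_eq
      rw [h₁]
      simp [dif_comp, h₂, hv.closed.dif_eq, c.closed.dif_eq, he', hu.closed.dif_eq,
        hu.closed.isHom.sg_zero]
      abel)
  exact ⟨T₀, w, hw⟩

end

/-! ### Tensor products of DG quotients -/

theorem DGFunctor.comp_tensor_id {A C P K : DGCat k} (F : DGFunctor A P) (G : DGFunctor P C) :
    (F.comp G).tensor (DGFunctor.id K) =
      (F.tensor (DGFunctor.id K)).comp (G.tensor (DGFunctor.id K)) := by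
  refine DGFunctor.eq_of_map_eq rfl (heq_of_eq (funext fun X => funext fun Y => ?_))
  refine HomologicalComplex.hom_ext _ _ fun n => ModuleCat.hom_ext (tensor_ext fun p q h f κ => ?_)
  refine (tensorHom_tmul ((F.comp G).map X.1 Y.1) (𝟙 (K.Hom X.2 Y.2)) p q n h f κ).trans ?_
  refine Eq.trans ?_ (congrArg
    (((G.tensor (DGFunctor.id K)).map (F.obj X.1, X.2) (F.obj Y.1, Y.2)).f n).hom
    (tensorHom_tmul (F.map X.1 Y.1) (𝟙 (K.Hom X.2 Y.2)) p q n h f κ)).symm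
  exact (tensorHom_tmul (G.map (F.obj X.1) (F.obj Y.1)) (𝟙 (K.Hom X.2 Y.2)) p q n h _ κ).symm

section

variable {A C K : DGCat k} {ξ : DGFunctor A C} {B : Set A.Obj}

theorem closed_tprod_id {D : DGCat k} {a b : Tot D} {y : Tot K} {n : ℤ} {f : a ⟶ b}
    (hf : Closed n f) : Closed n (tprod f (𝟙 y)) :=
  (DGFunctor.tensorObj_map_eq (y := y) f) ▸ hf.tot (DGFunctor.tensorObj D y.obj)

theorem tprod_id_id {D : DGCat k} (a : Tot D) (y : Tot K) :
    tprod (𝟙 a) (𝟙 y) = 𝟙 (tpair a y) :=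
  (DGFunctor.tensorObj_map_eq (y := y) (𝟙 a)).symm.trans
    ((DGFunctor.tensorObj D y.obj).tot.map_id a)

variable (ξ B) in
/-- The inverse of the image of the generator `𝟙 a' ⊗ 𝟙 y`. -/
def zeroGenTensorInv (a' : Tot A) (y : Tot K) :
    ((Cell.resolution ξ B a'.obj).tensor (DGFunctor.id K)).tot.obj
      (tpair (Cell.module ξ B a'.obj).pt y) ⟶
    ((Cell.resolution ξ B a'.obj).tensor (DGFunctor.id K)).tot.obj
      (((Cell.module ξ B a'.obj).inc.tensor (DGFunctor.id K)).tot.obj (tpair a' y)) :=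
  tprodFrom (Cell.resolution ξ B a'.obj) (a := (Cell.module ξ B a'.obj).pt)
    (Cell.zeroGenInv ξ B a'.obj) (𝟙 y)

variable (ξ B) in
theorem map_zeroGenTensor_comp (a' : Tot A) (y : Tot K) :
    ((Cell.resolution ξ B a'.obj).tensor (DGFunctor.id K)).tot.map
        (tprodFrom (Cell.module ξ B a'.obj).inc (a := a')
          ((Cell.module ξ B a'.obj).gen (Cell.zeroGen ξ B a'.obj)) (𝟙 y)) ≫
      zeroGenTensorInv ξ B a' y = 𝟙 _ :=
  (tensor_tot_map_tprod_comp (Cell.resolution ξ B a'.obj)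
    (a := (Cell.module ξ B a'.obj).inc.tot.obj a') (b := (Cell.module ξ B a'.obj).pt) _ _ _).trans
    ((congrArg (fun f => tprodFrom (Cell.resolution ξ B a'.obj)
      (a := (Cell.module ξ B a'.obj).inc.tot.obj a') f (𝟙 y))
        (Cell.map_zeroGen_comp ξ B a'.obj)).trans (tprod_id_id _ _))

variable (ξ B) in
theorem closed_zeroGenTensorInv (a' : Tot A) (y : Tot K) :
    Closed 0 (zeroGenTensorInv ξ B a' y) :=
  closed_tprod_id (Cell.closed_zeroGenInv ξ B a'.obj)

variable (ξ B) in
theorem isCellular_tensor (a' : Tot A) (y : Tot K) :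
    IsCellular ((Cell.module ξ B a'.obj).inc.tensor (DGFunctor.id K)) (DGCat.tensorSub B K)
      (Q := tpair (Cell.module ξ B a'.obj).pt y) (G := Cell.Gen ξ B a'.obj)
      (fun g => tpair ⟨(Cell.module ξ B a'.obj).o g⟩ y)
      (fun g => tprodFrom (Cell.module ξ B a'.obj).inc ((Cell.module ξ B a'.obj).gen g) (𝟙 y))
      (Cell.zeroGen ξ B a'.obj) :=
  IsCellular.tensor (Cell.isCellular ξ B a'.obj) (Cell.module ξ B a'.obj).exists_coord y

/-- The functor `ξ ⊗ 𝟙` factors through the resolution of `a'` tensored with `K`. The first functor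
is cellular at `pt ⊗ y`, the second has acyclic fibres by flatness, and together these give the
vanishing for the target `a' ⊗ y`. -/
theorem relVanish_tensor_single (hcon : ∀ b ∈ trSet B, Contractible (ξ.pretr.tot.obj b))
    (hvan : ∀ Y, RelVanish ξ.pretr (trSet B) Y) (hK : K.IsHomotopicallyFlat)
    (Y : Tot (A.tensor K)) : RelVanish (ξ.tensor (DGFunctor.id K)).pretr
      (trSet (DGCat.tensorSub B K)) (single Y) := by
  obtain ⟨a', y, rfl⟩ : ∃ a y, Y = tpair a y := ⟨⟨Y.obj.1⟩, ⟨Y.obj.2⟩, rfl⟩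
  have h : RelVanish (((Cell.module ξ B a'.obj).inc.tensor (DGFunctor.id K)).comp
      ((Cell.resolution ξ B a'.obj).tensor (DGFunctor.id K))).pretr
      (trSet (DGCat.tensorSub B K)) (single (tpair a' y)) := by
    apply IsCellular.relVanish (I := (Cell.module ξ B a'.obj).inc.tensor (DGFunctor.id K))
      (Q := tpair (Cell.module ξ B a'.obj).pt y) (G := Cell.Gen ξ B a'.obj)
      (o := fun g => tpair ⟨Cell.o ξ B a'.obj g⟩ y)
      (Ξ := (Cell.resolution ξ B a'.obj).tensor (DGFunctor.id K))
      (g₀ := Cell.zeroGen ξ B a'.obj)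
      (h := isCellular_tensor ξ B a' y)
      (e' := zeroGenTensorInv ξ B a' y)
    · exact closed_zeroGenTensorInv ξ B a' y
    · exact map_zeroGenTensor_comp ξ B a' y
    · exact fun X => RelAcyclic.tensor hK
        (Cell.relAcyclic_resolution a'.obj hcon hvan X.obj.1) X.obj.2 y.obj
  rw [← DGFunctor.comp_tensor_id, Cell.inc_comp_resolution] at h
  exact h

theorem relVanish_tensor (hcon : ∀ b ∈ trSet B, Contractible (ξ.pretr.tot.obj b))
    (hvan : ∀ Y, RelVanish ξ.pretr (trSet B) Y) (hK : K.IsHomotopicallyFlat)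
    (Y : Tot (A.tensor K).pretr) : RelVanish (ξ.tensor (DGFunctor.id K)).pretr
      (trSet (DGCat.tensorSub B K)) Y := by
  have h𝓑 := isPretriangulated_trSet (DGCat.tensorSub B K)
  induction Y using pretr_induction with
  | zero Y hY => exact .of_id_eq_zero h𝓑 hY
  | single Y hY =>
    obtain ⟨i, m, σ, σ', hσ, hσ', h₁, -⟩ := exists_iso_single Y hY
    exact (relVanish_tensor_single hcon hvan hK _).of_iso hσ hσ' h₁
  | cone c h₁ _ h₂ => exact h₁.of_cone h𝓑 c h₂

/-- A contraction of `ξ b` tensored with the identity of `x` contracts the image of `b ⊗ x`; shifts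
and extensions inherit contractibility. -/
theorem contractible_tensor (hcon : ∀ b ∈ trSet B, Contractible (ξ.pretr.tot.obj b))
    (X : Tot (A.tensor K).pretr) (hX : X ∈ trSet (DGCat.tensorSub B K)) :
    Contractible ((ξ.tensor (DGFunctor.id K)).pretr.tot.obj X) := by
  refine trSet_induction
    (P := fun X => Contractible ((ξ.tensor (DGFunctor.id K)).pretr.tot.obj X)) ?_ ?_ ?_ X hX
  · exact fun X hX => .of_id_eq_zero (by
      rw [← CategoryTheory.Functor.map_id, hX, CategoryTheory.Functor.map_zero])
  · intro X hX hXB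
    obtain ⟨i, m, σ, σ', hσ, hσ', h₁, -⟩ := exists_iso_single X hX
    obtain ⟨b, x, hbx⟩ : ∃ b x, X.term i = tpair b x :=
      ⟨⟨(X.term i).obj.1⟩, ⟨(X.term i).obj.2⟩, rfl⟩
    have hb : b.obj ∈ B := by
      have : (X.term i).obj ∈ DGCat.tensorSub B K := hXB i
      rw [hbx] at this
      exact this
    have hξ : Contractible (ξ.tot.obj b) := ((isSingle_single b).pretr ξ).contractible_iff.2
      (hcon _ (single_mem_trSet hb))
    have h₂ : Contractible ((ξ.tensor (DGFunctor.id K)).pretr.tot.obj (single (tpair b x))) :=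
      ((isSingle_single (tpair b x)).pretr (ξ.tensor (DGFunctor.id K))).contractible_iff.1
        (hξ.tot (DGFunctor.tensorObj C x.obj))
    rw [← hbx] at h₂
    exact h₂.of_iso (hσ.tot _) (hσ'.tot _) (by
      rw [← Functor.map_comp, h₁, CategoryTheory.Functor.map_id])
  · exact fun c h₁ h₂ => h₂.cone (c.map (ξ.tensor (DGFunctor.id K)).pretr)
      (c.map (ξ.tensor (DGFunctor.id K)).pretr).closed h₁

theorem Tot.exists_equiv_of_essSurj {D E : DGCat k} {F : DGFunctor D E} [(hoMap F).EssSurj]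
    (Y : Tot E) : ∃ (X : Tot D) (w : F.tot.obj X ⟶ Y), Equiv w := by
  obtain ⟨X, hX⟩ := exists_ho ((hoMap F).objPreimage Y.ho)
  let e := (hoMap F).objObjPreimageIso Y.ho
  rw [← hX] at e
  let e' : (F.tot.obj X).ho ≅ Y.ho := e
  obtain ⟨w, hw, -⟩ := exists_equiv_iso e'.hom
  exact ⟨X, w, hw⟩

theorem Tot.essSurj_of_exists_equiv {D E : DGCat k} {F : DGFunctor D E}
    (h : ∀ Y : Tot E, ∃ (X : Tot D) (w : F.tot.obj X ⟶ Y), Equiv w) : (hoMap F).EssSurj where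
  mem_essImage Y := by
    obtain ⟨Y, rfl⟩ := exists_ho Y
    obtain ⟨X, w, hw⟩ := h Y
    exact ⟨X.ho, ⟨hw.iso⟩⟩

theorem exists_equiv_tensor [(hoMap ξ).EssSurj] (Y : Tot (C.tensor K)) :
    ∃ (X : Tot (A.tensor K)) (w : (ξ.tensor (DGFunctor.id K)).tot.obj X ⟶ Y), Equiv w := by
  obtain ⟨c, y, rfl⟩ : ∃ c y, Y = tpair c y := ⟨⟨Y.obj.1⟩, ⟨Y.obj.2⟩, rfl⟩
  obtain ⟨a, w, hw⟩ := exists_equiv_of_essSurj (F := ξ) c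
  exact ⟨tpair a y, (DGFunctor.tensorObj C y.obj).tot.map w, hw.tot _⟩

/-- Essential surjectivity passes from objects to twisted complexes: the essential image contains
every one-term complex and is closed under extensions by `exists_equiv_cone_tot`. -/
theorem exists_equiv_pretr {D E : DGCat k} {F : DGFunctor D E} {B : Set D.Obj}
    (hcon : ∀ b ∈ trSet B, Contractible (F.pretr.tot.obj b))
    (hvan : ∀ Y, RelVanish F.pretr (trSet B) Y)
    (hF : ∀ Y : Tot E, ∃ (X : Tot D) (w : F.tot.obj X ⟶ Y), Equiv w) (Z : Tot E.pretr) :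
    ∃ (X : Tot D.pretr) (w : F.pretr.tot.obj X ⟶ Z), Equiv w := by
  have h𝓑 := isPretriangulated_trSet B
  induction Z using pretr_induction with
  | zero Z hZ =>
    obtain ⟨X, -, hX⟩ := h𝓑.exists_zero
    exact ⟨X, 0, equiv_of_id_eq_zero
      (by rw [← CategoryTheory.Functor.map_id, hX, CategoryTheory.Functor.map_zero]) hZ⟩
  | single Z hZ =>
    obtain ⟨i, m, τ, τ', hτ, hτ', h₃, h₄⟩ := exists_iso_single Z hZ
    obtain ⟨X, w, hw⟩ := hF (Z.term i)
    obtain ⟨X', σ, σ', hσ, hσ', h₁, h₂, -⟩ := h𝓑.exists_shift (single X) m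
    -- A one-term complex is a shift of a plain object, so the equivalence between plain objects is
    -- conjugated by shifts of the same degree on both sides.
    exact ⟨X', F.pretr.tot.map σ ≫ ((isSingle_single X).pretr F).lift (isSingle_single _) w ≫ τ',
      (((isSingle_single X).pretr F).lift_equiv (isSingle_single _) hw).conj (hσ.tot _)
        (hσ'.tot _) hτ hτ' (by rw [← Functor.map_comp, h₁, CategoryTheory.Functor.map_id])
        (by rw [← Functor.map_comp, h₂, CategoryTheory.Functor.map_id]) h₃ h₄⟩
  | cone c h₁ _ h₂ =>
    obtain ⟨X, u, hu⟩ := h₁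
    obtain ⟨b, v, hv⟩ := h₂
    exact exists_equiv_cone_tot h𝓑 (fibProp_isInvertedBy hcon) hvan c hu hv

/-- The hypothesis is unpacked into contractibility on `B^tr` and vanishing of relative classes;
both pass to the tensor product and, with essential surjectivity, are repacked into a localization.
-/
theorem IsDGQuotient.tensor (hξ : IsDGQuotient ξ B) (hK : K.IsHomotopicallyFlat) :
    IsDGQuotient (ξ.tensor (DGFunctor.id K)) (DGCat.tensorSub B K) := by
  have h𝓑 := isPretriangulated_trSet B
  have := hξ.essSurj
  have hloc : (hoMap ξ.pretr).IsLocalization (fibProp (trSet B)) :=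
    verdierClass_eq B ▸ hξ.isLocalization
  have hcon : ∀ b ∈ trSet B, Contractible (ξ.pretr.tot.obj b) := fun b hb =>
    contractible_of_isInvertedBy h𝓑 (Localization.inverts (hoMap ξ.pretr) (fibProp (trSet B))) hb
  have hvan : ∀ Y, RelVanish ξ.pretr (trSet B) Y := fun Y => relVanish_of_isLocalization h𝓑 Y
  have hess := exists_equiv_tensor (ξ := ξ) (K := K)
  have hcon' := contractible_tensor (K := K) hcon
  have hvan' := relVanish_tensor hcon hvan hK
  refine ⟨essSurj_of_exists_equiv hess, ?_⟩
  rw [verdierClass_eq]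
  have := essSurj_of_exists_equiv (exists_equiv_pretr hcon' hvan' hess)
  exact isLocalization_of_relVanish (isPretriangulated_trSet _) (fibProp_isInvertedBy hcon') hvan'

end

end
end DG

theorem proposition1p6p3 {k : Type u} [CommRing k] (A C K : DG.DGCat k) (B : Set A.Obj)
    (ξ : DG.DGFunctor A C) (hξ : DG.IsDGQuotient ξ B) (hK : K.IsHomotopicallyFlat) :
    DG.IsDGQuotient (ξ.tensor (DG.DGFunctor.id K)) (DG.DGCat.tensorSub B K) :=
  hξ.tensor hK
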